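/- **Conventions.** Let $p$ be a prime and $G$ a profinite group. A *naive* action of $G$ is one whose kernel is open. A $(G,\mathbb F_p)$-scheme is a quasi-compact scheme $S$ of characteristic $p$ with a naive action of $G$, which is covered by $G$-invariant affine open subschemes. For $1\le s<\infty$, a $(G,\mathbf W_s)$-module on $S$ is a quasi-coherent $\mathbf W_s(\mathcal O_S)$-module with a semilinear naive action of $G$, and a $G$-linearized line bundle is an invertible $\mathcal O_S$-module with a semilinear naive action of $G$. For such a line bundle $L$, $L^{(m)}=L^{\otimes p^m}$ is its pullback by the $m$-th power of Frobenius, and $\mathbf W_s(L)$ is its Teichmüller lift: the invertible $\mathbf W_s(\mathcal O_S)$-module with $G$-action whose cocycle is the Teichmüller representative of the one of $L$. Put $\mathbb Z/p^\infty=\mathbb Z_p$. Let $n\ge 1$ be an integer and $e\in\{1,2,\dots\}\cup\{\infty\}$. An *$(n,e)$-cyclotomic pair* $(G,\mathbb Z/p^{1+e}(1))$ is a profinite group $G$ with a free $\mathbb Z/p^{1+e}$-module of rank one $\mathbb Z/p^{1+e}(1)$ with a continuous $G$-action, given by a character $\chi:G\to(\mathbb Z/p^{1+e})^\times$, such that for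 every open subgroup $H\subset G$ the map $H^n(H,\mathbb Z/p^{1+e}(n))\to H^n(H,\mathbb Z/p(n))$ is onto, where $(n)$ denotes the twist of the action by $\chi^n$ (continuous cohomology, for the $p$-adic topology on the coefficients). For finite $s\le 1+e$ and a $(G,\mathbf W_s)$-module $M$, $M(n)$ is $M$ with its $G$-action twisted by $\chi^n$ modulo $p^s$. For a $(G,\mathbf W_s)$-module $M$ on $S$, $H^n((G,S),M)$ is the group of Yoneda classes of $n$-extensions of $\mathbf W_s(\mathcal O_S)$ by $M$ in the category of $(G,\mathbf W_s)$-modules. A class is *strongly geometrically trivial* if it is represented by an $n$-extension such that all the short exact sequences of which it is the splice have a $\mathbf W_s(\mathcal O_S)$-linear, not necessarily $G$-equivariant, splitting; these classes form $H^n_{sgt}((G,S),M)$. The reduction maps (from $\mathbf W_s$ to $\mathbf W_r$, for $s\ge r$) and the Frobenius pullbacks $c\mapsto c^{(m)}$ (from coefficients $\mathbf W_r(L)(n)$ to $\mathbf W_r(L^{(m)})(n)$) are those such that there is a morphism from an $n$-extension of the given class to an $n$-extension of the image class, semilinear along $\mathbf W_s(\mathcal O_S)\to\mathbf W_r(\mathcal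 O_S)$ (resp. along the $m$-th power of the Frobenius of $\mathbf W_r(\mathcal O_S)$), inducing the natural maps on both ends. If $e=\infty$, to lift a class with coefficients in $\mathbf W_r(L)(n)$ to (strongly geometrically trivial) coefficients in $\mathbf W_{1+e}(L)(n)$ means to represent it by the first term of a sequence of (strongly geometrically trivial) $n$-extensions $\mathcal E_s$ of $\mathbf W_s(\mathcal O_S)$ by $\mathbf W_s(L)(n)$, $s\ge r$, with morphisms $\mathcal E_{s+1}\to\mathcal E_s$, semilinear along $\mathbf W_{s+1}(\mathcal O_S)\to\mathbf W_s(\mathcal O_S)$, inducing the reductions on both ends. $G$ is *$(n,e)$-smooth* if for every perfect $\mathbb F_p$-algebra $A$ with a naive $G$-action, every locally free $A$-module $L_1$ of rank one with a semilinear naive $G$-action, and every $c\in H^n(G,L_1)$, there is a locally free $\mathbf W_{e+1}(A)$-module $L_{e+1}[c]$ of rank one with a semilinear $G$-action, naive modulo $p^s$ for every finite $s$, which lifts $L_1$ (equivariantly), such that $c$ is in the image of $H^n(G,L_{e+1}[c])\to H^n(G,L_1)$. **Theorem A.** Let $(G,\mathbb Z/p^{1+e}(1))$ be an $(n,e)$-cyclotomic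 pair, with $n\ge 1$ an integer and $e\in\{1,2,\dots\}\cup\{\infty\}$. 1. Let $1\le r\le e$ be an integer, $S$ a $(G,\mathbb F_p)$-scheme, $L$ a $G$-linearized line bundle on $S$ and $c_r\in H^n_{sgt}((G,S),\mathbf W_r(L)(n))$. Then there is an integer $m\ge 0$ such that the Frobenius pullback $c_r^{(m)}\in H^n_{sgt}((G,S),\mathbf W_r(L^{(m)})(n))$ lifts to a strongly geometrically trivial class with coefficients in $\mathbf W_{1+e}(L^{(m)})(n)$. 2. Let moreover $S$ be affine and perfect. Then every class in $H^n((G,S),\mathbf W_r(L)(n))$ lifts to coefficients in $\mathbf W_{1+e}(L)(n)$; that is, the reduction map $H^n((G,S),\mathbf W_{1+e}(L)(n))\to H^n((G,S),\mathbf W_r(L)(n))$ is onto. 3. $G$ is $(n,e)$-smooth. -/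

import Mathlib

open CategoryTheory AlgebraicGeometry Topology

universe u v w

noncomputable section

set_option linter.unusedSectionVars false
set_option linter.unusedVariables false

namespace WittLift

/-! ### Continuous cohomology of a topological group -/

section Cohomology

variable {G : Type w} [Group G] [TopologicalSpace G] {M : Type v} [AddCommGroup M]
  {M' : Type v} [AddCommGroup M']

/-- `f` is continuous for the `p`-adic topology on the abelian group `M` (which is the discrete
topology as soon as `M` is killed by a power of `p`). -/
def PadicCont (p : ℕ) {X : Type*} [TopologicalSpace X] (f : X → M) : Prop :=
  ∀ (s : ℕ) (x : X), ∀ᶠ y in 𝓝 x, ∃ m : M, f y = f x + p ^ s • m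

/-- The differential on inhomogeneous cochains. -/
def coboundary (ρ : Representation ℤ G M) (n : ℕ) :
    ((Fin n → G) → M) →+ ((Fin (n + 1) → G) → M) where
  toFun f g := ρ (g 0) (f fun i => g i.succ) + ∑ j : Fin (n + 1),
    (-1 : ℤ) ^ ((j : ℕ) + 1) • f (Fin.contractNth j (· * ·) g)
  map_zero' := by
    ext
    simp
  map_add' f f' := by
    ext
    simp [Finset.sum_add_distrib, add_add_add_comm]

/-- Continuous `n`-cochains, for the `p`-adic topology on the coefficients. -/
def contCochains (p : ℕ) (G : Type w) [TopologicalSpace G] (M : Type v) [AddCommGroup M]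
    (n : ℕ) : AddSubgroup ((Fin n → G) → M) where
  carrier := {f | PadicCont p f}
  zero_mem' := fun s x => Filter.Eventually.of_forall fun y => ⟨0, by simp⟩
  add_mem' := by
    intro f f' hf hf' s x
    filter_upwards [hf s x, hf' s x] with y hy hy'
    obtain ⟨m, hm⟩ := hy
    obtain ⟨m', hm'⟩ := hy'
    exact ⟨m + m', by simp only [Pi.add_apply, hm, hm', smul_add]; abel⟩
  neg_mem' := by
    intro f hf s x
    filter_upwards [hf s x] with y hy
    obtain ⟨m, hm⟩ := hy
    exact ⟨-m, by simp only [Pi.neg_apply, hm, smul_neg]; abel⟩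

/-- Continuous `n`-cocycles. -/
def contCocycles (p : ℕ) (ρ : Representation ℤ G M) (n : ℕ) : AddSubgroup ((Fin n → G) → M) :=
  contCochains p G M n ⊓ (coboundary ρ n).ker

/-- Coboundaries of continuous cochains. -/
def contCoboundaries (p : ℕ) (ρ : Representation ℤ G M) :
    ∀ n : ℕ, AddSubgroup ((Fin n → G) → M)
  | 0 => ⊥
  | n + 1 => (contCochains p G M n).map (coboundary ρ n)

/-- Continuous cohomology `H^n(G, M)`, where `M` carries the `p`-adic topology. If `M` is killed
by a power of `p`, this is the usual cohomology of a profinite group with values in a discrete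
module. -/
def ContH (p : ℕ) (ρ : Representation ℤ G M) (n : ℕ) : Type (max v w) :=
  contCocycles p ρ n ⧸ (contCoboundaries p ρ n).addSubgroupOf (contCocycles p ρ n)

instance (p : ℕ) (ρ : Representation ℤ G M) (n : ℕ) : AddCommGroup (ContH p ρ n) :=
  inferInstanceAs (AddCommGroup
    (contCocycles p ρ n ⧸ (contCoboundaries p ρ n).addSubgroupOf (contCocycles p ρ n)))

/-- Composition of cochains with a homomorphism of coefficients. -/
def cochainMap (G : Type w) (f : M →+ M') (n : ℕ) : ((Fin n → G) → M) →+ ((Fin n → G) → M') where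
  toFun c := fun g => f (c g)
  map_zero' := by ext; simp
  map_add' c c' := by ext; simp

lemma cochainMap_mem (p : ℕ) (f : M →+ M') {n : ℕ} {c : (Fin n → G) → M}
    (hc : c ∈ contCochains p G M n) : cochainMap G f n c ∈ contCochains p G M' n := by
  intro s x
  filter_upwards [hc s x] with y hy
  obtain ⟨m, hm⟩ := hy
  exact ⟨f m, by simp [cochainMap, hm]⟩

lemma cochainMap_coboundary {ρ : Representation ℤ G M} {ρ' : Representation ℤ G M'}
    (f : M →+ M') (hf : ∀ g x, f (ρ g x) = ρ' g (f x)) {n : ℕ} (c : (Fin n → G) → M) :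
    cochainMap G f (n + 1) (coboundary ρ n c) = coboundary ρ' n (cochainMap G f n c) := by
  ext g
  simp [cochainMap, coboundary, hf, map_sum, map_zsmul]

/-- The map on `H^n` induced by a `G`-equivariant homomorphism of coefficients. -/
def ContH.map (p : ℕ) {ρ : Representation ℤ G M} {ρ' : Representation ℤ G M'}
    (f : M →+ M') (hf : ∀ g x, f (ρ g x) = ρ' g (f x)) (n : ℕ) :
    ContH p ρ n →+ ContH p ρ' n :=
  have hZ : ∀ c ∈ contCocycles p ρ n, cochainMap G f n c ∈ contCocycles p ρ' n := by
    intro c hc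
    refine ⟨cochainMap_mem p f hc.1, ?_⟩
    have h0 : coboundary ρ n c = 0 := hc.2
    change coboundary ρ' n _ = 0
    rw [← cochainMap_coboundary f hf, h0, map_zero]
  QuotientAddGroup.map _ _
    (((cochainMap G f n).comp (contCocycles p ρ n).subtype).codRestrict (contCocycles p ρ' n)
      fun c => hZ c c.2)
    (by
      rintro ⟨c, hc⟩ hb
      rw [AddSubgroup.mem_comap, AddSubgroup.mem_addSubgroupOf]
      rw [AddSubgroup.mem_addSubgroupOf] at hb
      cases n with
      | zero =>
        have h0 : c = 0 := hb
        change cochainMap G f 0 c = 0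
        rw [h0, map_zero]
      | succ n =>
        obtain ⟨b, hb1, hb2⟩ := hb
        refine ⟨cochainMap G f n b, cochainMap_mem p f hb1, ?_⟩
        rw [← cochainMap_coboundary f hf, hb2]
        rfl)

end Cohomology

/-! ### Cyclotomic pairs -/

section Cyclotomic

variable (p : ℕ) [Fact p.Prime]

/-- The ideal `⋂_{k ≤ N} p^k ℤ_p`, that is `p^N ℤ_p` for finite `N` and `0` for `N = ∞`. -/
def cycIdeal (N : ℕ∞) : Ideal ℤ_[p] := ⨅ (k : ℕ) (_ : (k : ℕ∞) ≤ N), Ideal.span {(p : ℤ_[p]) ^ k}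

/-- The ring `ℤ/p^N`, where `ℤ/p^∞ = ℤ_p`. -/
abbrev CycRing (N : ℕ∞) : Type := ℤ_[p] ⧸ cycIdeal p N

/-- The reduction `ℤ/p^N → ℤ/p^s`, for finite `s ≤ N`. -/
def cycRed {N : ℕ∞} (s : ℕ) (hs : (s : ℕ∞) ≤ N) : CycRing p N →+* ZMod (p ^ s) :=
  Ideal.Quotient.lift (cycIdeal p N) (PadicInt.toZModPow s) (by
    intro a ha
    rw [← RingHom.mem_ker, PadicInt.ker_toZModPow]
    exact (Ideal.mem_iInf.1 (Ideal.mem_iInf.1 ha s) hs))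

variable {p}

/-- A free `ℤ/p^N`-module of rank one with a continuous action of `G`, given by its
character: `ℤ/p^N(1)` is `ℤ/p^N`, on which `g` acts as multiplication by `χ g`. Continuity means
that an open subgroup acts trivially on `ℤ/p^s(1)`, for each finite `s ≤ N`. -/
structure CycChar (p : ℕ) [Fact p.Prime] (N : ℕ∞) (G : Type w) [Group G] [TopologicalSpace G] where
  /-- the character -/
  χ : G →* (CycRing p N)ˣ
  cont : ∀ (s : ℕ) (hs : (s : ℕ∞) ≤ N),
    IsOpen (((Units.map (cycRed p s hs : CycRing p N →* ZMod (p ^ s))).comp χ).ker : Set G)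

variable {N : ℕ∞} {G : Type w} [Group G] [TopologicalSpace G]

/-- The character giving the action on `ℤ/p^s(1)`. -/
def CycChar.mod (T : CycChar p N G) (s : ℕ) (hs : (s : ℕ∞) ≤ N) : G →* (ZMod (p ^ s))ˣ :=
  (Units.map (cycRed p s hs : CycRing p N →* ZMod (p ^ s))).comp T.χ

/-- The `G`-module given by a ring `R`, on which `g` acts as multiplication by `ψ g`. -/
def charRep {R : Type*} [CommRing R] (ψ : G →* Rˣ) : Representation ℤ G R where
  toFun g := LinearMap.mulLeft ℤ (ψ g : R)
  map_one' := by ext; simp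
  map_mul' g h := by ext; simp

/-- `(G, ℤ/p^{1+e}(1))` is an `(n, e)`-cyclotomic pair: for every open subgroup `H` of `G`, the
map `H^n(H, ℤ/p^{1+e}(n)) → H^n(H, ℤ/p(n))` is onto. -/
def IsCyclotomicPair (n : ℕ) (e : ℕ∞) (T : CycChar p (e + 1) G) : Prop :=
  ∀ H : Subgroup G, IsOpen (H : Set G) →
    Function.Surjective (ContH.map p
      (ρ := charRep ((T.χ ^ n).comp H.subtype))
      (ρ' := charRep (((T.mod 1 (by simp)) ^ n).comp H.subtype))
      (cycRed p 1 (by simp) : CycRing p (e + 1) →+* ZMod (p ^ 1)).toAddMonoidHom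
      (by intro g x; simp [charRep, CycChar.mod]) n)

end Cyclotomic

/-! ### Truncated Witt vectors in characteristic `p` -/

section Witt

variable (p : ℕ) [Fact p.Prime] (r : ℕ) {A : Type u} {B : Type v} [CommRing A] [CommRing B]

/-- Functoriality of truncated Witt vectors. -/
def wittMap (f : A →+* B) : TruncatedWittVector p r A →+* TruncatedWittVector p r B :=
  (WittVector.truncate (p := p) (R := A) r).liftOfRightInverse TruncatedWittVector.out
    TruncatedWittVector.truncateFun_out
    ⟨(WittVector.truncate r).comp (WittVector.map f), by
      intro x hx
      rw [WittVector.mem_ker_truncate] at hx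
      rw [RingHom.mem_ker, RingHom.comp_apply, ← RingHom.mem_ker, WittVector.mem_ker_truncate]
      intro i hi
      rw [WittVector.map_coeff, hx i hi, map_zero]⟩

variable {p r}

lemma wittMap_truncate (f : A →+* B) (x : WittVector p A) :
    wittMap p r f (WittVector.truncate r x) = WittVector.truncate r (WittVector.map f x) :=
  RingHom.liftOfRightInverse_comp_apply _ _ _ _ x

@[simp] lemma coeff_wittMap (f : A →+* B) (x : TruncatedWittVector p r A) (i : Fin r) :
    (wittMap p r f x).coeff i = f (x.coeff i) := by
  obtain ⟨x, rfl⟩ := WittVector.truncate_surjective p r A x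
  rw [wittMap_truncate, WittVector.coeff_truncate, WittVector.coeff_truncate,
    WittVector.map_coeff]

variable (p r)

/-- The Teichmüller representative in truncated Witt vectors. -/
def teich : A →* TruncatedWittVector p r A :=
  (WittVector.truncate (p := p) (R := A) r : WittVector p A →* _).comp (WittVector.teichmuller p)

variable {p r}

lemma wittMap_teich (f : A →+* B) (a : A) : wittMap p r f (teich p r a) = teich p r (f a) := by
  change wittMap p r f (WittVector.truncate r (WittVector.teichmuller p a)) =
    WittVector.truncate r (WittVector.teichmuller p (f a))
  rw [wittMap_truncate, WittVector.map_teichmuller]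

lemma charP_of_natCast_eq_zero [Nontrivial A] (h : (p : A) = 0) : CharP A p :=
  have hp : p.Prime := Fact.out
  have h1 : ringChar A ∣ p := (ringChar.spec A p).1 h
  (ringChar.of_eq ((hp.eq_one_or_self_of_dvd _ h1).resolve_left (CharP.ringChar_ne_one)))

/-- The `m`-th power of the Frobenius of a ring in which `p = 0`. -/
def frob (m : ℕ) (h : (p : A) = 0) : A →+* A where
  toFun a := a ^ p ^ m
  map_one' := one_pow _
  map_mul' a b := mul_pow a b _
  map_zero' := zero_pow (pow_ne_zero _ (Fact.out : p.Prime).ne_zero)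
  map_add' a b := by
    rcases subsingleton_or_nontrivial A with hA | hA
    · exact Subsingleton.elim _ _
    · have := charP_of_natCast_eq_zero h
      exact add_pow_char_pow a b p m

lemma truncate_wittMap {t s : ℕ} (h : t ≤ s) (f : A →+* B) (x : TruncatedWittVector p s A) :
    TruncatedWittVector.truncate h (wittMap p s f x) =
      wittMap p t f (TruncatedWittVector.truncate h x) := by
  ext i
  simp

lemma wittMap_frob (m : ℕ) (hA : (p : A) = 0) (hB : (p : B) = 0) (f : A →+* B)
    (x : TruncatedWittVector p r A) :
    wittMap p r (frob m hB) (wittMap p r f x) = wittMap p r f (wittMap p r (frob m hA) x) := by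
  ext i
  simp [frob]

lemma truncated_natCast_pow (h : (p : A) = 0) : (p : TruncatedWittVector p r A) ^ r = 0 := by
  rcases subsingleton_or_nontrivial A with hA | hA
  · ext i
    exact Subsingleton.elim _ _
  · have := charP_of_natCast_eq_zero h
    have h1 : ((p : WittVector p A) ^ r) ∈ RingHom.ker (WittVector.truncate (p := p) (R := A) r) := by
      rw [WittVector.mem_ker_truncate]
      intro i hi
      exact WittVector.coeff_p_pow_eq_zero p A hi.ne
    rw [RingHom.mem_ker, map_pow, map_natCast] at h1
    exact h1

end Witt

/-! ### `G`-schemes of characteristic `p` -/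

/-- A `(G, 𝔽_p)`-scheme: a quasi-compact scheme of characteristic `p` with an action of `G`, trivial
on an open subgroup, which is covered by `G`-invariant affine open subschemes. -/
structure GScheme (p : ℕ) (G : Type w) [Group G] [TopologicalSpace G] where
  /-- the underlying scheme -/
  S : Scheme.{u}
  /-- the action (multiplication in `Aut S` is composition of maps, so this is a left action) -/
  ρ : G →* Aut S
  naive : ∃ K : OpenSubgroup G, ∀ g ∈ K, ρ g = 1
  cover : ∀ x : S, ∃ U : S.Opens, x ∈ U ∧ IsAffineOpen U ∧ ∀ g, (ρ g).hom ⁻¹ᵁ U = U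
  compact : CompactSpace S
  char : (p : Γ(S, ⊤)) = 0

section Sheaves

variable {p : ℕ} {G : Type w} [Group G] [TopologicalSpace G]

namespace GScheme

variable (X : GScheme.{u} p G)

/-- The automorphism of the scheme given by `g`. -/
def map (g : G) : X.S ⟶ X.S := (X.ρ g).hom

lemma map_one : X.map 1 = 𝟙 X.S := by
  rw [map, MonoidHom.map_one]
  rfl

lemma map_mul (g h : G) : X.map (g * h) = X.map h ≫ X.map g := by
  rw [map, MonoidHom.map_mul]
  rfl

/-- The translate `g • U` of an open subset. -/
def tr (g : G) (U : X.S.Opens) : X.S.Opens := X.map g⁻¹ ⁻¹ᵁ U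

lemma tr_one (U : X.S.Opens) : X.tr 1 U = U := by
  simp only [tr, inv_one, map_one]
  rfl

lemma tr_mul (g h : G) (U : X.S.Opens) : X.tr (g * h) U = X.tr g (X.tr h U) := by
  simp only [tr, mul_inv_rev, map_mul]
  rfl

lemma tr_mono (g : G) {U V : X.S.Opens} (h : V ≤ U) : X.tr g V ≤ X.tr g U :=
  fun _ hx => h hx

variable {X}

lemma le_tr_one {U V : X.S.Opens} (h : V ≤ U) : V ≤ X.tr 1 U := by
  rwa [tr_one]

lemma le_of_le_tr_one {U V : X.S.Opens} (h : V ≤ X.tr 1 U) : V ≤ U := by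
  rwa [tr_one] at h

lemma le_tr_mul {g h : G} {U V W : X.S.Opens} (h1 : V ≤ X.tr g U) (h2 : U ≤ X.tr h W) :
    V ≤ X.tr (g * h) W := by
  rw [tr_mul]
  exact h1.trans (X.tr_mono g h2)

lemma tr_inv_le {g : G} {U V : X.S.Opens} (h : V ≤ X.tr g U) : X.tr g⁻¹ V ≤ U := by
  have := X.tr_mono g⁻¹ h
  rwa [← tr_mul, inv_mul_cancel, tr_one] at this

lemma le_tr_tr_inv (g : G) (V : X.S.Opens) : V ≤ X.tr g (X.tr g⁻¹ V) := by
  rw [← tr_mul, mul_inv_cancel, tr_one]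

lemma char_obj (X : GScheme.{u} p G) (U : X.S.Opens) : (p : Γ(X.S, U)) = 0 := by
  have := congrArg (X.S.presheaf.map (homOfLE (le_top : U ≤ ⊤)).op).hom X.char
  simpa using this

end GScheme

variable (X : GScheme.{u} p G)

/-- A `G`-equivariant presheaf of rings on `X`. For opens `V ⊆ g • U`, the map `act g` is the
action of `g`, from sections over `U` to sections over `g • U`, followed by restriction to `V`. In
particular, `act 1` is the restriction. -/
structure GRing where
  /-- sections -/
  obj : X.S.Opens → Type u
  [ring : ∀ U, CommRing (obj U)]
  /-- action of `G` followed by restriction -/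
  act : ∀ (g : G) {U V : X.S.Opens}, V ≤ X.tr g U → obj U →+* obj V
  act_one : ∀ (U : X.S.Opens) (h : U ≤ X.tr 1 U) (x : obj U), act 1 h x = x
  act_act : ∀ (g g' : G) {U V W : X.S.Opens} (h : V ≤ X.tr g U) (h' : U ≤ X.tr g' W)
    (x : obj W), act g h (act g' h' x) = act (g * g') (GScheme.le_tr_mul h h') x

attribute [instance] GRing.ring

variable {X}

/-- Restriction of sections. -/
def GRing.res (R : GRing X) {U V : X.S.Opens} (h : V ≤ U) : R.obj U →+* R.obj V :=
  R.act 1 (GScheme.le_tr_one h)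

/-- A `G`-equivariant morphism of presheaves of rings. -/
structure GRing.Hom (R R' : GRing X) where
  /-- the map on sections -/
  app : ∀ U, R.obj U →+* R'.obj U
  app_act : ∀ (g : G) {U V : X.S.Opens} (h : V ≤ X.tr g U) (x : R.obj U),
    app V (R.act g h x) = R'.act g h (app U x)

/-- The identity. -/
def GRing.Hom.id (R : GRing X) : GRing.Hom R R := ⟨fun _ => RingHom.id _, fun _ _ _ _ _ => rfl⟩

variable (X)

/-- The structure sheaf, on which `g` acts as `f ↦ f ∘ g⁻¹`. -/
def GScheme.O : GRing X where
  obj U := Γ(X.S, U)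
  act g U V h := ((X.map g⁻¹).appLE U V h).hom
  act_one U h x := by
    have : ∀ (f : X.S ⟶ X.S) (hf : f = 𝟙 X.S) (h : U ≤ f ⁻¹ᵁ U), (f.appLE U U h).hom x = x := by
      rintro f rfl h
      exact ConcreteCategory.congr_hom (X.S.presheaf.map_id _) x
    exact this _ (by rw [inv_one, GScheme.map_one]) h
  act_act g g' U V W h h' x := by
    have : ∀ (f : X.S ⟶ X.S) (_ : f = X.map g⁻¹ ≫ X.map g'⁻¹) (h2 : V ≤ f ⁻¹ᵁ W),
        ((X.map g⁻¹).appLE U V h).hom (((X.map g'⁻¹).appLE W U h').hom x) =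
          (f.appLE W V h2).hom x := by
      rintro f rfl h2
      rw [← Scheme.Hom.appLE_comp_appLE _ _ W U V h' h]
      rfl
    exact this (X.map (g * g')⁻¹) (by rw [mul_inv_rev, GScheme.map_mul]) _

variable [Fact p.Prime]

/-- The sheaf `W_r(O_X)` of truncated Witt vectors of length `r`. -/
def GScheme.W (r : ℕ) : GRing X where
  obj U := TruncatedWittVector p r (X.O.obj U)
  act g U V h := wittMap p r (X.O.act g h)
  act_one U h x := TruncatedWittVector.ext fun i =>
    (coeff_wittMap _ x i).trans (X.O.act_one U h _)
  act_act g g' U V W h h' x := TruncatedWittVector.ext fun i =>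
    ((coeff_wittMap _ _ i).trans (congrArg _ (coeff_wittMap _ x i))).trans
      ((X.O.act_act g g' h h' _).trans (coeff_wittMap _ x i).symm)

/-- The components of a section of `W_r(O_X)`. -/
def GScheme.coeff {r : ℕ} (i : Fin r) {U : X.S.Opens} (x : (X.W r).obj U) : X.O.obj U :=
  TruncatedWittVector.coeff (p := p) i x

/-- The section of `W_r(O_X)` with given components. -/
def GScheme.wmk {r : ℕ} {U : X.S.Opens} (x : Fin r → X.O.obj U) : (X.W r).obj U :=
  TruncatedWittVector.mk p x

/-- The Teichmüller representative of a section of `O_X`. -/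
def GScheme.teich (r : ℕ) {U : X.S.Opens} : X.O.obj U →* (X.W r).obj U :=
  WittLift.teich p r

variable {X} in
lemma GScheme.W_ext {r : ℕ} {U : X.S.Opens} {x y : (X.W r).obj U}
    (h : ∀ i, X.coeff i x = X.coeff i y) : x = y :=
  TruncatedWittVector.ext h

@[simp] lemma GScheme.coeff_wmk {r : ℕ} {U : X.S.Opens} (x : Fin r → X.O.obj U) (i : Fin r) :
    X.coeff i (X.wmk x) = x i :=
  rfl

lemma GScheme.coeff_act {r : ℕ} (g : G) {U V : X.S.Opens} (h : V ≤ X.tr g U) (x : (X.W r).obj U)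
    (i : Fin r) : X.coeff i ((X.W r).act g h x) = X.O.act g h (X.coeff i x) :=
  coeff_wittMap (X.O.act g h) x i

lemma GScheme.teich_act (r : ℕ) (g : G) {U V : X.S.Opens} (h : V ≤ X.tr g U) (a : X.O.obj U) :
    (X.W r).act g h (X.teich r a) = X.teich r (X.O.act g h a) :=
  wittMap_teich (X.O.act g h) a

/-- The reduction `W_s(O_X) → W_t(O_X)`, for `t ≤ s`. -/
def GScheme.trunc {t s : ℕ} (h' : t ≤ s) : GRing.Hom (X.W s) (X.W t) where
  app U := TruncatedWittVector.truncate h'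
  app_act g U V h x := truncate_wittMap h' (X.O.act g h) x

/-- The `m`-th power of the Frobenius of `W_r(O_X)`. -/
def GScheme.frob (r m : ℕ) : GRing.Hom (X.W r) (X.W r) where
  app U := wittMap p r (WittLift.frob m (X.char_obj U))
  app_act g U V h x := wittMap_frob m _ _ (X.O.act g h) x

lemma GScheme.trunc_teich {t s : ℕ} (h' : t ≤ s) {U : X.S.Opens} (a : X.O.obj U) :
    (X.trunc h').app U (X.teich s a) = X.teich t a :=
  TruncatedWittVector.truncate_wittVector_truncate h' (WittVector.teichmuller p a)

lemma GScheme.frob_teich (r m : ℕ) {U : X.S.Opens} (a : X.O.obj U) :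
    (X.frob r m).app U (X.teich r a) = X.teich r a ^ p ^ m :=
  (wittMap_teich _ a).trans (_root_.map_pow (WittLift.teich p r) a (p ^ m))

variable {X}

lemma GRing.act_congr (R : GRing X) {g g' : G} (hg : g = g') {U V : X.S.Opens}
    (h : V ≤ X.tr g U) (h' : V ≤ X.tr g' U) (x : R.obj U) : R.act g h x = R.act g' h' x := by
  subst hg
  rfl

lemma GRing.act_act' (R : GRing X) {g g' k : G} (e : g * g' = k) {U V W : X.S.Opens}
    (h : V ≤ X.tr g U) (h' : U ≤ X.tr g' W) (h'' : V ≤ X.tr k W) (x : R.obj W) :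
    R.act g h (R.act g' h' x) = R.act k h'' x := by
  subst e
  exact R.act_act g g' h h' x

lemma GRing.res_act (R : GRing X) (g : G) {U V W : X.S.Opens} (h : W ≤ V) (h' : V ≤ X.tr g U)
    (x : R.obj U) : R.res h (R.act g h' x) = R.act g (h.trans h') x :=
  R.act_act' (one_mul g) _ _ _ x

lemma GRing.act_res (R : GRing X) (g : G) {U V W : X.S.Opens} (h : W ≤ X.tr g V) (h' : V ≤ U)
    (x : R.obj U) : R.act g h (R.res h' x) = R.act g (h.trans (X.tr_mono g h')) x :=
  R.act_act' (mul_one g) _ _ _ x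

lemma GRing.res_res (R : GRing X) {U V W : X.S.Opens} (h : W ≤ V) (h' : V ≤ U)
    (x : R.obj U) : R.res h (R.res h' x) = R.res (h.trans h') x :=
  R.act_act' (one_mul 1) _ _ _ x

lemma GRing.res_self (R : GRing X) {U : X.S.Opens} (h : U ≤ U) (x : R.obj U) : R.res h x = x :=
  R.act_one U _ x

lemma GRing.act_inv_act (R : GRing X) (g : G) {U V : X.S.Opens} (h : V ≤ X.tr g⁻¹ U)
    (h' : U ≤ X.tr g V) (x : R.obj V) : R.act g⁻¹ h (R.act g h' x) = x :=
  (R.act_act' (inv_mul_cancel g) h h' (GScheme.le_tr_one le_rfl) x).trans (R.act_one _ _ x)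

lemma GRing.act_act_inv (R : GRing X) (g : G) {U V : X.S.Opens} (h : V ≤ X.tr g U)
    (h' : U ≤ X.tr g⁻¹ V) (x : R.obj V) : R.act g h (R.act g⁻¹ h' x) = x :=
  (R.act_act' (mul_inv_cancel g) h h' (GScheme.le_tr_one le_rfl) x).trans (R.act_one _ _ x)

/-! ### Equivariant sheaves of modules -/

/-- A `G`-linearized module over `R`: a sheaf of `R`-modules with a semilinear action of `G`, an
open subgroup of which acts trivially. As for rings, `act g` is the action of `g`, from sections
over `U` to sections over `g • U`, followed by restriction to `V ⊆ g • U`; restriction is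
`act 1`. -/
structure GMod (R : GRing X) where
  /-- sections -/
  obj : X.S.Opens → Type u
  [grp : ∀ U, AddCommGroup (obj U)]
  [mod : ∀ U, Module (R.obj U) (obj U)]
  /-- action of `G` followed by restriction -/
  act : ∀ (g : G) {U V : X.S.Opens}, V ≤ X.tr g U → obj U →+ obj V
  act_smul : ∀ (g : G) {U V : X.S.Opens} (h : V ≤ X.tr g U) (a : R.obj U) (x : obj U),
    act g h (a • x) = R.act g h a • act g h x
  act_one : ∀ (U : X.S.Opens) (h : U ≤ X.tr 1 U) (x : obj U), act 1 h x = x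
  act_act : ∀ (g g' : G) {U V W : X.S.Opens} (h : V ≤ X.tr g U) (h' : U ≤ X.tr g' W)
    (x : obj W), act g h (act g' h' x) = act (g * g') (GScheme.le_tr_mul h h') x
  sep : ∀ {U : X.S.Opens} (x y : obj U), (∀ t ∈ U, ∃ (V : X.S.Opens) (h : V ≤ U), t ∈ V ∧
    act 1 (GScheme.le_tr_one h) x = act 1 (GScheme.le_tr_one h) y) → x = y
  glue : ∀ {ι : Type u} {U : X.S.Opens} (V : ι → X.S.Opens) (hV : ∀ i, V i ≤ U),
    (∀ t ∈ U, ∃ i, t ∈ V i) → ∀ x : ∀ i, obj (V i),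
    (∀ (i j : ι) (W : X.S.Opens) (hi : W ≤ V i) (hj : W ≤ V j),
      act 1 (GScheme.le_tr_one hi) (x i) = act 1 (GScheme.le_tr_one hj) (x j)) →
    ∃ y : obj U, ∀ i, act 1 (GScheme.le_tr_one (hV i)) y = x i
  naive : ∃ K : OpenSubgroup G, ∀ g ∈ K, ∀ {U V : X.S.Opens} (h : V ≤ X.tr g U) (h' : V ≤ U)
    (x : obj U), act g h x = act 1 (GScheme.le_tr_one h') x

attribute [instance] GMod.grp GMod.mod

namespace GMod

variable {R R' : GRing X}

/-- Restriction of sections. -/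
def res (M : GMod R) {U V : X.S.Opens} (h : V ≤ U) : M.obj U →+ M.obj V :=
  M.act 1 (GScheme.le_tr_one h)

lemma act_congr (M : GMod R) {g g' : G} (hg : g = g') {U V : X.S.Opens}
    (h : V ≤ X.tr g U) (h' : V ≤ X.tr g' U) (x : M.obj U) : M.act g h x = M.act g' h' x := by
  subst hg
  rfl

lemma act_act' (M : GMod R) {g g' k : G} (e : g * g' = k) {U V W : X.S.Opens}
    (h : V ≤ X.tr g U) (h' : U ≤ X.tr g' W) (h'' : V ≤ X.tr k W) (x : M.obj W) :
    M.act g h (M.act g' h' x) = M.act k h'' x := by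
  subst e
  exact M.act_act g g' h h' x

lemma res_act (M : GMod R) (g : G) {U V W : X.S.Opens} (h : W ≤ V) (h' : V ≤ X.tr g U)
    (x : M.obj U) : M.res h (M.act g h' x) = M.act g (h.trans h') x :=
  M.act_act' (one_mul g) _ _ _ x

lemma act_res (M : GMod R) (g : G) {U V W : X.S.Opens} (h : W ≤ X.tr g V) (h' : V ≤ U)
    (x : M.obj U) : M.act g h (M.res h' x) = M.act g (h.trans (X.tr_mono g h')) x :=
  M.act_act' (mul_one g) _ _ _ x

lemma res_res (M : GMod R) {U V W : X.S.Opens} (h : W ≤ V) (h' : V ≤ U)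
    (x : M.obj U) : M.res h (M.res h' x) = M.res (h.trans h') x :=
  M.act_act' (one_mul 1) _ _ _ x

lemma res_self (M : GMod R) {U : X.S.Opens} (h : U ≤ U) (x : M.obj U) : M.res h x = x :=
  M.act_one U _ x

lemma act_inv_act (M : GMod R) (g : G) {U V : X.S.Opens} (h : V ≤ X.tr g⁻¹ U) (h' : U ≤ X.tr g V)
    (x : M.obj V) : M.act g⁻¹ h (M.act g h' x) = x :=
  (M.act_act' (inv_mul_cancel g) h h' (GScheme.le_tr_one le_rfl) x).trans (M.act_one _ _ x)

lemma act_act_inv (M : GMod R) (g : G) {U V : X.S.Opens} (h : V ≤ X.tr g U) (h' : U ≤ X.tr g⁻¹ V)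
    (x : M.obj V) : M.act g h (M.act g⁻¹ h' x) = x :=
  (M.act_act' (mul_inv_cancel g) h h' (GScheme.le_tr_one le_rfl) x).trans (M.act_one _ _ x)

/-- A `G`-equivariant morphism of sheaves `M → N` that is semilinear along `φ`. -/
structure Hom (φ : GRing.Hom R R') (M : GMod R) (N : GMod R') where
  /-- the map on sections -/
  app : ∀ U, M.obj U →+ N.obj U
  app_smul : ∀ U (a : R.obj U) (x : M.obj U), app U (a • x) = φ.app U a • app U x
  app_act : ∀ (g : G) {U V : X.S.Opens} (h : V ≤ X.tr g U) (x : M.obj U),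
    app V (M.act g h x) = N.act g h (app U x)

/-- The identity. -/
def Hom.id (M : GMod R) : Hom (GRing.Hom.id R) M M :=
  ⟨fun _ => AddMonoidHom.id _, fun _ _ _ => rfl, fun _ _ _ _ _ => rfl⟩

end GMod

lemma O_act_one {U V : X.S.Opens} (h : V ≤ U) (x : X.O.obj U) :
    X.O.act 1 (GScheme.le_tr_one h) x = (X.S.presheaf.map (homOfLE h).op).hom x := by
  have : ∀ (f : X.S ⟶ X.S) (_ : f = 𝟙 X.S) (h' : V ≤ f ⁻¹ᵁ U),
      (f.appLE U V h').hom x = (X.S.presheaf.map (homOfLE h).op).hom x := by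
    rintro f rfl h'
    rfl
  exact this (X.map 1⁻¹) (by rw [inv_one, GScheme.map_one]) _

lemma O_sep {U : X.S.Opens} (x y : X.O.obj U) (H : ∀ t ∈ U, ∃ (V : X.S.Opens) (h : V ≤ U), t ∈ V ∧
    X.O.act 1 (GScheme.le_tr_one h) x = X.O.act 1 (GScheme.le_tr_one h) y) : x = y := by
  choose V hV ht e using fun t : U => H t t.2
  refine X.S.sheaf.eq_of_locally_eq' V U (fun t => homOfLE (hV t))
    (fun t ht' => TopologicalSpace.Opens.mem_iSup.2 ⟨⟨t, ht'⟩, ht ⟨t, ht'⟩⟩) x y fun t => ?_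
  have := e t
  rw [O_act_one, O_act_one] at this
  exact this

lemma O_glue {ι : Type u} {U : X.S.Opens} (V : ι → X.S.Opens) (hV : ∀ i, V i ≤ U)
    (hc : ∀ t ∈ U, ∃ i, t ∈ V i) (x : ∀ i, X.O.obj (V i))
    (H : ∀ (i j : ι) (W : X.S.Opens) (hi : W ≤ V i) (hj : W ≤ V j),
      X.O.act 1 (GScheme.le_tr_one hi) (x i) = X.O.act 1 (GScheme.le_tr_one hj) (x j)) :
    ∃ y : X.O.obj U, ∀ i, X.O.act 1 (GScheme.le_tr_one (hV i)) y = x i := by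
  obtain ⟨y, hy, -⟩ := X.S.sheaf.existsUnique_gluing' V U (fun i => homOfLE (hV i))
    (fun t ht => TopologicalSpace.Opens.mem_iSup.2 (hc t ht)) x (by
      intro i j
      have := H i j (V i ⊓ V j) inf_le_left inf_le_right
      rw [O_act_one, O_act_one] at this
      exact this)
  exact ⟨y, fun i => (O_act_one (hV i) y).trans (hy i)⟩

lemma W_sep {r : ℕ} {U : X.S.Opens} (x y : (X.W r).obj U)
    (H : ∀ t ∈ U, ∃ (V : X.S.Opens) (h : V ≤ U), t ∈ V ∧
      (X.W r).act 1 (GScheme.le_tr_one h) x = (X.W r).act 1 (GScheme.le_tr_one h) y) : x = y := by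
  refine GScheme.W_ext fun i => O_sep _ _ fun t ht => ?_
  obtain ⟨V, h, hV, e⟩ := H t ht
  refine ⟨V, h, hV, ?_⟩
  rw [← GScheme.coeff_act, ← GScheme.coeff_act, e]

lemma W_glue {r : ℕ} {ι : Type u} {U : X.S.Opens} (V : ι → X.S.Opens) (hV : ∀ i, V i ≤ U)
    (hc : ∀ t ∈ U, ∃ i, t ∈ V i) (x : ∀ i, (X.W r).obj (V i))
    (H : ∀ (i j : ι) (W : X.S.Opens) (hi : W ≤ V i) (hj : W ≤ V j),
      (X.W r).act 1 (GScheme.le_tr_one hi) (x i) = (X.W r).act 1 (GScheme.le_tr_one hj) (x j)) :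
    ∃ y : (X.W r).obj U, ∀ i, (X.W r).act 1 (GScheme.le_tr_one (hV i)) y = x i := by
  have : ∀ k : Fin r, ∃ y : X.O.obj U, ∀ i, X.O.act 1 (GScheme.le_tr_one (hV i)) y =
      X.coeff k (x i) := fun k => O_glue V hV hc _ (by
    intro i j W hi hj
    rw [← GScheme.coeff_act, ← GScheme.coeff_act, H i j W hi hj])
  choose y hy using this
  refine ⟨X.wmk y, fun i => GScheme.W_ext fun k => ?_⟩
  rw [GScheme.coeff_act, ← hy, GScheme.coeff_wmk]

lemma W_naive (r : ℕ) : ∃ K : OpenSubgroup G, ∀ g ∈ K, ∀ {U V : X.S.Opens} (h : V ≤ X.tr g U)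
    (h' : V ≤ U) (x : (X.W r).obj U),
    (X.W r).act g h x = (X.W r).act 1 (GScheme.le_tr_one h') x := by
  obtain ⟨K, hK⟩ := X.naive
  refine ⟨K, fun g hg U V h h' x => ?_⟩
  refine GScheme.W_ext fun i => ?_
  rw [GScheme.coeff_act, GScheme.coeff_act, O_act_one]
  have : ∀ (f : X.S ⟶ X.S) (_ : f = 𝟙 X.S) (h : V ≤ f ⁻¹ᵁ U) (x : Γ(X.S, U)),
      (f.appLE U V h).hom x = (X.S.presheaf.map (homOfLE h').op).hom x := by
    rintro f rfl h x
    rfl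
  exact this (X.map g⁻¹) (by rw [GScheme.map, hK _ (inv_mem hg)]; rfl) h _

variable (X) in
/-- `W_r(O_X)`, as a module over itself. -/
def GScheme.WMod (r : ℕ) : GMod (X.W r) where
  obj U := (X.W r).obj U
  act g U V h := ((X.W r).act g h).toAddMonoidHom
  act_smul g U V h a x := _root_.map_mul ((X.W r).act g h) a x
  act_one := (X.W r).act_one
  act_act := (X.W r).act_act
  sep := W_sep
  glue := W_glue
  naive := W_naive r

variable (X) in
/-- The open subscheme where a section of `O_X` is invertible. -/
def GScheme.basicOpen {U : X.S.Opens} (f : X.O.obj U) : X.S.Opens :=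
  X.S.basicOpen (show Γ(X.S, U) from f)

lemma GScheme.basicOpen_le {U : X.S.Opens} (f : X.O.obj U) : X.basicOpen f ≤ U :=
  Scheme.basicOpen_le X.S _

/-- Quasi-coherence of a sheaf of `W_r(O_X)`-modules: for every affine open `U` and `f ∈ O(U)`, the
module of sections over `D(f)` is the localization of the module of sections over `U` at the
Teichmüller representative of `f` (recall that `W_r(A_f)` is the localization of `W_r(A)` at the
Teichmüller representative of `f`). -/
def GMod.IsQCoh {r : ℕ} (M : GMod (X.W r)) : Prop :=
  ∀ (U : X.S.Opens), IsAffineOpen U → ∀ f : X.O.obj U,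
    (∀ x : M.obj U, M.res (GScheme.basicOpen_le f) x = 0 →
      ∃ k : ℕ, (X.teich r f) ^ k • x = 0) ∧
    (∀ y : M.obj (X.basicOpen f), ∃ (k : ℕ) (x : M.obj U), M.res (GScheme.basicOpen_le f) x =
      (X.W r).res (GScheme.basicOpen_le f) (X.teich r f) ^ k • y)

/-! ### Line bundles and their Teichmüller lifts -/

/-- A section of a module over `O_X` is a generator if it is a basis of the restriction of the
module to its open of definition. -/
def GMod.IsGen (L : GMod X.O) {U : X.S.Opens} (ℓ : L.obj U) : Prop :=
  ∀ (V : X.S.Opens) (h : V ≤ U), Function.Bijective fun a : X.O.obj V => a • L.res h ℓ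

lemma GMod.IsGen.act {L : GMod X.O} {U V : X.S.Opens} {ℓ : L.obj U} (hℓ : L.IsGen ℓ) (g : G)
    (h : V ≤ X.tr g U) : L.IsGen (L.act g h ℓ) := by
  intro V' h'
  have key : ∀ a : X.O.obj V', L.act g⁻¹ le_rfl (a • L.res h' (L.act g h ℓ)) =
      X.O.act g⁻¹ le_rfl a • L.res (GScheme.tr_inv_le (h'.trans h)) ℓ := by
    intro a
    rw [L.act_smul, L.res_act]
    congr 1
    exact L.act_act' (inv_mul_cancel g) _ _ _ _
  have hinj : ∀ x y : L.obj V', L.act g⁻¹ (le_rfl : X.tr g⁻¹ V' ≤ _) x = L.act g⁻¹ le_rfl y →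
      x = y := by
    intro x y e
    have := congrArg (L.act g (GScheme.le_tr_tr_inv g V')) e
    rwa [L.act_act_inv, L.act_act_inv] at this
  have hb := hℓ _ (GScheme.tr_inv_le (h'.trans h))
  constructor
  · intro a b hab
    have := congrArg (L.act g⁻¹ (le_rfl : X.tr g⁻¹ V' ≤ _)) hab
    simp only [key] at this
    have := congrArg (X.O.act g (GScheme.le_tr_tr_inv g V')) (hb.1 this)
    rwa [X.O.act_act_inv, X.O.act_act_inv] at this
  · intro x
    obtain ⟨a, ha⟩ := hb.2 (L.act g⁻¹ le_rfl x)
    refine ⟨X.O.act g (GScheme.le_tr_tr_inv g V') a, hinj _ _ ?_⟩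
    rw [key, X.O.act_inv_act]
    exact ha

lemma GMod.IsGen.res {L : GMod X.O} {U V : X.S.Opens} {ℓ : L.obj U} (hℓ : L.IsGen ℓ)
    (h : V ≤ U) : L.IsGen (L.res h ℓ) :=
  hℓ.act 1 _

variable (X) in
/-- A `G`-linearized line bundle on `X`. -/
structure LineBundle extends GMod X.O where
  locallyFree : ∀ t : X.S, ∃ (U : X.S.Opens) (_ : t ∈ U) (ℓ : obj U), toGMod.IsGen ℓ

namespace GMod

variable (L : GMod X.O)

/-- Pairs of an open `V ⊆ U` and a generator of `L` over `V`. -/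
structure Gens (U : X.S.Opens) where
  /-- the open -/
  V : X.S.Opens
  le : V ≤ U
  /-- the generator -/
  ℓ : L.obj V
  isGen : L.IsGen ℓ

variable {L}

/-- Viewing a generator as a generator over a bigger open. -/
abbrev Gens.of {U U' : X.S.Opens} (q : L.Gens U) (h : U ≤ U') : L.Gens U' :=
  ⟨q.V, q.le.trans h, q.ℓ, q.isGen⟩

/-- The translate of a generator by `g⁻¹`. -/
abbrev Gens.translate {U V : X.S.Opens} (q : L.Gens V) (g : G) (h : V ≤ X.tr g U) : L.Gens U :=
  ⟨X.tr g⁻¹ q.V, GScheme.tr_inv_le (q.le.trans h), L.act g⁻¹ le_rfl q.ℓ, q.isGen.act _ _⟩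

/-- Restriction of a generator of `L` over an open of `U` to an open of `U'`. -/
abbrev Gens.restrict {U U' V : X.S.Opens} (q : L.Gens U) (h : V ≤ q.V) (h' : V ≤ U') :
    L.Gens U' :=
  ⟨V, h', L.res h q.ℓ, q.isGen.res h⟩

variable (L)

/-- Sections over `U` of the Teichmüller lift of `L^{⊗ k}` to `W_r`. Writing such a section as
`σ(ℓ) τ(ℓ)^k` for each local generator `ℓ` of `L`, where `τ(aℓ) = [a] τ(ℓ)`, it amounts to a
family of `σ(ℓ) ∈ W_r(O_X)(V)`, one for each generator `ℓ` of `L` over an open `V ⊆ U`, such that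
`[a]^k σ(a ℓ) = σ(ℓ)`. -/
def teichSections (r k : ℕ) (U : X.S.Opens) : AddSubgroup (∀ q : L.Gens U, (X.W r).obj q.V) where
  carrier := {σ | ∀ (q q' : L.Gens U) (h : q'.V ≤ q.V) (a : X.O.obj q'.V),
    q'.ℓ = a • L.res h q.ℓ → X.teich r a ^ k * σ q' = (X.W r).res h (σ q)}
  zero_mem' := by
    intro q q' h a ha
    simp
  add_mem' := by
    intro σ σ' hσ hσ' q q' h a ha
    simp only [Pi.add_apply, mul_add, _root_.map_add, hσ q q' h a ha, hσ' q q' h a ha]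
  neg_mem' := by
    intro σ hσ q q' h a ha
    simp only [Pi.neg_apply, mul_neg, _root_.map_neg, hσ q q' h a ha]

variable {L} {r k : ℕ}

lemma teichSections_res {U : X.S.Opens} (σ : L.teichSections r k U) (q q' : L.Gens U)
    (h : q'.V ≤ q.V) (e : q'.ℓ = L.res h q.ℓ) : σ.1 q' = (X.W r).res h (σ.1 q) := by
  have := σ.2 q q' h 1 (by rw [one_smul, e])
  rwa [_root_.map_one, one_pow, one_mul] at this

instance (U : X.S.Opens) : Module ((X.W r).obj U) (L.teichSections r k U) where
  smul b σ := ⟨fun q => (X.W r).res q.le b * σ.1 q, by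
    intro q q' h a ha
    rw [mul_left_comm, σ.2 q q' h a ha, _root_.map_mul, GRing.res_res]⟩
  one_smul σ := Subtype.ext <| funext fun q => by
    change (X.W r).res q.le 1 * σ.1 q = σ.1 q
    rw [_root_.map_one, one_mul]
  mul_smul b c σ := Subtype.ext <| funext fun q => by
    change (X.W r).res q.le (b * c) * σ.1 q = (X.W r).res q.le b * ((X.W r).res q.le c * σ.1 q)
    rw [_root_.map_mul, mul_assoc]
  smul_zero b := Subtype.ext <| funext fun q => mul_zero _
  smul_add b σ σ' := Subtype.ext <| funext fun q => mul_add _ _ _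
  add_smul b c σ := Subtype.ext <| funext fun q => by
    change (X.W r).res q.le (b + c) * σ.1 q =
      (X.W r).res q.le b * σ.1 q + (X.W r).res q.le c * σ.1 q
    rw [_root_.map_add, add_mul]
  zero_smul σ := Subtype.ext <| funext fun q => by
    change (X.W r).res q.le 0 * σ.1 q = 0
    rw [_root_.map_zero, zero_mul]

lemma smul_teichSections {U : X.S.Opens} (b : (X.W r).obj U) (σ : L.teichSections r k U)
    (q : L.Gens U) : (b • σ).1 q = (X.W r).res q.le b * σ.1 q :=
  rfl

/-- The action of `g` on sections of the Teichmüller lift: `(g σ)(ℓ) = g (σ (g⁻¹ ℓ))`. -/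
def teichAct (g : G) {U V : X.S.Opens} (h : V ≤ X.tr g U) :
    L.teichSections r k U →+ L.teichSections r k V where
  toFun σ := ⟨fun q => (X.W r).act g (GScheme.le_tr_tr_inv g q.V) (σ.1 (q.translate g h)), by
    intro q q' hq a ha
    have e := σ.2 (q.translate g h) (q'.translate g h) (X.tr_mono g⁻¹ hq)
      (X.O.act g⁻¹ le_rfl a) (by
        change L.act g⁻¹ _ q'.ℓ = _ • L.res _ (L.act g⁻¹ _ q.ℓ)
        rw [ha, L.act_smul, L.act_res, L.res_act])
    have e' := congrArg ((X.W r).act g (GScheme.le_tr_tr_inv g q'.V)) e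
    rw [_root_.map_mul, _root_.map_pow, GScheme.teich_act, X.O.act_act_inv, GRing.act_res] at e'
    rw [e', GRing.res_act]⟩
  map_zero' := Subtype.ext <| funext fun q => _root_.map_zero _
  map_add' σ σ' := Subtype.ext <| funext fun q => _root_.map_add _ _ _

lemma teichAct_def (g : G) {U V : X.S.Opens} (h : V ≤ X.tr g U) (σ : L.teichSections r k U)
    (q : L.Gens V) : (teichAct g h σ).1 q =
      (X.W r).act g (GScheme.le_tr_tr_inv g q.V) (σ.1 (q.translate g h)) :=
  rfl

lemma teichAct_apply (g : G) {U V : X.S.Opens} (h : V ≤ X.tr g U) (σ : L.teichSections r k U)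
    (q : L.Gens V) (q₀ : L.Gens U) (h₀ : q.V ≤ X.tr g q₀.V) (e : q.ℓ = L.act g h₀ q₀.ℓ) :
    (teichAct g h σ).1 q = (X.W r).act g h₀ (σ.1 q₀) := by
  rw [teichAct_def, teichSections_res σ q₀ (q.translate g h) (GScheme.tr_inv_le h₀) (by
    change L.act g⁻¹ _ q.ℓ = _
    rw [e]
    exact L.act_act' (inv_mul_cancel g) _ _ _ _), GRing.act_res]

lemma teichAct_one_apply {U V : X.S.Opens} (h : V ≤ U) (σ : L.teichSections r k U)
    (q : L.Gens V) : (teichAct 1 (GScheme.le_tr_one h) σ).1 q = σ.1 (q.of h) := by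
  rw [teichAct_apply 1 _ σ q (q.of h) (GScheme.le_tr_one le_rfl) (L.act_one _ _ _).symm]
  exact (X.W r).act_one _ _ _

lemma teich_sep {U : X.S.Opens} (σ σ' : L.teichSections r k U)
    (H : ∀ t ∈ U, ∃ (V : X.S.Opens) (h : V ≤ U), t ∈ V ∧
      teichAct 1 (GScheme.le_tr_one h) σ = teichAct 1 (GScheme.le_tr_one h) σ') : σ = σ' := by
  refine Subtype.ext <| funext fun q => W_sep _ _ fun t ht => ?_
  obtain ⟨V, h, hV, e⟩ := H t (q.le ht)
  have hle : q.V ⊓ V ≤ q.V := inf_le_left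
  have hle' : q.V ⊓ V ≤ V := inf_le_right
  refine ⟨q.V ⊓ V, hle, ⟨ht, hV⟩, ?_⟩
  have e1 := congrFun (congrArg Subtype.val e) (q.restrict hle hle')
  rw [teichAct_one_apply h, teichAct_one_apply h] at e1
  have e2 := fun τ : L.teichSections r k U => teichSections_res τ q
    ((q.restrict hle hle').of h) hle rfl
  exact (e2 σ).symm.trans (e1.trans (e2 σ'))

lemma teich_glue {ι : Type u} {U : X.S.Opens} (V : ι → X.S.Opens) (hV : ∀ i, V i ≤ U)
    (hc : ∀ t ∈ U, ∃ i, t ∈ V i) (x : ∀ i, L.teichSections r k (V i))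
    (H : ∀ (i j : ι) (W : X.S.Opens) (hi : W ≤ V i) (hj : W ≤ V j),
      teichAct 1 (GScheme.le_tr_one hi) (x i) = teichAct 1 (GScheme.le_tr_one hj) (x j)) :
    ∃ y : L.teichSections r k U, ∀ i, teichAct 1 (GScheme.le_tr_one (hV i)) y = x i := by
  have hl : ∀ (q : L.Gens U) (i : ι), q.V ⊓ V i ≤ q.V := fun q i => inf_le_left
  have hr : ∀ (q : L.Gens U) (i : ι), q.V ⊓ V i ≤ V i := fun q i => inf_le_right
  have hq : ∀ q : L.Gens U, ∃ y : (X.W r).obj q.V, ∀ i,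
      (X.W r).res (hl q i) y = (x i).1 (q.restrict (hl q i) (hr q i)) := by
    intro q
    refine W_glue (fun i => q.V ⊓ V i) (hl q) (fun t ht => ?_) _ ?_
    · obtain ⟨i, hi⟩ := hc t (q.le ht)
      exact ⟨i, ht, hi⟩
    · intro i j W hi hj
      have hWq : W ≤ q.V := hi.trans (hl q i)
      have e := congrFun (congrArg Subtype.val (H i j W (hi.trans (hr q i)) (hj.trans (hr q j))))
        (q.restrict hWq le_rfl)
      rw [teichAct_one_apply (hi.trans (hr q i)), teichAct_one_apply (hj.trans (hr q j))] at e
      have ei := teichSections_res (x i) (q.restrict (hl q i) (hr q i))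
        ((q.restrict hWq le_rfl).of (hi.trans (hr q i))) hi (L.res_res _ _ _).symm
      have ej := teichSections_res (x j) (q.restrict (hl q j) (hr q j))
        ((q.restrict hWq le_rfl).of (hj.trans (hr q j))) hj (L.res_res _ _ _).symm
      exact ei.symm.trans (e.trans ej)
  choose y hy using hq
  refine ⟨⟨y, ?_⟩, fun i => Subtype.ext <| funext fun q => ?_⟩
  · intro q q' h a ha
    refine W_sep _ _ fun t ht => ?_
    obtain ⟨i, hi⟩ := hc t (q'.le ht)
    refine ⟨q'.V ⊓ V i, hl q' i, ⟨ht, hi⟩, ?_⟩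
    have hle : q'.V ⊓ V i ≤ q.V ⊓ V i := inf_le_inf h le_rfl
    have e := (x i).2 (q.restrict (hl q i) (hr q i)) (q'.restrict (hl q' i) (hr q' i)) hle
      (X.O.res (hl q' i) a) (by
        change L.res _ q'.ℓ = _ • L.res _ (L.res _ q.ℓ)
        rw [L.res_res]
        exact (congrArg (L.res (hl q' i)) ha).trans
          ((L.act_smul 1 (GScheme.le_tr_one (hl q' i)) a (L.res h q.ℓ)).trans
            (congrArg (X.O.res (hl q' i) a • ·) (L.res_res (hl q' i) h q.ℓ))))
    rw [← hy q i, ← hy q' i, GRing.res_res] at e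
    have e1 : (X.W r).res (hl q' i) (X.teich r a ^ k * y q') =
        X.teich r (X.O.res (hl q' i) a) ^ k * (X.W r).res (hl q' i) (y q') := by
      rw [_root_.map_mul, _root_.map_pow]
      exact congrArg (fun z => z ^ k * _) (X.teich_act r 1 _ a)
    exact e1.trans (e.trans (GRing.res_res _ (hl q' i) h (y q)).symm)
  · rw [teichAct_one_apply (hV i)]
    have hle : q.V ≤ q.V ⊓ V i := le_inf le_rfl q.le
    have e1 := congrArg ((X.W r).res hle) (hy (q.of (hV i)) i)
    have e2 := teichSections_res (x i) ((q.of (hV i)).restrict (hl _ i) (hr (q.of (hV i)) i)) q hle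
      ((L.res_res _ _ _).trans (L.res_self _ _)).symm
    rw [e2]
    refine Eq.trans ?_ e1
    rw [GRing.res_res, GRing.res_self]

lemma tr_eq_of_mem {K : OpenSubgroup G} (hK : ∀ g ∈ K, X.ρ g = 1) {g : G} (hg : g ∈ K)
    (V : X.S.Opens) : X.tr g V = V := by
  rw [GScheme.tr, GScheme.map, hK _ (inv_mem hg)]
  rfl

variable (L) in
/-- The Teichmüller lift `W_r(L^{⊗ k})` of `L^{⊗ k}`, for a `G`-linearized line bundle `L`. For
`k = p ^ m`, it is the Teichmüller lift of the Frobenius pullback `L^{(m)}`. -/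
def teichLift (r k : ℕ) : GMod (X.W r) where
  obj U := L.teichSections r k U
  act g U V h := teichAct g h
  act_smul g U V h b σ := Subtype.ext <| funext fun q => by
    rw [teichAct_def, smul_teichSections, smul_teichSections, teichAct_def, _root_.map_mul,
      GRing.act_res, GRing.res_act]
  act_one U h σ := Subtype.ext <| funext fun q => by
    rw [teichAct_apply 1 h σ q q (GScheme.le_tr_one le_rfl) (L.act_one _ _ _).symm]
    exact (X.W r).act_one _ _ _
  act_act g g' U V W h h' σ := Subtype.ext <| funext fun q => by
    rw [teichAct_apply (g * g') _ σ q ((q.translate g h).translate g' h')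
      (GScheme.le_tr_mul (GScheme.le_tr_tr_inv g q.V)
        (GScheme.le_tr_tr_inv g' (q.translate g h).V)) (by
        rw [← L.act_act g g' (GScheme.le_tr_tr_inv g q.V)
          (GScheme.le_tr_tr_inv g' (q.translate g h).V), L.act_act_inv, L.act_act_inv]),
      teichAct_def, teichAct_def, GRing.act_act]
  sep := teich_sep
  glue := teich_glue
  naive := by
    obtain ⟨K, hK⟩ := L.naive
    obtain ⟨K', hK'⟩ := W_naive (X := X) r
    obtain ⟨K'', hK''⟩ := X.naive
    refine ⟨K ⊓ K' ⊓ K'', fun g hg U V h h' σ => Subtype.ext <| funext fun q => ?_⟩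
    have h₀ : q.V ≤ X.tr g (q.of h').V := (tr_eq_of_mem hK'' hg.2 q.V).ge
    rw [teichAct_one_apply h', teichAct_apply g h σ q (q.of h') h₀
      ((hK g hg.1.1 h₀ le_rfl q.ℓ).trans (L.act_one _ _ _)).symm]
    exact (hK' g hg.1.2 h₀ le_rfl _).trans ((X.W r).act_one _ _ _)

end GMod

/-! ### Cyclotomic twists -/

lemma smul_congr_of_smul_eq_zero {M : Type*} [AddCommGroup M] {N : ℕ} {x : M} (hx : N • x = 0)
    {a b : ℕ} (h : (a : ZMod N) = b) : a • x = b • x := by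
  obtain ⟨d, hd⟩ := (Nat.modEq_iff_dvd.1 ((ZMod.natCast_eq_natCast_iff a b N).1 h))
  have e : (b : ℤ) = a + d * N := by
    rw [mul_comm, ← hd]
    ring
  have := congrArg (fun z : ℤ => z • x) e
  simp only [add_zsmul, mul_zsmul, natCast_zsmul, hx, smul_zero, add_zero] at this
  exact this.symm

lemma natCast_val (p s : ℕ) [Fact p.Prime] (a : ZMod (p ^ s)) : ((a.val : ℕ) : ZMod (p ^ s)) = a :=
  ZMod.natCast_zmod_val a

namespace GMod

lemma pow_smul_eq_zero {s : ℕ} (M : GMod (X.W s)) {U : X.S.Opens} (x : M.obj U) :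
    p ^ s • x = 0 := by
  have h : ((p : (X.W s).obj U)) ^ s = 0 := truncated_natCast_pow (X.char_obj U)
  have h1 : ((p ^ s : ℕ) : (X.W s).obj U) • x = p ^ s • x := Nat.cast_smul_eq_nsmul _ _ _
  rw [← h1, Nat.cast_pow, h, zero_smul]

/-- The twist of a module over `W_s(O_X)` by a character of `G` with values in the units of
`ℤ/p^s`: the same sheaf, on which the action of `g` is multiplied by `ψ g`. -/
def twist {s : ℕ} (M : GMod (X.W s)) (ψ : G →* (ZMod (p ^ s))ˣ) (hψ : IsOpen (ψ.ker : Set G)) :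
    GMod (X.W s) where
  obj := M.obj
  act g U V h := (nsmulAddMonoidHom (ψ g : ZMod (p ^ s)).val).comp (M.act g h)
  act_smul g U V h a x := by
    change (ψ g : ZMod (p ^ s)).val • M.act g h (a • x) =
      (X.W s).act g h a • ((ψ g : ZMod (p ^ s)).val • M.act g h x)
    rw [M.act_smul, smul_comm]
  act_one U h x := by
    change (ψ 1 : ZMod (p ^ s)).val • M.act 1 h x = x
    rw [M.act_one]
    refine (smul_congr_of_smul_eq_zero (M.pow_smul_eq_zero x) (b := 1) ?_).trans (one_smul _ x)
    rw [natCast_val, _root_.map_one, Units.val_one, Nat.cast_one]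
  act_act g g' U V W h h' x := by
    change (ψ g : ZMod (p ^ s)).val • M.act g h ((ψ g' : ZMod (p ^ s)).val • M.act g' h' x) =
      (ψ (g * g') : ZMod (p ^ s)).val • M.act (g * g') _ x
    rw [_root_.map_nsmul, M.act_act, ← mul_smul]
    refine smul_congr_of_smul_eq_zero (M.pow_smul_eq_zero _) ?_
    rw [Nat.cast_mul, natCast_val, natCast_val, natCast_val, _root_.map_mul, Units.val_mul]
  sep {U} x y H := M.sep x y fun t ht => by
    obtain ⟨V, h, hV, e⟩ := H t ht
    refine ⟨V, h, hV, ?_⟩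
    have key : ∀ z : M.obj U, (ψ 1 : ZMod (p ^ s)).val • M.act 1 (GScheme.le_tr_one h) z =
        M.act 1 (GScheme.le_tr_one h) z := fun z => by
      refine (smul_congr_of_smul_eq_zero (M.pow_smul_eq_zero _) (b := 1) ?_).trans (one_smul _ _)
      rw [natCast_val, _root_.map_one, Units.val_one, Nat.cast_one]
    exact (key x).symm.trans (e.trans (key y))
  glue {ι U} V hV hc x H := by
    have key : ∀ {U V : X.S.Opens} (h : V ≤ U) (z : M.obj U),
        (ψ 1 : ZMod (p ^ s)).val • M.act 1 (GScheme.le_tr_one h) z =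
        M.act 1 (GScheme.le_tr_one h) z := fun h z => by
      refine (smul_congr_of_smul_eq_zero (M.pow_smul_eq_zero _) (b := 1) ?_).trans (one_smul _ _)
      rw [natCast_val, _root_.map_one, Units.val_one, Nat.cast_one]
    obtain ⟨y, hy⟩ := M.glue V hV hc x fun i j W hi hj =>
      (key hi (x i)).symm.trans ((H i j W hi hj).trans (key hj (x j)))
    exact ⟨y, fun i => (key (hV i) y).trans (hy i)⟩
  naive := by
    obtain ⟨K, hK⟩ := M.naive
    refine ⟨K ⊓ ⟨ψ.ker, hψ⟩, fun g hg U V h h' x => ?_⟩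
    have e : ψ g = ψ 1 := by
      rw [_root_.map_one]
      exact hg.2
    change (ψ g : ZMod (p ^ s)).val • M.act g h x =
      (ψ 1 : ZMod (p ^ s)).val • M.act 1 (GScheme.le_tr_one h') x
    rw [e, hK g hg.1 h h' x]

/-- The twist of a semilinear morphism, by compatible characters. -/
def Hom.twist {s t : ℕ} {φ : GRing.Hom (X.W s) (X.W t)} {M : GMod (X.W s)} {N : GMod (X.W t)}
    (f : Hom φ M N) {ψ : G →* (ZMod (p ^ s))ˣ} {ψ' : G →* (ZMod (p ^ t))ˣ}
    (hψ : IsOpen (ψ.ker : Set G)) (hψ' : IsOpen (ψ'.ker : Set G))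
    (e : ∀ g, (((ψ g : ZMod (p ^ s)).val : ℕ) : ZMod (p ^ t)) = ψ' g) :
    Hom φ (M.twist ψ hψ) (N.twist ψ' hψ') where
  app := f.app
  app_smul := f.app_smul
  app_act g U V h (x : M.obj U) := by
    change f.app V ((ψ g : ZMod (p ^ s)).val • M.act g h x) =
      (ψ' g : ZMod (p ^ t)).val • N.act g h (f.app U x)
    rw [_root_.map_nsmul, f.app_act]
    refine smul_congr_of_smul_eq_zero (N.pow_smul_eq_zero _) ?_
    rw [e, natCast_val]

variable (L : GMod X.O)

/-- Reduction of Teichmüller lifts. -/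
def teichTrunc {t s : ℕ} (h' : t ≤ s) (k : ℕ) :
    Hom (X.trunc h') (L.teichLift s k) (L.teichLift t k) where
  app U :=
    { toFun := fun σ => ⟨fun q => (X.trunc h').app _ (σ.1 q), by
        intro q q' h a ha
        have := congrArg ((X.trunc h').app _) (σ.2 q q' h a ha)
        rw [_root_.map_mul, _root_.map_pow, X.trunc_teich] at this
        rw [this]
        exact (X.trunc h').app_act _ _ _⟩
      map_zero' := Subtype.ext <| funext fun q => _root_.map_zero _
      map_add' := fun σ σ' => Subtype.ext <| funext fun q => _root_.map_add _ _ _ }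
  app_smul U b σ := Subtype.ext <| funext fun q =>
    (_root_.map_mul ((X.trunc h').app q.V) _ _).trans
      (congrArg (· * _) ((X.trunc h').app_act _ _ _))
  app_act g U V h σ := Subtype.ext <| funext fun q => (X.trunc h').app_act _ _ _

/-- The `m`-th power of the Frobenius, from the lift of `L^{⊗ k}` to that of
`L^{⊗ k p^m}`. -/
def teichFrob (r m k : ℕ) :
    Hom (X.frob r m) (L.teichLift r k) (L.teichLift r (k * p ^ m)) where
  app U :=
    { toFun := fun σ => ⟨fun q => (X.frob r m).app _ (σ.1 q), by
        intro q q' h a ha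
        have := congrArg ((X.frob r m).app _) (σ.2 q q' h a ha)
        rw [_root_.map_mul, _root_.map_pow, X.frob_teich, ← pow_mul, mul_comm (p ^ m)] at this
        rw [this]
        exact (X.frob r m).app_act _ _ _⟩
      map_zero' := Subtype.ext <| funext fun q => _root_.map_zero _
      map_add' := fun σ σ' => Subtype.ext <| funext fun q => _root_.map_add _ _ _ }
  app_smul U b σ := Subtype.ext <| funext fun q =>
    (_root_.map_mul ((X.frob r m).app q.V) _ _).trans
      (congrArg (· * _) ((X.frob r m).app_act _ _ _))
  app_act g U V h σ := Subtype.ext <| funext fun q => (X.frob r m).app_act _ _ _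

end GMod

lemma CycChar.isOpen_ker_pow {N : ℕ∞} [IsTopologicalGroup G] (T : CycChar p N G) (n s : ℕ)
    (hs : (s : ℕ∞) ≤ N) : IsOpen (((T.mod s hs ^ n).ker : Subgroup G) : Set G) := by
  refine Subgroup.isOpen_mono (H₁ := (T.mod s hs).ker) (fun g hg => ?_) (T.cont s hs)
  rw [MonoidHom.mem_ker] at hg ⊢
  rw [MonoidHom.pow_apply, hg, one_pow]

lemma cycRed_compat {N : ℕ∞} {t s : ℕ} (h : t ≤ s) (hs : (s : ℕ∞) ≤ N) (ht : (t : ℕ∞) ≤ N) :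
    (ZMod.castHom (pow_dvd_pow p h) (ZMod (p ^ t))).comp (cycRed p s hs) = cycRed p t ht := by
  refine Ideal.Quotient.ringHom_ext ?_
  exact PadicInt.zmod_cast_comp_toZModPow t s h

lemma CycChar.mod_pow_compat {N : ℕ∞} (T : CycChar p N G) (n : ℕ) {t s : ℕ} (h : t ≤ s)
    (hs : (s : ℕ∞) ≤ N) (ht : (t : ℕ∞) ≤ N) (g : G) :
    (((((T.mod s hs ^ n) g : (ZMod (p ^ s))ˣ) : ZMod (p ^ s)).val : ℕ) : ZMod (p ^ t)) =
      ((T.mod t ht ^ n) g : (ZMod (p ^ t))ˣ) := by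
  have e := RingHom.congr_fun (cycRed_compat h hs ht) (T.χ g : CycRing p N)
  have e1 : ∀ a : ZMod (p ^ s), ((a.val : ℕ) : ZMod (p ^ t)) =
      ZMod.castHom (pow_dvd_pow p h) (ZMod (p ^ t)) a := by
    intro a
    rw [ZMod.castHom_apply, ZMod.natCast_val]
  rw [e1, MonoidHom.pow_apply, MonoidHom.pow_apply, Units.val_pow_eq_pow_val,
    Units.val_pow_eq_pow_val, _root_.map_pow]
  exact congrArg (· ^ n) e

namespace LineBundle

variable [IsTopologicalGroup G] (L : LineBundle X) {N : ℕ∞} (T : CycChar p N G) (n : ℕ)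

/-- The module `W_s(L^{⊗ k})(n)`, for finite `s ≤ N`. -/
def coef (s : ℕ) (hs : (s : ℕ∞) ≤ N) (k : ℕ) : GMod (X.W s) :=
  (L.teichLift s k).twist (T.mod s hs ^ n) (T.isOpen_ker_pow n s hs)

/-- The reduction `W_s(L^{⊗ k})(n) → W_t(L^{⊗ k})(n)`, for `t ≤ s`. -/
def coefTrunc {t s : ℕ} (h : t ≤ s) (hs : (s : ℕ∞) ≤ N) (ht : (t : ℕ∞) ≤ N) (k : ℕ) :
    GMod.Hom (X.trunc h) (L.coef T n s hs k) (L.coef T n t ht k) :=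
  (L.teichTrunc h k).twist _ _ (T.mod_pow_compat n h hs ht)

/-- The Frobenius `W_r(L^{⊗ k})(n) → W_r(L^{⊗ k p^m})(n)`. -/
def coefFrob (r : ℕ) (hr : (r : ℕ∞) ≤ N) (m k : ℕ) :
    GMod.Hom (X.frob r m) (L.coef T n r hr k) (L.coef T n r hr (k * p ^ m)) :=
  (L.teichFrob r m k).twist _ _ (T.mod_pow_compat n le_rfl hr hr)

end LineBundle

variable (X) in
/-- The reduction `W_s(O_X) → W_t(O_X)`, as a morphism of modules. -/
def GScheme.truncMod {t s : ℕ} (h : t ≤ s) : GMod.Hom (X.trunc h) (X.WMod s) (X.WMod t) where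
  app U := ((X.trunc h).app U).toAddMonoidHom
  app_smul U a x := _root_.map_mul ((X.trunc h).app U) a x
  app_act := (X.trunc h).app_act

variable (X) in
/-- The Frobenius of `W_r(O_X)`, as a morphism of modules. -/
def GScheme.frobMod (r m : ℕ) : GMod.Hom (X.frob r m) (X.WMod r) (X.WMod r) where
  app U := ((X.frob r m).app U).toAddMonoidHom
  app_smul U a x := _root_.map_mul ((X.frob r m).app U) a x
  app_act := (X.frob r m).app_act

/-! ### Extensions and `(G, S)`-cohomology -/

/-- A short exact sequence `0 → B → M → C → 0` of equivariant `W_r(O_X)`-modules, with `M`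
quasi-coherent. -/
structure SES {r : ℕ} (B C : GMod (X.W r)) where
  /-- the middle term -/
  M : GMod (X.W r)
  qcoh : M.IsQCoh
  /-- the inclusion -/
  ι : GMod.Hom (GRing.Hom.id _) B M
  /-- the projection -/
  π : GMod.Hom (GRing.Hom.id _) M C
  inj : ∀ U, Function.Injective (ι.app U)
  exact : ∀ U (x : M.obj U), π.app U x = 0 ↔ ∃ b, ι.app U b = x
  surj : ∀ U (c : C.obj U), ∀ t ∈ U, ∃ (V : X.S.Opens) (h : V ≤ U) (x : M.obj V), t ∈ V ∧
    π.app V x = C.res h c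

/-- The short exact sequence is geometrically split: its projection has a `W_r(O_X)`-linear
section, not necessarily `G`-equivariant. -/
def SES.IsSplit {r : ℕ} {B C : GMod (X.W r)} (E : SES B C) : Prop :=
  ∃ σ : ∀ U, C.obj U →ₗ[(X.W r).obj U] E.M.obj U,
    (∀ (U V : X.S.Opens) (h : V ≤ U) (c : C.obj U), σ V (C.res h c) = E.M.res h (σ U c)) ∧
    ∀ U (c : C.obj U), E.π.app U (σ U c) = c

/-- A morphism of short exact sequences, semilinear along `φ`, inducing `β` and `γ` on the ends. -/
def SES.Map {s t : ℕ} {φ : GRing.Hom (X.W s) (X.W t)} {B C : GMod (X.W s)} {B' C' : GMod (X.W t)}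
    (β : GMod.Hom φ B B') (γ : GMod.Hom φ C C') (E : SES B C) (E' : SES B' C') : Prop :=
  ∃ f : GMod.Hom φ E.M E'.M,
    (∀ U (b : B.obj U), f.app U (E.ι.app U b) = E'.ι.app U (β.app U b)) ∧
    ∀ U (x : E.M.obj U), E'.π.app U (f.app U x) = γ.app U (E.π.app U x)

/-- `n`-extensions `0 → B → M₁ → ⋯ → M_n → A → 0` of equivariant `W_r(O_X)`-modules, decomposed
into short exact sequences: a `1`-extension is a short exact sequence, and an `(n + 2)`-extension
is the splice of `0 → B → M₁ → C → 0` with an `(n + 1)`-extension of `A` by `C`. (By convention, a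
`0`-extension is a morphism `A → B`.) -/
def NExt {r : ℕ} (A : GMod (X.W r)) : ℕ → GMod (X.W r) → Type (max (u + 1) w)
  | 0, B => ULift.{max (u + 1) w} (GMod.Hom (GRing.Hom.id _) A B)
  | 1, B => SES B A
  | n + 2, B => Σ C : {C : GMod (X.W r) // C.IsQCoh}, SES B C.1 × NExt A (n + 1) C.1

/-- An extension is strongly geometrically trivial if all the short exact sequences of which it is
the splice are geometrically split. -/
def NExt.IsSGT {r : ℕ} {A : GMod (X.W r)} : ∀ {n : ℕ} {B : GMod (X.W r)}, NExt A n B → Prop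
  | 0, _, _ => True
  | 1, _, E => SES.IsSplit E
  | _ + 2, _, E => SES.IsSplit E.2.1 ∧ NExt.IsSGT E.2.2

/-- There is a morphism of `n`-extensions from `E` to `E'`, semilinear along `φ`, inducing the given
morphisms `α` and `β` on the ends. -/
def NExt.Map {s t : ℕ} {φ : GRing.Hom (X.W s) (X.W t)} {A : GMod (X.W s)} {A' : GMod (X.W t)}
    (α : GMod.Hom φ A A') : ∀ {n : ℕ} {B : GMod (X.W s)} {B' : GMod (X.W t)},
    GMod.Hom φ B B' → NExt A n B → NExt A' n B' → Prop
  | 0, _, _, β, E, E' => ∀ U x, E'.down.app U (α.app U x) = β.app U (E.down.app U x)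
  | 1, _, _, β, E, E' => SES.Map β α E E'
  | _ + 2, _, _, β, E, E' => ∃ γ : GMod.Hom φ E.1.1 E'.1.1,
      SES.Map β γ E.2.1 E'.2.1 ∧ NExt.Map α γ E.2.2 E'.2.2

/-- The cohomology `H^n((G, X), M)`: Yoneda classes of `n`-extensions of `W_r(O_X)` by `M`, that is,
classes of `n`-extensions under the equivalence relation generated by morphisms which are the
identity on both ends. -/
def YonedaH {r : ℕ} (n : ℕ) (M : GMod (X.W r)) : Type (max (u + 1) w) :=
  Quot fun E E' : NExt (X.WMod r) n M => NExt.Map (GMod.Hom.id _) (GMod.Hom.id M) E E'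

/-- The class of an `n`-extension. -/
def YonedaH.mk {r n : ℕ} {M : GMod (X.W r)} (E : NExt (X.WMod r) n M) : YonedaH n M :=
  Quot.mk _ E

/-- Strongly geometrically trivial classes. -/
def YonedaH.IsSGT {r n : ℕ} {M : GMod (X.W r)} (c : YonedaH n M) : Prop :=
  ∃ E : NExt (X.WMod r) n M, YonedaH.mk E = c ∧ E.IsSGT

namespace LineBundle

variable [IsTopologicalGroup G] (L : LineBundle X) {N : ℕ∞} (T : CycChar p N G) (n : ℕ)

/-- `n`-extensions of `W_s(O_X)` by `W_s(L^{⊗ k})(n)`. -/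
abbrev Ext (s : ℕ) (hs : (s : ℕ∞) ≤ N) (k : ℕ) : Type (max (u + 1) w) :=
  NExt (X.WMod s) n (L.coef T n s hs k)

/-- The cohomology `H^n((G, X), W_s(L^{⊗ k})(n))`. -/
abbrev H (s : ℕ) (hs : (s : ℕ∞) ≤ N) (k : ℕ) : Type (max (u + 1) w) :=
  YonedaH n (L.coef T n s hs k)

variable {T n}

/-- `c'` is the pullback of `c` by the `m`-th power of the Frobenius. -/
def IsFrobPullback {r : ℕ} {hr : (r : ℕ∞) ≤ N} {k : ℕ} (m : ℕ) (c : L.H T n r hr k)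
    (c' : L.H T n r hr (k * p ^ m)) : Prop :=
  ∃ (E : L.Ext T n r hr k) (E' : L.Ext T n r hr (k * p ^ m)), YonedaH.mk E = c ∧
    YonedaH.mk E' = c' ∧ NExt.Map (X.frobMod r m) (L.coefFrob T n r hr m k) E E'

/-- The extension `E'` is a reduction of the extension `E`. -/
def IsRed {t s : ℕ} (h : t ≤ s) {hs : (s : ℕ∞) ≤ N} {ht : (t : ℕ∞) ≤ N} {k : ℕ}
    (E : L.Ext T n s hs k) (E' : L.Ext T n t ht k) : Prop :=
  NExt.Map (X.truncMod h) (L.coefTrunc T n h hs ht k) E E'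

/-- `c'` is the reduction of `c`. -/
def Reduces {t s : ℕ} (h : t ≤ s) {hs : (s : ℕ∞) ≤ N} {ht : (t : ℕ∞) ≤ N} {k : ℕ}
    (c : L.H T n s hs k) (c' : L.H T n t ht k) : Prop :=
  ∃ (E : L.Ext T n s hs k) (E' : L.Ext T n t ht k), YonedaH.mk E = c ∧ YonedaH.mk E' = c' ∧
    L.IsRed h E E'

/-- The class `c ∈ H^n((G, X), W_r(L^{⊗ k})(n))` is the reduction of a class with coefficients
`W_N(L^{⊗ k})(n)`. For `N = ∞`, the latter is given by a compatible system of extensions over the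
`W_s(O_X)`, for `s ≥ r`. -/
def Lifts {r : ℕ} {hr : (r : ℕ∞) ≤ N} {k : ℕ} (c : L.H T n r hr k) : Prop :=
  (∀ (s : ℕ) (hs : (s : ℕ∞) = N), ∃ c' : L.H T n s hs.le k,
    L.Reduces (Nat.cast_le.1 (hr.trans hs.ge)) c' c) ∧
  ∀ hN : N = ⊤, ∃ E : ∀ i : ℕ, L.Ext T n (r + i) (hN ▸ le_top) k,
    YonedaH.mk (E 0) = c ∧ ∀ i, L.IsRed (Nat.le_succ (r + i)) (E (i + 1)) (E i)

/-- The class `c ∈ H^n((G, X), W_r(L^{⊗ k})(n))` is the reduction of a strongly geometrically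
trivial class with coefficients `W_N(L^{⊗ k})(n)`. For `N = ∞`, the latter is given by a compatible
system of strongly geometrically trivial extensions over the `W_s(O_X)`, for `s ≥ r`. -/
def LiftsSGT {r : ℕ} {hr : (r : ℕ∞) ≤ N} {k : ℕ} (c : L.H T n r hr k) : Prop :=
  (∀ (s : ℕ) (hs : (s : ℕ∞) = N), ∃ c' : L.H T n s hs.le k, c'.IsSGT ∧
    L.Reduces (Nat.cast_le.1 (hr.trans hs.ge)) c' c) ∧
  ∀ hN : N = ⊤, ∃ E : ∀ i : ℕ, L.Ext T n (r + i) (hN ▸ le_top) k,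
    (∀ i, (E i).IsSGT) ∧ YonedaH.mk (E 0) = c ∧
      ∀ i, L.IsRed (Nat.le_succ (r + i)) (E (i + 1)) (E i)

end LineBundle

end Sheaves

/-! ### Smooth profinite groups -/

section Smooth

variable (p : ℕ) [Fact p.Prime]

/-- The ideal of Witt vectors whose first `N` components vanish. -/
def wittIdeal (N : ℕ∞) (A : Type u) [CommRing A] : Ideal (WittVector p A) :=
  ⨅ (k : ℕ) (_ : (k : ℕ∞) ≤ N), RingHom.ker (WittVector.truncate (p := p) (R := A) k)

/-- The ring `W_N(A)` of Witt vectors of length `N`; for `N = ∞`, this is `W(A)`. -/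
abbrev WittRing (N : ℕ∞) (A : Type u) [CommRing A] : Type u := WittVector p A ⧸ wittIdeal p N A

/-- The projection `W_N(A) → A`, for `N ≥ 1`. -/
def wittResidue {N : ℕ∞} (hN : 1 ≤ N) (A : Type u) [CommRing A] : WittRing p N A →+* A :=
  Ideal.Quotient.lift (wittIdeal p N A) WittVector.constantCoeff (by
    intro x hx
    have h1 := Ideal.mem_iInf.1 (Ideal.mem_iInf.1 hx 1) (by exact_mod_cast hN)
    rw [WittVector.mem_ker_truncate] at h1
    exact h1 0 one_pos)

/-- A `G`-linearized invertible module over `W_N(A)`: a locally free module of rank one, with a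
semilinear action of `G` which is continuous for the `p`-adic topology, in the sense that an open
subgroup acts trivially modulo `p ^ s`, for each `s`. -/
structure WittLine (N : ℕ∞) (A : Type u) [CommRing A] (G : Type w) [Group G] [TopologicalSpace G]
    [MulSemiringAction G A] where
  /-- the underlying set -/
  L : Type u
  [grp : AddCommGroup L]
  [mod : Module (WittRing p N A) L]
  [act : DistribMulAction G L]
  invertible : Module.Invertible (WittRing p N A) L
  semilinear : ∀ (g : G) (w : WittVector p A) (x : L),
    g • ((Ideal.Quotient.mk _ w : WittRing p N A) • x) = (Ideal.Quotient.mk _ (WittVector.map (MulSemiringAction.toRingHom G A g) w) : WittRing p N A) •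
      g • x
  cont : ∀ s : ℕ, ∃ K : OpenSubgroup G, ∀ g ∈ K, ∀ x : L, ∃ y : L, g • x = x + p ^ s • y

attribute [instance] WittLine.grp WittLine.mod WittLine.act

/-- The profinite group `G` is `(n, e)`-smooth (relative to the prime `p`): for every perfect
`𝔽_p`-algebra `A` with a `G`-action, every `G`-linearized invertible `A`-module `L₁` and every class
`c ∈ H^n(G, L₁)`, there is a `G`-linearized invertible `W_{e + 1}(A)`-module `E` lifting `L₁`, such
that `c` is the image of a class in `H^n(G, E)`. -/
def IsSmooth (n : ℕ) (e : ℕ∞) (G : Type w) [Group G] [TopologicalSpace G] : Prop :=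
  ∀ (A : Type u) [CommRing A] [MulSemiringAction G A] (L₁ : Type u) [AddCommGroup L₁] [Module A L₁]
    [DistribMulAction G L₁],
    (p : A) = 0 → Function.Bijective (fun a : A => a ^ p) →
    (∃ K : OpenSubgroup G, ∀ g ∈ K, ∀ a : A, g • a = a) →
    Module.Invertible A L₁ →
    (∀ (g : G) (a : A) (x : L₁), g • (a • x) = (g • a) • g • x) →
    (∃ K : OpenSubgroup G, ∀ g ∈ K, ∀ x : L₁, g • x = x) →
    ∀ c : ContH p (Representation.ofDistribMulAction ℤ G L₁) n,
      ∃ (E : WittLine p (e + 1) A G) (q : E.L →+ L₁) (hq : ∀ (g : G) (x : E.L), q (g • x) = g • q x),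
        Function.Surjective q ∧
        (∀ (w : WittRing p (e + 1) A) (x : E.L),
          q (w • x) = wittResidue p le_add_self A w • q x) ∧
        (∀ x : E.L, q x = 0 ↔ x ∈ RingHom.ker (wittResidue p (N := e + 1) le_add_self A) •
          (⊤ : Submodule (WittRing p (e + 1) A) E.L)) ∧
        ∃ c' : ContH p (Representation.ofDistribMulAction ℤ G E.L) n, ContH.map p q hq n c' = c

end Smooth

end WittLift

end

/-! Everything rests on an identity in characteristic `p`. Let `V` be a finite `𝔽_p`-vector space,
`f : V → R` a linear map to a ring of characteristic `p`, and for a nonzero linear form `φ` on `V`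
let `t_φ` be the product of `f` over the affine hyperplane `φ = 1` (put `t_0 = 0`). Then `∑_φ φ(x)
t_φ = -f(x)^{p^m}`, where each hyperplane has `p^m` points (`exists_sum_smul_prod_eq_pow`). So a
power of the Frobenius factors, up to sign, as the evaluation `V → (V* → 𝔽_p)`, which lands in a
permutation module, followed by the combination of the `t_φ`. A group acting compatibly permutes the
`t_φ`. The second map has an obvious lift to Witt vectors: Teichmüller representatives are
multiplicative, hence still permuted, and `F ↦ ∑_φ F(φ) [t_φ]` is equivariant.

Let `c` be an `n`-cocycle with values in the sections of `L(n)`. Its values have finitely many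
translates, which span a finite `V`. The cyclotomic hypothesis holds for all open subgroups, so by
Shapiro's lemma a cocycle with values in functions `V* → 𝔽_p`, twisted by `χ^n`, lifts to functions
with values in `ℤ/p^{1+e}`, up to a coboundary (`exists_permRep_lift`). Pushing this lift forward by
the `[t_φ]` gives compatible cocycles in all the `W_s(L^{p^m})(n)`, because `t_φ` is a product of
`p^m` sections of `L`; they lift the Frobenius pullback of `c`
(`IsCyclotomicPair.exists_perm_cocycle`, `WittWeights.exists_lift_coeffZero`). For coefficients in
`W_r(L)`, this takes care of the first component. The remaining difference is `V(d)` for the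
Verschiebung `V` and a cocycle `d` with values in `W_{r-1}` of a higher power of `L`, and induction
on `r` concludes (`WittWeights.exists_lift`). Over a perfect base the Frobenius can be undone
(`WittWeights.exists_lift_of_perfect`).

Extension classes are turned into cocycles as follows. For a finite quotient of `G`, with underlying
set `Q`, the functions on the powers of `Q` with values in `W_r(O)` form a resolution of `W_r(O)`
with a non-equivariant contraction. A homogeneous cocycle on powers of `Q` gives a strongly
geometrically trivial extension by pushout (`FinTorsor.IsCocycle.ext`), functorially in the cocycle
and unchanged in class by coboundaries (`FinTorsor.IsCocycle.map_ext`). Conversely, an extension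
whose constituents are surjective on global sections receives a morphism from such a pushout
(`FinTorsor.exists_map_ext`). This covers strongly geometrically trivial extensions, and all
extensions on an affine scheme by quasi-coherence (`SES.exists_π_eq_of_isAffine`). The lifted
cocycles then give lifted extensions (`LineBundle.liftsSGT_mk_ext`).

For smoothness, the invertible `A`-module `L` is realized as the functions of rank one on its
`A(n)`-valued dual. The Witt-vector functions satisfying the same proportionality relations form an
invertible lift (`teichLine_invertible`), which carries the twist by `χ^n` in its action. The
permutation-module argument applies to functions on the dual, and the Frobenius is removed by
extracting `p^m`-th roots of the `t_φ` (`exists_lift_line`). -/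

noncomputable section

set_option linter.unusedSectionVars false
set_option linter.unusedVariables false

namespace WittLift

/-! ### A power of the Frobenius as a combination of products over affine hyperplanes. -/

section IntegralFormula

variable {p : ℕ} [Fact p.Prime] {R : Type*} [CommRing R] [Algebra (ZMod p) R]

lemma natCast_eq_zero_of_algebra (p : ℕ) (R : Type*) [CommRing R] [Algebra (ZMod p) R] :
    (p : R) = 0 := by
  rw [← map_natCast (algebraMap (ZMod p) R), ZMod.natCast_self, map_zero]

/-- This is `X^p - X = ∏ (X - c)`, homogenized. Being universal in `Y` and `δ`, it may be checked in
the fraction field of a polynomial ring, where `δ` can be divided out. -/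
lemma prod_sub_smul (Y δ : R) :
    ∏ c : ZMod p, (Y - c • δ) = Y ^ p - δ ^ (p - 1) * Y := by
  have hp : p.Prime := Fact.out
  have key : ∏ c : ZMod p, ((MvPolynomial.X 0 : MvPolynomial (Fin 2) (ZMod p)) -
      c • MvPolynomial.X 1) =
      MvPolynomial.X 0 ^ p - MvPolynomial.X 1 ^ (p - 1) * MvPolynomial.X 0 := by
    apply FaithfulSMul.algebraMap_injective (MvPolynomial (Fin 2) (ZMod p))
      (FractionRing (MvPolynomial (Fin 2) (ZMod p)))
    set K := FractionRing (MvPolynomial (Fin 2) (ZMod p))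
    set φ := algebraMap (MvPolynomial (Fin 2) (ZMod p)) K
    have hd : φ (MvPolynomial.X 1) ≠ 0 := by
      rw [Ne, map_eq_zero_iff _ (FaithfulSMul.algebraMap_injective _ _)]
      exact MvPolynomial.X_ne_zero 1
    set d := φ (MvPolynomial.X 1)
    set y := φ (MvPolynomial.X 0)
    have hroots := FiniteField.roots_X_pow_card_sub_X (ZMod p)
    have hdeg := FiniteField.X_pow_card_sub_X_natDegree_eq (ZMod p) hp.one_lt
    rw [ZMod.card] at hroots
    have hmonic : (Polynomial.X ^ p - Polynomial.X : Polynomial (ZMod p)).Monic :=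
      Polynomial.monic_X_pow_sub (by rw [Polynomial.degree_X]; exact_mod_cast hp.one_lt)
    have h0 := Polynomial.prod_multiset_X_sub_C_of_monic_of_roots_card_eq hmonic (by
      rw [hroots, hdeg]
      simp)
    rw [hroots] at h0
    have h1 := congrArg (Polynomial.aeval (y / d)) h0
    change Polynomial.aeval (y / d) (∏ a : ZMod p, (Polynomial.X - Polynomial.C a)) = _ at h1
    simp only [map_prod, map_sub, Polynomial.aeval_X, Polynomial.aeval_C, map_pow] at h1
    rw [map_prod, map_sub, map_mul, map_pow, map_pow]
    have h2 : ∀ c : ZMod p, φ (MvPolynomial.X 0 - c • MvPolynomial.X 1) =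
        d * (y / d - algebraMap (ZMod p) K c) := by
      intro c
      rw [map_sub, mul_sub, mul_div_cancel₀ _ hd, Algebra.smul_def, map_mul, mul_comm d]
      rfl
    simp only [h2]
    rw [Finset.prod_mul_distrib, h1, Finset.prod_const, Finset.card_univ, ZMod.card, mul_sub,
      ← mul_pow, mul_div_cancel₀ _ hd]
    rw [← pow_sub_one_mul hp.ne_zero d, mul_assoc, mul_div_cancel₀ _ hd]
  have := congrArg (MvPolynomial.aeval ![Y, δ]) key
  simpa using this

/-- The polynomial whose roots form the image of a finite vector space is additive. -/
lemma exists_additive_prod (d : ℕ) (f : (Fin d → ZMod p) →ₗ[ZMod p] R) :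
    ∃ F : R →ₗ[ZMod p] R, ∀ Y, F Y = ∏ v, (Y - f v) := by
  induction d with
  | zero => 
    refine ⟨LinearMap.id, fun Y => ?_⟩
    rw [Fintype.prod_subsingleton _ 0, map_zero, sub_zero]
    rfl
  | succ d ih =>
    obtain ⟨F, hF⟩ := ih (f ∘ₗ (Fin.consLinearEquiv (ZMod p) (fun _ : Fin (d + 1) => ZMod p)).toLinearMap ∘ₗ
      LinearMap.inr (ZMod p) (ZMod p) (Fin d → ZMod p))
    -- Splitting off the first coordinate `c`, the product becomes `∏_c F(Y - c f(e₀)) = ∏_c (F(Y) -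
    -- c δ) = F(Y)^p - δ^{p-1} F(Y)`, which is again additive in `Y`.
    let δ := F (f (Fin.cons 1 0))
    have hfr : ∀ c : ZMod p, ∀ x : R, (c • x) ^ p = c • x ^ p := by
      intro c x
      rw [_root_.smul_pow, ZMod.pow_card]
    refine ⟨{ toFun := fun Y => F Y ^ p - δ ^ (p - 1) * F Y
              map_add' := fun x y => ?_
              map_smul' := fun c x => ?_ }, fun Y => ?_⟩
    · have := (frob 1 (natCast_eq_zero_of_algebra p R)).map_add (F x) (F y)
      simp only [frob, pow_one, RingHom.coe_mk, MonoidHom.coe_mk, OneHom.coe_mk] at this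
      rw [map_add, this]
      ring
    · rw [map_smul, hfr, mul_smul_comm, smul_sub, RingHom.id_apply]
    · change F Y ^ p - δ ^ (p - 1) * F Y = _
      rw [← prod_sub_smul, ← (Fin.consEquiv fun _ : Fin (d + 1) => ZMod p).prod_comp,
        Fintype.prod_prod_type]
      refine Finset.prod_congr rfl fun c _ => ?_
      have h1 : F Y - c • δ = F (Y - c • f (Fin.cons 1 0)) := by
        rw [map_sub, map_smul]
      rw [h1, hF]
      refine Finset.prod_congr rfl fun v _ => ?_
      rw [sub_sub]
      congr 1
      change _ + f (Fin.cons 0 v) = f (Fin.cons c v)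
      rw [← map_smul, ← map_add]
      congr 1
      ext i
      refine Fin.cases ?_ (fun i => ?_) i <;> simp

lemma exists_additive_prod_of_finite {K : Type*} [AddCommGroup K] [Module (ZMod p) K] [Fintype K]
    (f : K →ₗ[ZMod p] R) : ∃ F : R →ₗ[ZMod p] R, ∀ Y, F Y = ∏ v, (Y - f v) := by
  have := Module.Finite.of_finite (R := ZMod p) (M := K)
  let e := Module.finBasis (ZMod p) K |>.equivFun
  obtain ⟨F, hF⟩ := exists_additive_prod _ (f ∘ₗ e.symm.toLinearMap)
  refine ⟨F, fun Y => (hF Y).trans ?_⟩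
  exact e.symm.toEquiv.prod_comp fun v => Y - f v

/-- In the binomial expansion, the power sums `∑ t^i` over `𝔽_p` vanish for `i < p - 1`, and the
last one is `-1`; hence `β` disappears. -/
lemma sum_sub_smul_pow (α β : R) :
    ∑ t : ZMod p, (β - t • α) ^ (p - 1) = -α ^ (p - 1) := by
  classical
  have hp : p.Prime := Fact.out
  have h1 : ∀ t : ZMod p, (β - t • α) ^ (p - 1) = ∑ i ∈ Finset.range (p - 1 + 1),
      (t ^ i) • ((-α) ^ i * β ^ (p - 1 - i) * ((p - 1).choose i : R)) := by
    intro t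
    rw [sub_eq_neg_add, add_pow]
    refine Finset.sum_congr rfl fun i _ => ?_
    rw [← smul_neg, _root_.smul_pow, smul_mul_assoc, smul_mul_assoc]
  simp only [h1]
  rw [Finset.sum_comm]
  simp only [← Finset.sum_smul]
  rw [Finset.sum_range_succ, Finset.sum_eq_zero, zero_add]
  · have h2 : ∑ t : ZMod p, t ^ (p - 1) = -1 := by
      have := FiniteField.sum_pow_units (ZMod p) (p - 1)
      rw [ZMod.card, if_pos dvd_rfl] at this
      rw [← this, ← Finset.sum_subset (Finset.subset_univ (Finset.univ.erase (0 : ZMod p)))]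
      · symm
        refine Finset.sum_bij (fun (u : (ZMod p)ˣ) _ => (u : ZMod p)) ?_ ?_ ?_ ?_
        · intro a _
          simp
        · intro a _ b _ h
          exact Units.ext h
        · intro b hb
          exact ⟨Units.mk0 b (by simpa using hb), Finset.mem_univ _, rfl⟩
        · intro a _
          simp
      · intro x _ hx
        simp only [Finset.mem_erase, Finset.mem_univ, and_true, not_not] at hx
        rw [hx, zero_pow]
        have := hp.two_le
        omega
    rw [h2, Nat.sub_self, pow_zero, mul_one, Nat.choose_self, Nat.cast_one, mul_one, neg_smul,
      one_smul]
    -- The sign of `(-α)^{p-1}` is immaterial: the exponent is even for odd `p`, and `2 = 0` for `p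
    -- = 2`.
    rcases hp.eq_two_or_odd' with h | h
    · subst h
      have h3 := natCast_eq_zero_of_algebra 2 R
      rw [Nat.cast_ofNat] at h3
      simp only [Nat.add_one_sub_one, pow_one]
      linear_combination α * h3
    · rw [(Nat.Odd.sub_odd h odd_one).neg_pow]
  · intro i hi
    rw [FiniteField.sum_pow_lt_card_sub_one, zero_smul]
    rw [ZMod.card]
    exact Finset.mem_range.1 hi

/-- Products over the level sets of a nonzero linear form, in terms of the additive polynomial of its
kernel. -/
lemma exists_additive_levelProd {V : Type*} [AddCommGroup V] [Module (ZMod p) V] [Fintype V]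
    (f : V →ₗ[ZMod p] R) (φ : V →ₗ[ZMod p] ZMod p) {y : V} (hy : φ y = 1) :
    ∃ F : R →ₗ[ZMod p] R, ∀ (s : ZMod p) (X : R),
      (∏ v, if φ v = s then X - f v else 1) = F (X - s • f y) := by
  classical
  obtain ⟨F, hF⟩ := exists_additive_prod_of_finite (f ∘ₗ (LinearMap.ker φ).subtype)
  refine ⟨F, fun s X => ?_⟩
  -- Translation by `s • y` carries the kernel of `φ` onto the level set `φ = s`.
  rw [hF, ← Equiv.prod_comp (Equiv.addRight (s • y)), ← Finset.prod_filter,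
    Finset.prod_subtype (p := fun v => v ∈ LinearMap.ker φ) (F := inferInstance) _ (fun v => by
      simp [hy])]
  refine Finset.prod_congr rfl fun v _ => ?_
  simp only [Equiv.coe_addRight, map_add, map_smul, LinearMap.comp_apply, Submodule.subtype_apply]
  ring

/-- Induction on `d`: a form is written `(t, φ)`, and the sum over `t` for fixed `φ` turns out to be
the `p`-th power of the term of `φ` in dimension `d`, minus a quantity `FV` independent of `φ`. The
`p^d` copies of `FV` cancel when `d > 0`, so that the whole sum is the Frobenius of the previous
one. In dimension zero there is no nonzero form. -/
lemma sum_kerProd (d : ℕ) (f : (Fin d → ZMod p) →ₗ[ZMod p] R) (X : R) :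
    (∑ φ : Fin d → ZMod p, if φ = 0 then 0 else
      ∏ v, if φ ⬝ᵥ v = 0 then X - f v else 1) = if d = 0 then 0 else -X ^ p ^ (d - 1) := by
  classical
  induction d with
  | zero =>
    rw [if_pos rfl]
    exact Finset.sum_eq_zero fun φ _ => if_pos (Subsingleton.elim _ _)
  | succ d ih =>
    have hp : p.Prime := Fact.out
    have hp0 : (p : R) = 0 := natCast_eq_zero_of_algebra p R
    rw [if_neg (Nat.succ_ne_zero d), Nat.add_sub_cancel]
    set f' : (Fin d → ZMod p) →ₗ[ZMod p] R :=
      f ∘ₗ (Fin.consLinearEquiv (ZMod p) (fun _ : Fin (d + 1) => ZMod p)).toLinearMap ∘ₗ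
      LinearMap.inr (ZMod p) (ZMod p) (Fin d → ZMod p) with hf'
    have hcons : ∀ (c : ZMod p) (v : Fin d → ZMod p), f (Fin.cons c v) =
        c • f (Fin.cons 1 0) + f' v := by
      intro c v
      change _ = _ + f (Fin.cons 0 v)
      rw [← map_smul, ← map_add]
      congr 1
      ext i
      refine Fin.cases ?_ (fun i => ?_) i <;> simp
    have hprod : ∀ (t : ZMod p) (φ : Fin d → ZMod p), (∏ v : Fin (d + 1) → ZMod p,
        if (Fin.cons t φ : Fin (d + 1) → ZMod p) ⬝ᵥ v = 0 then X - f v else 1) =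
        ∏ c : ZMod p, ∏ v : Fin d → ZMod p,
          if φ ⬝ᵥ v = -(t * c) then X - c • f (Fin.cons 1 0) - f' v else 1 := by
      intro t φ
      rw [← (Fin.consEquiv fun _ : Fin (d + 1) => ZMod p).prod_comp, Fintype.prod_prod_type]
      refine Finset.prod_congr rfl fun c _ => Finset.prod_congr rfl fun v _ => ?_
      change (if (Fin.cons t φ : Fin (d + 1) → ZMod p) ⬝ᵥ (Fin.cons c v : Fin (d + 1) → ZMod p) = 0
        then X - f (Fin.cons c v) else 1) = _
      have e : (Fin.cons t φ : Fin (d + 1) → ZMod p) ⬝ᵥ (Fin.cons c v : Fin (d + 1) → ZMod p) =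
          t * c + φ ⬝ᵥ v := Matrix.cons_dotProduct_cons t φ c v
      rw [e, hcons, sub_sub]
      simp only [eq_neg_iff_add_eq_zero, add_comm]
    set FV : R := ∏ v : Fin d → ZMod p, (X - f' v) with hFV
    -- For `φ = 0` and `t ≠ 0` the kernel is the subspace where the first coordinate vanishes, with
    -- product `FV`; there are `p - 1` such terms.
    have h0 : (∑ t : ZMod p, if (Fin.cons t 0 : Fin (d + 1) → ZMod p) = 0 then 0 else
        ∏ v : Fin (d + 1) → ZMod p,
          if (Fin.cons t 0 : Fin (d + 1) → ZMod p) ⬝ᵥ v = 0 then X - f v else 1) = -FV := by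
      have h1 : ∀ t : ZMod p, (if (Fin.cons t 0 : Fin (d + 1) → ZMod p) = 0 then 0 else
        ∏ v : Fin (d + 1) → ZMod p,
          if (Fin.cons t 0 : Fin (d + 1) → ZMod p) ⬝ᵥ v = 0 then X - f v else 1) =
          if t = 0 then 0 else FV := by
        intro t
        by_cases ht : t = 0
        · rw [if_pos ht, if_pos]
          subst ht
          ext i
          refine Fin.cases ?_ (fun i => ?_) i <;> simp
        · rw [if_neg ht, if_neg (fun h => ht (by simpa using congrFun h 0)), hprod,
            Finset.prod_eq_single 0]
          · simp [hFV]
          · intro c _ hc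
            refine Finset.prod_eq_one fun v _ => if_neg ?_
            simp [eq_comm, ht, hc]
          · simp
      have h2 : ∀ t : ZMod p, (if t = 0 then 0 else FV) = FV - if t = 0 then FV else 0 := by
        intro t
        split_ifs <;> simp
      rw [Finset.sum_congr rfl fun t _ => (h1 t).trans (h2 t), Finset.sum_sub_distrib,
        Finset.sum_const, Finset.card_univ, ZMod.card, nsmul_eq_mul, hp0, Finset.sum_ite_eq' _ _ _]
      simp
    -- The products over the level sets `φ = s` are `F(X) - s α` for one additive `F`. Hence `FV =
    -- F(X)^p - α^{p-1} F(X)`, and the term of `(t, φ)` is `F(X)^p - (F(f e₀) - t α)^{p-1} F(X)`.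
    -- Summing over `t` kills the first part and leaves `α^{p-1} F(X) = F(X)^p - FV`.
    have hne : ∀ φ : Fin d → ZMod p, φ ≠ 0 → (∑ t : ZMod p,
        if (Fin.cons t φ : Fin (d + 1) → ZMod p) = 0 then 0 else
        ∏ v : Fin (d + 1) → ZMod p,
          if (Fin.cons t φ : Fin (d + 1) → ZMod p) ⬝ᵥ v = 0 then X - f v else 1) =
        (∏ v, if φ ⬝ᵥ v = 0 then X - f' v else 1) ^ p - FV := by
      intro φ hφ
      obtain ⟨i, hi⟩ := Function.ne_iff.1 hφ
      let Φ : (Fin d → ZMod p) →ₗ[ZMod p] ZMod p := dotProductBilin (ZMod p) (ZMod p) φ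
      have hy : Φ (Pi.single i (φ i)⁻¹) = 1 := by
        change φ ⬝ᵥ _ = 1
        rw [dotProduct_single]
        exact mul_inv_cancel₀ hi
      obtain ⟨F, hF⟩ := exists_additive_levelProd f' Φ hy
      set α := F (f' (Pi.single i (φ i)⁻¹)) with hα
      have hF' : ∀ (s : ZMod p) (X : R), (∏ v, if φ ⬝ᵥ v = s then X - f' v else 1) =
          F X - s • α := by
        intro s X
        refine (hF s X).trans ?_
        rw [map_sub, map_smul]
      have e1 : FV = F X ^ p - α ^ (p - 1) * F X := by
        rw [← prod_sub_smul]
        simp only [← hF']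
        rw [Finset.prod_comm]
        exact Finset.prod_congr rfl fun v _ => (by simp)
      have e2 : ∀ t : ZMod p, (if (Fin.cons t φ : Fin (d + 1) → ZMod p) = 0 then 0 else
          ∏ v : Fin (d + 1) → ZMod p,
            if (Fin.cons t φ : Fin (d + 1) → ZMod p) ⬝ᵥ v = 0 then X - f v else 1) =
          F X ^ p - (F (f (Fin.cons 1 0)) - t • α) ^ (p - 1) * F X := by
        intro t
        rw [if_neg, hprod, ← prod_sub_smul]
        · refine Finset.prod_congr rfl fun c _ => ?_
          rw [hF', map_sub, map_smul, smul_sub, neg_smul, smul_smul, mul_comm c t]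
          ring
        · intro h
          exact hφ (funext fun i => by simpa using congrFun h i.succ)
      rw [Finset.sum_congr rfl fun t _ => e2 t, Finset.sum_sub_distrib, ← Finset.sum_mul,
        sum_sub_smul_pow, hF' 0 X, e1, zero_smul, Finset.sum_const, Finset.card_univ, ZMod.card,
        nsmul_eq_mul, hp0]
      ring
    rw [← (Fin.consEquiv fun _ : Fin (d + 1) => ZMod p).sum_comp, Fintype.sum_prod_type_right]
    change (∑ φ : Fin d → ZMod p, ∑ t : ZMod p,
      if (Fin.cons t φ : Fin (d + 1) → ZMod p) = 0 then 0 else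
        ∏ v : Fin (d + 1) → ZMod p,
          if (Fin.cons t φ : Fin (d + 1) → ZMod p) ⬝ᵥ v = 0 then X - f v else 1) = _
    have h3 : ∀ φ : Fin d → ZMod p, (∑ t : ZMod p,
        if (Fin.cons t φ : Fin (d + 1) → ZMod p) = 0 then 0 else
        ∏ v : Fin (d + 1) → ZMod p,
          if (Fin.cons t φ : Fin (d + 1) → ZMod p) ⬝ᵥ v = 0 then X - f v else 1) =
        (frob 1 hp0 (if φ = 0 then 0 else ∏ v, if φ ⬝ᵥ v = 0 then X - f' v else 1)) - FV := by
      intro φ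
      by_cases hφ : φ = 0
      · rw [if_pos hφ, map_zero, zero_sub, hφ]
        exact h0
      · rw [if_neg hφ, hne φ hφ]
        congr 1
        simp only [frob, pow_one, RingHom.coe_mk, MonoidHom.coe_mk, OneHom.coe_mk]
    rw [Finset.sum_congr rfl fun φ _ => h3 φ, Finset.sum_sub_distrib, ← map_sum, ih f',
      Finset.sum_const, Finset.card_univ, Fintype.card_fun, ZMod.card, Fintype.card_fin,
      nsmul_eq_mul, Nat.cast_pow, hp0]
    -- For `d = 0` the inductive term is zero and the single copy `-FV = -X` survives; for `d > 0`
    -- the factor `p^d` kills the copies of `FV`.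
    by_cases hd : d = 0
    · subst hd
      simp only [if_true, map_zero, pow_zero, one_mul, zero_sub, pow_one, hFV]
      rw [Fintype.prod_subsingleton _ 0, map_zero]
      simp
    · rw [if_neg hd, zero_pow hd, zero_mul, sub_zero, map_neg]
      congr 1
      change (X ^ p ^ (d - 1)) ^ p ^ 1 = _
      rw [← pow_mul, ← pow_add, Nat.sub_add_cancel (Nat.pos_of_ne_zero hd)]

/-- The Frobenius is an integral combination of products of vectors over affine hyperplanes. -/
theorem exists_sum_smul_prod_eq_pow {V : Type*} [AddCommGroup V] [Module (ZMod p) V] [Fintype V]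
    [Fintype (V →ₗ[ZMod p] ZMod p)] [DecidableEq (V →ₗ[ZMod p] ZMod p)] :
    ∃ m : ℕ, (∀ φ : V →ₗ[ZMod p] ZMod p, φ ≠ 0 → Fintype.card {v // φ v = 1} = p ^ m) ∧
      ∀ {R : Type u} [CommRing R] [Algebra (ZMod p) R] (f : V →ₗ[ZMod p] R) (x : V),
      (∑ φ : V →ₗ[ZMod p] ZMod p, φ x • if φ = 0 then 0 else
        ∏ v : {v // φ v = 1}, f v) = -(f x) ^ p ^ m := by
  classical
  have hp : p.Prime := Fact.out
  have := Module.Finite.of_finite (R := ZMod p) (M := V)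
  let b := Module.finBasis (ZMod p) V
  have hsurj : ∀ φ : V →ₗ[ZMod p] ZMod p, φ ≠ 0 → ∃ y, φ y = 1 := by
    intro φ hφ
    obtain ⟨y, hy⟩ := DFunLike.ne_iff.1 hφ
    exact ⟨(φ y)⁻¹ • y, by rw [map_smul, smul_eq_mul]; exact inv_mul_cancel₀ hy⟩
  -- The level set `φ = 1` is a translate of the kernel, which has dimension one less than `V`. If
  -- `V = 0`, the truncated subtraction gives `0`, and both sides of the identity vanish.
  refine ⟨Module.finrank (ZMod p) V - 1, fun φ hφ => ?_, fun {R} _ _ f x => ?_⟩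
  · obtain ⟨y, hy⟩ := hsurj φ hφ
    have e1 : Fintype.card {v // φ v = 1} = Nat.card (LinearMap.ker φ) := by
      rw [← Nat.card_eq_fintype_card]
      exact Nat.card_congr ((Equiv.subRight y).subtypeEquiv fun v => by
        simp [hy, sub_eq_zero])
    have e2 := LinearMap.finrank_range_add_finrank_ker φ
    have e3 : LinearMap.range φ = ⊤ := LinearMap.range_eq_top.2 fun c =>
      ⟨c • y, by rw [map_smul, hy, smul_eq_mul, mul_one]⟩
    rw [e3, finrank_top, Module.finrank_self] at e2
    rw [e1, Module.natCard_eq_pow_finrank (K := ZMod p), Nat.card_zmod, ← e2, Nat.add_sub_cancel_left]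
  -- Let `F` be the additive polynomial that vanishes on `f(ker φ)` and let `φ y = 1`. The
  -- hyperplane product is `F(f y)`. As `φ(x) y - x` lies in the kernel, `φ(x) F(f y) = F(f x)`,
  -- which is the product over the kernel treated in `sum_kerProd`.
  · have h1 : ∀ φ : V →ₗ[ZMod p] ZMod p, (φ x • if φ = 0 then (0 : R) else
        ∏ v : {v // φ v = 1}, f v) = if φ = 0 then 0 else
          ∏ v, if φ v = 0 then f x - f v else 1 := by
      intro φ
      by_cases hφ : φ = 0
      · rw [if_pos hφ, if_pos hφ, smul_zero]
      rw [if_neg hφ, if_neg hφ]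
      obtain ⟨y, hy⟩ := hsurj φ hφ
      obtain ⟨F, hF⟩ := exists_additive_levelProd f φ hy
      have e1 : (∏ v : {v // φ v = 1}, f v) = F (f y) := by
        have := hF (-1) 0
        rw [zero_sub, neg_smul, one_smul, neg_neg] at this
        rw [← this, ← Equiv.prod_comp (Equiv.neg V), ← Finset.prod_filter]
        rw [← Finset.prod_subtype (p := fun v => φ v = 1) (Finset.univ.filter fun v => φ v = 1)
          (by simp) fun v => f v]
        refine Finset.prod_congr ?_ fun v _ => by simp
        ext v
        simp
      rw [e1, hF 0, zero_smul, sub_zero, ← map_smul, ← sub_eq_zero, ← map_sub]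
      have e2 := hF 0 (φ x • f y - f x)
      rw [zero_smul, sub_zero] at e2
      rw [← e2]
      refine Finset.prod_eq_zero (Finset.mem_univ (φ x • y - x)) ?_
      rw [if_pos (by simp [hy])]
      simp
    rw [Finset.sum_congr rfl fun φ _ => h1 φ]
    have h2 := sum_kerProd _ (f ∘ₗ b.equivFun.symm.toLinearMap) (f x)
    rw [← (b.constr (ZMod p)).toEquiv.sum_comp]
    have h3 : ∀ φ : Fin (Module.finrank (ZMod p) V) → ZMod p,
        (if b.constr (ZMod p) φ = 0 then 0 else
          ∏ v, if b.constr (ZMod p) φ v = 0 then f x - f v else 1) =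
        if φ = 0 then 0 else
        ∏ v, if φ ⬝ᵥ v = 0 then f x - (f ∘ₗ b.equivFun.symm.toLinearMap) v else 1 := by
      intro φ
      rw [← b.equivFun.symm.toEquiv.prod_comp]
      simp only [LinearEquiv.map_eq_zero_iff]
      congr 1
      refine Finset.prod_congr rfl fun v _ => ?_
      have : b.constr (ZMod p) φ (b.equivFun.symm v) = φ ⬝ᵥ v := by
        rw [Module.Basis.constr_apply_fintype, LinearEquiv.apply_symm_apply, dotProduct_comm]
        rfl
      change (if b.constr (ZMod p) φ (b.equivFun.symm v) = 0 then _ else _) = _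
      rw [this]
      rfl
    refine (Finset.sum_congr rfl fun φ _ => h3 φ).trans (h2.trans ?_)
    split_ifs with h
    · have hx : x = 0 := by
        have := Module.finrank_zero_iff.1 h
        exact Subsingleton.elim _ _
      rw [hx, map_zero, zero_pow (pow_ne_zero _ hp.ne_zero), neg_zero]
    · rfl

end IntegralFormula

/-! ### Homogeneous cochains and the prism homotopy. -/

section Homogeneous

variable {X X' M M' : Type*} [AddCommGroup M] [AddCommGroup M']

/-- The differential on homogeneous cochains. -/
def hδ {n : ℕ} (u : (Fin n → X) → M) (x : Fin (n + 1) → X) : M :=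
  ∑ j : Fin (n + 1), (-1 : ℤ) ^ (j : ℕ) • u fun i => x (j.succAbove i)

lemma hδ_zero {n : ℕ} : hδ (fun _ : Fin n → X => (0 : M)) = fun _ => 0 := by
  ext
  simp [hδ]

lemma hδ_sub {n : ℕ} (u v : (Fin n → X) → M) :
    hδ (fun x => u x - v x) = fun x => hδ u x - hδ v x := by
  ext
  simp [hδ, Finset.sum_sub_distrib, smul_sub]

lemma map_hδ {n : ℕ} (f : M →+ M') (u : (Fin n → X) → M) (x : Fin (n + 1) → X) :
    f (hδ u x) = hδ (fun y => f (u y)) x := by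
  simp [hδ, map_sum, map_zsmul]

lemma hδ_comp {n : ℕ} (u : (Fin n → X) → M) (π : X' → X) (x : Fin (n + 1) → X') :
    hδ u (π ∘ x) = hδ (fun y => u (π ∘ y)) x :=
  rfl

/-- The face opposite to the added vertex is `x`; the other faces keep that vertex and change sign.
Coning in this way is the basis of all the inductions below and of the contraction of the standard
resolution. -/
lemma hδ_cons {n : ℕ} (u : (Fin (n + 1) → X) → M) (q : X) (x : Fin (n + 1) → X) :
    hδ u (Fin.cons q x : Fin (n + 2) → X) = u x - hδ (fun y => u (Fin.cons q y : Fin (n + 1) → X)) x := by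
  rw [hδ, Fin.sum_univ_succ, hδ, sub_eq_add_neg, ← Finset.sum_neg_distrib]
  congr 1
  · simp
  · refine Finset.sum_congr rfl fun j _ => ?_
    rw [Fin.val_succ, pow_succ, mul_neg_one, neg_smul]
    congr 3
    ext i
    refine Fin.cases ?_ (fun i => ?_) i
    · simp
    · simp

lemma hδ_hδ : ∀ {n : ℕ} (u : (Fin n → X) → M), hδ (hδ u) = fun _ => 0
  | 0, u => by
    ext x
    simp [hδ, Fin.sum_univ_succ, Subsingleton.elim (fun i : Fin 0 => x _) default]
  | n + 1, u => by
    ext x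
    rw [← Fin.cons_self_tail x, hδ_cons]
    have : (fun y => hδ u (Fin.cons (x 0) y : Fin (n + 2) → X)) =
        fun y => u y - hδ (fun y => u (Fin.cons (x 0) y : Fin (n + 1) → X)) y := by
      ext y
      rw [hδ_cons]
    rw [this, hδ_sub, hδ_hδ]
    simp

/-- The prism operator: a homotopy between the pullbacks of homogeneous cochains by two maps. -/
def prism (π ρ : X' → X) : ∀ (n : ℕ), ((Fin (n + 1) → X) → M) → (Fin n → X') → M
  | 0, _, _ => 0
  | n + 1, u, x => u (Fin.cons (π (x 0)) (ρ ∘ x) : Fin (n + 2) → X) -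
      prism π ρ n (fun y => u (Fin.cons (π (x 0)) y : Fin (n + 2) → X)) (Fin.tail x)

lemma prism_cons (π ρ : X' → X) (n : ℕ) (u : (Fin (n + 2) → X) → M) (q : X') (x : Fin n → X') :
    prism π ρ (n + 1) u (Fin.cons q x : Fin (n + 1) → X') =
      u (Fin.cons (π q) (Fin.cons (ρ q) (ρ ∘ x) : Fin (n + 1) → X) : Fin (n + 2) → X) -
      prism π ρ n (fun y => u (Fin.cons (π q) y : Fin (n + 2) → X)) x := by
  rw [prism, Fin.cons_zero, Fin.tail_cons]
  congr 2
  congr 1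
  ext i
  refine Fin.cases ?_ (fun i => ?_) i <;> simp

lemma prism_sub (π ρ : X' → X) : ∀ (n : ℕ) (u v : (Fin (n + 1) → X) → M),
    prism π ρ n (fun x => u x - v x) = fun x => prism π ρ n u x - prism π ρ n v x
  | 0, u, v => by
    ext
    simp [prism]
  | n + 1, u, v => by
    ext x
    simp only [prism, prism_sub π ρ n]
    abel

/-- The recursion defining `prism` and `hδ_cons` both split off the first vertex, so the induction
hypothesis is applied to the cochain `u(π q, ·)`. The terms that involve both `π q` and `ρ q`
cancel. -/
lemma hδ_prism (π ρ : X' → X) : ∀ (n : ℕ) (u : (Fin (n + 1) → X) → M) (x : Fin (n + 1) → X'),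
    hδ (prism π ρ n u) x + prism π ρ (n + 1) (hδ u) x = u (ρ ∘ x) - u (π ∘ x)
  | 0, u, x => by
    have h1 : ∀ y : Fin 2 → X, hδ u y = u (fun _ => y 1) - u fun _ => y 0 := by
      intro y
      rw [hδ, Fin.sum_univ_two]
      simp only [Fin.val_zero, pow_zero, one_smul, Fin.val_one, pow_one, neg_smul, ← sub_eq_add_neg]
      congr 2 <;> ext i <;> rw [Subsingleton.elim (α := Fin 1) i 0] <;> rfl
    have h2 : ∀ τ : X' → X, τ ∘ x = fun _ => τ (x 0) := by
      intro τ
      ext i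
      rw [Subsingleton.elim (α := Fin 1) i 0]
      rfl
    have h3 : prism π ρ 0 u = fun _ => 0 := rfl
    rw [h3, hδ_zero, prism, h1, h2 ρ, h2 π]
    simp [prism]
  | n + 1, u, x => by
    obtain ⟨q, x, rfl⟩ : ∃ (q : X') (y : Fin (n + 1) → X'), x = (Fin.cons q y : Fin (n + 2) → X') :=
      ⟨_, _, (Fin.cons_self_tail x).symm⟩
    have hcomp : ∀ τ : X' → X, τ ∘ (Fin.cons q x : Fin (n + 2) → X') =
        (Fin.cons (τ q) (τ ∘ x) : Fin (n + 2) → X) := by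
      intro τ
      ext i
      refine Fin.cases ?_ (fun i => ?_) i <;> simp
    have e1 : (fun y => prism π ρ (n + 1) u (Fin.cons q y : Fin (n + 1) → X')) = fun y =>
        u (Fin.cons (π q) (Fin.cons (ρ q) (ρ ∘ y) : Fin (n + 1) → X) : Fin (n + 2) → X) -
        prism π ρ n (fun y => u (Fin.cons (π q) y : Fin (n + 2) → X)) y := by
      ext y
      exact prism_cons π ρ n u q y
    have e2 : (fun y => hδ u (Fin.cons (π q) y : Fin (n + 3) → X)) = fun y => u y -
        hδ (fun y => u (Fin.cons (π q) y : Fin (n + 2) → X)) y := by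
      ext y
      exact hδ_cons u (π q) y
    have ih := hδ_prism π ρ n (fun y => u (Fin.cons (π q) y : Fin (n + 2) → X)) x
    have e3 : hδ (fun y : Fin n → X' =>
        u (Fin.cons (π q) (Fin.cons (ρ q) (ρ ∘ y) : Fin (n + 1) → X) : Fin (n + 2) → X)) x =
        hδ (fun y : Fin n → X =>
          u (Fin.cons (π q) (Fin.cons (ρ q) y : Fin (n + 1) → X) : Fin (n + 2) → X)) (ρ ∘ x) := rfl
    rw [hcomp, hcomp, hδ_cons, prism_cons, e1, e2, hδ_sub, prism_sub, hδ_cons, hδ_cons]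
    beta_reduce
    rw [e3]
    rw [← sub_eq_zero] at ih ⊢
    rw [← ih]
    abel

end Homogeneous

/-! ### Continuity for the `p`-adic topology. -/

section PadicCont

variable {p : ℕ} {X Y : Type*} [TopologicalSpace X] [TopologicalSpace Y] {M : Type*}
  [AddCommGroup M] {M' : Type*} [AddCommGroup M']

lemma PadicCont.comp {f : Y → M} (hf : PadicCont p f) {g : X → Y} (hg : Continuous g) :
    PadicCont p fun x => f (g x) :=
  fun s x => (hg.tendsto x).eventually (hf s (g x))

lemma PadicCont.map {f : X → M} (hf : PadicCont p f) (g : M →+ M') : PadicCont p fun x => g (f x) := by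
  intro s x
  filter_upwards [hf s x] with y hy
  obtain ⟨m, hm⟩ := hy
  exact ⟨g m, by rw [hm, map_add, map_nsmul]⟩

lemma PadicCont.add {f g : X → M} (hf : PadicCont p f) (hg : PadicCont p g) :
    PadicCont p fun x => f x + g x := by
  intro s x
  filter_upwards [hf s x, hg s x] with y hy hy'
  obtain ⟨m, hm⟩ := hy
  obtain ⟨m', hm'⟩ := hy'
  exact ⟨m + m', by rw [hm, hm', smul_add]; abel⟩

lemma PadicCont.sub {f g : X → M} (hf : PadicCont p f) (hg : PadicCont p g) :
    PadicCont p fun x => f x - g x := by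
  simpa [sub_eq_add_neg] using hf.add (hg.map (-AddMonoidHom.id M))

lemma PadicCont.pi {Z : Type*} [Finite Z] {M : Z → Type*} [∀ z, AddCommGroup (M z)] {f : X → ∀ z, M z}
    (hf : ∀ z, PadicCont p fun x => f x z) : PadicCont p f := by
  intro s x
  filter_upwards [Filter.eventually_all.2 fun z => hf z s x] with y hy
  choose m hm using hy
  exact ⟨m, funext hm⟩

lemma padicCont_of_isLocallyConstant {f : X → M} (hf : IsLocallyConstant f) : PadicCont p f := by
  intro s x
  filter_upwards [hf.eventually_eq x] with y hy
  exact ⟨0, by rw [hy, smul_zero, add_zero]⟩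

lemma PadicCont.isLocallyConstant {f : X → M} (hf : PadicCont p f) {s : ℕ}
    (hs : ∀ m : M, p ^ s • m = 0) : IsLocallyConstant f := by
  rw [IsLocallyConstant.iff_eventually_eq]
  intro x
  filter_upwards [hf s x] with y hy
  obtain ⟨m, hm⟩ := hy
  rw [hm, hs, add_zero]

lemma continuous_finCons {T : Type*} [TopologicalSpace T] {n : ℕ} {f : T → X} {g : T → Fin n → X}
    (hf : Continuous f) (hg : Continuous g) :
    Continuous fun t => (Fin.cons (f t) (g t) : Fin (n + 1) → X) := by
  refine continuous_pi fun i => ?_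
  refine Fin.cases ?_ (fun i => ?_) i
  · simpa using hf
  · simpa [Function.comp_def] using (continuous_apply i).comp hg

/-- The parameter space `T` is what makes the induction possible: each step of the recursion freezes
the vertex `π (x 0)`, which has to become a parameter on which the cochain depends continuously. -/
lemma prism_padicCont {X' : Type v} [TopologicalSpace X'] {π ρ : X' → X} (hπ : Continuous π)
    (hρ : Continuous ρ) : ∀ (n : ℕ) {T : Type v} [TopologicalSpace T]
    {u : T → (Fin (n + 1) → X) → M}, PadicCont p (fun a : T × (Fin (n + 1) → X) => u a.1 a.2) →
    PadicCont p fun a : T × (Fin n → X') => prism π ρ n (u a.1) a.2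
  | 0, T, _, u, hu => by
    simp only [prism]
    exact fun s x => Filter.Eventually.of_forall fun y => ⟨0, by simp⟩
  | n + 1, T, _, u, hu => by
    simp only [prism]
    refine PadicCont.sub ?_ ?_
    · refine hu.comp (g := fun a : T × (Fin (n + 1) → X') =>
        (a.1, (Fin.cons (π (a.2 0)) (ρ ∘ a.2) : Fin (n + 2) → X))) ?_
      refine continuous_fst.prodMk (continuous_finCons (by fun_prop) ?_)
      exact continuous_pi fun i => hρ.comp (by fun_prop : Continuous fun a : T × (Fin (n + 1) → X') => a.2 i)
    · have := prism_padicCont hπ hρ n (T := T × X')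
        (u := fun a y => u a.1 (Fin.cons (π a.2) y : Fin (n + 2) → X)) (by
          refine hu.comp (g := fun a : (T × X') × (Fin (n + 1) → X) =>
            (a.1.1, (Fin.cons (π a.1.2) a.2 : Fin (n + 2) → X))) ?_
          exact (by fun_prop : Continuous fun a : (T × X') × (Fin (n + 1) → X) => a.1.1).prodMk
            (continuous_finCons (hπ.comp (by fun_prop : Continuous fun a : (T × X') × (Fin (n + 1) → X) => a.1.2))
              continuous_snd))
      refine this.comp (g := fun a : T × (Fin (n + 1) → X') => ((a.1, a.2 0), Fin.tail a.2)) ?_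
      refine (by fun_prop : Continuous fun a : T × (Fin (n + 1) → X') => (a.1, a.2 0)).prodMk ?_
      exact continuous_pi fun i => by
        simp only [Fin.tail]
        fun_prop

end PadicCont

/-! ### Passage between inhomogeneous and homogeneous cochains. -/

section Inhomogeneous

variable {G : Type w} [Group G] {M : Type v} [AddCommGroup M] (ρ : Representation ℤ G M)

/-- The homogeneous cochain attached to an inhomogeneous cochain. -/
def homog {n : ℕ} (c : (Fin n → G) → M) (x : Fin (n + 1) → G) : M :=
  ρ (x 0) (c fun i => (x i.castSucc)⁻¹ * x i.succ)

lemma homog_smul {n : ℕ} (c : (Fin n → G) → M) (g : G) (x : Fin (n + 1) → G) :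
    homog ρ c (fun i => g * x i) = ρ g (homog ρ c x) := by
  simp only [homog, map_mul, Module.End.mul_apply, mul_inv_rev, mul_assoc, inv_mul_cancel_left]

lemma homog_partialProd {n : ℕ} (c : (Fin n → G) → M) (g : Fin n → G) :
    homog ρ c (Fin.partialProd g) = c g := by
  simp only [homog, Fin.partialProd_zero, map_one, Module.End.one_apply,
    Fin.partialProd_right_inv]

lemma eq_smul_partialProd {n : ℕ} (x : Fin (n + 1) → G) :
    x = fun i => x 0 * Fin.partialProd (fun i : Fin n => (x i.castSucc)⁻¹ * x i.succ) i :=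
  (Fin.partialProd_left_inv x).symm

/-- On the simplex `(1, g₀, g₀g₁, …)`, deleting a vertex other than the initial one contracts two
consecutive arguments (or drops the last one); deleting the initial vertex gives a simplex starting
at `g₀`, whence the action of `g₀`. -/
lemma coboundary_partialProd {n : ℕ} {u : (Fin (n + 1) → G) → M}
    (hu : ∀ g x, u (fun i => g * x i) = ρ g (u x)) (g : Fin (n + 1) → G) :
    coboundary ρ n (fun g => u (Fin.partialProd g)) g = hδ u (Fin.partialProd g) := by
  rw [hδ, Fin.sum_univ_succ]
  change ρ (g 0) _ + ∑ j : Fin (n + 1), _ = _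
  congr 1
  · simp only [Fin.val_zero, pow_zero, one_smul, Fin.succAbove_zero, Fin.partialProd_succ']
    rw [hu]
    rfl
  · refine Finset.sum_congr rfl fun j _ => ?_
    beta_reduce
    rw [Fin.partialProd_contractNth]
    rfl

/-- Both sides are equivariant and every simplex is a translate of a partial product, where
`coboundary_partialProd` applies. -/
lemma hδ_homog {n : ℕ} (c : (Fin n → G) → M) (x : Fin (n + 2) → G) :
    hδ (homog ρ c) x = homog ρ (coboundary ρ n c) x := by
  have h : ∀ (g : G) (x : Fin (n + 2) → G), hδ (homog ρ c) (fun i => g * x i) =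
      ρ g (hδ (homog ρ c) x) := by
    intro g x
    change _ = (ρ g).toAddMonoidHom _
    rw [map_hδ]
    change hδ (fun y => homog ρ c fun i => g * y i) x = _
    simp only [homog_smul]
    rfl
  rw [eq_smul_partialProd x, h, homog_smul, homog_partialProd,
    ← coboundary_partialProd ρ (homog_smul ρ c)]
  simp only [homog_partialProd]

lemma coboundary_coboundary {n : ℕ} (c : (Fin n → G) → M) :
    coboundary ρ (n + 1) (coboundary ρ n c) = 0 := by
  ext g
  rw [← homog_partialProd ρ (coboundary ρ (n + 1) _), ← hδ_homog]
  have : homog ρ (coboundary ρ n c) = hδ (homog ρ c) := funext fun x => (hδ_homog ρ c x).symm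
  rw [this, hδ_hδ]
  rfl

lemma continuous_partialProd [TopologicalSpace G] [IsTopologicalGroup G] (n : ℕ) :
    Continuous fun g : Fin n → G => Fin.partialProd g := by
  refine continuous_pi fun i => ?_
  induction i using Fin.induction with
  | zero => simpa using continuous_const
  | succ j ih =>
    simp only [Fin.partialProd_succ]
    exact ih.mul (continuous_apply j)

/-- The action of `G` is continuous for the `p`-adic topology. -/
def RepCont [TopologicalSpace G] (p : ℕ) : Prop :=
  ∀ s : ℕ, ∃ K : OpenSubgroup G, ∀ g ∈ K, ∀ m : M, ∃ m' : M, ρ g m = m + p ^ s • m'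

variable {ρ}

lemma RepCont.padicCont_smul [TopologicalSpace G] [IsTopologicalGroup G] {p : ℕ}
    (hρ : RepCont ρ p) {X : Type*} [TopologicalSpace X] {f : X → M} (hf : PadicCont p f)
    {γ : X → G} (hγ : Continuous γ) : PadicCont p fun x => ρ (γ x) (f x) := by
  intro s x
  obtain ⟨K, hK⟩ := hρ s
  have h1 : ∀ᶠ y in 𝓝 x, (γ x)⁻¹ * γ y ∈ K := by
    refine (continuous_const.mul hγ).continuousAt.eventually (K.isOpen'.mem_nhds ?_)
    simp
  filter_upwards [h1, hf s x] with y hy hy'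
  obtain ⟨m, hm⟩ := hy'
  obtain ⟨m', hm'⟩ := hK _ hy (f y)
  refine ⟨ρ (γ x) (m + m'), ?_⟩
  have : ρ (γ y) (f y) = ρ (γ x) (ρ ((γ x)⁻¹ * γ y) (f y)) := by
    rw [← Module.End.mul_apply, ← map_mul, mul_inv_cancel_left]
  rw [this, hm', hm, map_add, map_add, map_nsmul, map_nsmul, add_assoc, ← smul_add, ← map_add]

lemma RepCont.homog_padicCont [TopologicalSpace G] [IsTopologicalGroup G] {p : ℕ}
    (hρ : RepCont ρ p) {n : ℕ} {c : (Fin n → G) → M} (hc : PadicCont p c) :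
    PadicCont p (homog ρ c) := by
  refine hρ.padicCont_smul (hc.comp ?_) (continuous_apply 0)
  fun_prop

end Inhomogeneous

/-! ### Shapiro's lemma and the lifting of cocycles with values in permutation modules. -/

section Shapiro

variable {p : ℕ} {G : Type w} [Group G] [TopologicalSpace G] [IsTopologicalGroup G]

/-- A continuous retraction of a topological group onto an open subgroup, as left `H`-sets. -/
lemma exists_continuous_equivariant_retraction (H : Subgroup G) (hH : IsOpen (H : Set G)) :
    ∃ π : G → H, Continuous π ∧ ∀ (h : H) (g : G), π (h * g) = h * π g := by
  have : DiscreteTopology (G ⧸ H) := QuotientGroup.discreteTopology hH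
  have hmem : ∀ g : G, g * (QuotientGroup.mk g⁻¹ : G ⧸ H).out ∈ H := by
    intro g
    have := QuotientGroup.eq.1 (QuotientGroup.out_eq' (QuotientGroup.mk g⁻¹ : G ⧸ H)).symm
    rwa [inv_inv] at this
  refine ⟨fun g => ⟨_, hmem g⟩, ?_, fun h g => Subtype.ext ?_⟩
  · refine Continuous.subtype_mk (continuous_id.mul ?_) _
    exact (continuous_of_discreteTopology (f := fun x : G ⧸ H => x.out)).comp
      (QuotientGroup.continuous_mk.comp continuous_inv)
  · have : (QuotientGroup.mk ((h : G) * g)⁻¹ : G ⧸ H) = QuotientGroup.mk g⁻¹ := by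
      rw [QuotientGroup.eq]
      simp
    simp only [this, Subgroup.coe_mul, mul_assoc]

variable {R R' : Type*} [CommRing R] [CommRing R'] (f : R →+* R')

/-- Functions on a `G`-set with values in a ring, on which `G` acts through a character. -/
def permRep {R : Type*} [CommRing R] (ψ : G →* Rˣ) (Z : Type*) [MulAction G Z] :
    Representation ℤ G (Z → R) where
  toFun g :=
    { toFun := fun F z => (ψ g : R) * F (g⁻¹ • z)
      map_add' := fun F F' => funext fun z => mul_add _ _ _
      map_smul' := fun c F => funext fun z => mul_smul_comm c (ψ g : R) (F (g⁻¹ • z)) }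
  map_one' := by
    ext F z
    simp
  map_mul' g h := by
    ext F z
    simp [mul_smul, mul_assoc]

lemma permRep_apply {R : Type*} [CommRing R] (ψ : G →* Rˣ) {Z : Type*} [MulAction G Z] (g : G)
    (F : Z → R) (z : Z) : permRep ψ Z g F z = (ψ g : R) * F (g⁻¹ • z) :=
  rfl

/-- Every continuous cocycle with values in `R'(ψ')` lifts to `R(ψ)`, up to a coboundary. -/
def CocyclesLift (p : ℕ) {H : Type*} [Group H] [TopologicalSpace H] {R R' : Type*} [CommRing R] [CommRing R']
    (f : R →+* R') (ψ : H →* Rˣ) (ψ' : H →* R'ˣ) (ν : ℕ) : Prop :=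
  ∀ y ∈ contCocycles p (charRep ψ') (ν + 1), ∃ Y ∈ contCocycles p (charRep ψ) (ν + 1),
    ∃ b ∈ contCochains p H R' ν, ∀ x, f (Y x) = y x + coboundary (charRep ψ') ν b x

variable {f} {ψ : G →* Rˣ} {ψ' : G →* R'ˣ} 

lemma RepCont.comp_subtype {R : Type*} [CommRing R] {ψ : G →* Rˣ} (h : RepCont (charRep ψ) p)
    {H : Subgroup G} : RepCont (charRep (ψ.comp H.subtype)) p := by
  intro s
  obtain ⟨K, hK⟩ := h s
  exact ⟨K.comap H.subtype continuous_subtype_val, fun g hg m => hK g hg m⟩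

/-- Shapiro's lemma at the level of cocycles: lifting cocycles with values in permutation modules
reduces to lifting cocycles of stabilizers. -/
lemma exists_stabilizer_lift (hψ : ∀ g, f (ψ g) = ψ' g) (hc' : RepCont (charRep ψ') p) (hc : RepCont (charRep ψ) p)
    {ν : ℕ} (H : Subgroup G) (hH : IsOpen (H : Set G))
    (hsurj : CocyclesLift p f (ψ.comp H.subtype) (ψ'.comp H.subtype) ν)
    {c : (Fin (ν + 2) → G) → R'} (hcont : PadicCont p c) (hc0 : ∀ x, hδ c x = 0)
    (hceq : ∀ (h : H) x, c (fun i => h * x i) = ψ' h * c x) :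
    ∃ (U : (Fin (ν + 2) → G) → R) (β : (Fin (ν + 1) → G) → R'), PadicCont p U ∧ PadicCont p β ∧
      (∀ x, hδ U x = 0) ∧ (∀ (h : H) x, U (fun i => h * x i) = ψ h * U x) ∧
      (∀ (h : H) x, β (fun i => h * x i) = ψ' h * β x) ∧ ∀ x, f (U x) = c x + hδ β x := by
  obtain ⟨π, hπ, hπH⟩ := exists_continuous_equivariant_retraction H hH
  let cH : (Fin (ν + 2) → H) → R' := fun x => c fun i => x i
  have hcH : ∀ (h : H) x, cH (fun i => h * x i) = charRep (ψ'.comp H.subtype) h (cH x) :=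
    fun h x => hceq h fun i => x i
  have hcH0 : ∀ x, hδ cH x = 0 := fun x => hc0 fun i => x i
  have hcHc : PadicCont p cH := hcont.comp (by fun_prop)
  obtain ⟨Y, ⟨hY1, hY2⟩, b, hb, hYb⟩ := hsurj (fun g => cH (Fin.partialProd g))
    ⟨hcHc.comp (continuous_partialProd _), by
      ext g
      rw [coboundary_partialProd _ hcH, hcH0]
      rfl⟩
  have hY0 : ∀ x, hδ (homog (charRep (ψ.comp H.subtype)) Y) x = 0 := by
    intro x
    rw [hδ_homog, show coboundary _ _ Y = 0 from hY2, homog, Pi.zero_apply, map_zero]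
  have hYf : ∀ x, f (homog (charRep (ψ.comp H.subtype)) Y x) =
      cH x + hδ (homog (charRep (ψ'.comp H.subtype)) b) x := by
    intro x
    rw [hδ_homog]
    conv_rhs => rw [eq_smul_partialProd x, hcH, homog_smul, homog_partialProd]
    rw [← map_add, ← hYb]
    change f ((ψ (x 0) : R) * _) = (ψ' (x 0) : R') * _
    rw [map_mul, hψ]
  -- The restriction to `H` is lifted, and the lift is pulled back to `G` along the `H`-equivariant
  -- retraction `π`. As `π` followed by the inclusion need not be the identity of `G`, the prism
  -- operator supplies the coboundary between the pullback of `c` and `c` itself.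
  refine ⟨fun x => homog (charRep (ψ.comp H.subtype)) Y (π ∘ x),
    fun x => homog (charRep (ψ'.comp H.subtype)) b (π ∘ x) - prism (fun g => (π g : G)) id _ c x,
    ?_, ?_, ?_, ?_, ?_, ?_⟩
  · refine (hc.comp_subtype.homog_padicCont hY1).comp ?_
    exact continuous_pi fun i => hπ.comp (continuous_apply i)
  · refine PadicCont.sub ((hc'.comp_subtype.homog_padicCont (p := p) (c := b) hb).comp ?_) ?_
    · exact continuous_pi fun i => hπ.comp (continuous_apply i)
    · exact (prism_padicCont (π := fun g => (π g : G)) (ρ := id) (continuous_subtype_val.comp hπ)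
        continuous_id (ν + 1) (T := PUnit) (u := fun _ => c) (hcont.comp continuous_snd)).comp
        (g := fun x => (PUnit.unit, x)) (by fun_prop)
  · intro x
    exact hY0 (π ∘ x)
  · intro h x
    have : π ∘ (fun i => (h : G) * x i) = fun i => h * (π ∘ x) i := funext fun i => hπH h (x i)
    beta_reduce
    rw [this, homog_smul]
    rfl
  · intro h x
    have : π ∘ (fun i => (h : G) * x i) = fun i => h * (π ∘ x) i := funext fun i => hπH h (x i)
    beta_reduce
    rw [this, homog_smul]
    -- Two cochains are needed for the induction: after freezing the first vertex, the left side
    -- involves `π (h x₀) = h π(x₀)` and the right side `π(x₀)`.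
    have hpr : ∀ (n : ℕ) (c : (Fin (n + 1) → G) → R')
        (c' : (Fin (n + 1) → G) → R') (_ : ∀ x, c (fun i => h * x i) = ψ' h * c' x)
        (x : Fin n → G), prism (fun g => (π g : G)) id n c (fun i => h * x i) =
        ψ' h * prism (fun g => (π g : G)) id n c' x := by
      intro n
      induction n with
      | zero =>
        intro c c' _ x
        simp [prism]
      | succ n ih =>
        intro c c' hcc x
        rw [prism, prism, mul_sub, ← hcc]
        congr 1
        · congr 1
          ext i
          refine Fin.cases ?_ (fun i => ?_) i <;> simp [hπH]
        · refine ih _ _ (fun y => ?_) _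
          rw [← hcc]
          congr 1
          ext i
          refine Fin.cases ?_ (fun i => ?_) i <;> simp [hπH]
    rw [hpr _ c c (fun x => hceq h x), mul_sub]
    rfl
  · intro x
    rw [hYf, hδ_sub]
    have h1 : hδ (fun x => prism (fun g => (π g : G)) id (ν + 1) c x) x + _ = _ :=
      hδ_prism (fun g => (π g : G)) id (ν + 1) c x
    have h2 : prism (fun g => (π g : G)) id (ν + 1 + 1) (hδ c) x = 0 := by
      have : ∀ n (y : Fin n → G), prism (fun g => (π g : G)) id n
          (fun _ : Fin (n + 1) → G => (0 : R')) y = 0 := by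
        intro n
        induction n with
        | zero => simp [prism]
        | succ n ih => intro y; rw [prism, ih, sub_zero]
      rw [show hδ c = fun _ => 0 from funext hc0, this]
    rw [h2, add_zero] at h1
    beta_reduce
    rw [h1]
    change c ((fun g => (π g : G)) ∘ x) + hδ _ (π ∘ x) = c x + (hδ _ (π ∘ x) - (c (id ∘ x) - _))
    rw [Function.id_comp]
    ring

/-- With an orbit representative `r z` and `t z` carrying it to `z`, a cochain known at `r z` is
spread over its orbit by transport along `t z`. The result is `G`-equivariant because `(t z)⁻¹ g
t(g⁻¹ z)` stabilizes `r z`, where equivariance is assumed. -/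
lemma smul_transport {Z : Type*} [MulAction G Z] {n : ℕ} {S : Type*} [CommRing S] (χ : G →* Sˣ)
    (V : Z → (Fin n → G) → S)
    (hV : ∀ z (h : MulAction.stabilizer G z) x, V z (fun i => h * x i) = χ h * V z x)
    {r : Z → Z} {t : Z → G} (hr : ∀ (g : G) z, r (g • z) = r z)
    (hmem : ∀ g z, (t z)⁻¹ * g * t (g⁻¹ • z) ∈ MulAction.stabilizer G (r z))
    (g : G) (x : Fin n → G) (z : Z) :
    (χ (t z) : S) * V (r z) (fun i => (t z)⁻¹ * (g * x i)) =
      (χ g : S) * ((χ (t (g⁻¹ • z)) : S) * V (r (g⁻¹ • z)) fun i => (t (g⁻¹ • z))⁻¹ * x i) := by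
  have := hV (r z) ⟨_, hmem g z⟩ fun i => (t (g⁻¹ • z))⁻¹ * x i
  simp only [mul_assoc, mul_inv_cancel_left] at this
  have e : (χ (t z) : S) * χ ((t z)⁻¹ * (g * t (g⁻¹ • z))) = χ g * χ (t (g⁻¹ • z)) := by
    rw [← Units.val_mul, ← map_mul, mul_inv_cancel_left, map_mul, Units.val_mul]
  rw [hr, this, ← mul_assoc, e, mul_assoc]

/-- Cocycles with values in permutation modules lift, if those of all open subgroups do. -/
theorem exists_permRep_lift (hψ : ∀ g, f (ψ g) = ψ' g) (hc' : RepCont (charRep ψ') p) (hc : RepCont (charRep ψ) p)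
    {ν : ℕ} (hsurj : ∀ H : Subgroup G, IsOpen (H : Set G) →
      CocyclesLift p f (ψ.comp H.subtype) (ψ'.comp H.subtype) ν)
    {Z : Type*} [Finite Z] [MulAction G Z] (hZ : ∀ z : Z, IsOpen (MulAction.stabilizer G z : Set G))
    {c : (Fin (ν + 1) → G) → Z → R'} (hcc : c ∈ contCocycles p (permRep ψ' Z) (ν + 1)) :
    ∃ C ∈ contCocycles p (permRep ψ Z) (ν + 1), ∃ b ∈ contCochains p G (Z → R') ν,
      ∀ x z, f (C x z) = c x z + coboundary (permRep ψ' Z) ν b x z := by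
  let r : Z → Z := fun z => (Quotient.mk (MulAction.orbitRel G Z) z).out
  have hr : ∀ (g : G) z, r (g • z) = r z := by
    intro g z
    have : Quotient.mk (MulAction.orbitRel G Z) (g • z) = Quotient.mk (MulAction.orbitRel G Z) z :=
      Quotient.sound ⟨g, rfl⟩
    simp only [r, this]
  have ht : ∀ z, ∃ t : G, t • r z = z := by
    intro z
    have : (MulAction.orbitRel G Z) (r z) z := Quotient.exact (Quotient.out_eq _)
    obtain ⟨g, hg⟩ := this
    exact ⟨g⁻¹, by rw [← hg, inv_smul_smul]⟩
  choose t ht using ht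
  have hperm : RepCont (permRep ψ' Z) p := by
    intro s
    obtain ⟨K, hK⟩ := hc' s
    let K' : Subgroup G := K ⊓ ⨅ z : Z, MulAction.stabilizer G z
    have hK' : IsOpen (K' : Set G) := by
      rw [Subgroup.coe_inf, Subgroup.coe_iInf]
      exact K.isOpen'.inter (isOpen_iInter_of_finite hZ)
    refine ⟨⟨K', hK'⟩, fun g hg F => ?_⟩
    choose m hm using fun z => hK g hg.1 (F z)
    refine ⟨m, funext fun z => ?_⟩
    have hz : g⁻¹ • z = z := by
      have := Subgroup.mem_iInf.1 hg.2 z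
      exact (MulAction.stabilizer G z).inv_mem this
    rw [permRep_apply, hz]
    exact hm z
  set ch := homog (permRep ψ' Z) c with hch
  have hcheq : ∀ g x z, ch (fun i => g * x i) z = (ψ' g : R') * ch x (g⁻¹ • z) := by
    intro g x z
    rw [hch, homog_smul, permRep_apply]
  have hch0 : ∀ x z, hδ ch x z = 0 := by
    intro x z
    rw [hch, hδ_homog, show coboundary _ _ c = 0 from hcc.2, homog, Pi.zero_apply, map_zero]
    rfl
  have hchc : PadicCont p ch := hperm.homog_padicCont hcc.1
  -- The component at `z₀` of the homogeneous cocycle is a cocycle on `G` that is equivariant under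
  -- the open stabilizer of `z₀`; this is the Shapiro correspondence.
  have key := fun z₀ : Z => exists_stabilizer_lift hψ hc' hc (MulAction.stabilizer G z₀) (hZ z₀)
    (hsurj _ (hZ z₀)) (c := fun x => ch x z₀)
    (hchc.map (Pi.evalAddMonoidHom (fun _ : Z => R') z₀))
    (fun x => by
      rw [← hch0 x z₀]
      exact (map_hδ (Pi.evalAddMonoidHom (fun _ : Z => R') z₀) ch x).symm)
    (fun h x => by
      rw [hcheq, show (h : G)⁻¹ • z₀ = z₀ from (MulAction.stabilizer G z₀).inv_mem h.2])
  choose U β hU hβ hU0 hUe hβe hUf using key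
  have hmem : ∀ g z, (t z)⁻¹ * g * t (g⁻¹ • z) ∈ MulAction.stabilizer G (r z) := by
    intro g z
    rw [MulAction.mem_stabilizer_iff, mul_smul, mul_smul]
    have := ht (g⁻¹ • z)
    rw [hr] at this
    rw [this, smul_inv_smul, inv_smul_eq_iff, ht]
  have hUg := fun g x z => smul_transport ψ U hUe hr hmem g x z
  have hβg := fun g x z => smul_transport ψ' β hβe hr hmem g x z
  -- Only the lifts at the orbit representatives are kept; the others are replaced by their
  -- translates, to obtain equivariance under all of `G`.
  let Ch : (Fin (ν + 2) → G) → Z → R := fun x z => (ψ (t z) : R) * U (r z) (fun i => (t z)⁻¹ * x i)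
  let B : (Fin (ν + 1) → G) → Z → R' := fun x z => (ψ' (t z) : R') * β (r z) (fun i => (t z)⁻¹ * x i)
  have hChe : ∀ g x, Ch (fun i => g * x i) = permRep ψ Z g (Ch x) :=
    fun g x => funext fun z => hUg g x z
  have hBe : ∀ g x, B (fun i => g * x i) = permRep ψ' Z g (B x) :=
    fun g x => funext fun z => hβg g x z
  have hChc : PadicCont p Ch := PadicCont.pi fun z =>
    ((hU (r z)).comp (by fun_prop)).map (AddMonoidHom.mulLeft (ψ (t z) : R))
  have hBc : PadicCont p B := PadicCont.pi fun z =>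
    ((hβ (r z)).comp (by fun_prop)).map (AddMonoidHom.mulLeft (ψ' (t z) : R'))
  have hδCh : ∀ x, hδ Ch x = 0 := by
    intro x
    ext z
    have h1 := map_hδ (Pi.evalAddMonoidHom (fun _ : Z => R) z) Ch x
    have h2 := map_hδ (AddMonoidHom.mulLeft (ψ (t z) : R)) (U (r z)) fun i => (t z)⁻¹ * x i
    rw [hU0, map_zero] at h2
    exact h1.trans h2.symm
  have hδB : ∀ x z, hδ B x z = (ψ' (t z) : R') * hδ (β (r z)) fun i => (t z)⁻¹ * x i := by
    intro x z
    have h1 := map_hδ (Pi.evalAddMonoidHom (fun _ : Z => R') z) B x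
    have h2 := map_hδ (AddMonoidHom.mulLeft (ψ' (t z) : R')) (β (r z)) fun i => (t z)⁻¹ * x i
    exact h1.trans h2.symm
  refine ⟨fun g => Ch (Fin.partialProd g), ⟨hChc.comp (continuous_partialProd _), ?_⟩,
    fun g => B (Fin.partialProd g), hBc.comp (continuous_partialProd _), fun g z => ?_⟩
  · ext1 g
    exact (coboundary_partialProd _ hChe g).trans (hδCh _)
  · rw [coboundary_partialProd _ hBe, hδB]
    have h3 : c g z = (ψ' (t z) : R') * ch (fun i => (t z)⁻¹ * Fin.partialProd g i) (r z) := by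
      have := hcheq (t z) (fun i => (t z)⁻¹ * Fin.partialProd g i) z
      simp only [mul_inv_cancel_left] at this
      rw [show (t z)⁻¹ • z = r z from inv_smul_eq_iff.2 (ht z).symm] at this
      rw [← this, hch, homog_partialProd]
    rw [h3, ← mul_add, ← hUf, map_mul, hψ]

end Shapiro

/-! ### Continuity of cyclotomic characters and the lifting of cocycles from `𝔽_p(n)`. -/

section Cyclotomic

variable {p : ℕ} [Fact p.Prime] {N : ℕ∞} {G : Type w} [Group G] [TopologicalSpace G]

/-- The reduction of `ℤ/p^N` to `𝔽_p`. -/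
def cycOne (p : ℕ) [Fact p.Prime] {N : ℕ∞} (hN : 1 ≤ N) : CycRing p N →+* ZMod p :=
  (ZMod.ringEquivCongr (pow_one p) : ZMod (p ^ 1) →+* ZMod p).comp
    (cycRed p 1 (by exact_mod_cast hN))

/-- The character giving the action on `𝔽_p(n)`. -/
def CycChar.one (T : CycChar p N G) (hN : 1 ≤ N) (n : ℕ) : G →* (ZMod p)ˣ :=
  (Units.map (cycOne p hN : CycRing p N →* ZMod p)).comp (T.χ ^ n)

/-- Continuity of the character is given at finite levels, while cochains are continuous for
divisibility by `p^s`; this compares the two. One takes `t = s` if `s ≤ N`. Otherwise `N` is finite,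
and `t = N` works since the reduction is then injective. -/
lemma exists_cycRed_eq_zero (N : ℕ∞) (s : ℕ) : ∃ (t : ℕ) (ht : (t : ℕ∞) ≤ N),
    ∀ a : CycRing p N, cycRed p t ht a = 0 → ∃ b, a = p ^ s * b := by
  have hker : ∀ (t : ℕ) (ht : (t : ℕ∞) ≤ N) (z : ℤ_[p]),
      cycRed p t ht (Ideal.Quotient.mk _ z) = 0 → z ∈ Ideal.span {(p : ℤ_[p]) ^ t} := by
    intro t ht z hz
    rw [← PadicInt.ker_toZModPow]
    exact hz
  by_cases hs : (s : ℕ∞) ≤ N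
  · refine ⟨s, hs, fun a ha => ?_⟩
    obtain ⟨z, rfl⟩ := Ideal.Quotient.mk_surjective a
    obtain ⟨b, rfl⟩ := Ideal.mem_span_singleton.1 (hker s hs z ha)
    exact ⟨Ideal.Quotient.mk _ b, by simp⟩
  · obtain ⟨t, rfl⟩ := ENat.ne_top_iff_exists.1 (ne_top_of_lt (not_le.1 hs))
    refine ⟨t, le_rfl, fun a ha => ⟨0, ?_⟩⟩
    obtain ⟨z, rfl⟩ := Ideal.Quotient.mk_surjective a
    rw [mul_zero, Ideal.Quotient.eq_zero_iff_mem]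
    refine Ideal.mem_iInf.2 fun k => Ideal.mem_iInf.2 fun hk => ?_
    exact Ideal.span_singleton_le_span_singleton.2 (pow_dvd_pow _ (Nat.cast_le.1 hk))
      (hker t le_rfl z ha)

lemma CycChar.exists_openSubgroup (T : CycChar p N G) (n s : ℕ) : ∃ K : OpenSubgroup G, ∀ g ∈ K,
    ∃ b : CycRing p N, ((T.χ ^ n) g : CycRing p N) = 1 + p ^ s * b := by
  obtain ⟨t, ht, h⟩ := exists_cycRed_eq_zero (p := p) N s
  refine ⟨⟨_, T.cont t ht⟩, fun g hg => ?_⟩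
  obtain ⟨b, hb⟩ := h ((T.χ ^ n) g - 1) (by
    have : Units.map (cycRed p t ht : CycRing p N →* ZMod (p ^ t)) (T.χ g) = 1 := hg
    have := congrArg Units.val this
    rw [Units.coe_map, Units.val_one] at this
    rw [map_sub, map_one, MonoidHom.pow_apply, Units.val_pow_eq_pow_val, map_pow,
      show cycRed p t ht (T.χ g : CycRing p N) = 1 from this, one_pow, sub_self])
  exact ⟨b, by rw [← hb]; ring⟩

lemma CycChar.repCont (T : CycChar p N G) (n : ℕ) : RepCont (charRep (T.χ ^ n)) p := by
  intro s
  obtain ⟨K, hK⟩ := T.exists_openSubgroup n s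
  refine ⟨K, fun g hg m => ?_⟩
  obtain ⟨b, hb⟩ := hK g hg
  refine ⟨b * m, ?_⟩
  change ((T.χ ^ n) g : CycRing p N) * m = _
  rw [hb, nsmul_eq_mul, Nat.cast_pow]
  ring

lemma CycChar.repCont_one (T : CycChar p N G) (hN : 1 ≤ N) (n : ℕ) :
    RepCont (charRep (T.one hN n)) p := by
  intro s
  obtain ⟨K, hK⟩ := T.exists_openSubgroup n 1
  refine ⟨K, fun g hg m => ⟨0, ?_⟩⟩
  obtain ⟨b, hb⟩ := hK g hg
  change cycOne p hN ((T.χ ^ n) g : CycRing p N) * m = _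
  rw [hb, map_add, map_one, map_mul, map_pow, map_natCast, pow_one, CharP.cast_eq_zero]
  simp

/-- The surjectivity on cohomology is unwound into a statement on cocycles, and `ZMod (p ^ 1)` is
exchanged for `ZMod p`. -/
lemma IsCyclotomicPair.cocyclesLift {ν : ℕ} {e : ℕ∞} {T : CycChar p (e + 1) G}
    (hT : IsCyclotomicPair (ν + 1) e T) (H : Subgroup G) (hH : IsOpen (H : Set G)) :
    CocyclesLift p (cycOne p (N := e + 1) le_add_self) ((T.χ ^ (ν + 1)).comp H.subtype)
      ((T.one le_add_self (ν + 1)).comp H.subtype) ν := by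
  intro y hy
  let ε : ZMod (p ^ 1) ≃+* ZMod p := ZMod.ringEquivCongr (pow_one p)
  let ρ' : Representation ℤ H (ZMod (p ^ 1)) :=
    charRep (((T.mod 1 (by simp)) ^ (ν + 1)).comp H.subtype)
  have hε : ∀ (g : H) (x : ZMod (p ^ 1)), ε (ρ' g x) =
      charRep ((T.one le_add_self (ν + 1)).comp H.subtype) g (ε x) := by
    intro g x
    simp [ρ', charRep, CycChar.mod, CycChar.one, cycOne, ε]
  have hε' : ∀ (g : H) (x : ZMod p), ε.symm
      (charRep ((T.one le_add_self (ν + 1)).comp H.subtype) g x) = ρ' g (ε.symm x) := by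
    intro g x
    rw [RingEquiv.symm_apply_eq, hε, RingEquiv.apply_symm_apply]
  let y' : contCocycles p ρ' (ν + 1) := ⟨cochainMap H (ε.symm : ZMod p →+ ZMod (p ^ 1)) _ y,
    cochainMap_mem p _ hy.1, by
      change coboundary ρ' _ _ = 0
      rw [← cochainMap_coboundary (ε.symm : ZMod p →+ ZMod (p ^ 1)) hε',
        show coboundary _ _ y = 0 from hy.2, map_zero]⟩
  obtain ⟨Yq, hYq⟩ := hT H hH (QuotientAddGroup.mk y')
  obtain ⟨Y, rfl⟩ := QuotientAddGroup.mk_surjective Yq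
  have h1 := QuotientAddGroup.eq.1 hYq.symm
  rw [AddSubgroup.mem_addSubgroupOf] at h1
  obtain ⟨b, hb, hbY⟩ := h1
  refine ⟨Y, Y.2, cochainMap H (ε : ZMod (p ^ 1) →+ ZMod p) _ b, cochainMap_mem p _ hb, fun x => ?_⟩
  have h2 := cochainMap_coboundary (ε : ZMod (p ^ 1) →+ ZMod p) hε b
  have h3 := congrFun hbY x
  have h4 : cycRed p 1 (by simp) (Y.1 x) = ε.symm (y x) + coboundary ρ' ν b x := by
    rw [h3]
    change _ = ε.symm (y x) + (-(ε.symm (y x)) + cycRed p 1 (by simp) (Y.1 x))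
    abel
  change ε (cycRed p 1 (by simp) (Y.1 x)) = _
  rw [h4, map_add, RingEquiv.apply_symm_apply, ← h2]
  rfl

end Cyclotomic

/-! ### From finite representations to functions on the dual. -/

section Dual

variable {p : ℕ} [Fact p.Prime] {G : Type w} [Group G]
  {V : Type*} [AddCommGroup V] [Module (ZMod p) V] (τ : Representation (ZMod p) G V)

/-- The action on the dual of a representation. -/
@[reducible] def dualAction : MulAction G (V →ₗ[ZMod p] ZMod p) where
  smul g φ := φ ∘ₗ τ g⁻¹
  one_smul φ := by
    change φ ∘ₗ τ 1⁻¹ = φ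
    rw [inv_one, map_one]
    rfl
  mul_smul g h φ := by
    change φ ∘ₗ τ (g * h)⁻¹ = (φ ∘ₗ τ h⁻¹) ∘ₗ τ g⁻¹
    rw [mul_inv_rev, map_mul]
    rfl

/-- Functions on the dual of a representation, on which `G` acts through a character. -/
def dualRep {R : Type*} [CommRing R] (ψ : G →* Rˣ) :
    Representation ℤ G ((V →ₗ[ZMod p] ZMod p) → R) :=
  letI := dualAction τ
  permRep ψ _

lemma dualRep_apply {R : Type*} [CommRing R] (ψ : G →* Rˣ) (g : G)
    (F : (V →ₗ[ZMod p] ZMod p) → R) (φ : V →ₗ[ZMod p] ZMod p) :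
    dualRep τ ψ g F φ = (ψ g : R) * F (φ ∘ₗ τ g) := by
  change (ψ g : R) * F (φ ∘ₗ τ g⁻¹⁻¹) = _
  rw [inv_inv]

variable [TopologicalSpace G] [IsTopologicalGroup G]

/-- A cocycle with values in a finite representation over `𝔽_p` gives rise to a cocycle with values
in functions on the dual, which lifts to characteristic zero if `G` is cyclotomic. -/
theorem IsCyclotomicPair.exists_dual_lift {ν : ℕ} {e : ℕ∞} {T : CycChar p (e + 1) G}
    (hT : IsCyclotomicPair (ν + 1) e T) [Finite V]
    (hτ : ∃ K : OpenSubgroup G, ∀ g ∈ K, τ g = 1) {ρ : Representation ℤ G V}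
    (hρ : ∀ g v, ρ g v = (T.one le_add_self (ν + 1) g : ZMod p) • τ g v)
    {c : (Fin (ν + 1) → G) → V} (hc : IsLocallyConstant c) (hc0 : coboundary ρ (ν + 1) c = 0) :
    ∃ C : (Fin (ν + 1) → G) → (V →ₗ[ZMod p] ZMod p) → CycRing p (e + 1), PadicCont p C ∧
      coboundary (dualRep τ (T.χ ^ (ν + 1))) (ν + 1) C = 0 ∧
      ∃ b : (Fin ν → G) → (V →ₗ[ZMod p] ZMod p) → ZMod p, IsLocallyConstant b ∧
        ∀ x φ, cycOne p le_add_self (C x φ) =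
          φ (c x) + coboundary (dualRep τ (T.one le_add_self (ν + 1))) ν b x φ := by
  let _ := dualAction τ
  have : Finite (V →ₗ[ZMod p] ZMod p) := DFunLike.finite _
  -- Evaluation at vectors maps `V`, with its twisted action, equivariantly to a permutation module,
  -- to which `exists_permRep_lift` applies.
  let ev : V →+ ((V →ₗ[ZMod p] ZMod p) → ZMod p) :=
    { toFun := fun v φ => φ v
      map_zero' := funext fun φ => map_zero φ
      map_add' := fun v w => funext fun φ => map_add φ v w }
  have hev : ∀ g v, ev (ρ g v) = dualRep τ (T.one le_add_self (ν + 1)) g (ev v) := by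
    intro g v
    ext φ
    rw [dualRep_apply, hρ]
    exact map_smul φ _ _
  obtain ⟨K, hK⟩ := hτ
  obtain ⟨C, hC, b, hb, h⟩ := exists_permRep_lift (f := cycOne p (N := e + 1) le_add_self)
    (ψ := T.χ ^ (ν + 1)) (ψ' := T.one le_add_self (ν + 1)) (fun g => rfl) (T.repCont_one _ _)
    (T.repCont _) (fun H hH => hT.cocyclesLift H hH) (Z := V →ₗ[ZMod p] ZMod p)
    (fun φ => Subgroup.isOpen_mono (H₁ := K.toSubgroup) (fun g hg => by
      change φ ∘ₗ τ g⁻¹ = φ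
      rw [hK _ (K.inv_mem hg)]
      rfl) K.isOpen')
    (c := cochainMap G ev _ c) ⟨padicCont_of_isLocallyConstant (hc.comp ev), by
      change coboundary (dualRep τ (T.one le_add_self (ν + 1))) _ _ = 0
      rw [← cochainMap_coboundary ev hev, hc0, map_zero]⟩
  refine ⟨C, hC.1, hC.2, b, PadicCont.isLocallyConstant (p := p) hb (s := 1) fun m => ?_, h⟩
  ext φ
  simp

end Dual

/-! ### Frobenius pullbacks of cocycles, through permutation modules. -/

section FrobeniusLift

variable {p : ℕ} [Fact p.Prime] {G : Type w} [Group G] [TopologicalSpace G] [IsTopologicalGroup G]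

/-- The permutation-module form of the Frobenius pullback of a cocycle with values in a ring of
characteristic `p`: it is, up to a coboundary, a combination of products of its values, with
coefficients in a cocycle that lifts to characteristic zero. -/
theorem IsCyclotomicPair.exists_perm_cocycle [CompactSpace G] {ν : ℕ} {e : ℕ∞}
    {T : CycChar p (e + 1) G} (hT : IsCyclotomicPair (ν + 1) e T)
    {R : Type u} [CommRing R] [Algebra (ZMod p) R] (act : G →* (R →+* R))
    {ρ : Representation ℤ G R}
    (hρ : ∀ g a, ρ g a = (T.one le_add_self (ν + 1) g : ZMod p) • act g a)
    {c : (Fin (ν + 1) → G) → R} (hc : IsLocallyConstant c)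
    (hnaive : ∃ K : OpenSubgroup G, ∀ g ∈ K, ∀ x, act g (c x) = c x)
    (hc0 : coboundary ρ (ν + 1) c = 0) :
    ∃ (Φ : Type u) (_ : Fintype Φ) (_ : MulAction G Φ) (t : Φ → R) (m : ℕ),
      (∀ g φ, act g (t φ) = t (g • φ)) ∧
      (∀ φ, t φ = 0 ∨ ∃ x : Fin (p ^ m) → R,
        (∀ i, x i ∈ AddSubgroup.closure {a | ∃ g y, act g (c y) = a}) ∧ t φ = ∏ i, x i) ∧
      ∃ C : (Fin (ν + 1) → G) → Φ → CycRing p (e + 1), PadicCont p C ∧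
        coboundary (permRep (T.χ ^ (ν + 1)) Φ) (ν + 1) C = 0 ∧
        ∃ b : (Fin ν → G) → Φ → ZMod p, IsLocallyConstant b ∧
          ∀ x, ∑ φ, cycOne p le_add_self (C x φ) • t φ = c x ^ p ^ m +
            ∑ φ, coboundary (permRep (T.one le_add_self (ν + 1)) Φ) ν b x φ • t φ := by
  classical
  obtain ⟨K, hK⟩ := hnaive
  -- By compactness `c` has finitely many values and the open subgroup fixing them has finite index,
  -- so `S` is finite; its span `V` is a finite `𝔽_p`-vector space stable under `G`.
  set S : Set R := {a | ∃ g y, act g (c y) = a} with hS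
  have hSfin : S.Finite := by
    have h1 : Finite (G ⧸ K.toSubgroup) := Subgroup.quotient_finite_of_isOpen _ K.isOpen'
    refine ((hc.range_finite.prod (Set.finite_univ (α := G ⧸ K.toSubgroup))).image
      fun q => act q.2.out q.1).subset ?_
    rintro a ⟨g, y, rfl⟩
    refine ⟨(c y, (g : G ⧸ K.toSubgroup)), ⟨⟨y, rfl⟩, trivial⟩, ?_⟩
    obtain ⟨k, hk⟩ := QuotientGroup.mk_out_eq_mul K.toSubgroup g
    change act (QuotientGroup.mk g : G ⧸ K.toSubgroup).out (c y) = _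
    rw [hk, map_mul]
    exact congrArg (act g) (hK k k.2 y)
  let V : Submodule (ZMod p) R := Submodule.span (ZMod p) S
  have hVfin : Module.Finite (ZMod p) V := Module.Finite.span_of_finite _ hSfin
  have hVfin' : Finite V := Module.finite_of_finite (ZMod p)
  have : Fintype V := Fintype.ofFinite V
  let actL : G → (R →ₗ[ZMod p] R) := fun g => (act g).toAddMonoidHom.toZModLinearMap p
  have hactV : ∀ g, ∀ v ∈ V, actL g v ∈ V := by
    intro g v hv
    have : V ≤ V.comap (actL g) := Submodule.span_le.2 (by
      rintro a ⟨h, y, rfl⟩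
      refine Submodule.subset_span ⟨g * h, y, ?_⟩
      rw [map_mul]
      rfl)
    exact this hv
  let τ : Representation (ZMod p) G V :=
    { toFun := fun g => (actL g).restrict (hactV g)
      map_one' := by
        ext v
        change act 1 v = v
        rw [map_one]
        rfl
      map_mul' := fun g h => by
        ext v
        change act (g * h) v = act g (act h v)
        rw [map_mul]
        rfl }
  have hτ : ∃ K : OpenSubgroup G, ∀ g ∈ K, τ g = 1 := by
    have hst : ∀ s : S, ∃ U : OpenSubgroup G, ∀ g ∈ U, act g s = s := by
      rintro ⟨_, h, y, rfl⟩
      -- The stabilizer of the translate of a value by `h` contains the conjugate `h K h⁻¹`.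
      refine ⟨K.comap (MulAut.conj h⁻¹).toMonoidHom (by
        change Continuous fun g => h⁻¹ * g * h⁻¹⁻¹
        fun_prop), fun g hg => ?_⟩
      have h1 : act (h⁻¹ * g * h⁻¹⁻¹) (c y) = c y := hK _ hg y
      have h2 := congrArg (act h) h1
      have h3 : ∀ g' a, act h (act g' a) = act (h * g') a := fun g' a => by
        rw [map_mul]
        rfl
      have h4 : act g (act h (c y)) = act (g * h) (c y) := by
        rw [map_mul]
        rfl
      rw [h3] at h2
      refine h4.trans (Eq.trans ?_ h2)
      congr 2
      group
    choose U hU using hst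
    have := hSfin.to_subtype
    refine ⟨⟨⨅ s : S, (U s).toSubgroup, by
      change IsOpen ((⨅ s : S, (U s).toSubgroup : Subgroup G) : Set G)
      rw [Subgroup.coe_iInf]
      exact isOpen_iInter_of_finite fun s => (U s).isOpen'⟩, fun g hg => ?_⟩
    have h1 : V ≤ LinearMap.eqLocus (actL g) LinearMap.id := Submodule.span_le.2 fun s hs =>
      hU ⟨s, hs⟩ g (Subgroup.mem_iInf.1 hg ⟨s, hs⟩)
    ext v
    exact h1 v.2
  let ρV : Representation ℤ G V :=
    { toFun := fun g => ((T.one le_add_self (ν + 1) g : ZMod p) • τ g).toAddMonoidHom.toIntLinearMap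
      map_one' := by
        ext v
        simp
      map_mul' := fun g h => by
        ext v
        simp [mul_smul]
        rw [smul_comm] }
  have hρV : ∀ g v, ρV g v = (T.one le_add_self (ν + 1) g : ZMod p) • τ g v := fun g v => rfl
  have hcV : ∀ x, c x ∈ V := fun x => Submodule.subset_span ⟨1, x, by rw [map_one]; rfl⟩
  let cV : (Fin (ν + 1) → G) → V := fun x => ⟨c x, hcV x⟩
  have hcVl : IsLocallyConstant cV := by
    rw [IsLocallyConstant.iff_eventually_eq] at hc ⊢
    intro x
    filter_upwards [hc x] with y hy
    exact Subtype.ext hy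
  have hcV0 : coboundary ρV (ν + 1) cV = 0 := by
    have h1 := cochainMap_coboundary (ρ := ρV) (ρ' := ρ) V.subtype.toAddMonoidHom
      (fun g v => (hρ g v).symm) cV
    ext x
    have h2 := congrFun (h1.trans hc0) x
    exact h2
  obtain ⟨C, hC, hC0, b, hb, hCb⟩ := hT.exists_dual_lift τ hτ hρV hcVl hcV0
  have : Finite (V →ₗ[ZMod p] ZMod p) := DFunLike.finite _
  have : Fintype (V →ₗ[ZMod p] ZMod p) := Fintype.ofFinite _
  obtain ⟨m, hm1, hm2⟩ := exists_sum_smul_prod_eq_pow.{u} (p := p) (V := V)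
  let t : (V →ₗ[ZMod p] ZMod p) → R := fun φ => if φ = 0 then 0 else ∏ v : {v // φ v = 1}, (v : V)
  have hsum : ∀ v : V, ∑ φ : V →ₗ[ZMod p] ZMod p, φ v • t φ = -(v : R) ^ p ^ m :=
    fun v => hm2 V.subtype v
  let _ := dualAction τ
  have hdual : ∀ {n : ℕ} {A : Type _} [CommRing A] (ψ : G →* Aˣ) (F : (Fin n → G) → _ → A),
    coboundary (permRep ψ (V →ₗ[ZMod p] ZMod p)) n (-F) =
      -coboundary (dualRep τ ψ) n F := fun ψ F => map_neg _ F
  -- The signs on `C` and `b` compensate for the minus sign in the hyperplane formula.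
  refine ⟨V →ₗ[ZMod p] ZMod p, inferInstance, dualAction τ, t, m, fun g φ => ?_, fun φ => ?_,
    -C, ?_, ?_, -b, ?_, fun x => ?_⟩
  · change _ = t (φ ∘ₗ τ g⁻¹)
    have hinv : ∀ v, τ g⁻¹ (τ g v) = v := fun v => by
      rw [← Module.End.mul_apply, ← map_mul, inv_mul_cancel, map_one]
      rfl
    have hinv' : ∀ v, τ g (τ g⁻¹ v) = v := fun v => by
      rw [← Module.End.mul_apply, ← map_mul, mul_inv_cancel, map_one]
      rfl
    have h0 : φ ∘ₗ τ g⁻¹ = 0 ↔ φ = 0 := by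
      constructor
      · intro h
        ext v
        rw [← hinv v]
        exact LinearMap.congr_fun h (τ g v)
      · rintro rfl
        rfl
    simp only [t, h0]
    split_ifs with h
    · exact map_zero _
    · rw [map_prod]
      let eq : {v // φ v = 1} ≃ {v // (φ ∘ₗ τ g⁻¹) v = 1} :=
        { toFun := fun v => ⟨τ g v, by
            change φ (τ g⁻¹ (τ g v)) = 1
            rw [hinv, v.2]⟩
          invFun := fun v => ⟨τ g⁻¹ v, v.2⟩
          left_inv := fun v => Subtype.ext (hinv v)
          right_inv := fun v => Subtype.ext (hinv' v) }
      exact Fintype.prod_equiv eq _ _ fun v => rfl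
  · by_cases h : φ = 0
    · exact Or.inl (if_pos h)
    · right
      let eq := (Fintype.equivFinOfCardEq (hm1 φ h)).symm
      refine ⟨fun i => ((eq i : {v // φ v = 1}) : V), fun i => ?_, ?_⟩
      · have h1 : (((eq i : {v // φ v = 1}) : V) : R) ∈ V := ((eq i : {v // φ v = 1}) : V).2
        -- Scalars of `𝔽_p` act as natural numbers, so the span is the additive closure. Later on,
        -- the factors of `t φ` are then controlled by additive subgroups only.
        have h2 : ∀ a ∈ V, a ∈ AddSubgroup.closure S := by
          intro a ha
          induction ha using Submodule.span_induction with
          | mem x h => exact AddSubgroup.subset_closure h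
          | zero => exact zero_mem _
          | add x y _ _ hx hy => exact add_mem hx hy
          | smul z x _ hx =>
            rw [← ZMod.natCast_zmod_val z, Nat.cast_smul_eq_nsmul]
            exact nsmul_mem hx _
        exact h2 _ h1
      · simp only [t, if_neg h]
        exact (Equiv.prod_comp eq fun v : {v // φ v = 1} => ((v : V) : R)).symm
  · exact (contCochains p G _ (ν + 1)).neg_mem hC
  · rw [hdual, hC0, neg_zero]
  · exact hb.comp Neg.neg
  · have h1 : ∀ φ, cycOne p le_add_self ((-C) x φ) • t φ =
        -(φ (cV x) • t φ) + coboundary (permRep (T.one le_add_self (ν + 1)) (V →ₗ[ZMod p] ZMod p)) ν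
          (-b) x φ • t φ := by
      intro φ
      rw [hdual, Pi.neg_apply, Pi.neg_apply, Pi.neg_apply, Pi.neg_apply, map_neg, hCb, neg_smul,
        add_smul, neg_add, neg_smul]
    rw [Finset.sum_congr rfl fun φ _ => h1 φ, Finset.sum_add_distrib, Finset.sum_neg_distrib, hsum,
      neg_neg]

end FrobeniusLift

/-! ### Operations on truncated Witt vectors -/

section TruncatedWitt

variable {p : ℕ} [Fact p.Prime] {R : Type u} [CommRing R] {R' : Type v} [CommRing R']

/-- The ring homomorphism `ℤ/N → W`, for a ring `W` in which `N = 0`. -/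
def zmodHom {N : ℕ} {W : Type*} [CommRing W] (h : (N : W) = 0) : ZMod N →+* W :=
  ZMod.castHom (ringChar.dvd h) W

lemma zmodHom_mul {N : ℕ} [NeZero N] {W : Type*} [CommRing W] (h : (N : W) = 0) (a : ZMod N) (w : W) :
    zmodHom h a * w = a.val • w := by
  rw [nsmul_eq_mul]
  congr 1
  conv_lhs => rw [← ZMod.natCast_zmod_val a]
  rw [map_natCast]

/-- The first component of a truncated Witt vector. -/
def coeffZero (p s : ℕ) [Fact p.Prime] (R : Type u) [CommRing R] :
    TruncatedWittVector p (s + 1) R →+* R where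
  toFun x := x.coeff 0
  map_one' := by
    rw [← map_one (WittVector.truncate (p := p) (R := R) (s + 1)), WittVector.coeff_truncate]
    exact WittVector.one_coeff_zero p R
  map_mul' x y := by
    obtain ⟨x, rfl⟩ := WittVector.truncate_surjective p (s + 1) R x
    obtain ⟨y, rfl⟩ := WittVector.truncate_surjective p (s + 1) R y
    rw [← map_mul]
    simp only [WittVector.coeff_truncate]
    exact WittVector.mul_coeff_zero x y
  map_zero' := by simp
  map_add' x y := by
    obtain ⟨x, rfl⟩ := WittVector.truncate_surjective p (s + 1) R x
    obtain ⟨y, rfl⟩ := WittVector.truncate_surjective p (s + 1) R y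
    rw [← map_add]
    simp only [WittVector.coeff_truncate]
    exact WittVector.add_coeff_zero x y

lemma coeffZero_teich (s : ℕ) (a : R) : coeffZero p s R (teich p (s + 1) a) = a := by
  change (WittVector.truncate (s + 1) (WittVector.teichmuller p a)).coeff 0 = a
  rw [WittVector.coeff_truncate]
  exact WittVector.teichmuller_coeff_zero p a

lemma coeffZero_wittMap (s : ℕ) (f : R →+* R') (x : TruncatedWittVector p (s + 1) R) :
    coeffZero p s R' (wittMap p (s + 1) f x) = f (coeffZero p s R x) :=
  coeff_wittMap f x 0

lemma coeffZero_injective : Function.Injective (coeffZero p 0 R) := fun x y h =>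
  TruncatedWittVector.ext fun i => by
    rw [Fin.fin_one_eq_zero i]
    exact h

/-- In length one, Witt vectors are the ring itself and the Teichmüller map is its identification,
hence additive. -/
lemma teich_coeffZero (x : TruncatedWittVector p 1 R) : teich p 1 (coeffZero p 0 R x) = x :=
  coeffZero_injective (coeffZero_teich 0 _)

lemma teich_one_add (a b : R) : teich p 1 (a + b) = teich p 1 a + teich p 1 b :=
  coeffZero_injective (by rw [coeffZero_teich, map_add, coeffZero_teich, coeffZero_teich])

lemma teich_one_neg (a : R) : teich p 1 (-a) = -teich p 1 a :=
  coeffZero_injective (by rw [coeffZero_teich, map_neg, coeffZero_teich])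

lemma teich_zero (s : ℕ) : teich p s (0 : R) = 0 := by
  change WittVector.truncate s (WittVector.teichmuller p (0 : R)) = 0
  rw [WittVector.teichmuller_zero, map_zero]

lemma truncate_teich {t s : ℕ} (h : t ≤ s) (a : R) :
    TruncatedWittVector.truncate h (teich p s a) = teich p t a :=
  TruncatedWittVector.truncate_wittVector_truncate h (WittVector.teichmuller p a)

instance : Subsingleton (TruncatedWittVector p 0 R) :=
  ⟨fun _ _ => TruncatedWittVector.ext fun i => i.elim0⟩

/-- The Verschiebung on truncated Witt vectors. -/
def tV (p s : ℕ) [Fact p.Prime] (R : Type u) [CommRing R] :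
    TruncatedWittVector p s R →+ TruncatedWittVector p (s + 1) R :=
  -- The Verschiebung shifts components by one, so its first `s + 1` components depend only on the
  -- first `s` of the argument, and any lift of a truncated vector may be used.
  have key : ∀ x : WittVector p R,
      WittVector.truncate (s + 1) (WittVector.verschiebung (WittVector.truncate s x).out) =
        WittVector.truncate (s + 1) (WittVector.verschiebung x) := fun x => by
    ext i
    rw [WittVector.coeff_truncate, WittVector.coeff_truncate]
    refine Fin.cases ?_ (fun j => ?_) i
    · exact (WittVector.verschiebung_coeff_zero _).trans (WittVector.verschiebung_coeff_zero _).symm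
    · refine (WittVector.verschiebung_coeff_succ _ j).trans
        (Eq.trans ?_ (WittVector.verschiebung_coeff_succ _ j).symm)
      rw [TruncatedWittVector.coeff_out, WittVector.coeff_truncate]
  { toFun := fun x => WittVector.truncate (s + 1) (WittVector.verschiebung x.out)
    map_zero' := by
      rw [← map_zero (WittVector.truncate (p := p) (R := R) s), key, map_zero, map_zero]
    map_add' := fun x y => by
      obtain ⟨x, rfl⟩ := WittVector.truncate_surjective p s R x
      obtain ⟨y, rfl⟩ := WittVector.truncate_surjective p s R y
      rw [← map_add, key, key, key, map_add, map_add] }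

@[simp] lemma coeff_tV_zero (s : ℕ) (x : TruncatedWittVector p s R) :
    (tV p s R x).coeff 0 = 0 := by
  change (WittVector.truncate (s + 1) (WittVector.verschiebung x.out)).coeff 0 = 0
  rw [WittVector.coeff_truncate]
  exact WittVector.verschiebung_coeff_zero _

@[simp] lemma coeff_tV_succ (s : ℕ) (x : TruncatedWittVector p s R) (i : Fin s) :
    (tV p s R x).coeff i.succ = x.coeff i := by
  change (WittVector.truncate (s + 1) (WittVector.verschiebung x.out)).coeff i.succ = _
  rw [WittVector.coeff_truncate]
  exact (WittVector.verschiebung_coeff_succ _ _).trans (TruncatedWittVector.coeff_out _ _)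

lemma tV_truncate (s : ℕ) (x : WittVector p R) :
    tV p s R (WittVector.truncate s x) = WittVector.truncate (s + 1) (WittVector.verschiebung x) := by
  ext i
  refine Fin.cases ?_ (fun j => ?_) i
  · rw [coeff_tV_zero, WittVector.coeff_truncate]
    exact (WittVector.verschiebung_coeff_zero _).symm
  · rw [coeff_tV_succ, WittVector.coeff_truncate, WittVector.coeff_truncate]
    exact (WittVector.verschiebung_coeff_succ _ _).symm

lemma tV_injective (s : ℕ) : Function.Injective (tV p s R) := fun x y h =>
  TruncatedWittVector.ext fun i => by rw [← coeff_tV_succ, h, coeff_tV_succ]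

lemma exists_tV_eq {s : ℕ} {x : TruncatedWittVector p (s + 1) R} (h : coeffZero p s R x = 0) :
    ∃ y, tV p s R y = x := by
  refine ⟨TruncatedWittVector.mk p fun i => x.coeff i.succ, TruncatedWittVector.ext fun i => ?_⟩
  refine Fin.cases ?_ (fun j => ?_) i
  · rw [coeff_tV_zero]
    exact h.symm
  · rw [coeff_tV_succ, TruncatedWittVector.coeff_mk]

lemma wittMap_tV (s : ℕ) (f : R →+* R') (x : TruncatedWittVector p s R) :
    wittMap p (s + 1) f (tV p s R x) = tV p s R' (wittMap p s f x) := by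
  ext i
  refine Fin.cases ?_ (fun j => ?_) i <;> simp

lemma truncate_tV {t s : ℕ} (h : t ≤ s) (x : TruncatedWittVector p s R) :
    TruncatedWittVector.truncate (Nat.succ_le_succ h) (tV p s R x) =
      tV p t R (TruncatedWittVector.truncate h x) := by
  ext i
  refine Fin.cases ?_ (fun j => ?_) i
  · rw [TruncatedWittVector.coeff_truncate, coeff_tV_zero]
    exact coeff_tV_zero s x
  · rw [TruncatedWittVector.coeff_truncate, coeff_tV_succ, TruncatedWittVector.coeff_truncate]
    exact coeff_tV_succ s x (Fin.castLE h j)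

lemma coeffZero_truncate {t s : ℕ} (h : t ≤ s) (x : TruncatedWittVector p (s + 1) R) :
    coeffZero p t R (TruncatedWittVector.truncate (Nat.succ_le_succ h) x) = coeffZero p s R x :=
  TruncatedWittVector.coeff_truncate (Nat.succ_le_succ h) 0 x

lemma wittMap_comp {R'' : Type*} [CommRing R''] (s : ℕ) (f : R →+* R') (f' : R' →+* R'')
    (x : TruncatedWittVector p s R) :
    wittMap p s f' (wittMap p s f x) = wittMap p s (f'.comp f) x := by
  ext i
  simp

lemma wittMap_id (s : ℕ) (x : TruncatedWittVector p s R) : wittMap p s (RingHom.id R) x = x := by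
  ext i
  simp

lemma wittMap_injective (s : ℕ) {f : R →+* R'} (hf : Function.Injective f) :
    Function.Injective (wittMap p s f) := fun x y h => TruncatedWittVector.ext fun i => hf (by
      rw [← coeff_wittMap, h, coeff_wittMap])

/-- The projection formula for the Verschiebung. -/
lemma mul_tV (s : ℕ) (h : (p : R) = 0) (y : TruncatedWittVector p (s + 1) R)
    (x : TruncatedWittVector p s R) :
    y * tV p s R x =
      tV p s R (wittMap p s (frob 1 h) (TruncatedWittVector.truncate s.le_succ y) * x) := by
  rcases subsingleton_or_nontrivial R with hR | hR
  · ext i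
    exact Subsingleton.elim _ _
  have := charP_of_natCast_eq_zero h
  obtain ⟨x, rfl⟩ := WittVector.truncate_surjective p s R x
  obtain ⟨y, rfl⟩ := WittVector.truncate_surjective p (s + 1) R y
  -- In characteristic `p`, the Witt vector Frobenius raises the components to the `p`-th power.
  -- This reduces the formula to `V(x F(y)) = V(x) y`.
  have e : WittVector.map (frob 1 h) y = WittVector.frobenius y := by
    ext i
    rw [WittVector.map_coeff, WittVector.coeff_frobenius_charP]
    change y.coeff i ^ p ^ 1 = _
    rw [pow_one]
  rw [TruncatedWittVector.truncate_wittVector_truncate, wittMap_truncate, e, ← map_mul, tV_truncate,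
    tV_truncate, ← map_mul, mul_comm (WittVector.frobenius y), WittVector.verschiebung_mul_frobenius,
    mul_comm y]

lemma pow_smul_truncated (h : (p : R) = 0) (s : ℕ) (x : TruncatedWittVector p s R) :
    p ^ s • x = 0 := by
  rw [nsmul_eq_mul, Nat.cast_pow, truncated_natCast_pow h, zero_mul]

lemma frob_frob (h : (p : R) = 0) (m m' : ℕ) (s : ℕ) (x : TruncatedWittVector p s R) :
    wittMap p s (frob m' h) (wittMap p s (frob m h) x) = wittMap p s (frob (m + m') h) x := by
  ext i
  rw [coeff_wittMap, coeff_wittMap, coeff_wittMap]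
  change (x.coeff i ^ p ^ m) ^ p ^ m' = x.coeff i ^ p ^ (m + m')
  rw [← pow_mul, pow_add]

end TruncatedWitt

/-! ### Lifting cocycles with values in graded pieces of Witt vectors -/

/-- A ring `R` of characteristic `p` with an action of `G`, together with `G`-stable subgroups
`N s k` of `W_s(R)`, which behave like the sections of the Teichmüller lifts of the powers `L^{⊗ k}`
of a line bundle. -/
structure WittWeights (p : ℕ) [Fact p.Prime] (G : Type w) [Group G] [TopologicalSpace G]
    (R : Type u) [CommRing R] where
  char : (p : R) = 0
  act : G →* (R →+* R)
  N : ∀ s : ℕ, ℕ → AddSubgroup (TruncatedWittVector p s R)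
  trunc_mem : ∀ {t s : ℕ} (h : t ≤ s) {k : ℕ} {x}, x ∈ N s k →
    TruncatedWittVector.truncate h x ∈ N t k
  frob_mem : ∀ {s k : ℕ} (m : ℕ) {x}, x ∈ N s k → wittMap p s (frob m char) x ∈ N s (k * p ^ m)
  tV_mem : ∀ {s k : ℕ} {x}, tV p s R x ∈ N (s + 1) k ↔ x ∈ N s (k * p)
  teich_mem : ∀ (s : ℕ) {k m : ℕ} (x : Fin (p ^ m) → R), (∀ i, teich p 1 (x i) ∈ N 1 k) →
    teich p s (∏ i, x i) ∈ N s (k * p ^ m)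
  act_mem : ∀ (g : G) {s k : ℕ} {x}, x ∈ N s k → wittMap p s (act g) x ∈ N s k
  naive : ∀ s k : ℕ, ∃ K : OpenSubgroup G, ∀ g ∈ K, ∀ x ∈ N s k, wittMap p s (act g) x = x

/-! ### Linear combinations of a family of elements permuted by the group. -/

section PermSum

variable {G : Type w} [Group G] [TopologicalSpace G] [IsTopologicalGroup G] {A : Type*} {W : Type*} [CommRing A] [CommRing W]

/-- Combinations of a finite family of elements permuted by `G`, as a function of the coefficients. -/
def permSum {Φ : Type*} [Fintype Φ] (κ : A →+* W) (t : Φ → W) : (Φ → A) →+ W where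
  toFun F := ∑ φ, κ (F φ) * t φ
  map_zero' := by simp
  map_add' F F' := by simp [add_mul, Finset.sum_add_distrib]

lemma permSum_apply {Φ : Type*} [Fintype Φ] (κ : A →+* W) (t : Φ → W) (F : Φ → A) :
    permSum κ t F = ∑ φ, κ (F φ) * t φ :=
  rfl

lemma permSum_permRep {Φ : Type*} [Fintype Φ] [MulAction G Φ] (κ : A →+* W) (ψ : G →* Aˣ)
    (t : Φ → W) (σ : W →+* W) (hσκ : ∀ a, σ (κ a) = κ a) (g : G)
    (hσt : ∀ φ, σ (t φ) = t (g • φ)) (F : Φ → A) :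
    permSum κ t (permRep ψ Φ g F) = κ (ψ g) * σ (permSum κ t F) := by
  rw [permSum_apply, permSum_apply, map_sum, Finset.mul_sum]
  refine (Fintype.sum_equiv (MulAction.toPerm g) _ _ fun φ => ?_).symm
  rw [permRep_apply, MulAction.toPerm_apply, inv_smul_smul, map_mul, map_mul, hσκ, hσt, mul_assoc]

lemma permSum_padicCont {X : Type*} [TopologicalSpace X] {Φ : Type*} [Fintype Φ] {p : ℕ}
    (κ : A →+* W) (t : Φ → W) {C : X → Φ → A} (hC : PadicCont p C) :
    PadicCont p fun x => permSum κ t (C x) :=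
  hC.map (permSum κ t)

end PermSum

lemma castHom_comp_cycRed {p : ℕ} [Fact p.Prime] {N : ℕ∞} {s : ℕ} (h0 : s ≠ 0) (hs : (s : ℕ∞) ≤ N)
    (hN : 1 ≤ N) :
    (ZMod.castHom (dvd_pow_self p h0) (ZMod p)).comp (cycRed p s hs) = cycOne p hN := by
  rw [cycOne, ← cycRed_compat (Nat.one_le_iff_ne_zero.2 h0) hs, ← RingHom.comp_assoc]
  congr 1
  exact Subsingleton.elim _ _

namespace WittWeights

variable {p : ℕ} [Fact p.Prime] {G : Type w} [Group G] [TopologicalSpace G]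
  {R : Type u} [CommRing R] (P : WittWeights p G R)

/-- The action of `G` on `W_s(R)`, twisted by a character. -/
def rep (s : ℕ) (ψ : G →* (ZMod (p ^ s))ˣ) : Representation ℤ G (TruncatedWittVector p s R) where
  toFun g := ((nsmulAddMonoidHom (ψ g : ZMod (p ^ s)).val).comp
    (wittMap p s (P.act g)).toAddMonoidHom).toIntLinearMap
  map_one' := by
    ext1 x
    change (ψ 1 : ZMod (p ^ s)).val • wittMap p s (P.act 1) x = x
    rw [map_one P.act]
    refine (congrArg _ (wittMap_id s x)).trans ?_
    refine (smul_congr_of_smul_eq_zero (pow_smul_truncated P.char s x) (b := 1) ?_).trans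
      (one_smul _ x)
    rw [natCast_val, map_one, Units.val_one, Nat.cast_one]
  map_mul' g h := by
    ext1 x
    change (ψ (g * h) : ZMod (p ^ s)).val • wittMap p s (P.act (g * h)) x =
      (ψ g : ZMod (p ^ s)).val • wittMap p s (P.act g)
        ((ψ h : ZMod (p ^ s)).val • wittMap p s (P.act h) x)
    rw [map_nsmul, ← mul_smul, wittMap_comp, map_mul P.act]
    refine smul_congr_of_smul_eq_zero (pow_smul_truncated P.char s _) ?_
    rw [Nat.cast_mul, natCast_val, natCast_val, natCast_val, map_mul, Units.val_mul]

lemma rep_apply (s : ℕ) (ψ : G →* (ZMod (p ^ s))ˣ) (g : G) (x : TruncatedWittVector p s R) :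
    P.rep s ψ g x = (ψ g : ZMod (p ^ s)).val • wittMap p s (P.act g) x :=
  rfl

lemma rep_mem {s k : ℕ} (ψ : G →* (ZMod (p ^ s))ˣ) (g : G) {x : TruncatedWittVector p s R}
    (hx : x ∈ P.N s k) : P.rep s ψ g x ∈ P.N s k :=
  nsmul_mem (P.act_mem g hx) _

lemma frob_rep {s : ℕ} (ψ : G →* (ZMod (p ^ s))ˣ) (m : ℕ) (g : G) (x : TruncatedWittVector p s R) :
    wittMap p s (frob m P.char) (P.rep s ψ g x) =
      P.rep s ψ g (wittMap p s (frob m P.char) x) := by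
  rw [rep_apply, rep_apply, map_nsmul, wittMap_frob m P.char P.char]

variable {N : ℕ∞} (T : CycChar p N G) (n : ℕ)

/-- The two characters take values modulo different powers of `p`. As `p^s` kills `W_s(R)`, the
value modulo `p^{s+1}` acts there through its reduction. -/
lemma tV_rep {s : ℕ} (hs : ((s + 1 : ℕ) : ℕ∞) ≤ N) (hs' : (s : ℕ∞) ≤ N) (g : G)
    (x : TruncatedWittVector p s R) :
    tV p s R (P.rep s (T.mod s hs' ^ n) g x) = P.rep (s + 1) (T.mod (s + 1) hs ^ n) g (tV p s R x) := by
  have h : ((T.mod s hs' ^ n) g : ZMod (p ^ s)).val • wittMap p s (P.act g) x =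
      ((T.mod (s + 1) hs ^ n) g : ZMod (p ^ (s + 1))).val • wittMap p s (P.act g) x := by
    refine smul_congr_of_smul_eq_zero (pow_smul_truncated P.char s _) ?_
    rw [natCast_val, T.mod_pow_compat n s.le_succ hs hs' g]
  rw [rep_apply, rep_apply, wittMap_tV, h, map_nsmul]

/-- Locally constant cocycles with values in `N s k`. -/
structure IsCocycle {s : ℕ} (ψ : G →* (ZMod (p ^ s))ˣ) (n k : ℕ)
    (c : (Fin n → G) → TruncatedWittVector p s R) : Prop where
  cont : IsLocallyConstant c
  mem : ∀ x, c x ∈ P.N s k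
  cocycle : coboundary (P.rep s ψ) n c = 0

lemma coboundary_mem {s k : ℕ} (ψ : G →* (ZMod (p ^ s))ˣ) {n : ℕ}
    {c : (Fin n → G) → TruncatedWittVector p s R} (hc : ∀ x, c x ∈ P.N s k) (x : Fin (n + 1) → G) :
    coboundary (P.rep s ψ) n c x ∈ P.N s k :=
  add_mem (P.rep_mem ψ _ (hc _)) (sum_mem fun _ _ => zsmul_mem (hc _) _)

variable {P} in
lemma IsCocycle.frob {s k : ℕ} {ψ : G →* (ZMod (p ^ s))ˣ} {n : ℕ}
    {c : (Fin n → G) → TruncatedWittVector p s R} (hc : P.IsCocycle ψ n k c) (m : ℕ) :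
    P.IsCocycle ψ n (k * p ^ m) fun x => wittMap p s (WittLift.frob m P.char) (c x) := by
  refine ⟨hc.cont.comp _, fun x => P.frob_mem m (hc.mem x), ?_⟩
  have h := cochainMap_coboundary (wittMap p s (WittLift.frob m P.char)).toAddMonoidHom
    (P.frob_rep ψ m) c
  rw [hc.cocycle, map_zero] at h
  exact h.symm

variable {P} in
lemma IsCocycle.add {s k : ℕ} {ψ : G →* (ZMod (p ^ s))ˣ} {n : ℕ}
    {c c' : (Fin n → G) → TruncatedWittVector p s R} (hc : P.IsCocycle ψ n k c)
    (hc' : P.IsCocycle ψ n k c') : P.IsCocycle ψ n k fun x => c x + c' x := by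
  refine ⟨hc.cont.comp₂ hc'.cont (· + ·), fun x => add_mem (hc.mem x) (hc'.mem x), ?_⟩
  refine (map_add (coboundary (P.rep s ψ) n) c c').trans ?_
  rw [hc.cocycle, hc'.cocycle, add_zero]

variable {P} in
lemma IsCocycle.sub {s k : ℕ} {ψ : G →* (ZMod (p ^ s))ˣ} {n : ℕ}
    {c c' : (Fin n → G) → TruncatedWittVector p s R} (hc : P.IsCocycle ψ n k c)
    (hc' : P.IsCocycle ψ n k c') : P.IsCocycle ψ n k fun x => c x - c' x := by
  refine ⟨hc.cont.comp₂ hc'.cont (· - ·), fun x => sub_mem (hc.mem x) (hc'.mem x), ?_⟩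
  refine (map_sub (coboundary (P.rep s ψ) n) c c').trans ?_
  rw [hc.cocycle, hc'.cocycle, sub_zero]

lemma rep_repCont [IsTopologicalGroup G] {s k : ℕ} {ψ : G →* (ZMod (p ^ s))ˣ} (hψ : IsOpen (ψ.ker : Set G)) :
    ∃ K : OpenSubgroup G, ∀ g ∈ K, ∀ x ∈ P.N s k, P.rep s ψ g x = x := by
  obtain ⟨K, hK⟩ := P.naive s k
  refine ⟨K ⊓ ⟨ψ.ker, hψ⟩, fun g hg x hx => ?_⟩
  rw [rep_apply, hK g hg.1 x hx]
  have e : ψ g = 1 := hg.2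
  refine (smul_congr_of_smul_eq_zero (pow_smul_truncated P.char s x) (b := 1) ?_).trans
    (one_smul _ x)
  rw [natCast_val, e, Units.val_one, Nat.cast_one]

/-- The membership hypothesis is essential to the argument: an open subgroup is only known to act
trivially on each `N s k`, not on all Witt vectors. -/
lemma isLocallyConstant_coboundary [IsTopologicalGroup G] {s k : ℕ} {ψ : G →* (ZMod (p ^ s))ˣ}
    (hψ : IsOpen (ψ.ker : Set G)) {n : ℕ} {c : (Fin n → G) → TruncatedWittVector p s R}
    (hcl : IsLocallyConstant c) (hc : ∀ x, c x ∈ P.N s k) :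
    IsLocallyConstant (coboundary (P.rep s ψ) n c) := by
  obtain ⟨K, hK⟩ := P.rep_repCont (k := k) hψ
  rw [IsLocallyConstant.iff_eventually_eq] at hcl ⊢
  intro x
  have h1 : ∀ᶠ y in 𝓝 x, P.rep s ψ (y 0) (c fun i => y i.succ) =
      P.rep s ψ (x 0) (c fun i => x i.succ) := by
    have hy : ∀ᶠ y in 𝓝 x, c (fun i => y i.succ) = c fun i => x i.succ :=
      (show Continuous fun (y : Fin (n + 1) → G) (i : Fin n) => y i.succ by fun_prop).continuousAt.eventually
        (hcl _)
    have hg : ∀ᶠ y in 𝓝 x, (x 0)⁻¹ * y 0 ∈ K :=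
      (show Continuous fun y : Fin (n + 1) → G => (x 0)⁻¹ * y 0 by fun_prop).continuousAt.eventually
        (K.isOpen'.mem_nhds (by simp))
    filter_upwards [hy, hg] with y hy hg
    have e := congrArg (P.rep s ψ (x 0)) (hK _ hg _ (hc fun i => x i.succ))
    rw [← Module.End.mul_apply, ← map_mul, mul_inv_cancel_left] at e
    rw [hy, e]
  have h2 : ∀ j : Fin (n + 1), ∀ᶠ y in 𝓝 x, c (Fin.contractNth j (· * ·) y) =
      c (Fin.contractNth j (· * ·) x) := by
    intro j
    have : Continuous fun y : Fin (n + 1) → G => Fin.contractNth j (· * ·) y := by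
      refine continuous_pi fun i => ?_
      rcases lt_trichotomy (i : ℕ) j with h | h | h
      · simp only [Fin.contractNth_apply_of_lt _ _ _ _ h]
        fun_prop
      · simp only [Fin.contractNth_apply_of_eq _ _ _ _ h]
        fun_prop
      · simp only [Fin.contractNth_apply_of_gt _ _ _ _ h]
        fun_prop
    exact this.continuousAt.eventually (hcl _)
  filter_upwards [h1, Filter.eventually_all.2 h2] with y hy hy'
  simp only [coboundary, AddMonoidHom.coe_mk, ZeroHom.coe_mk, hy, hy']

/-- The step of the induction in the proof of the lifting theorem: after a Frobenius pullback and up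
to a coboundary, the first component of a cocycle lifts. -/
lemma exists_lift_coeffZero [IsTopologicalGroup G] [CompactSpace G] {ν : ℕ} {e : ℕ∞}
    {T : CycChar p (e + 1) G} (hT : IsCyclotomicPair (ν + 1) e T) {r : ℕ}
    (hr : ((r + 1 : ℕ) : ℕ∞) ≤ e + 1) {k : ℕ} {c : (Fin (ν + 1) → G) → TruncatedWittVector p (r + 1) R}
    (hc : P.IsCocycle (T.mod (r + 1) hr ^ (ν + 1)) (ν + 1) k c) :
    ∃ (m : ℕ) (C : ∀ s : ℕ, (s : ℕ∞) ≤ e + 1 → (Fin (ν + 1) → G) → TruncatedWittVector p s R),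
      (∀ s hs, P.IsCocycle (T.mod s hs ^ (ν + 1)) (ν + 1) (k * p ^ m) (C s hs)) ∧
      (∀ t s ht hs (h : t ≤ s) x, TruncatedWittVector.truncate h (C s hs x) = C t ht x) ∧
      ∃ b : (Fin ν → G) → TruncatedWittVector p (r + 1) R, IsLocallyConstant b ∧
        (∀ x, b x ∈ P.N (r + 1) (k * p ^ m)) ∧
        ∀ x, coeffZero p r R (wittMap p (r + 1) (WittLift.frob m P.char) (c x) - C (r + 1) hr x +
          coboundary (P.rep (r + 1) (T.mod (r + 1) hr ^ (ν + 1))) ν b x) = 0 := by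
  let _ : Algebra (ZMod p) R := (zmodHom P.char).toAlgebra
  have hsm : ∀ (z : ZMod p) (a : R), z • a = zmodHom P.char z * a := fun z a => rfl
  let ρ : Representation ℤ G R :=
    { toFun := fun g => ((DistribSMul.toAddMonoidHom R (T.one le_add_self (ν + 1) g : ZMod p)).comp
        (P.act g).toAddMonoidHom).toIntLinearMap
      map_one' := by
        ext1 a
        change (T.one le_add_self (ν + 1) 1 : ZMod p) • P.act 1 a = a
        rw [map_one, map_one, Units.val_one, one_smul]
        rfl
      map_mul' := fun g h => by
        ext1 a
        change (T.one le_add_self (ν + 1) (g * h) : ZMod p) • P.act (g * h) a =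
          (T.one le_add_self (ν + 1) g : ZMod p) • P.act g
            ((T.one le_add_self (ν + 1) h : ZMod p) • P.act h a)
        rw [map_mul, map_mul, hsm, hsm, hsm, map_mul (P.act g), Units.val_mul, map_mul, mul_assoc]
        congr 1
        rw [← RingHom.comp_apply (P.act g), Subsingleton.elim ((P.act g).comp _) (zmodHom P.char)]
        rfl }
  have hρ : ∀ g a, ρ g a = (T.one le_add_self (ν + 1) g : ZMod p) • P.act g a := fun g a => rfl
  have hone : ∀ (g : G), ((((T.mod (r + 1) hr ^ (ν + 1)) g : (ZMod (p ^ (r + 1)))ˣ) :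
      ZMod (p ^ (r + 1))).val : ZMod p) = T.one le_add_self (ν + 1) g := by
    intro g
    rw [ZMod.natCast_val, ← ZMod.castHom_apply (h := dvd_pow_self p r.succ_ne_zero)]
    refine Eq.trans ?_ (RingHom.congr_fun (castHom_comp_cycRed r.succ_ne_zero hr le_add_self)
      ((T.χ ^ (ν + 1)) g : CycRing p (e + 1)))
    simp [CycChar.mod]
  have hcz : ∀ g x, coeffZero p r R (P.rep (r + 1) (T.mod (r + 1) hr ^ (ν + 1)) g x) =
      ρ g (coeffZero p r R x) := by
    intro g x
    rw [rep_apply, map_nsmul, coeffZero_wittMap, hρ, ← hone, Nat.cast_smul_eq_nsmul]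
  have hczb : ∀ {n : ℕ} (c : (Fin n → G) → TruncatedWittVector p (r + 1) R) x,
      coeffZero p r R (coboundary (P.rep (r + 1) (T.mod (r + 1) hr ^ (ν + 1))) n c x) =
      coboundary ρ n (fun y => coeffZero p r R (c y)) x := fun c x =>
    congrFun (cochainMap_coboundary (coeffZero p r R).toAddMonoidHom hcz c) x
  obtain ⟨K, hK⟩ := P.naive (r + 1) k
  obtain ⟨Φ, _, _, t, m, ht, htm, C, hC, hC0, b, hb, hCb⟩ := hT.exists_perm_cocycle P.act hρ
    (c := fun x => coeffZero p r R (c x)) (hc.cont.comp _)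
    ⟨K, fun g hg x => by rw [← coeffZero_wittMap, hK g hg _ (hc.mem x)]⟩ (by
      ext x
      rw [← hczb, hc.cocycle, Pi.zero_apply, map_zero, Pi.zero_apply])
  have hp : ∀ s : ℕ, ((p ^ s : ℕ) : TruncatedWittVector p s R) = 0 := fun s => by
    rw [Nat.cast_pow, truncated_natCast_pow P.char]
  have htN : ∀ s φ, teich p s (t φ) ∈ P.N s (k * p ^ m) := by
    intro s φ
    rcases htm φ with h | ⟨x, hx, h⟩
    · rw [h, teich_zero]
      exact zero_mem _
    · rw [h]
      refine P.teich_mem s x fun i => ?_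
      -- Each factor is a sum of translates of first components of values of `c`, whose length-one
      -- Teichmüller representatives have weight `k`; additivity of `teich p 1` extends this to the
      -- whole closure.
      have hxi := hx i
      generalize x i = a at hxi
      induction hxi using AddSubgroup.closure_induction with
      | mem a ha =>
        obtain ⟨g, y, rfl⟩ := ha
        have h1 := P.act_mem g (P.trunc_mem (Nat.succ_le_succ r.zero_le) (hc.mem y))
        rw [← teich_coeffZero (wittMap p 1 _ _), coeffZero_wittMap, coeffZero_truncate r.zero_le] at h1
        exact h1
      | zero => rw [teich_zero]; exact zero_mem _
      | add a b _ _ ha hb => rw [teich_one_add]; exact add_mem ha hb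
      | neg a _ ha => rw [teich_one_neg]; exact neg_mem ha
  have hκ : ∀ (s : ℕ) (hs : (s : ℕ∞) ≤ e + 1) g a, wittMap p s (P.act g)
      ((zmodHom (hp s)).comp (cycRed p s hs) a) = (zmodHom (hp s)).comp (cycRed p s hs) a := by
    intro s hs g a
    rw [RingHom.comp_apply, ← RingHom.comp_apply (wittMap p s (P.act g)),
      Subsingleton.elim ((wittMap p s (P.act g)).comp _) (zmodHom (hp s))]
  have hσt : ∀ s g φ, wittMap p s (P.act g) (teich p s (t φ)) = teich p s (t (g • φ)) :=
    fun s g φ => by rw [wittMap_teich, ht]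
  have hCN : ∀ (s : ℕ) (hs : (s : ℕ∞) ≤ e + 1) F, permSum ((zmodHom (hp s)).comp (cycRed p s hs))
      (fun φ => teich p s (t φ)) F ∈ P.N s (k * p ^ m) := by
    intro s hs F
    refine sum_mem fun φ _ => ?_
    rw [RingHom.comp_apply, zmodHom_mul]
    exact nsmul_mem (htN s φ) _
  -- The lift in length `s` combines the representatives `[t_φ]` with the `ℤ/p^{1+e}`-valued cocycle
  -- reduced modulo `p^s`. For the correcting cochain, the coefficients `b x φ` in `𝔽_p` are
  -- replaced by arbitrary integer representatives, since only the first component of its coboundary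
  -- is claimed.
  refine ⟨m, fun s hs x => permSum ((zmodHom (hp s)).comp (cycRed p s hs))
    (fun φ => teich p s (t φ)) (C x), fun s hs => ⟨?_, fun x => hCN s hs _, ?_⟩, ?_,
    fun x => permSum (zmodHom (hp (r + 1)))
      (fun φ => teich p (r + 1) (t φ)) fun φ => ((b x φ).val : ZMod (p ^ (r + 1))), ?_, ?_, ?_⟩
  · exact (permSum_padicCont _ _ hC).isLocallyConstant (pow_smul_truncated P.char s)
  · have h1 := cochainMap_coboundary (permSum ((zmodHom (hp s)).comp (cycRed p s hs))
      (fun φ => teich p s (t φ))) (ρ := permRep (T.χ ^ (ν + 1)) Φ)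
      (ρ' := P.rep s (T.mod s hs ^ (ν + 1))) (fun g F => by
        rw [permSum_permRep _ _ _ (wittMap p s (P.act g)) (hκ s hs g) g (hσt s g), RingHom.comp_apply,
          zmodHom_mul, rep_apply]
        congr 2
        simp [CycChar.mod]) C
    rw [hC0, map_zero] at h1
    exact h1.symm
  · intro t' s ht' hs h x
    change TruncatedWittVector.truncate h (permSum _ _ _) = permSum _ _ _
    rw [permSum_apply, permSum_apply, map_sum]
    refine Finset.sum_congr rfl fun φ _ => ?_
    rw [map_mul, truncate_teich]
    congr 1
    rw [RingHom.comp_apply, RingHom.comp_apply, ← cycRed_compat h hs ht', RingHom.comp_apply,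
      ← RingHom.comp_apply (TruncatedWittVector.truncate h), ← RingHom.comp_apply (zmodHom (hp t'))]
    exact RingHom.congr_fun (Subsingleton.elim _ _) _
  · exact hb.comp fun F => permSum (zmodHom (hp (r + 1))) (fun φ => teich p (r + 1) (t φ))
      fun φ => ((F φ).val : ZMod (p ^ (r + 1)))
  · intro x
    refine sum_mem fun φ _ => ?_
    rw [zmodHom_mul]
    exact nsmul_mem (htN _ φ) _
  · intro x
    have h1 : coeffZero p r R (permSum ((zmodHom (hp (r + 1))).comp (cycRed p (r + 1) hr))
        (fun φ => teich p (r + 1) (t φ)) (C x)) = ∑ φ, cycOne p le_add_self (C x φ) • t φ := by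
      rw [permSum_apply, map_sum]
      refine Finset.sum_congr rfl fun φ _ => ?_
      rw [map_mul, coeffZero_teich, hsm]
      congr 1
      rw [← castHom_comp_cycRed r.succ_ne_zero hr le_add_self, ← RingHom.comp_apply,
        ← RingHom.comp_apply (zmodHom P.char), ← RingHom.comp_assoc, ← RingHom.comp_assoc]
      congr 2
      exact Subsingleton.elim _ _
    have h2 : ∀ y, coeffZero p r R (permSum (zmodHom (hp (r + 1)))
        (fun φ => teich p (r + 1) (t φ)) fun φ => ((b y φ).val : ZMod (p ^ (r + 1)))) =
        permSum (zmodHom P.char) t (b y) := by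
      intro y
      rw [permSum_apply, permSum_apply, map_sum]
      refine Finset.sum_congr rfl fun φ _ => ?_
      rw [map_mul, coeffZero_teich, map_natCast, map_natCast]
      congr 1
      conv_rhs => rw [← ZMod.natCast_zmod_val (b y φ), map_natCast]
    have h3 : coboundary ρ ν (fun y => permSum (zmodHom P.char) t (b y)) x =
        ∑ φ, coboundary (permRep (T.one le_add_self (ν + 1)) Φ) ν b x φ • t φ :=
      (congrFun (cochainMap_coboundary (permSum (zmodHom P.char) t)
        (ρ := permRep (T.one le_add_self (ν + 1)) Φ) (ρ' := ρ) (fun g F => by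
          rw [permSum_permRep _ _ _ (P.act g) (fun a => by
            rw [← RingHom.comp_apply (P.act g), Subsingleton.elim ((P.act g).comp _)
              (zmodHom P.char)]) g (ht g)]
          rfl) b) x).symm
    rw [map_add, map_sub, hczb, h1, hCb x]
    simp only [h2]
    rw [h3, coeffZero_wittMap]
    change coeffZero p r R (c x) ^ p ^ m - _ + _ = 0
    ring

end WittWeights

namespace WittWeights

variable {p : ℕ} [Fact p.Prime] {G : Type w} [Group G] [TopologicalSpace G]
  {R : Type u} [CommRing R] (P : WittWeights p G R)

lemma frob_coboundary {s : ℕ} (ψ : G →* (ZMod (p ^ s))ˣ) (m : ℕ) {n : ℕ}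
    (c : (Fin n → G) → TruncatedWittVector p s R) (x : Fin (n + 1) → G) :
    wittMap p s (WittLift.frob m P.char) (coboundary (P.rep s ψ) n c x) =
      coboundary (P.rep s ψ) n (fun y => wittMap p s (WittLift.frob m P.char) (c y)) x :=
  congrFun (cochainMap_coboundary (wittMap p s (WittLift.frob m P.char)).toAddMonoidHom
    (P.frob_rep ψ m) c) x

lemma tV_coboundary {N : ℕ∞} (T : CycChar p N G) (n : ℕ) {s : ℕ} (hs : ((s + 1 : ℕ) : ℕ∞) ≤ N)
    (hs' : (s : ℕ∞) ≤ N) {i : ℕ} (c : (Fin i → G) → TruncatedWittVector p s R) (x : Fin (i + 1) → G) :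
    tV p s R (coboundary (P.rep s (T.mod s hs' ^ n)) i c x) =
      coboundary (P.rep (s + 1) (T.mod (s + 1) hs ^ n)) i (fun y => tV p s R (c y)) x :=
  congrFun (cochainMap_coboundary (tV p s R) (P.tV_rep T n hs hs') c) x

/-- A cocycle with values in `W_r` lifts to a compatible system of cocycles with values in the
`W_s`, after a Frobenius pullback and up to a coboundary. -/
theorem exists_lift [IsTopologicalGroup G] [CompactSpace G] {ν : ℕ} {e : ℕ∞}
    {T : CycChar p (e + 1) G} (hT : IsCyclotomicPair (ν + 1) e T) : ∀ (r : ℕ)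
    (hr : (r : ℕ∞) ≤ e + 1) {k : ℕ} {c : (Fin (ν + 1) → G) → TruncatedWittVector p r R},
    P.IsCocycle (T.mod r hr ^ (ν + 1)) (ν + 1) k c →
    ∃ (m : ℕ) (C : ∀ s : ℕ, (s : ℕ∞) ≤ e + 1 → (Fin (ν + 1) → G) → TruncatedWittVector p s R),
      (∀ s hs, P.IsCocycle (T.mod s hs ^ (ν + 1)) (ν + 1) (k * p ^ m) (C s hs)) ∧
      (∀ t s ht hs (h : t ≤ s) x, TruncatedWittVector.truncate h (C s hs x) = C t ht x) ∧
      ∃ b : (Fin ν → G) → TruncatedWittVector p r R, IsLocallyConstant b ∧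
        (∀ x, b x ∈ P.N r (k * p ^ m)) ∧
        ∀ x, C r hr x = wittMap p r (WittLift.frob m P.char) (c x) +
          coboundary (P.rep r (T.mod r hr ^ (ν + 1))) ν b x
  | 0, hr, k, c, hc => by
    -- `W_0` is zero, so that the zero cocycle in every length is a lift.
    refine ⟨0, fun s hs x => 0, fun s hs => ⟨IsLocallyConstant.const 0, fun x => zero_mem _, ?_⟩,
      fun t s ht hs h x => map_zero _, fun x => 0, IsLocallyConstant.const 0, fun x => zero_mem _,
      fun x => Subsingleton.elim _ _⟩
    exact map_zero (coboundary (P.rep s (T.mod s hs ^ (ν + 1))) (ν + 1))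
  | r + 1, hr, k, c, hc => by
    obtain ⟨m, C, hC, hCt, b, hb, hbN, hCb⟩ := P.exists_lift_coeffZero hT hr hc
    set ψ := T.mod (r + 1) hr ^ (ν + 1)
    have hψ : IsOpen (ψ.ker : Set G) := T.isOpen_ker_pow (ν + 1) (r + 1) hr
    have hr' : (r : ℕ∞) ≤ e + 1 := le_trans (by exact_mod_cast r.le_succ) hr
    -- The first component of the corrected difference is zero, so the difference is a Verschiebung.
    choose d hd using fun x => exists_tV_eq (hCb x)
    have hE : P.IsCocycle ψ (ν + 1) (k * p ^ m) fun x => tV p r R (d x) := by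
      have h1 : P.IsCocycle ψ (ν + 1) (k * p ^ m) (coboundary (P.rep (r + 1) ψ) ν b) :=
        ⟨P.isLocallyConstant_coboundary hψ hb hbN, P.coboundary_mem ψ hbN, coboundary_coboundary _ _⟩
      have h2 := ((hc.frob m).sub (hC (r + 1) hr)).add h1
      convert h2 using 2 with x
      exact hd x
    -- Injectivity and equivariance of the Verschiebung transfer the cocycle property to `d`. The
    -- weight is multiplied by `p`, because `[a]^k V(y) = V([a]^{kp} y)`.
    have hD : P.IsCocycle (T.mod r hr' ^ (ν + 1)) (ν + 1) (k * p ^ m * p) d := by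
      refine ⟨IsLocallyConstant.desc d (tV p r R) hE.cont (tV_injective r),
        fun x => P.tV_mem.1 (hE.mem x), ?_⟩
      ext1 x
      refine tV_injective r ?_
      rw [P.tV_coboundary T (ν + 1) hr hr', Pi.zero_apply, map_zero]
      exact congrFun hE.cocycle x
    obtain ⟨m', D, hDc, hDt, b', hb', hbN', hDb⟩ := exists_lift hT r hr' hD
    have hk1 : k * p ^ m * p ^ m' = k * p ^ (m + m') := by ring
    have hk2 : k * p ^ m * p * p ^ m' = k * p ^ (m + m') * p := by ring
    have hN : ∀ {s : ℕ}, ((s + 1 : ℕ) : ℕ∞) ≤ e + 1 → (s : ℕ∞) ≤ e + 1 := fun {s} h =>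
      le_trans (by exact_mod_cast s.le_succ) h
    -- The Verschiebungs of the lifts of `d` have length one more, and their weight is back to `k
    -- p^{m+m'}`. Length zero is filled in by zero.
    let B : ∀ s : ℕ, (s : ℕ∞) ≤ e + 1 → (Fin (ν + 1) → G) → TruncatedWittVector p s R
      | 0, _ => fun _ => 0
      | s + 1, hs => fun x => tV p s R (D s (hN hs) x)
    have hB : ∀ s hs, P.IsCocycle (T.mod s hs ^ (ν + 1)) (ν + 1) (k * p ^ (m + m')) (B s hs) := by
      rintro (_ | s) hs
      · exact ⟨IsLocallyConstant.const 0, fun x => zero_mem _, map_zero (coboundary _ _)⟩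
      · refine ⟨(hDc s (hN hs)).cont.comp (tV p s R), fun x => P.tV_mem.2 ?_, ?_⟩
        · rw [← hk2]
          exact (hDc s (hN hs)).mem x
        · ext1 x
          refine (P.tV_coboundary T (ν + 1) hs (hN hs) _ x).symm.trans ?_
          rw [(hDc s (hN hs)).cocycle, Pi.zero_apply, map_zero]
          rfl
    -- Lifting `d` costs a further `p^{m'}`-Frobenius, which must also be applied to the lift of the
    -- first component; it commutes with the Verschiebung because it is induced by a ring
    -- homomorphism.
    refine ⟨m + m', fun s hs x => wittMap p s (WittLift.frob m' P.char) (C s hs x) + B s hs x,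
      fun s hs => ?_, fun t s ht hs h x => ?_,
      fun x => wittMap p (r + 1) (WittLift.frob m' P.char) (b x) + tV p r R (b' x), ?_, fun x => ?_,
      fun x => ?_⟩
    · have h1 := (hC s hs).frob m'
      rw [hk1] at h1
      exact h1.add (hB s hs)
    · rw [map_add, truncate_wittMap, hCt t s ht hs h]
      congr 1
      rcases t with _ | t
      · exact Subsingleton.elim _ _
      · obtain ⟨s, rfl⟩ := Nat.exists_eq_succ_of_ne_zero (Nat.ne_of_gt (Nat.lt_of_lt_of_le t.succ_pos h))
        exact (truncate_tV (Nat.le_of_succ_le_succ h) _).trans (congrArg _ (hDt t s (hN ht) (hN hs) _ x))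
    · exact (hb.comp _).comp₂ (hb'.comp (tV p r R)) (· + ·)
    · have h1 := P.frob_mem m' (hbN x)
      rw [hk1] at h1
      refine add_mem h1 (P.tV_mem.2 ?_)
      rw [← hk2]
      exact hbN' x
    · have h1 : coboundary (P.rep (r + 1) ψ) ν
          (fun x => wittMap p (r + 1) (WittLift.frob m' P.char) (b x) + tV p r R (b' x)) x =
          wittMap p (r + 1) (WittLift.frob m' P.char) (coboundary (P.rep (r + 1) ψ) ν b x) +
            tV p r R (coboundary (P.rep r (T.mod r hr' ^ (ν + 1))) ν b' x) := by
        rw [P.frob_coboundary, P.tV_coboundary T (ν + 1) hr hr']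
        exact congrFun (map_add (coboundary (P.rep (r + 1) ψ) ν)
          (fun x => wittMap p (r + 1) (WittLift.frob m' P.char) (b x)) fun x => tV p r R (b' x)) x
      rw [h1]
      change _ + tV p r R (D r (hN hr) x) = _
      rw [hDb, map_add, ← wittMap_tV, hd x, ← frob_frob P.char m m']
      simp only [map_add, map_sub]
      abel

/-- A variant for perfect `R`, where no Frobenius pullback is needed. -/
theorem exists_lift_of_perfect [IsTopologicalGroup G] [CompactSpace G] {ν : ℕ} {e : ℕ∞}
    {T : CycChar p (e + 1) G} (hT : IsCyclotomicPair (ν + 1) e T)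
    (hinj : ∀ m, Function.Injective (WittLift.frob m P.char))
    (hsurj : ∀ (s k m : ℕ), ∀ x ∈ P.N s (k * p ^ m), ∃ y ∈ P.N s k,
      wittMap p s (WittLift.frob m P.char) y = x) (r : ℕ)
    (hr : (r : ℕ∞) ≤ e + 1) {k : ℕ} {c : (Fin (ν + 1) → G) → TruncatedWittVector p r R}
    (hc : P.IsCocycle (T.mod r hr ^ (ν + 1)) (ν + 1) k c) :
    ∃ (C : ∀ s : ℕ, (s : ℕ∞) ≤ e + 1 → (Fin (ν + 1) → G) → TruncatedWittVector p s R),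
      (∀ s hs, P.IsCocycle (T.mod s hs ^ (ν + 1)) (ν + 1) k (C s hs)) ∧
      (∀ t s ht hs (h : t ≤ s) x, TruncatedWittVector.truncate h (C s hs x) = C t ht x) ∧
      ∃ b : (Fin ν → G) → TruncatedWittVector p r R, IsLocallyConstant b ∧
        (∀ x, b x ∈ P.N r k) ∧
        ∀ x, C r hr x = c x + coboundary (P.rep r (T.mod r hr ^ (ν + 1))) ν b x := by
  obtain ⟨m, C, hC, hCt, b, hb, hbN, hCb⟩ := P.exists_lift hT r hr hc
  choose C' hC' hC'' using fun s hs x => hsurj s k m (C s hs x) ((hC s hs).mem x)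
  choose b' hb' hb'' using fun x => hsurj r k m (b x) (hbN x)
  -- The lifts of the Frobenius pullback have preimages of weight `k` under Frobenius. Injectivity
  -- brings all the required equations back to these preimages.
  have hF := fun s => wittMap_injective (p := p) s (hinj m)
  refine ⟨C', fun s hs => ⟨?_, hC' s hs, ?_⟩, fun t s ht hs h x => hF t ?_, b', ?_, hb',
    fun x => hF r ?_⟩
  · refine IsLocallyConstant.desc _ (wittMap p s (WittLift.frob m P.char)) ?_ (hF s)
    convert (hC s hs).cont using 1
    exact funext fun x => hC'' s hs x
  · ext1 x
    refine hF s ?_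
    rw [P.frob_coboundary, Pi.zero_apply, map_zero]
    simp only [hC'']
    exact congrFun (hC s hs).cocycle x
  · rw [← truncate_wittMap, hC'', hC'', hCt]
  · refine IsLocallyConstant.desc _ (wittMap p r (WittLift.frob m P.char)) ?_ (hF r)
    convert hb using 1
    exact funext hb''
  · rw [map_add, P.frob_coboundary, hC'', hCb]
    simp only [hb'']

end WittWeights

/-! ### Equivariant sheaves of modules: semilinear maps, kernels, twisted direct sums. -/

section EquivariantModules

variable {p : ℕ} {G : Type w} [Group G] [TopologicalSpace G] {X : GScheme.{u} p G}

lemma GScheme.le_tr_top (g : G) (U : X.S.Opens) : U ≤ X.tr g ⊤ := fun _ _ => trivial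

lemma GRing.Hom.app_res {R R' : GRing X} (φ : GRing.Hom R R') {U V : X.S.Opens} (h : V ≤ U)
    (a : R.obj U) : φ.app V (R.res h a) = R'.res h (φ.app U a) :=
  φ.app_act 1 _ a

namespace GMod

variable {R R' : GRing X}

lemma res_smul (M : GMod R) {U V : X.S.Opens} (h : V ≤ U) (a : R.obj U) (x : M.obj U) :
    M.res h (a • x) = R.res h a • M.res h x :=
  M.act_smul 1 _ a x

lemma Hom.app_res {φ : GRing.Hom R R'} {M : GMod R} {N : GMod R'} (f : Hom φ M N)
    {U V : X.S.Opens} (h : V ≤ U) (x : M.obj U) : f.app V (M.res h x) = N.res h (f.app U x) :=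
  f.app_act 1 _ x

/-- Semilinear maps of sheaves of modules, not necessarily equivariant. -/
structure Lin (φ : GRing.Hom R R') (M : GMod R) (N : GMod R') where
  app : ∀ U, M.obj U →+ N.obj U
  app_smul : ∀ U (a : R.obj U) (x : M.obj U), app U (a • x) = φ.app U a • app U x
  app_res : ∀ {U V : X.S.Opens} (h : V ≤ U) (x : M.obj U), app V (M.res h x) = N.res h (app U x)

/-- The semilinear map underlying an equivariant one. -/
def Hom.lin {φ : GRing.Hom R R'} {M : GMod R} {N : GMod R'} (f : Hom φ M N) : Lin φ M N :=
  ⟨f.app, f.app_smul, f.app_res⟩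

namespace Lin

variable {φ : GRing.Hom R R'} {M M' : GMod R} {N N' : GMod R'}

/-- Composition with a linear map on the target. -/
def comp (f : Lin (GRing.Hom.id _) N N') (g : Lin φ M N) : Lin φ M N' where
  app U := (f.app U).comp (g.app U)
  app_smul U a x := (congrArg _ (g.app_smul U a x)).trans (f.app_smul U _ _)
  app_res h x := (congrArg _ (g.app_res h x)).trans (f.app_res h _)

/-- Composition with a linear map on the source. -/
def comp' (f : Lin φ M N) (g : Lin (GRing.Hom.id _) M' M) : Lin φ M' N where
  app U := (f.app U).comp (g.app U)
  app_smul U a x := (congrArg _ (g.app_smul U a x)).trans (f.app_smul U _ _)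
  app_res h x := (congrArg _ (g.app_res h x)).trans (f.app_res h _)

/-- The sum of two semilinear maps. -/
def add (f g : Lin φ M N) : Lin φ M N where
  app U := f.app U + g.app U
  app_smul U a x := by
    rw [AddMonoidHom.add_apply, f.app_smul, g.app_smul, ← smul_add]
    rfl
  app_res h x := by
    rw [AddMonoidHom.add_apply, f.app_res, g.app_res, ← _root_.map_add]
    rfl

/-- A semilinear map that is equivariant. -/
def hom (f : Lin φ M N) (hf : ∀ (g : G) {U V : X.S.Opens} (h : V ≤ X.tr g U) (x : M.obj U),
    f.app V (M.act g h x) = N.act g h (f.app U x)) : Hom φ M N :=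
  ⟨f.app, f.app_smul, hf⟩

end Lin

/-- The zero map. -/
def Lin.zero (φ : GRing.Hom R R') (M : GMod R) (N : GMod R') : Lin φ M N where
  app U := 0
  app_smul U a x := (smul_zero _).symm
  app_res h x := (_root_.map_zero _).symm

/-- The kernel of an equivariant linear map. -/
def ker {M N : GMod R} (f : Hom (GRing.Hom.id R) M N) : GMod R where
  obj U := (f.app U).ker
  mod U :=
    { smul := fun a x => ⟨a • x.1, by
        have h : f.app U (a • x.1) = a • f.app U x.1 := f.app_smul U a x.1
        have h' : f.app U x.1 = 0 := x.2
        rw [AddMonoidHom.mem_ker, h, h', smul_zero]⟩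
      one_smul := fun x => Subtype.ext (one_smul _ _)
      mul_smul := fun a b x => Subtype.ext (mul_smul a b x.1)
      smul_zero := fun a => Subtype.ext (smul_zero a)
      smul_add := fun a x y => Subtype.ext (smul_add a x.1 y.1)
      add_smul := fun a b x => Subtype.ext (add_smul a b x.1)
      zero_smul := fun x => Subtype.ext (zero_smul _ x.1) }
  act g U V h :=
    { toFun := fun x => ⟨M.act g h x.1, by
        have h' : f.app U x.1 = 0 := x.2
        rw [AddMonoidHom.mem_ker, f.app_act, h', _root_.map_zero]⟩
      map_zero' := Subtype.ext (_root_.map_zero _)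
      map_add' := fun x y => Subtype.ext (_root_.map_add _ _ _) }
  act_smul g U V h a x := Subtype.ext (M.act_smul g h a x.1)
  act_one U h x := Subtype.ext (M.act_one U h x.1)
  act_act g g' U V W h h' x := Subtype.ext (M.act_act g g' h h' x.1)
  sep x y H := Subtype.ext <| M.sep x.1 y.1 fun t ht => by
    obtain ⟨V, h, hV, e⟩ := H t ht
    exact ⟨V, h, hV, congrArg Subtype.val e⟩
  glue V hV hc x H := by
    obtain ⟨y, hy⟩ := M.glue V hV hc (fun i => (x i).1) fun i j W hi hj =>
      congrArg Subtype.val (H i j W hi hj)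
    refine ⟨⟨y, ?_⟩, fun i => Subtype.ext (hy i)⟩
    refine N.sep _ _ fun t ht => ?_
    obtain ⟨i, hi⟩ := hc t ht
    refine ⟨V i, hV i, hi, ?_⟩
    have h' : f.app (V i) (x i).1 = 0 := (x i).2
    rw [← f.app_act, hy, h', _root_.map_zero]
  naive := by
    obtain ⟨K, hK⟩ := M.naive
    exact ⟨K, fun g hg U V h h' x => Subtype.ext (hK g hg h h' x.1)⟩

/-- The inclusion of the kernel. -/
def kerι {M N : GMod R} (f : Hom (GRing.Hom.id R) M N) : Hom (GRing.Hom.id R) (ker f) M where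
  app U := (f.app U).ker.subtype
  app_smul U a x := rfl
  app_act g U V h x := rfl

lemma kerι_injective {M N : GMod R} (f : Hom (GRing.Hom.id R) M N) (U : X.S.Opens) :
    Function.Injective ((kerι f).app U) := Subtype.val_injective

lemma app_kerι {M N : GMod R} (f : Hom (GRing.Hom.id R) M N) (U : X.S.Opens) (x : (ker f).obj U) :
    f.app U ((kerι f).app U x) = 0 := x.2

/-- The factorization through the kernel of a morphism that composes to zero. -/
def kerLift {φ : GRing.Hom R R'} {L : GMod R} {M N : GMod R'} (f : Hom (GRing.Hom.id R') M N)
    (g : Hom φ L M) (hg : ∀ U x, f.app U (g.app U x) = 0) : Hom φ L (ker f) where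
  app U := (g.app U).codRestrict _ (hg U)
  app_smul U a x := Subtype.ext (g.app_smul U a x)
  app_act g' U V h x := Subtype.ext (g.app_act g' h x)

lemma kerι_kerLift {φ : GRing.Hom R R'} {L : GMod R} {M N : GMod R'} (f : Hom (GRing.Hom.id R') M N)
    (g : Hom φ L M) (hg : ∀ U x, f.app U (g.app U x) = 0) (U : X.S.Opens) (x : L.obj U) :
    (kerι f).app U ((kerLift f g hg).app U x) = g.app U x := rfl

/-- The data of an extension of `C` by `B` that is split as an extension of sheaves of modules: the
element `g` of `G` acts on `B × C` by `g (b, c) = (g b + τ g c, g c)`. -/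
structure Twisting (B C : GMod R) where
  τ : ∀ (g : G) {U V : X.S.Opens}, V ≤ X.tr g U → C.obj U →+ B.obj V
  τ_smul : ∀ (g : G) {U V : X.S.Opens} (h : V ≤ X.tr g U) (a : R.obj U) (x : C.obj U),
    τ g h (a • x) = R.act g h a • τ g h x
  τ_one : ∀ {U V : X.S.Opens} (h : V ≤ X.tr 1 U) (x : C.obj U), τ 1 h x = 0
  τ_mul : ∀ (g g' : G) {U V W : X.S.Opens} (h : V ≤ X.tr g U) (h' : U ≤ X.tr g' W) (x : C.obj W),
    τ (g * g') (GScheme.le_tr_mul h h') x = B.act g h (τ g' h' x) + τ g h (C.act g' h' x)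
  naive : ∃ K : OpenSubgroup G, ∀ g ∈ K, ∀ {U V : X.S.Opens} (h : V ≤ X.tr g U) (_ : V ≤ U)
    (x : C.obj U), τ g h x = 0

/-- The extension attached to a twisting. -/
def Twisting.obj {B C : GMod R} (t : Twisting B C) : GMod R where
  obj U := B.obj U × C.obj U
  act g U V h :=
    { toFun := fun x => (B.act g h x.1 + t.τ g h x.2, C.act g h x.2)
      map_zero' := by simp
      map_add' := fun x y => Prod.ext (by
        simp only [Prod.fst_add, Prod.snd_add, _root_.map_add]
        abel) (_root_.map_add _ _ _) }
  act_smul g U V h a x := Prod.ext (by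
    change B.act g h (a • x.1) + t.τ g h (a • x.2) = R.act g h a • (B.act g h x.1 + t.τ g h x.2)
    rw [B.act_smul, t.τ_smul, smul_add]) (C.act_smul g h a x.2)
  act_one U h x := Prod.ext (by
    change B.act 1 h x.1 + t.τ 1 h x.2 = x.1
    rw [B.act_one, t.τ_one, add_zero]) (C.act_one U h x.2)
  act_act g g' U V W h h' x := Prod.ext (by
    change B.act g h (B.act g' h' x.1 + t.τ g' h' x.2) + t.τ g h (C.act g' h' x.2) =
      B.act (g * g') _ x.1 + t.τ (g * g') _ x.2
    rw [_root_.map_add, B.act_act, t.τ_mul g g' h h', add_assoc]) (C.act_act g g' h h' x.2)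
  sep x y H := Prod.ext
    (B.sep x.1 y.1 fun s hs => by
      obtain ⟨V, h, hV, e⟩ := H s hs
      refine ⟨V, h, hV, ?_⟩
      have e1 := congrArg Prod.fst e
      change B.act 1 _ x.1 + t.τ 1 _ x.2 = B.act 1 _ y.1 + t.τ 1 _ y.2 at e1
      rwa [t.τ_one, t.τ_one, add_zero, add_zero] at e1)
    (C.sep x.2 y.2 fun s hs => by
      obtain ⟨V, h, hV, e⟩ := H s hs
      exact ⟨V, h, hV, congrArg Prod.snd e⟩)
  glue V hV hc x H := by
    obtain ⟨y, hy⟩ := B.glue V hV hc (fun i => (x i).1) fun i j W hi hj => by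
      have e1 := congrArg Prod.fst (H i j W hi hj)
      change B.act 1 _ (x i).1 + t.τ 1 _ (x i).2 = B.act 1 _ (x j).1 + t.τ 1 _ (x j).2 at e1
      rwa [t.τ_one, t.τ_one, add_zero, add_zero] at e1
    obtain ⟨z, hz⟩ := C.glue V hV hc (fun i => (x i).2) fun i j W hi hj =>
      congrArg Prod.snd (H i j W hi hj)
    refine ⟨(y, z), fun i => Prod.ext ?_ (hz i)⟩
    change B.act 1 _ y + t.τ 1 _ z = (x i).1
    rw [t.τ_one, add_zero, hy]
  naive := by
    obtain ⟨K, hK⟩ := B.naive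
    obtain ⟨K', hK'⟩ := C.naive
    obtain ⟨K'', hK''⟩ := t.naive
    refine ⟨K ⊓ K' ⊓ K'', fun g hg U V h h' x => Prod.ext ?_ (hK' g hg.1.2 h h' x.2)⟩
    change B.act g h x.1 + t.τ g h x.2 = B.act 1 _ x.1 + t.τ 1 _ x.2
    rw [hK g hg.1.1 h h', hK'' g hg.2 h h', t.τ_one]

lemma Twisting.res_apply {B C : GMod R} (t : Twisting B C) {U V : X.S.Opens}
    (h : V ≤ U) (x : t.obj.obj U) : t.obj.res h x = (B.res h x.1, C.res h x.2) :=
  Prod.ext (by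
    change B.act 1 _ x.1 + t.τ 1 _ x.2 = _
    rw [t.τ_one, add_zero]
    rfl) rfl

end GMod

end EquivariantModules

/-- A finite transitive `G`-set with a base point, whose stabilizer is an open normal subgroup. -/
structure FinTorsor (G : Type w) [Group G] [TopologicalSpace G] where
  Q : Type
  [fintype : Fintype Q]
  [decEq : DecidableEq Q]
  [action : MulAction G Q]
  o : Q
  trans : ∀ q : Q, ∃ g : G, g • o = q
  isOpen : IsOpen (MulAction.stabilizer G o : Set G)
  normal : ∀ (g : G) (q : Q), g • o = o → g • q = q

attribute [instance] FinTorsor.fintype FinTorsor.decEq FinTorsor.action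

/-! ### The standard resolution attached to a finite quotient of the group. -/

section Resolution

variable {p : ℕ} [Fact p.Prime] {G : Type w} [Group G] [TopologicalSpace G] {X : GScheme.{u} p G}

/-- The functions on a power of `D` with values in `W_r(O_X)`. -/
def FinTorsor.P (D : FinTorsor G) (X : GScheme.{u} p G) (r n : ℕ) : GMod (X.W r) where
  obj U := (Fin n → D.Q) → (X.W r).obj U
  act g U V h :=
    { toFun := fun f x => (X.W r).act g h (f (g⁻¹ • x))
      map_zero' := funext fun x => _root_.map_zero _
      map_add' := fun f f' => funext fun x => _root_.map_add _ _ _ }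
  act_smul g U V h a f := funext fun x => _root_.map_mul ((X.W r).act g h) a _
  act_one U h f := funext fun x => by
    change (X.W r).act 1 h (f (1⁻¹ • x)) = f x
    rw [inv_one, one_smul, (X.W r).act_one]
  act_act g g' U V W h h' f := funext fun x => by
    change (X.W r).act g h ((X.W r).act g' h' (f (g'⁻¹ • g⁻¹ • x))) =
      (X.W r).act (g * g') _ (f ((g * g')⁻¹ • x))
    rw [(X.W r).act_act, mul_inv_rev, mul_smul]
  sep f f' H := funext fun x => W_sep _ _ fun t ht => by
    obtain ⟨V, h, hV, e⟩ := H t ht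
    refine ⟨V, h, hV, ?_⟩
    have e1 := congrFun e x
    change (X.W r).act 1 _ (f (1⁻¹ • x)) = (X.W r).act 1 _ (f' (1⁻¹ • x)) at e1
    rwa [inv_one, one_smul] at e1
  glue V hV hc f H := by
    have : ∀ x, ∃ y, ∀ i, (X.W r).act 1 (GScheme.le_tr_one (hV i)) y = f i x := fun x =>
      W_glue V hV hc (fun i => f i x) fun i j W hi hj => by
        have e1 := congrFun (H i j W hi hj) x
        change (X.W r).act 1 _ (f i (1⁻¹ • x)) = (X.W r).act 1 _ (f j (1⁻¹ • x)) at e1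
        rwa [inv_one, one_smul] at e1
    choose y hy using this
    refine ⟨y, fun i => funext fun x => ?_⟩
    change (X.W r).act 1 _ (y (1⁻¹ • x)) = f i x
    rw [inv_one, one_smul, hy]
  naive := by
    obtain ⟨K, hK⟩ := W_naive (X := X) r
    refine ⟨K ⊓ ⟨MulAction.stabilizer G D.o, D.isOpen⟩, fun g hg U V h h' f => funext fun x => ?_⟩
    change (X.W r).act g h (f (g⁻¹ • x)) = (X.W r).act 1 _ (f (1⁻¹ • x))
    have e : g⁻¹ • x = x := funext fun i => D.normal _ _ (inv_mem hg.2 : g⁻¹ ∈ MulAction.stabilizer G D.o)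
    rw [e, inv_one, one_smul, hK g hg.1 h h']

namespace FinTorsor

variable (D : FinTorsor G) {r s t : ℕ}

lemma P_act {n : ℕ} (g : G) {U V : X.S.Opens} (h : V ≤ X.tr g U) (f : (D.P X r n).obj U)
    (x : Fin n → D.Q) : (D.P X r n).act g h f x = (X.W r).act g h (f (g⁻¹ • x)) := rfl

lemma P_res {n : ℕ} {U V : X.S.Opens} (h : V ≤ U) (f : (D.P X r n).obj U) (x : Fin n → D.Q) :
    (D.P X r n).res h f x = (X.W r).res h (f x) := by
  refine (D.P_act 1 _ f x).trans ?_
  rw [inv_one, one_smul]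
  rfl

lemma P_smul {n : ℕ} {U : X.S.Opens} (a : (X.W r).obj U) (f : (D.P X r n).obj U)
    (x : Fin n → D.Q) : (a • f) x = a * f x := rfl

variable (X r) in
/-- The basis of the functions on `Q ^ n`. -/
def e {n : ℕ} (x : Fin n → D.Q) : (D.P X r n).obj ⊤ := Pi.single x 1

lemma act_e {n : ℕ} (g : G) (x : Fin n → D.Q) :
    (D.P X r n).act g (GScheme.le_tr_top g ⊤) (D.e X r x) = D.e X r (g • x) := by
  refine funext fun y => ?_
  rw [P_act]
  by_cases h : y = g • x
  · subst h
    simp [e]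
  · have h' : g⁻¹ • y ≠ x := fun h' => h (by rw [← h', smul_inv_smul])
    simp [e, h, h']

lemma P_eq_sum {n : ℕ} {U : X.S.Opens} (f : (D.P X r n).obj U) :
    f = ∑ x, f x • (D.P X r n).res le_top (D.e X r x) := by
  refine funext fun y => ?_
  have h1 : (∑ x, f x • (D.P X r n).res le_top (D.e X r x)) y =
      ∑ x, (f x • (D.P X r n).res le_top (D.e X r x) : (D.P X r n).obj U) y :=
    Finset.sum_apply y _ _
  rw [h1, Finset.sum_eq_single y]
  · rw [P_smul, P_res]
    simp [e]
  · intro x _ hx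
    rw [P_smul, P_res]
    simp [e, hx.symm]
  · simp

variable {D}

/-- Semilinear maps on functions are determined by the basis. -/
lemma lin_ext {φ : GRing.Hom (X.W r) (X.W s)} {n : ℕ} {M : GMod (X.W s)}
    {A A' : GMod.Lin φ (D.P X r n) M} (h : ∀ x, A.app ⊤ (D.e X r x) = A'.app ⊤ (D.e X r x))
    (U : X.S.Opens) (f : (D.P X r n).obj U) : A.app U f = A'.app U f := by
  rw [D.P_eq_sum f, map_sum, map_sum]
  refine Finset.sum_congr rfl fun x _ => ?_
  rw [A.app_smul, A'.app_smul, A.app_res, A'.app_res, h]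

variable (D)

/-- The semilinear map on functions with given values on the basis. -/
def lam (φ : GRing.Hom (X.W r) (X.W s)) {n : ℕ} {M : GMod (X.W s)} (u : (Fin n → D.Q) → M.obj ⊤) :
    GMod.Lin φ (D.P X r n) M where
  app U :=
    { toFun := fun f => ∑ x, φ.app U (f x) • M.res le_top (u x)
      map_zero' := Finset.sum_eq_zero fun x _ => by
        change φ.app U 0 • _ = _
        rw [_root_.map_zero, zero_smul]
      map_add' := fun f f' => by
        rw [← Finset.sum_add_distrib]
        refine Finset.sum_congr rfl fun x _ => ?_
        rw [← add_smul, ← _root_.map_add]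
        rfl }
  app_smul U a f := by
    change ∑ x, φ.app U (a * f x) • _ = φ.app U a • ∑ x, φ.app U (f x) • _
    rw [Finset.smul_sum]
    refine Finset.sum_congr rfl fun x _ => ?_
    rw [_root_.map_mul, mul_smul]
  app_res {U V} h f := by
    change ∑ x, φ.app V ((D.P X r n).res h f x) • _ = M.res h (∑ x, φ.app U (f x) • _)
    rw [map_sum]
    refine Finset.sum_congr rfl fun x _ => ?_
    rw [P_res, φ.app_res, GMod.res_smul, GMod.res_res]

lemma lam_apply (φ : GRing.Hom (X.W r) (X.W s)) {n : ℕ} {M : GMod (X.W s)}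
    (u : (Fin n → D.Q) → M.obj ⊤) (U : X.S.Opens) (f : (D.P X r n).obj U) :
    (D.lam φ u).app U f = ∑ x, φ.app U (f x) • M.res le_top (u x) := rfl

lemma lam_e (φ : GRing.Hom (X.W r) (X.W s)) {n : ℕ} {M : GMod (X.W s)}
    (u : (Fin n → D.Q) → M.obj ⊤) (x : Fin n → D.Q) : (D.lam φ u).app ⊤ (D.e X r x) = u x := by
  rw [lam_apply, Finset.sum_eq_single x]
  · rw [M.res_self, e, Pi.single_eq_same, _root_.map_one, one_smul]
  · intro y _ hy
    rw [e, Pi.single_eq_of_ne hy, _root_.map_zero, zero_smul]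
  · simp

lemma lam_act (φ : GRing.Hom (X.W r) (X.W s)) {n : ℕ} {M : GMod (X.W s)}
    {u : (Fin n → D.Q) → M.obj ⊤} (hu : ∀ g x, u (g • x) = M.act g (GScheme.le_tr_top g ⊤) (u x))
    (g : G) {U V : X.S.Opens} (h : V ≤ X.tr g U) (f : (D.P X r n).obj U) :
    (D.lam φ u).app V ((D.P X r n).act g h f) = M.act g h ((D.lam φ u).app U f) := by
  rw [lam_apply, lam_apply, map_sum]
  refine (Fintype.sum_equiv (MulAction.toPerm g) _ _ fun x => ?_).symm
  rw [MulAction.toPerm_apply, P_act, inv_smul_smul, φ.app_act, M.act_smul, M.act_res, hu, M.res_act]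

/-- The equivariant semilinear map on functions with given values on the basis. -/
def lamHom (φ : GRing.Hom (X.W r) (X.W s)) {n : ℕ} {M : GMod (X.W s)}
    (u : (Fin n → D.Q) → M.obj ⊤) (hu : ∀ g x, u (g • x) = M.act g (GScheme.le_tr_top g ⊤) (u x)) :
    GMod.Hom φ (D.P X r n) M :=
  (D.lam φ u).hom (D.lam_act φ hu)

/-- The differential `P_{n+1} → P_n`. -/
def d (X : GScheme.{u} p G) (r n : ℕ) : GMod.Hom (GRing.Hom.id _) (D.P X r (n + 1)) (D.P X r n) :=
  D.lamHom (GRing.Hom.id _) (hδ (D.e X r)) fun g x => by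
    have := map_hδ ((D.P X r n).act g (GScheme.le_tr_top g ⊤)) (D.e X r) x
    rw [this]
    simp only [act_e]
    rfl

lemma d_e {n : ℕ} (x : Fin (n + 1) → D.Q) : (D.d X r n).app ⊤ (D.e X r x) = hδ (D.e X r) x :=
  D.lam_e _ _ x

/-- The contracting homotopy `P_n → P_{n+1}`, which is not equivariant. -/
def h (X : GScheme.{u} p G) (r n : ℕ) : GMod.Lin (GRing.Hom.id _) (D.P X r n) (D.P X r (n + 1)) :=
  D.lam (GRing.Hom.id _) fun x => D.e X r (Fin.cons D.o x : Fin (n + 1) → D.Q)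

lemma h_e {n : ℕ} (x : Fin n → D.Q) :
    (D.h X r n).app ⊤ (D.e X r x) = D.e X r (Fin.cons D.o x : Fin (n + 1) → D.Q) :=
  D.lam_e _ _ x

lemma d_d {n : ℕ} (U : X.S.Opens) (f : (D.P X r (n + 2)).obj U) :
    (D.d X r n).app U ((D.d X r (n + 1)).app U f) = 0 := by
  refine lin_ext (A := (D.d X r n).lin.comp (D.d X r (n + 1)).lin) (A' := GMod.Lin.zero _ _ _)
    (fun x => ?_) U f
  change (D.d X r n).app ⊤ ((D.d X r (n + 1)).app ⊤ (D.e X r x)) = 0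
  rw [d_e, map_hδ]
  simp only [d_e]
  exact congrFun (hδ_hδ _) x

/-- On basis elements this is `hδ_cons` with the base point as added vertex. The complex is
therefore split exact without the group action; the base point is not fixed by `G`, so `h` need not
be equivariant. -/
lemma d_h_add_h_d {n : ℕ} (U : X.S.Opens) (f : (D.P X r (n + 1)).obj U) :
    (D.d X r (n + 1)).app U ((D.h X r (n + 1)).app U f) +
      (D.h X r n).app U ((D.d X r n).app U f) = f := by
  refine lin_ext (A := ((D.d X r (n + 1)).lin.comp (D.h X r (n + 1))).add
    ((D.h X r n).comp (D.d X r n).lin)) (A' := (GMod.Hom.id _).lin)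
    (fun x => ?_) U f
  change (D.d X r (n + 1)).app ⊤ ((D.h X r (n + 1)).app ⊤ (D.e X r x)) +
      (D.h X r n).app ⊤ ((D.d X r n).app ⊤ (D.e X r x)) = D.e X r x
  rw [h_e, d_e, d_e, map_hδ, hδ_cons]
  simp only [h_e]
  abel

lemma d_h_zero (U : X.S.Opens) (f : (D.P X r 0).obj U) :
    (D.d X r 0).app U ((D.h X r 0).app U f) = f := by
  refine lin_ext (A := (D.d X r 0).lin.comp (D.h X r 0)) (A' := (GMod.Hom.id _).lin)
    (fun x => ?_) U f
  change (D.d X r 0).app ⊤ ((D.h X r 0).app ⊤ (D.e X r x)) = D.e X r x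
  rw [h_e, d_e]
  simp [hδ, Subsingleton.elim _ x]

/-- The syzygies of the standard resolution of `W_r(O_X)`. -/
def Z (X : GScheme.{u} p G) (r : ℕ) : ℕ → GMod (X.W r)
  | 0 => X.WMod r
  | n + 1 => GMod.ker (D.d X r n)

/-- The inclusion of a syzygy. -/
def j (X : GScheme.{u} p G) (r : ℕ) : ∀ n, GMod.Hom (GRing.Hom.id _) (D.Z X r n) (D.P X r n)
  | 0 =>
    { app := fun U =>
        { toFun := fun a _ => a
          map_zero' := rfl
          map_add' := fun _ _ => rfl }
      app_smul := fun U a x => rfl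
      app_act := fun g U V h x => rfl }
  | n + 1 => GMod.kerι _

lemma j_injective : ∀ (n : ℕ) (U : X.S.Opens), Function.Injective ((D.j X r n).app U)
  | 0, U => fun a b h => congrFun h default
  | n + 1, U => GMod.kerι_injective _ U

lemma d_j {n : ℕ} (U : X.S.Opens) (z : (D.Z X r (n + 1)).obj U) :
    (D.d X r n).app U ((D.j X r (n + 1)).app U z) = 0 := GMod.app_kerι _ U z

/-- The projection to a syzygy. -/
def π (X : GScheme.{u} p G) (r : ℕ) : ∀ n, GMod.Hom (GRing.Hom.id _) (D.P X r (n + 1)) (D.Z X r n)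
  | 0 =>
    { app := fun U =>
        { toFun := fun f => (D.d X r 0).app U f default
          map_zero' := by rw [_root_.map_zero]; rfl
          map_add' := fun _ _ => by rw [_root_.map_add]; rfl }
      app_smul := fun U a f => congrFun ((D.d X r 0).app_smul U a f) default
      app_act := fun g U V h f => by
        have h1 := congrFun ((D.d X r 0).app_act g h f) default
        rw [P_act, Subsingleton.elim (g⁻¹ • default) (default : Fin 0 → D.Q)] at h1
        exact h1 }
  | n + 1 => GMod.kerLift _ (D.d X r (n + 1)) D.d_d

lemma j_π : ∀ (n : ℕ) (U : X.S.Opens) (f : (D.P X r (n + 1)).obj U),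
    (D.j X r n).app U ((D.π X r n).app U f) = (D.d X r n).app U f
  | 0, U, f => funext fun x => by rw [Subsingleton.elim x default]; rfl
  | n + 1, U, f => GMod.kerι_kerLift _ _ D.d_d U f

/-- The section of the projection to a syzygy. -/
def σ (X : GScheme.{u} p G) (r n : ℕ) : GMod.Lin (GRing.Hom.id _) (D.Z X r n) (D.P X r (n + 1)) :=
  (D.h X r n).comp (D.j X r n).lin

lemma σ_apply {n : ℕ} (U : X.S.Opens) (z : (D.Z X r n).obj U) :
    (D.σ X r n).app U z = (D.h X r n).app U ((D.j X r n).app U z) := rfl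

/-- A syzygy is a cycle, on which `d h + h d = 1` becomes `d h = 1`. In degree zero, `Q^0` is a
point and `d h = 1` holds on all of `P_0 = W_r(O)`. -/
lemma π_σ : ∀ {n : ℕ} (U : X.S.Opens) (z : (D.Z X r n).obj U),
    (D.π X r n).app U ((D.σ X r n).app U z) = z
  | 0, U, z => D.j_injective 0 U (by rw [j_π, σ_apply, d_h_zero])
  | n + 1, U, z => D.j_injective (n + 1) U (by
      have h1 := D.d_h_add_h_d U ((D.j X r (n + 1)).app U z)
      rw [d_j, _root_.map_zero, add_zero] at h1
      rw [j_π, σ_apply, h1])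

lemma π_j {n : ℕ} (U : X.S.Opens) (z : (D.Z X r (n + 1)).obj U) :
    (D.π X r n).app U ((D.j X r (n + 1)).app U z) = 0 :=
  D.j_injective n U (by rw [j_π, d_j, _root_.map_zero])

lemma exists_j_eq {n : ℕ} {U : X.S.Opens} {f : (D.P X r (n + 1)).obj U}
    (hf : (D.π X r n).app U f = 0) : ∃ z, (D.j X r (n + 1)).app U z = f :=
  ⟨⟨f, by
    have h1 := D.j_π n U f
    rw [hf, _root_.map_zero] at h1
    exact h1.symm⟩, rfl⟩

end FinTorsor

end Resolution

/-! ### Components of the product of a Witt vector by a Teichmüller representative. -/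

section TeichmullerCoeff

variable {p : ℕ} [Fact p.Prime] {A : Type u} [CommRing A]

/-- The two summands have disjoint supports, so that they add componentwise. -/
lemma teichmuller_add_verschiebung (x : WittVector p A) : x = WittVector.teichmuller p (x.coeff 0) +
    WittVector.verschiebung (WittVector.mk p fun i => x.coeff (i + 1)) := by
  ext i
  have h : ∀ n, (WittVector.teichmuller p (x.coeff 0)).coeff n = 0 ∨
      (WittVector.verschiebung (WittVector.mk p fun i => x.coeff (i + 1))).coeff n = 0 := by
    rintro (_ | n)
    · exact Or.inr (WittVector.verschiebung_coeff_zero _)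
    · exact Or.inl (WittVector.teichmuller_coeff_pos p _ _ n.succ_pos)
  rw [WittVector.coeff_add_of_disjoint _ _ _ h]
  rcases i with _ | i
  · rw [WittVector.verschiebung_coeff_zero, add_zero, WittVector.teichmuller_coeff_zero]
  · rw [WittVector.verschiebung_coeff_succ, WittVector.teichmuller_coeff_pos p _ _ i.succ_pos,
      zero_add, WittVector.coeff_mk]

/-- Writing `x = [x₀] + V(x')`, the projection formula gives `[a] x = [a x₀] + V([a^p] x')`, and
induction on the component applies to `x'` with `a^p` in place of `a`. -/
lemma coeff_teichmuller_mul (h : (p : A) = 0) (a : A) (x : WittVector p A) (i : ℕ) :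
    (WittVector.teichmuller p a * x).coeff i = a ^ p ^ i * x.coeff i := by
  rcases subsingleton_or_nontrivial A with hA | hA
  · exact Subsingleton.elim _ _
  have := charP_of_natCast_eq_zero h
  have hF : ∀ a : A, WittVector.frobenius (WittVector.teichmuller p a) =
      WittVector.teichmuller p (a ^ p) := fun a => by
    rw [WittVector.frobenius_eq_map_frobenius, WittVector.map_teichmuller]
    rfl
  have key : ∀ (a : A) (x : WittVector p A), WittVector.teichmuller p a * x =
      WittVector.teichmuller p (a * x.coeff 0) + WittVector.verschiebung
        (WittVector.teichmuller p (a ^ p) * WittVector.mk p fun i => x.coeff (i + 1)) := by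
    intro a x
    conv_lhs => rw [teichmuller_add_verschiebung x]
    rw [mul_add, ← map_mul, ← hF, mul_comm (WittVector.frobenius _),
      WittVector.verschiebung_mul_frobenius, mul_comm (WittVector.verschiebung _)]
  have key' : ∀ (a : A) (y : WittVector p A) i, (WittVector.teichmuller p a +
      WittVector.verschiebung y).coeff i = (WittVector.teichmuller p a).coeff i +
      (WittVector.verschiebung y).coeff i := fun a y i =>
    WittVector.coeff_add_of_disjoint _ _ _ (by
      rintro (_ | n)
      · exact Or.inr (WittVector.verschiebung_coeff_zero _)
      · exact Or.inl (WittVector.teichmuller_coeff_pos p _ _ n.succ_pos))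
  induction i generalizing a x with
  | zero => rw [key, key', WittVector.teichmuller_coeff_zero, WittVector.verschiebung_coeff_zero,
      add_zero, pow_zero, pow_one]
  | succ i ih =>
    rw [key, key', WittVector.teichmuller_coeff_pos p _ _ i.succ_pos,
      WittVector.verschiebung_coeff_succ, ih, zero_add, WittVector.coeff_mk, ← pow_mul, pow_succ']

lemma coeff_teich_mul (h : (p : A) = 0) {s : ℕ} (a : A) (x : TruncatedWittVector p s A) (i : Fin s) :
    (teich p s a * x).coeff i = a ^ p ^ (i : ℕ) * x.coeff i := by
  obtain ⟨x, rfl⟩ := WittVector.truncate_surjective p s A x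
  change (WittVector.truncate s (WittVector.teichmuller p a) * _).coeff i = _
  rw [← map_mul, WittVector.coeff_truncate, WittVector.coeff_truncate, coeff_teichmuller_mul h]

end TeichmullerCoeff

/-! ### Quasi-coherence of Witt vector sheaves, syzygies and twisted sums. -/

section QuasiCoherence

variable {p : ℕ} [Fact p.Prime] {G : Type w} [Group G] [TopologicalSpace G] {X : GScheme.{u} p G}

lemma O_res {U V : X.S.Opens} (h : V ≤ U) (x : X.O.obj U) :
    X.O.res h x = (X.S.presheaf.map (homOfLE h).op).hom x := O_act_one h x

lemma exists_pow_mul_eq_zero_of_res {U : X.S.Opens} (hU : IsAffineOpen U) (f x : X.O.obj U)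
    (hx : X.O.res (GScheme.basicOpen_le f) x = 0) : ∃ k : ℕ, f ^ k * x = 0 := by
  rw [O_res] at hx
  exact exists_pow_mul_eq_zero_of_res_basicOpen_eq_zero_of_isAffineOpen X.S hU x f hx

lemma exists_res_eq_pow_mul {U : X.S.Opens} (hU : IsAffineOpen U) (f : X.O.obj U)
    (y : X.O.obj (X.basicOpen f)) : ∃ (k : ℕ) (x : X.O.obj U),
    X.O.res (GScheme.basicOpen_le f) x = X.O.res (GScheme.basicOpen_le f) f ^ k * y := by
  obtain ⟨k, x, h⟩ := exists_eq_pow_mul_of_isAffineOpen X.S U hU f y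
  refine ⟨k, x, (O_res _ _).trans (Eq.trans h ?_)⟩
  rw [O_res]
  rfl

lemma GScheme.coeff_teich_mul {r : ℕ} {U : X.S.Opens} (a : X.O.obj U) (x : (X.W r).obj U)
    (i : Fin r) : X.coeff i (X.teich r a * x) = a ^ p ^ (i : ℕ) * X.coeff i x :=
  WittLift.coeff_teich_mul (X.char_obj U) a x i

lemma GScheme.res_teich (r : ℕ) {U V : X.S.Opens} (h : V ≤ U) (a : X.O.obj U) :
    (X.W r).res h (X.teich r a) = X.teich r (X.O.res h a) :=
  X.teich_act r 1 _ a

lemma GScheme.coeff_res {r : ℕ} {U V : X.S.Opens} (h : V ≤ U) (x : (X.W r).obj U) (i : Fin r) :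
    X.coeff i ((X.W r).res h x) = X.O.res h (X.coeff i x) :=
  X.coeff_act 1 _ x i

/-- Multiplication by `[f]^k` multiplies the `i`-th component by `f^{k p^i}`, with `p^i ≥ 1`; so the
sum of the exponents that work for the components of `x` works for `x`. -/
lemma W_exists_pow_mul_eq_zero {r : ℕ} {U : X.S.Opens} (hU : IsAffineOpen U) (f : X.O.obj U)
    (x : (X.W r).obj U) (hx : (X.W r).res (GScheme.basicOpen_le f) x = 0) :
    ∃ k : ℕ, X.teich r f ^ k * x = 0 := by
  choose k hk using fun i => exists_pow_mul_eq_zero_of_res hU f (X.coeff i x) (by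
    rw [← GScheme.coeff_res, hx]
    exact TruncatedWittVector.coeff_zero p r _ i)
  refine ⟨∑ i, k i, GScheme.W_ext fun i => ?_⟩
  rw [← _root_.map_pow, GScheme.coeff_teich_mul, ← pow_mul]
  have h1 : k i ≤ (∑ i, k i) * p ^ (i : ℕ) :=
    (Finset.single_le_sum (fun _ _ => Nat.zero_le _) (Finset.mem_univ i)).trans
      (Nat.le_mul_of_pos_right _ (pow_pos (Fact.out : p.Prime).pos _))
  obtain ⟨m, hm⟩ := Nat.exists_eq_add_of_le h1
  rw [hm, add_comm, pow_add, mul_assoc, hk, mul_zero]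
  exact (TruncatedWittVector.coeff_zero p r _ i).symm

lemma W_exists_res_eq {r : ℕ} {U : X.S.Opens} (hU : IsAffineOpen U) (f : X.O.obj U)
    (y : (X.W r).obj (X.basicOpen f)) : ∃ (k : ℕ) (x : (X.W r).obj U),
    (X.W r).res (GScheme.basicOpen_le f) x =
      (X.W r).res (GScheme.basicOpen_le f) (X.teich r f) ^ k * y := by
  choose k x hx using fun i => exists_res_eq_pow_mul hU f (X.coeff i y)
  have h1 : ∀ i : Fin r, ∃ m, (∑ i, k i) * p ^ (i : ℕ) = m + k i := fun i => by
    have h1 : k i ≤ (∑ i, k i) * p ^ (i : ℕ) :=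
      (Finset.single_le_sum (fun _ _ => Nat.zero_le _) (Finset.mem_univ i)).trans
        (Nat.le_mul_of_pos_right _ (pow_pos (Fact.out : p.Prime).pos _))
    exact ⟨_, (Nat.sub_add_cancel h1).symm⟩
  choose m hm using h1
  -- The powers `f ^ m i` raise the exponent `k i` of each component to the prescribed value `(∑ k)
  -- p^i`.
  refine ⟨∑ i, k i, X.wmk fun i => f ^ m i * x i, GScheme.W_ext fun i => ?_⟩
  rw [GScheme.coeff_res, GScheme.coeff_wmk, GScheme.res_teich, ← _root_.map_pow,
    GScheme.coeff_teich_mul, ← pow_mul, hm, pow_add, mul_assoc, ← hx, _root_.map_mul,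
    _root_.map_pow]

lemma WMod_isQCoh (r : ℕ) : (X.WMod r).IsQCoh := fun U hU f =>
  ⟨W_exists_pow_mul_eq_zero hU f, W_exists_res_eq hU f⟩

lemma FinTorsor.P_isQCoh (D : FinTorsor G) (r n : ℕ) : (D.P X r n).IsQCoh := by
  intro U hU f
  refine ⟨fun x hx => ?_, fun y => ?_⟩
  · choose k hk using fun z => W_exists_pow_mul_eq_zero hU f (x z) (by
      rw [← D.P_res, hx]
      rfl)
    refine ⟨∑ z, k z, funext fun z => ?_⟩
    obtain ⟨m, hm⟩ := Nat.exists_eq_add_of_le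
      (Finset.single_le_sum (fun _ _ => Nat.zero_le _) (Finset.mem_univ z) : k z ≤ ∑ z, k z)
    rw [D.P_smul, hm, add_comm, pow_add, mul_assoc, hk, mul_zero]
    rfl
  · choose k x hx using fun z => W_exists_res_eq hU f (y z)
    have h1 : ∀ z, ∃ m, ∑ z, k z = m + k z := fun z => by
      have h1 : k z ≤ ∑ z, k z := Finset.single_le_sum (fun _ _ => Nat.zero_le _) (Finset.mem_univ z)
      exact ⟨_, (Nat.sub_add_cancel h1).symm⟩
    choose m hm using h1
    refine ⟨∑ z, k z, fun z => X.teich r f ^ m z * x z, funext fun z => ?_⟩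
    refine (D.P_res _ _ z).trans ?_
    refine (_root_.map_mul ((X.W r).res _) _ _).trans ?_
    rw [D.P_smul, hm z, pow_add, mul_assoc, ← hx, _root_.map_pow]

lemma GMod.ker_isQCoh {r : ℕ} {M N : GMod (X.W r)} (f : GMod.Hom (GRing.Hom.id _) M N)
    (hM : M.IsQCoh) (hN : N.IsQCoh) : (GMod.ker f).IsQCoh := by
  intro U hU a
  refine ⟨fun x hx => ?_, fun y => ?_⟩
  · obtain ⟨k, hk⟩ := (hM U hU a).1 x.1 (congrArg Subtype.val hx)
    exact ⟨k, Subtype.ext hk⟩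
  · obtain ⟨k, x, hx⟩ := (hM U hU a).2 y.1
    -- The extension `x` of a multiple of `y` need not lie in the kernel, but its image vanishes on
    -- the basic open and is killed by a further power.
    obtain ⟨l, hl⟩ := (hN U hU a).1 (f.app U x) (by
      have h' : f.app _ y.1 = 0 := y.2
      rw [← f.app_res, hx, f.app_smul, h', smul_zero])
    refine ⟨l + k, ⟨X.teich r a ^ l • x, (f.app_smul U _ x).trans hl⟩, Subtype.ext ?_⟩
    refine (M.res_smul (GScheme.basicOpen_le a) _ _).trans ?_
    change _ = _ ^ (l + k) • y.1
    rw [hx, _root_.map_pow, ← mul_smul, ← pow_add]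

lemma GMod.Twisting.isQCoh {r : ℕ} {B C : GMod (X.W r)} (t : GMod.Twisting B C)
    (hB : B.IsQCoh) (hC : C.IsQCoh) : t.obj.IsQCoh := by
  intro U hU a
  refine ⟨fun x hx => ?_, fun y => ?_⟩
  · rw [t.res_apply] at hx
    obtain ⟨k, hk⟩ := (hB U hU a).1 x.1 (congrArg Prod.fst hx)
    obtain ⟨l, hl⟩ := (hC U hU a).1 x.2 (congrArg Prod.snd hx)
    refine ⟨k + l, Prod.ext ?_ ?_⟩
    · change X.teich r a ^ (k + l) • x.1 = 0
      rw [add_comm, pow_add, mul_smul, hk, smul_zero]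
    · change X.teich r a ^ (k + l) • x.2 = 0
      rw [pow_add, mul_smul, hl, smul_zero]
  · obtain ⟨k, x, hx⟩ := (hB U hU a).2 y.1
    obtain ⟨l, z, hz⟩ := (hC U hU a).2 y.2
    refine ⟨k + l, (X.teich r a ^ l • x, X.teich r a ^ k • z), ?_⟩
    refine (t.res_apply _ _).trans (Prod.ext ?_ ?_)
    · refine (B.res_smul (GScheme.basicOpen_le a) _ _).trans ?_
      change _ = _ ^ (k + l) • y.1
      rw [hx, _root_.map_pow, ← mul_smul, ← pow_add, add_comm]
    · refine (C.res_smul (GScheme.basicOpen_le a) _ _).trans ?_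
      change _ = _ ^ (k + l) • y.2
      rw [hz, _root_.map_pow, ← mul_smul, ← pow_add]

lemma FinTorsor.Z_isQCoh (D : FinTorsor G) (r : ℕ) : ∀ n, (D.Z X r n).IsQCoh
  | 0 => WMod_isQCoh r
  | n + 1 => GMod.ker_isQCoh _ (D.P_isQCoh r _) (D.P_isQCoh r _)

end QuasiCoherence

/-! ### Quasi-coherence of Teichmüller lifts of line bundles. -/

section TeichQuasiCoherence

variable {p : ℕ} [Fact p.Prime] {G : Type w} [Group G] [TopologicalSpace G] {X : GScheme.{u} p G}

namespace GMod

section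

variable {L : GMod X.O} {r k : ℕ} {V : X.S.Opens} {ℓ : L.obj V}

lemma IsGen.exists_smul (hℓ : L.IsGen ℓ) {V' : X.S.Opens} (h : V' ≤ V) {ℓ' : L.obj V'}
    (hℓ' : L.IsGen ℓ') : ∃ a b : X.O.obj V', ℓ' = a • L.res h ℓ ∧ L.res h ℓ = b • ℓ' ∧ a * b = 1 := by
  obtain ⟨a, ha⟩ := (hℓ V' h).2 ℓ'
  obtain ⟨b, hb⟩ := (hℓ' V' le_rfl).2 (L.res h ℓ)
  simp only [L.res_self] at ha hb
  refine ⟨a, b, ha.symm, hb.symm, (hℓ V' h).1 ?_⟩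
  change (a * b) • L.res h ℓ = (1 : X.O.obj V') • L.res h ℓ
  rw [mul_comm, mul_smul, one_smul, ha, hb]

/-- A section of the Teichmüller lift is determined by its coordinate in a generator. -/
lemma teichSections_ext (hℓ : L.IsGen ℓ) {σ σ' : L.teichSections r k V}
    (h : σ.1 ⟨V, le_rfl, ℓ, hℓ⟩ = σ'.1 ⟨V, le_rfl, ℓ, hℓ⟩) : σ = σ' := by
  refine Subtype.ext <| funext fun q => ?_
  obtain ⟨a, b, ha, hb, hab⟩ := hℓ.exists_smul q.le q.isGen
  have key : ∀ τ : L.teichSections r k V,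
      τ.1 q = X.teich r b ^ k * (X.W r).res q.le (τ.1 ⟨V, le_rfl, ℓ, hℓ⟩) := by
    intro τ
    rw [← τ.2 ⟨V, le_rfl, ℓ, hℓ⟩ q q.le a ha, ← mul_assoc, ← mul_pow, ← _root_.map_mul, mul_comm b,
      hab, _root_.map_one, one_pow, one_mul]
  rw [key, key, h]

/-- Sections of the Teichmüller lift with a given coordinate in a generator. -/
lemma exists_teichSections (hℓ : L.IsGen ℓ) (y : (X.W r).obj V) :
    ∃ σ : L.teichSections r k V, σ.1 ⟨V, le_rfl, ℓ, hℓ⟩ = y := by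
  choose a b ha hb hab using fun q : L.Gens V => hℓ.exists_smul q.le q.isGen
  refine ⟨⟨fun q => X.teich r (b q) ^ k * (X.W r).res q.le y, fun q q' h c hc => ?_⟩, ?_⟩
  · have h1 : c * b q' = X.O.res h (b q) := by
      have e1 : L.res q'.le ℓ = X.O.res h (b q) • L.res h q.ℓ := by
        have := congrArg (L.res h) (hb q)
        rw [L.res_res, L.res_smul] at this
        exact this
      refine (q.isGen.res h q'.V le_rfl).1 ?_
      change (c * b q') • L.res le_rfl (L.res h q.ℓ) = X.O.res h (b q) • L.res le_rfl (L.res h q.ℓ)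
      rw [L.res_self, mul_comm, mul_smul, ← hc, ← hb, e1]
    rw [_root_.map_mul, _root_.map_pow, GScheme.res_teich, ← h1, GRing.res_res, ← mul_assoc,
      ← mul_pow, ← _root_.map_mul]
  · have h1 : b ⟨V, le_rfl, ℓ, hℓ⟩ = 1 := by
      refine (hℓ V le_rfl).1 ?_
      have := hb ⟨V, le_rfl, ℓ, hℓ⟩
      change b ⟨V, le_rfl, ℓ, hℓ⟩ • L.res le_rfl ℓ = (1 : X.O.obj V) • L.res le_rfl ℓ
      rw [one_smul, L.res_self] at *
      exact this.symm
    change X.teich r (b ⟨V, le_rfl, ℓ, hℓ⟩) ^ k * (X.W r).res le_rfl y = y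
    rw [h1, _root_.map_one, one_pow, one_mul, GRing.res_self]

end

/-- The condition in the definition of quasi-coherence, for one affine open. -/
def QCohAt {r : ℕ} (M : GMod (X.W r)) (U : X.S.Opens) : Prop := ∀ f : X.O.obj U,
    (∀ x : M.obj U, M.res (GScheme.basicOpen_le f) x = 0 → ∃ k : ℕ, (X.teich r f) ^ k • x = 0) ∧
    (∀ y : M.obj (X.basicOpen f), ∃ (k : ℕ) (x : M.obj U), M.res (GScheme.basicOpen_le f) x =
      (X.W r).res (GScheme.basicOpen_le f) (X.teich r f) ^ k • y)

/-- A generator identifies the lift over `V` with `W_r(O)`, by taking the coordinate at the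
generator, compatibly with restriction. -/
lemma teichLift_qcohAt {L : GMod X.O} (r k : ℕ) {V : X.S.Opens} (hV : IsAffineOpen V) {ℓ : L.obj V}
    (hℓ : L.IsGen ℓ) : (L.teichLift r k).QCohAt V := by
  intro f
  have hres : ∀ σ : L.teichSections r k V, ((L.teichLift r k).res (GScheme.basicOpen_le f) σ).1
      ⟨X.basicOpen f, le_rfl, L.res (GScheme.basicOpen_le f) ℓ, hℓ.res _⟩ =
      (X.W r).res (GScheme.basicOpen_le f) (σ.1 ⟨V, le_rfl, ℓ, hℓ⟩) := fun σ => by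
    refine (teichAct_one_apply (GScheme.basicOpen_le f) σ _).trans ?_
    exact teichSections_res σ ⟨V, le_rfl, ℓ, hℓ⟩ _ (GScheme.basicOpen_le f) rfl
  refine ⟨fun σ hσ => ?_, fun y => ?_⟩
  · obtain ⟨m, hm⟩ := W_exists_pow_mul_eq_zero hV f (σ.1 ⟨V, le_rfl, ℓ, hℓ⟩) (by
      refine (hres σ).symm.trans ?_
      rw [hσ]
      rfl)
    refine ⟨m, teichSections_ext hℓ ?_⟩
    refine (smul_teichSections (X.teich r f ^ m) σ ⟨V, le_rfl, ℓ, hℓ⟩).trans ?_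
    rw [GRing.res_self, hm]
    rfl
  · obtain ⟨m, x, hx⟩ := W_exists_res_eq hV f
      (y.1 ⟨X.basicOpen f, le_rfl, L.res (GScheme.basicOpen_le f) ℓ, hℓ.res _⟩)
    obtain ⟨σ, hσ⟩ := exists_teichSections (k := k) hℓ x
    refine ⟨m, σ, teichSections_ext (hℓ.res (GScheme.basicOpen_le f)) ?_⟩
    rw [hres, hσ, hx]
    refine Eq.trans ?_ (smul_teichSections ((X.W r).res (GScheme.basicOpen_le f)
      (X.teich r f) ^ m) y ⟨X.basicOpen f, le_rfl, _, hℓ.res _⟩).symm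
    rw [GRing.res_self]

lemma basicOpen_res {U V : X.S.Opens} (h : V ≤ U) (f : X.O.obj U) :
    X.basicOpen (X.O.res h f) = V ⊓ X.basicOpen f := by
  rw [O_res]
  exact Scheme.basicOpen_res X.S (U := U) (V := V) f (homOfLE h).op

/-- Quasi-coherence may be checked locally. -/
lemma qcohAt_of_cover {r : ℕ} (M : GMod (X.W r)) {U : X.S.Opens} {ι : Type u} [Finite ι]
    (V : ι → X.S.Opens) (hV : ∀ i, V i ≤ U) (hc : ∀ t ∈ U, ∃ i, t ∈ V i)
    (h1 : ∀ i, M.QCohAt (V i)) (h2 : ∀ i j, M.QCohAt (V i ⊓ V j)) : M.QCohAt U := by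
  have := Fintype.ofFinite ι
  intro f
  have hle : ∀ {W : X.S.Opens} (h : W ≤ U), X.basicOpen (X.O.res h f) ≤ X.basicOpen f := fun h => by
    rw [basicOpen_res]
    exact inf_le_right
  have hexp : ∀ k : ι → ℕ, ∀ i, ∃ m, ∑ i, k i = m + k i := fun k i => by
    have h1 : k i ≤ ∑ i, k i := Finset.single_le_sum (fun _ _ => Nat.zero_le _) (Finset.mem_univ i)
    exact ⟨_, (Nat.sub_add_cancel h1).symm⟩
  have hzero : ∀ {W : X.S.Opens} (h : W ≤ U) (hW : M.QCohAt W) (x : M.obj W),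
      M.res (GScheme.basicOpen_le (X.O.res h f)) x = 0 → ∃ m : ℕ, X.teich r (X.O.res h f) ^ m • x = 0 :=
    fun h hW x => (hW (X.O.res h f)).1 x
  refine ⟨fun x hx => ?_, fun y => ?_⟩
  · choose k hk using fun i => hzero (hV i) (h1 i) (M.res (hV i) x) (by
      rw [M.res_res, ← M.res_res (hle (hV i)) (GScheme.basicOpen_le f), hx, _root_.map_zero])
    refine ⟨∑ i, k i, M.sep _ _ fun t ht => ?_⟩
    obtain ⟨i, hi⟩ := hc t ht
    refine ⟨V i, hV i, hi, ?_⟩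
    change M.res (hV i) _ = M.res (hV i) _
    obtain ⟨m, hm⟩ := hexp k i
    rw [M.res_smul, _root_.map_pow, GScheme.res_teich, hm, pow_add, mul_smul, hk, smul_zero,
      _root_.map_zero]
  · choose k x hx using fun i => (h1 i (X.O.res (hV i) f)).2 (M.res (hle (hV i)) y)
    choose m hm using hexp k
    -- The cover being finite, one exponent serves for all its members; after this the local
    -- extensions `x' i` all restrict to the same multiple of `y`.
    set k₀ := ∑ i, k i
    obtain ⟨x', hxe⟩ : ∃ x' : ∀ i, M.obj (V i), ∀ i, x' i = X.teich r (X.O.res (hV i) f) ^ m i • x i :=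
      ⟨_, fun i => rfl⟩
    have hx' : ∀ i, M.res (GScheme.basicOpen_le (X.O.res (hV i) f)) (x' i) =
        M.res (hle (hV i)) ((X.W r).res (GScheme.basicOpen_le f) (X.teich r f) ^ k₀ • y) := by
      intro i
      rw [hxe, M.res_smul, hx, ← mul_smul, M.res_smul, _root_.map_pow, ← pow_add, _root_.map_pow, ← hm,
        GRing.res_res, GScheme.res_teich, GScheme.res_teich, GRing.res_res]
    have hij : ∀ i j, ∃ l : ℕ, X.teich r (X.O.res (inf_le_left.trans (hV i) : V i ⊓ V j ≤ U) f) ^ l •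
        (M.res (inf_le_left : V i ⊓ V j ≤ V i) (x' i) - M.res inf_le_right (x' j)) = 0 := by
      intro i j
      have hW : V i ⊓ V j ≤ U := inf_le_left.trans (hV i)
      have hWi : X.basicOpen (X.O.res hW f) ≤ X.basicOpen (X.O.res (hV i) f) := by
        rw [basicOpen_res, basicOpen_res]
        exact inf_le_inf_right _ inf_le_left
      have hWj : X.basicOpen (X.O.res hW f) ≤ X.basicOpen (X.O.res (hV j) f) := by
        rw [basicOpen_res, basicOpen_res]
        exact inf_le_inf_right _ inf_le_right
      refine hzero hW (h2 i j) _ ?_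
      rw [_root_.map_sub, M.res_res, M.res_res, ← M.res_res hWi (GScheme.basicOpen_le _),
        ← M.res_res hWj (GScheme.basicOpen_le _), hx', hx', M.res_res, M.res_res, sub_self]
    choose l hl using hij
    -- The local extensions agree only over the basic open. One common further power of `[f]` makes
    -- them agree on all pairwise intersections, so that they glue.
    have hl' : ∀ i j, X.teich r (X.O.res (inf_le_left.trans (hV i) : V i ⊓ V j ≤ U) f) ^
        (∑ i, ∑ j, l i j) •
        (M.res (inf_le_left : V i ⊓ V j ≤ V i) (x' i) - M.res inf_le_right (x' j)) = 0 := by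
      intro i j
      have h3 : l i j ≤ ∑ i, ∑ j, l i j :=
        (Finset.single_le_sum (f := fun j => l i j) (fun _ _ => Nat.zero_le _) (Finset.mem_univ j)).trans
          (Finset.single_le_sum (f := fun i => ∑ j, l i j) (fun _ _ => Nat.zero_le _) (Finset.mem_univ i))
      rw [← Nat.sub_add_cancel h3, pow_add, mul_smul, hl, smul_zero]
    set l₀ := ∑ i, ∑ j, l i j
    obtain ⟨z, hz⟩ := M.glue V hV hc (fun i => X.teich r (X.O.res (hV i) f) ^ l₀ • x' i) (by
      intro i j W hi hj
      change M.res hi _ = M.res hj _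
      have h3 := congrArg (M.res (le_inf hi hj)) (hl' i j)
      rw [_root_.map_zero, M.res_smul, _root_.map_sub, M.res_res, M.res_res, smul_sub, sub_eq_zero,
        _root_.map_pow, GScheme.res_teich, GRing.res_res] at h3
      rw [M.res_smul, M.res_smul, _root_.map_pow, _root_.map_pow, GScheme.res_teich,
        GScheme.res_teich, GRing.res_res, GRing.res_res]
      exact h3)
    refine ⟨l₀ + k₀, z, M.sep _ _ fun t ht => ?_⟩
    obtain ⟨i, hi⟩ := hc t (GScheme.basicOpen_le f ht)
    refine ⟨_, hle (hV i), ?_, ?_⟩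
    · rw [basicOpen_res]
      exact ⟨hi, ht⟩
    · change M.res (hle (hV i)) _ = M.res (hle (hV i)) _
      have h3 : M.res (hV i) z = _ := hz i
      rw [M.res_res, ← M.res_res (GScheme.basicOpen_le _) (hV i), h3, M.res_smul, hx', pow_add,
        mul_smul, M.res_smul _ (_ ^ l₀), _root_.map_pow, _root_.map_pow, GScheme.res_teich,
        GScheme.res_teich, GScheme.res_teich, GRing.res_res, GRing.res_res]

end GMod

/-- An affine open is a finite union of basic opens on which `L` has a generator. Their pairwise
intersections are basic opens of products, hence again affine with a generator. -/
lemma LineBundle.teichLift_isQCoh (L : LineBundle X) (r k : ℕ) : (L.teichLift r k).IsQCoh := by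
  intro U hU
  have h1 : ∀ t : U, ∃ f : X.O.obj U, t.1 ∈ X.basicOpen f ∧
      ∃ ℓ : L.obj (X.basicOpen f), L.IsGen ℓ := by
    intro t
    obtain ⟨V, ht, ℓ, hℓ⟩ := L.locallyFree t
    obtain ⟨f, hf, htf⟩ := hU.exists_basicOpen_le ⟨t.1, ht⟩ t.2
    exact ⟨f, htf, L.res hf ℓ, hℓ.res hf⟩
  choose f hf ℓ hℓ using h1
  obtain ⟨s, hs⟩ := hU.isCompact.elim_finite_subcover (fun t : U => (X.basicOpen (f t) : Set X.S))
    (fun t => (X.basicOpen (f t)).2) fun t ht => Set.mem_iUnion.2 ⟨⟨t, ht⟩, hf ⟨t, ht⟩⟩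
  refine GMod.qcohAt_of_cover _ (ι := s) (fun i => X.basicOpen (f i))
    (fun i => GScheme.basicOpen_le _) (fun t ht => ?_)
    (fun i => GMod.teichLift_qcohAt r k (hU.basicOpen (f i)) (hℓ i)) fun i j => ?_
  · obtain ⟨i, hi, hti⟩ := Set.mem_iUnion₂.1 (hs ht)
    exact ⟨⟨i, hi⟩, hti⟩
  · refine GMod.teichLift_qcohAt r k ?_ ((hℓ i).res (inf_le_left : _ ⊓ X.basicOpen (f j) ≤ _))
    exact (Scheme.basicOpen_mul X.S (U := U) (f i) (f j)) ▸ hU.basicOpen _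

/-- The twist leaves the restriction maps unchanged, since they are the action of the identity, on
which the character is trivial. -/
lemma LineBundle.coef_isQCoh [IsTopologicalGroup G] (L : LineBundle X) {N : ℕ∞} (T : CycChar p N G)
    (n s : ℕ) (hs : (s : ℕ∞) ≤ N) (k : ℕ) : (L.coef T n s hs k).IsQCoh := by
  have key : ∀ {U V : X.S.Opens} (h : V ≤ U) (x : (L.teichLift s k).obj U),
      (L.coef T n s hs k).res h x = (L.teichLift s k).res h x := by
    intro U V h x
    refine (smul_congr_of_smul_eq_zero ((L.teichLift s k).pow_smul_eq_zero _) (b := 1) ?_).trans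
      (one_smul _ _)
    rw [natCast_val, _root_.map_one, Units.val_one, Nat.cast_one]
  intro U hU f
  obtain ⟨h1, h2⟩ := L.teichLift_isQCoh s k U hU f
  refine ⟨fun x hx => h1 x ((key _ x).symm.trans hx), fun y => ?_⟩
  obtain ⟨m, x, hx⟩ := h2 y
  exact ⟨m, x, (key _ x).trans hx⟩

end TeichQuasiCoherence

/-! ### Extensions attached to cocycles of a finite quotient. -/

section CanonicalExtension

variable {p : ℕ} [Fact p.Prime] {G : Type w} [Group G] [TopologicalSpace G] {X : GScheme.{u} p G}

namespace FinTorsor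

variable (D : FinTorsor G) {r : ℕ}

/-- The short exact sequences of the standard resolution. -/
def ses (X : GScheme.{u} p G) (r n : ℕ) : SES (D.Z X r (n + 1)) (D.Z X r n) where
  M := D.P X r (n + 1)
  qcoh := D.P_isQCoh r _
  ι := D.j X r (n + 1)
  π := D.π X r n
  inj := D.j_injective (n + 1)
  exact U x := ⟨fun h => D.exists_j_eq h, by
    rintro ⟨z, rfl⟩
    exact D.π_j U z⟩
  surj U c t ht := ⟨U, le_rfl, (D.σ X r n).app U c, ht, by rw [π_σ, GMod.res_self]⟩

lemma ses_isSplit (n : ℕ) : (D.ses X r n).IsSplit :=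
  ⟨fun U => { toFun := (D.σ X r n).app U
              map_add' := map_add _
              map_smul' := (D.σ X r n).app_smul U }, fun U V h c => (D.σ X r n).app_res h c,
    fun U c => D.π_σ U c⟩

/-- The standard resolution, as an extension of `W_r(O_X)` by a syzygy. -/
def resolution (X : GScheme.{u} p G) (r : ℕ) : ∀ n, NExt (X.WMod r) n (D.Z X r n)
  | 0 => ⟨GMod.Hom.id _⟩
  | 1 => D.ses X r 0
  | n + 2 => ⟨⟨D.Z X r (n + 1), D.Z_isQCoh r _⟩, D.ses X r (n + 1), resolution X r (n + 1)⟩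

lemma resolution_isSGT : ∀ n, (D.resolution X r n).IsSGT
  | 0 => trivial
  | 1 => D.ses_isSplit 0
  | n + 2 => ⟨D.ses_isSplit _, resolution_isSGT (n + 1)⟩

/-- Homogeneous cocycles of the finite quotient group attached to `D`. -/
structure IsCocycle {B : GMod (X.W r)} {n : ℕ} (u : (Fin (n + 1) → D.Q) → B.obj ⊤) : Prop where
  smul : ∀ g x, u (g • x) = B.act g (GScheme.le_tr_top g ⊤) (u x)
  hδ_eq : ∀ x, hδ u x = 0

variable {D}

/-- The linear map on the syzygies attached to a cocycle, extended to functions. -/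
def θ {B : GMod (X.W r)} {n : ℕ} (u : (Fin (n + 2) → D.Q) → B.obj ⊤) :
    GMod.Lin (GRing.Hom.id _) (D.P X r (n + 1)) B :=
  (D.lam (GRing.Hom.id _) u).comp (D.h X r (n + 1))

lemma θ_apply {B : GMod (X.W r)} {n : ℕ} (u : (Fin (n + 2) → D.Q) → B.obj ⊤) (U : X.S.Opens)
    (f : (D.P X r (n + 1)).obj U) :
    (θ u).app U f = (D.lam (GRing.Hom.id _) u).app U ((D.h X r (n + 1)).app U f) := rfl

/-- On the basis this is the cocycle condition: the map defined by `u` kills boundaries. -/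
lemma IsCocycle.lam_d {B : GMod (X.W r)} {n : ℕ} {u : (Fin (n + 1) → D.Q) → B.obj ⊤}
    (hu : D.IsCocycle u) (U : X.S.Opens) (f : (D.P X r (n + 2)).obj U) :
    (D.lam (GRing.Hom.id _) u).app U ((D.d X r (n + 1)).app U f) = 0 := by
  refine lin_ext (A := (D.lam (GRing.Hom.id _) u).comp (D.d X r (n + 1)).lin)
    (A' := GMod.Lin.zero _ _ _) (fun x => ?_) U f
  change (D.lam (GRing.Hom.id _) u).app ⊤ ((D.d X r (n + 1)).app ⊤ (D.e X r x)) = 0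
  rw [d_e, map_hδ]
  simp only [lam_e]
  exact hu.hδ_eq x

/-- The contraction `h` is not equivariant, but for a cycle `f` both `h(g f)` and `g h(f)` have
boundary `g f`. Their difference is a cycle, hence a boundary, and is killed by the cocycle. -/
lemma IsCocycle.θ_act {B : GMod (X.W r)} {n : ℕ} {u : (Fin (n + 2) → D.Q) → B.obj ⊤}
    (hu : D.IsCocycle u) (g : G) {U V : X.S.Opens} (h : V ≤ X.tr g U)
    {f : (D.P X r (n + 1)).obj U} (hf : (D.d X r n).app U f = 0) :
    (θ u).app V ((D.P X r (n + 1)).act g h f) = B.act g h ((θ u).app U f) := by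
  rw [θ_apply, θ_apply, ← D.lam_act _ hu.smul, ← sub_eq_zero, ← map_sub]
  set z := (D.h X r (n + 1)).app V ((D.P X r (n + 1)).act g h f) -
    (D.P X r (n + 1 + 1)).act g h ((D.h X r (n + 1)).app U f) with hz
  have h1 := D.d_h_add_h_d V ((D.P X r (n + 1)).act g h f)
  have h2 := congrArg ((D.P X r (n + 1)).act g h) (D.d_h_add_h_d U f)
  rw [(D.d X r n).app_act, hf, map_zero, map_zero, add_zero] at h1
  rw [hf, map_zero, add_zero] at h2
  have h3 : (D.d X r (n + 1)).app V z = 0 := by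
    rw [hz, map_sub, (D.d X r (n + 1)).app_act, h1, h2, sub_self]
  have h4 := D.d_h_add_h_d V z
  rw [h3, map_zero, add_zero] at h4
  rw [← h4, hu.lam_d]

variable (D) in
/-- The failure of equivariance of the section of the projection to a syzygy. -/
def defect (X : GScheme.{u} p G) (r n : ℕ) (g : G) {U V : X.S.Opens} (h : V ≤ X.tr g U) :
    (D.Z X r n).obj U →+ (D.P X r (n + 1)).obj V :=
  ((D.P X r (n + 1)).act g h).comp ((D.σ X r n).app U) -
    ((D.σ X r n).app V).comp ((D.Z X r n).act g h)

lemma defect_apply {n : ℕ} (g : G) {U V : X.S.Opens} (h : V ≤ X.tr g U) (z : (D.Z X r n).obj U) :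
    D.defect X r n g h z = (D.P X r (n + 1)).act g h ((D.σ X r n).app U z) -
      (D.σ X r n).app V ((D.Z X r n).act g h z) := rfl

/-- The projection to the syzygy is equivariant, so two lifts of the same element differ by a cycle.
This is what allows `θ_act` to be applied to the defect. -/
lemma d_defect {n : ℕ} (g : G) {U V : X.S.Opens} (h : V ≤ X.tr g U) (z : (D.Z X r n).obj U) :
    (D.d X r n).app V (D.defect X r n g h z) = 0 := by
  rw [defect_apply, ← D.j_π, map_sub, (D.π X r n).app_act, D.π_σ, D.π_σ, sub_self, map_zero]

lemma defect_smul {n : ℕ} (g : G) {U V : X.S.Opens} (h : V ≤ X.tr g U) (a : (X.W r).obj U)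
    (z : (D.Z X r n).obj U) :
    D.defect X r n g h (a • z) = (X.W r).act g h a • D.defect X r n g h z := by
  have h1 : (D.σ X r n).app U (a • z) = a • (D.σ X r n).app U z := (D.σ X r n).app_smul U a z
  have h2 : (D.σ X r n).app V ((X.W r).act g h a • (D.Z X r n).act g h z) =
    (X.W r).act g h a • (D.σ X r n).app V ((D.Z X r n).act g h z) := (D.σ X r n).app_smul V _ _
  rw [defect_apply, defect_apply, h1, GMod.act_smul, GMod.act_smul, h2, smul_sub]

lemma defect_one {n : ℕ} {g : G} {U V : X.S.Opens} (h : V ≤ X.tr g U) (h' : V ≤ U)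
    (z : (D.Z X r n).obj U)
    (h1 : (D.P X r (n + 1)).act g h ((D.σ X r n).app U z) =
      (D.P X r (n + 1)).res h' ((D.σ X r n).app U z))
    (h2 : (D.Z X r n).act g h z = (D.Z X r n).res h' z) :
    D.defect X r n g h z = 0 := by
  rw [defect_apply, h1, h2, (D.σ X r n).app_res, sub_self]

lemma defect_mul {n : ℕ} (g g' : G) {U V W : X.S.Opens} (h : V ≤ X.tr g U) (h' : U ≤ X.tr g' W)
    (z : (D.Z X r n).obj W) :
    D.defect X r n (g * g') (GScheme.le_tr_mul h h') z =
      (D.P X r (n + 1)).act g h (D.defect X r n g' h' z) +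
        D.defect X r n g h ((D.Z X r n).act g' h' z) := by
  rw [defect_apply, defect_apply, defect_apply, map_sub ((D.P X r (n + 1)).act g h), GMod.act_act,
    GMod.act_act, sub_add_sub_cancel]

/-- The twisting attached to a cocycle. -/
def IsCocycle.twisting {B : GMod (X.W r)} {n : ℕ} {u : (Fin (n + 2) → D.Q) → B.obj ⊤}
    (hu : D.IsCocycle u) : GMod.Twisting B (D.Z X r n) where
  τ g U V h := ((θ u).app V).comp (D.defect X r n g h)
  τ_smul g U V h a z :=
    (congrArg ((θ u).app V) (defect_smul g h a z)).trans ((θ u).app_smul V _ _)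
  τ_one {U V} h z := (congrArg ((θ u).app V) (defect_one h (GScheme.le_of_le_tr_one h) z rfl
    rfl)).trans (map_zero _)
  τ_mul g g' U V W h h' z := (congrArg ((θ u).app V) (defect_mul g g' h h' z)).trans
    ((map_add ((θ u).app V) _ _).trans (congrArg (· + _) (hu.θ_act g h (d_defect g' h' z))))
  naive := by
    obtain ⟨K, hK⟩ := (D.P X r (n + 1)).naive
    obtain ⟨K', hK'⟩ := (D.Z X r n).naive
    exact ⟨K ⊓ K', fun g hg U V h h' z => (congrArg ((θ u).app V) (defect_one h h' z
      (hK g hg.1 h h' _) (hK' g hg.2 h h' _))).trans (map_zero _)⟩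

lemma IsCocycle.τ_apply {B : GMod (X.W r)} {n : ℕ} {u : (Fin (n + 2) → D.Q) → B.obj ⊤}
    (hu : D.IsCocycle u) (g : G) {U V : X.S.Opens} (h : V ≤ X.tr g U) (z : (D.Z X r n).obj U) :
    hu.twisting.τ g h z = (θ u).app V (D.defect X r n g h z) := rfl

/-- The short exact sequence attached to a cocycle: the pushout of the standard one. -/
def IsCocycle.ses {B : GMod (X.W r)} (hB : B.IsQCoh) {n : ℕ} {u : (Fin (n + 2) → D.Q) → B.obj ⊤}
    (hu : D.IsCocycle u) : SES B (D.Z X r n) where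
  M := hu.twisting.obj
  qcoh := hu.twisting.isQCoh hB (D.Z_isQCoh r n)
  ι :=
    { app := fun U => AddMonoidHom.inl (B.obj U) ((D.Z X r n).obj U)
      app_smul := fun U a b => Prod.ext rfl (smul_zero _).symm
      app_act := fun g U V h b => Prod.ext (by
        change B.act g h b = B.act g h b + hu.twisting.τ g h 0
        rw [map_zero, add_zero]) (map_zero ((D.Z X r n).act g h)).symm }
  π :=
    { app := fun U => AddMonoidHom.snd (B.obj U) ((D.Z X r n).obj U)
      app_smul := fun U a b => rfl
      app_act := fun g U V h b => rfl }
  inj U b b' h := congrArg Prod.fst h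
  exact U x := ⟨fun h => ⟨x.1, Prod.ext rfl h.symm⟩, by
    rintro ⟨b, rfl⟩
    rfl⟩
  surj U c t ht := ⟨U, le_rfl, (0, c), ht, (GMod.res_self _ _ _).symm⟩

lemma IsCocycle.ses_isSplit {B : GMod (X.W r)} (hB : B.IsQCoh) {n : ℕ}
    {u : (Fin (n + 2) → D.Q) → B.obj ⊤} (hu : D.IsCocycle u) : (hu.ses hB).IsSplit :=
  ⟨fun U => { toFun := fun c => (0, c)
              map_add' := fun c c' => Prod.ext (add_zero 0).symm rfl
              map_smul' := fun a c => Prod.ext (smul_zero a).symm rfl },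
    fun U V h c => by
    have h1 := hu.twisting.res_apply h ((0, c) : hu.twisting.obj.obj U)
    refine Eq.trans ?_ h1.symm
    exact Prod.ext (map_zero (B.res h)).symm rfl,
    fun U c => rfl⟩

/-- The extension attached to a cocycle. -/
def IsCocycle.ext {B : GMod (X.W r)} (hB : B.IsQCoh) : ∀ {n : ℕ} {u : (Fin (n + 2) → D.Q) → B.obj ⊤},
    D.IsCocycle u → NExt (X.WMod r) (n + 1) B
  | 0, _, hu => hu.ses hB
  | n + 1, _, hu => ⟨⟨D.Z X r (n + 1), D.Z_isQCoh r _⟩, hu.ses hB, D.resolution X r (n + 1)⟩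

lemma IsCocycle.ext_isSGT {B : GMod (X.W r)} (hB : B.IsQCoh) :
    ∀ {n : ℕ} {u : (Fin (n + 2) → D.Q) → B.obj ⊤} (hu : D.IsCocycle u), (hu.ext hB).IsSGT
  | 0, _, hu => hu.ses_isSplit hB
  | n + 1, _, hu => ⟨hu.ses_isSplit hB, D.resolution_isSGT _⟩

end FinTorsor

/-! ### Comparison of an arbitrary extension with the standard resolution -/

/-- The projection is surjective on global sections, on which the stabilizer of the base point of
`D` acts trivially. -/
def SES.IsGood {r : ℕ} (D : FinTorsor G) {B C : GMod (X.W r)} (E : SES B C) : Prop :=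
  (∀ c : C.obj ⊤, ∃ x, E.π.app ⊤ x = c) ∧
    ∀ g : G, g • D.o = D.o → ∀ x, E.M.act g (GScheme.le_tr_top g ⊤) x = x

/-- All the short exact sequences of which the extension is the splice are good. -/
def NExt.IsGood {r : ℕ} (D : FinTorsor G) {A : GMod (X.W r)} : ∀ {n : ℕ} {B : GMod (X.W r)},
    NExt A n B → Prop
  | 0, _, _ => True
  | 1, _, E => SES.IsGood D E
  | _ + 2, _, E => SES.IsGood D E.2.1 ∧ NExt.IsGood D E.2.2

namespace FinTorsor

variable {D : FinTorsor G} {r : ℕ}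

/-- This is the relative projectivity of `P_{n+1}`: its basis is permuted, with stabilizers that act
trivially on the global sections of the middle term, so a lift of the basis can be chosen
equivariantly. On the kernels one obtains `γ'`. -/
lemma exists_lift {B C : GMod (X.W r)} {E : SES B C} (hE : E.IsGood D) {n : ℕ}
    (γ : GMod.Hom (GRing.Hom.id _) (D.Z X r n) C) :
    ∃ (f : GMod.Hom (GRing.Hom.id _) (D.P X r (n + 1)) E.M)
      (γ' : GMod.Hom (GRing.Hom.id _) (D.Z X r (n + 1)) B),
      (∀ U x, E.π.app U (f.app U x) = γ.app U ((D.π X r n).app U x)) ∧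
      ∀ U z, E.ι.app U (γ'.app U z) = f.app U ((D.j X r (n + 1)).app U z) := by
  choose l hl using hE.1
  choose t ht using D.trans
  let v : (Fin (n + 1) → D.Q) → C.obj ⊤ := fun x => γ.app ⊤ ((D.π X r n).app ⊤ (D.e X r x))
  have hv : ∀ g x, v (g • x) = C.act g (GScheme.le_tr_top g ⊤) (v x) := fun g x => by
    simp only [v]
    rw [← act_e, (D.π X r n).app_act, γ.app_act]
  -- A tuple is moved so that its first entry is the base point, lifted arbitrarily there, and moved
  -- back. The element `t (x 0)` is determined up to the stabilizer of the base point, which acts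
  -- trivially on tuples by normality and on the sections because `E` is good.
  let u : (Fin (n + 1) → D.Q) → E.M.obj ⊤ := fun x =>
    E.M.act (t (x 0)) (GScheme.le_tr_top _ ⊤) (l (v ((t (x 0))⁻¹ • x)))
  have hu : ∀ g x, u (g • x) = E.M.act g (GScheme.le_tr_top g ⊤) (u x) := by
    intro g x
    simp only [u]
    obtain ⟨k, hk⟩ : ∃ k, t ((g • x) 0) = g * t (x 0) * k :=
      ⟨(g * t (x 0))⁻¹ * t ((g • x) 0), by group⟩
    have hko : k • D.o = D.o := by
      have h1 := ht ((g • x) 0)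
      rw [hk, mul_smul, mul_smul] at h1
      have h2 : (g • x) 0 = g • x 0 := rfl
      have h3 : t (x 0) • k • D.o = x 0 := by
        rw [h2] at h1
        exact (MulAction.injective g) h1
      exact (MulAction.injective (t (x 0))) (h3.trans (ht (x 0)).symm)
    have hk' : ∀ y : Fin (n + 1) → D.Q, k⁻¹ • y = y := fun y => funext fun i =>
      D.normal _ _ (by rw [inv_smul_eq_iff, hko])
    have h4 : (t ((g • x) 0))⁻¹ • g • x = (t (x 0))⁻¹ • x := by
      rw [hk, mul_inv_rev, mul_inv_rev, mul_smul, mul_smul, inv_smul_smul, hk']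
    rw [h4, E.M.act_act, E.M.act_congr hk _ (GScheme.le_tr_top _ ⊤),
      ← E.M.act_act (g * t (x 0)) k (GScheme.le_tr_top _ ⊤) (GScheme.le_tr_top _ ⊤), hE.2 k hko]
  let f := D.lamHom (GRing.Hom.id _) u hu
  have hf : ∀ U x, E.π.app U (f.app U x) = γ.app U ((D.π X r n).app U x) := by
    refine lin_ext (A := E.π.lin.comp f.lin) (A' := γ.lin.comp (D.π X r n).lin) fun x => ?_
    change E.π.app ⊤ ((D.lam (GRing.Hom.id _) u).app ⊤ (D.e X r x)) = v x
    rw [lam_e]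
    simp only [u]
    rw [E.π.app_act, hl, ← hv, smul_inv_smul]
  have hz : ∀ U z, ∃ b, E.ι.app U b = f.app U ((D.j X r (n + 1)).app U z) := fun U z =>
    (E.exact U _).1 (by rw [hf, D.π_j, map_zero])
  choose b hb using hz
  refine ⟨f, ⟨fun U => ⟨⟨b U, E.inj U ?_⟩, fun z z' => E.inj U ?_⟩, fun U a z => E.inj U ?_,
    fun g U V h z => E.inj V ?_⟩, hf, hb⟩
  · rw [hb, map_zero, map_zero, map_zero]
  · simp only
    rw [map_add, hb, hb, hb, map_add, map_add]
  · change E.ι.app U (b U (a • z)) = E.ι.app U (a • b U z)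
    have h1 := E.ι.app_smul U a (b U z)
    have h2 := (D.j X r (n + 1)).app_smul U a z
    rw [h1, hb, hb, h2, f.app_smul]
    rfl
  · change E.ι.app V (b V _) = E.ι.app V (B.act g h (b U z))
    rw [E.ι.app_act, hb, hb, (D.j X r (n + 1)).app_act, f.app_act]

/-- The comparison of resolutions: starting from the identity of `W_r(O)`, `exists_lift` is applied
to one short exact sequence after another. -/
lemma exists_map_resolution : ∀ {n : ℕ} {B : GMod (X.W r)} (E : NExt (X.WMod r) n B),
    E.IsGood D → ∃ γ : GMod.Hom (GRing.Hom.id _) (D.Z X r n) B,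
      NExt.Map (GMod.Hom.id _) γ (D.resolution X r n) E
  | 0, B, E, _ => ⟨E.down, fun U x => rfl⟩
  | 1, B, E, hE => by
    obtain ⟨f, γ', h1, h2⟩ := exists_lift (E := E) hE (n := 0) (GMod.Hom.id _)
    exact ⟨γ', f, fun U b => (h2 U b).symm, fun U x => h1 U x⟩
  | n + 2, B, E, hE => by
    obtain ⟨γ, hγ⟩ := exists_map_resolution E.2.2 hE.2
    obtain ⟨f, γ', h1, h2⟩ := exists_lift hE.1 γ
    exact ⟨γ', γ, ⟨f, fun U b => (h2 U b).symm, fun U x => h1 U x⟩, hγ⟩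

/-- A morphism from the standard sequence to `E` factors through its pushout along `γ'`. That
pushout is the sequence attached to the cocycle obtained by evaluating `γ'` on the boundaries of
basis elements. -/
lemma exists_map_ses {B C : GMod (X.W r)} (hB : B.IsQCoh) {E : SES B C} {n : ℕ}
    {γ : GMod.Hom (GRing.Hom.id _) (D.Z X r n) C}
    {f : GMod.Hom (GRing.Hom.id _) (D.P X r (n + 1)) E.M}
    {γ' : GMod.Hom (GRing.Hom.id _) (D.Z X r (n + 1)) B}
    (h1 : ∀ U x, E.π.app U (f.app U x) = γ.app U ((D.π X r n).app U x))
    (h2 : ∀ U z, E.ι.app U (γ'.app U z) = f.app U ((D.j X r (n + 1)).app U z)) :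
    ∃ (u : (Fin (n + 2) → D.Q) → B.obj ⊤) (hu : D.IsCocycle u),
      SES.Map (GMod.Hom.id _) γ (hu.ses hB) E := by
  let u : (Fin (n + 2) → D.Q) → B.obj ⊤ := fun x => γ'.app ⊤ ((D.π X r (n + 1)).app ⊤ (D.e X r x))
  have hu : D.IsCocycle u := by
    refine ⟨fun g x => ?_, fun x => ?_⟩
    · simp only [u]
      rw [← act_e, (D.π X r (n + 1)).app_act, γ'.app_act]
    · have h3 := map_hδ ((γ'.app ⊤).comp ((D.π X r (n + 1)).app ⊤)) (D.e X r) x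
      refine h3.symm.trans ?_
      rw [← d_e]
      change γ'.app ⊤ ((D.π X r (n + 1)).app ⊤ _) = 0
      have h4 : (D.π X r (n + 1)).app ⊤ ((D.d X r (n + 2)).app ⊤ (D.e X r x)) = 0 :=
        D.j_injective (n + 1) ⊤ (by rw [j_π, d_d, map_zero])
      rw [h4, map_zero]
  have hlam : ∀ U y, (D.lam (GRing.Hom.id _) u).app U y =
      γ'.app U ((D.π X r (n + 1)).app U y) := by
    refine lin_ext (A := D.lam (GRing.Hom.id _) u) (A' := γ'.lin.comp (D.π X r (n + 1)).lin)
      fun x => ?_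
    rw [lam_e]
    rfl
  have hθ : ∀ U z, (θ u).app U ((D.j X r (n + 1)).app U z) = γ'.app U z := by
    intro U z
    rw [θ_apply, hlam, ← D.σ_apply, π_σ]
  -- The map from the twisted sum is `(b, z) ↦ ι b + f(σ z)`; the twisting was made to absorb the
  -- failure of `σ` to be equivariant.
  refine ⟨u, hu, ⟨fun U => ((E.ι.app U).comp (AddMonoidHom.fst (B.obj U) ((D.Z X r n).obj U))) +
    ((f.app U).comp (((D.σ X r n).app U).comp (AddMonoidHom.snd (B.obj U) ((D.Z X r n).obj U)))), fun U a x => ?_,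
    fun g U V h x => ?_⟩, fun U b => ?_, fun U x => ?_⟩
  · change E.ι.app U (a • x.1) + f.app U ((D.σ X r n).app U (a • x.2)) =
      a • (E.ι.app U x.1 + f.app U ((D.σ X r n).app U x.2))
    have h3 := E.ι.app_smul U a x.1
    have h4 := (D.σ X r n).app_smul U a x.2
    rw [h3, h4, f.app_smul, smul_add]
    rfl
  · change E.ι.app V (B.act g h x.1 + hu.twisting.τ g h x.2) +
      f.app V ((D.σ X r n).app V ((D.Z X r n).act g h x.2)) =
      E.M.act g h (E.ι.app U x.1 + f.app U ((D.σ X r n).app U x.2))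
    have h3 : (D.π X r n).app V ((D.P X r (n + 1)).act g h ((D.σ X r n).app U x.2) -
      (D.σ X r n).app V ((D.Z X r n).act g h x.2)) = 0 := by
      rw [map_sub, (D.π X r n).app_act, D.π_σ, D.π_σ, sub_self]
    obtain ⟨z, hz⟩ := D.exists_j_eq h3
    rw [hu.τ_apply, defect_apply, ← hz, hθ, map_add, h2, hz, map_sub, map_add, E.ι.app_act, f.app_act]
    abel
  · change E.ι.app U b + f.app U ((D.σ X r n).app U 0) = E.ι.app U b
    rw [map_zero, map_zero, add_zero]
  · change E.π.app U (E.ι.app U x.1 + f.app U ((D.σ X r n).app U x.2)) = γ.app U x.2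
    rw [map_add, h1, π_σ, (E.exact U _).2 ⟨_, rfl⟩, zero_add]

/-- Every good extension receives a morphism from the extension attached to some cocycle. -/
theorem exists_map_ext : ∀ {n : ℕ} {B : GMod (X.W r)} (hB : B.IsQCoh)
    (E : NExt (X.WMod r) (n + 1) B), E.IsGood D →
    ∃ (u : (Fin (n + 2) → D.Q) → B.obj ⊤) (hu : D.IsCocycle u),
      NExt.Map (GMod.Hom.id _) (GMod.Hom.id _) (hu.ext hB) E
  | 0, B, hB, E, hE => by
    obtain ⟨f, γ', h1, h2⟩ := exists_lift (E := E) hE (n := 0) (GMod.Hom.id _)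
    exact exists_map_ses hB h1 h2
  | n + 1, B, hB, E, hE => by
    obtain ⟨γ, hγ⟩ := exists_map_resolution E.2.2 hE.2
    obtain ⟨f, γ', h1, h2⟩ := exists_lift hE.1 γ
    obtain ⟨u, hu, h3⟩ := exists_map_ses hB h1 h2
    exact ⟨u, hu, γ, h3, hγ⟩

end FinTorsor

end CanonicalExtension

/-! ### Functoriality of the standard resolution and of the attached extensions. -/

section FunctorialityOfResolution

variable {p : ℕ} [Fact p.Prime] {G : Type w} [Group G] [TopologicalSpace G] {X : GScheme.{u} p G}

/-- Composition of an equivariant semilinear map with an equivariant linear map on the source. -/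
def GMod.Hom.comp' {R R' : GRing X} {φ : GRing.Hom R R'} {M M' : GMod R} {N : GMod R'}
    (f : GMod.Hom φ M N) (g : GMod.Hom (GRing.Hom.id _) M' M) : GMod.Hom φ M' N where
  app U := (f.app U).comp (g.app U)
  app_smul U a x := (congrArg _ (g.app_smul U a x)).trans (f.app_smul U _ _)
  app_act g' U V h x := (congrArg _ (g.app_act g' h x)).trans (f.app_act g' h _)

namespace FinTorsor

/-- Equivariant pointed maps. -/
structure Hom (D' D : FinTorsor G) where
  toFun : D'.Q → D.Q
  map_smul : ∀ (g : G) x, toFun (g • x) = g • toFun x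
  map_o : toFun D'.o = D.o

/-- The identity. -/
def Hom.id (D : FinTorsor G) : Hom D D := ⟨fun x => x, fun _ _ => rfl, rfl⟩

variable {D' D : FinTorsor G} (q : Hom D' D) {r s : ℕ} (φ : GRing.Hom (X.W r) (X.W s))

/-- The map on functions on powers (push-forward of functions with finite support). -/
def push (n : ℕ) : GMod.Hom φ (D'.P X r n) (D.P X s n) :=
  D'.lamHom φ (fun x => D.e X s fun i => q.toFun (x i)) fun g x => by
    rw [act_e]
    exact congrArg (D.e X s) (funext fun i => q.map_smul g (x i))

lemma push_e {n : ℕ} (x : Fin n → D'.Q) :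
    (push q φ n).app ⊤ (D'.e X r x) = D.e X s fun i => q.toFun (x i) :=
  D'.lam_e _ _ x

lemma push_d {n : ℕ} (U : X.S.Opens) (f : (D'.P X r (n + 1)).obj U) :
    (push q φ n).app U ((D'.d X r n).app U f) = (D.d X s n).app U ((push q φ (n + 1)).app U f) := by
  refine lin_ext (A := (push q φ n).lin.comp' (D'.d X r n).lin)
    (A' := (D.d X s n).lin.comp (push q φ (n + 1)).lin) (fun x => ?_) U f
  change (push q φ n).app ⊤ ((D'.d X r n).app ⊤ (D'.e X r x)) =
    (D.d X s n).app ⊤ ((push q φ (n + 1)).app ⊤ (D'.e X r x))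
  rw [d_e, push_e, d_e, map_hδ]
  simp only [push_e]
  exact hδ_comp (D.e X s) q.toFun x

/-- The contraction adds the base point as a vertex, and morphisms of finite quotients preserve base
points. -/
lemma push_h {n : ℕ} (U : X.S.Opens) (f : (D'.P X r n).obj U) :
    (push q φ (n + 1)).app U ((D'.h X r n).app U f) = (D.h X s n).app U ((push q φ n).app U f) := by
  refine lin_ext (A := (push q φ (n + 1)).lin.comp' (D'.h X r n))
    (A' := (D.h X s n).comp (push q φ n).lin) (fun x => ?_) U f
  change (push q φ (n + 1)).app ⊤ ((D'.h X r n).app ⊤ (D'.e X r x)) =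
    (D.h X s n).app ⊤ ((push q φ n).app ⊤ (D'.e X r x))
  rw [h_e, push_e, push_e, h_e]
  refine congrArg (D.e X s) (funext fun i => ?_)
  refine Fin.cases ?_ (fun i => ?_) i
  · exact q.map_o
  · rfl

lemma push_zero (U : X.S.Opens) (f : (D'.P X r 0).obj U) (x : Fin 0 → D.Q) :
    (push q φ 0).app U f x = φ.app U (f default) := by
  have h1 : (push q φ 0).app U f =
      φ.app U (f default) • (D.P X s 0).res le_top (D.e X s fun i => q.toFun ((default : Fin 0 → D'.Q) i)) := by
    refine (D'.lam_apply φ _ U f).trans ?_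
    rw [Fintype.sum_unique]
  rw [h1, P_smul, P_res]
  have h2 : D.e X s (fun i => q.toFun ((default : Fin 0 → D'.Q) i)) x = 1 := by
    rw [Subsingleton.elim x]
    exact Pi.single_eq_same _ _
  rw [h2, _root_.map_one, mul_one]

variable {φ} (α : GMod.Hom φ (X.WMod r) (X.WMod s))

/-- The map on syzygies. -/
def pushZ : ∀ n, GMod.Hom φ (D'.Z X r n) (D.Z X s n)
  | 0 => α
  | n + 1 => GMod.kerLift (D.d X s n) ((push q φ (n + 1)).comp' (D'.j X r (n + 1))) fun U z =>
      (push_d q φ U _).symm.trans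
        ((congrArg ((push q φ n).app U) (D'.d_j U z)).trans (map_zero ((push q φ n).app U)))

variable (hα : ∀ U a, α.app U a = φ.app U a)

include hα

lemma j_pushZ : ∀ (n : ℕ) (U : X.S.Opens) (z : (D'.Z X r n).obj U),
    (D.j X s n).app U ((pushZ q α n).app U z) = (push q φ n).app U ((D'.j X r n).app U z)
  | 0, U, z => funext fun x => (hα U z).trans (push_zero q φ U ((D'.j X r 0).app U z) x).symm
  | n + 1, U, z => rfl

lemma π_push {n : ℕ} (U : X.S.Opens) (f : (D'.P X r (n + 1)).obj U) :
    (D.π X s n).app U ((push q φ (n + 1)).app U f) = (pushZ q α n).app U ((D'.π X r n).app U f) :=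
  D.j_injective n U (by rw [j_π, j_pushZ q α hα, j_π, push_d])

lemma σ_pushZ {n : ℕ} (U : X.S.Opens) (z : (D'.Z X r n).obj U) :
    (D.σ X s n).app U ((pushZ q α n).app U z) = (push q φ (n + 1)).app U ((D'.σ X r n).app U z) := by
  rw [σ_apply, σ_apply, j_pushZ q α hα, push_h]

lemma push_defect {n : ℕ} (g : G) {U V : X.S.Opens} (h : V ≤ X.tr g U) (z : (D'.Z X r n).obj U) :
    (push q φ (n + 1)).app V (D'.defect X r n g h z) =
      D.defect X s n g h ((pushZ q α n).app U z) := by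
  rw [defect_apply, defect_apply, map_sub, (push q φ (n + 1)).app_act, σ_pushZ q α hα,
    ← (pushZ q α n).app_act, σ_pushZ q α hα]

lemma map_resolution : ∀ n, NExt.Map α (pushZ q α n) (D'.resolution X r n) (D.resolution X s n)
  | 0 => fun U x => rfl
  | 1 => ⟨push q φ 1, fun U b => (j_pushZ q α hα 1 U b).symm, fun U x => π_push q α hα U x⟩
  | n + 2 => ⟨pushZ q α (n + 1), ⟨push q φ (n + 2), fun U b => (j_pushZ q α hα (n + 2) U b).symm,
      fun U x => π_push q α hα U x⟩, map_resolution (n + 1)⟩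

omit hα

variable {B : GMod (X.W r)} {B' : GMod (X.W s)} (β : GMod.Hom φ B B')

/-- A coboundary `hδ b` corresponds to the linear map of `b` composed with `d`. Since `d h f = f` on
cycles, replacing a cocycle by a cohomologous one changes `θ` there by the linear map of `b`. -/
lemma app_θ {n : ℕ} {u' : (Fin (n + 2) → D'.Q) → B.obj ⊤} {u : (Fin (n + 2) → D.Q) → B'.obj ⊤}
    {b : (Fin (n + 1) → D'.Q) → B'.obj ⊤}
    (hub : ∀ x, β.app ⊤ (u' x) = u (fun i => q.toFun (x i)) + hδ b x) (U : X.S.Opens)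
    {f : (D'.P X r (n + 1)).obj U} (hf : (D'.d X r n).app U f = 0) :
    β.app U ((θ u').app U f) = (θ u).app U ((push q φ (n + 1)).app U f) + (D'.lam φ b).app U f := by
  have h1 : ∀ f : (D'.P X r (n + 2)).obj U, β.app U ((D'.lam (GRing.Hom.id _) u').app U f) =
      (D.lam (GRing.Hom.id _) u).app U ((push q φ (n + 2)).app U f) +
        (D'.lam φ b).app U ((D'.d X r (n + 1)).app U f) := by
    refine lin_ext (A := β.lin.comp' (D'.lam (GRing.Hom.id _) u'))
      (A' := ((D.lam (GRing.Hom.id _) u).comp (push q φ (n + 2)).lin).add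
        ((D'.lam φ b).comp' (D'.d X r (n + 1)).lin)) (fun x => ?_) U
    change β.app ⊤ ((D'.lam (GRing.Hom.id _) u').app ⊤ (D'.e X r x)) =
      (D.lam (GRing.Hom.id _) u).app ⊤ ((push q φ (n + 2)).app ⊤ (D'.e X r x)) +
        (D'.lam φ b).app ⊤ ((D'.d X r (n + 1)).app ⊤ (D'.e X r x))
    rw [lam_e, push_e, lam_e, d_e, map_hδ, hub]
    simp only [lam_e]
  have h2 := D'.d_h_add_h_d U f
  rw [hf, map_zero, add_zero] at h2
  rw [θ_apply, θ_apply, h1, push_h, h2]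

include hα

lemma IsCocycle.map_ses (hB : B.IsQCoh) (hB' : B'.IsQCoh) {n : ℕ}
    {u' : (Fin (n + 2) → D'.Q) → B.obj ⊤} (hu' : D'.IsCocycle u')
    {u : (Fin (n + 2) → D.Q) → B'.obj ⊤} (hu : D.IsCocycle u)
    {b : (Fin (n + 1) → D'.Q) → B'.obj ⊤}
    (hb : ∀ g x, b (g • x) = B'.act g (GScheme.le_tr_top g ⊤) (b x))
    (hub : ∀ x, β.app ⊤ (u' x) = u (fun i => q.toFun (x i)) + hδ b x) :
    SES.Map β (pushZ q α n) (hu'.ses hB) (hu.ses hB') := by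
  -- The morphism of twisted sums is `(c, z) ↦ (β c + λ_b(σ z), push z)`, where `λ_b` is the linear
  -- map of `b`. The equivariance of `λ_b` makes the off-diagonal term compensate for the difference
  -- of the twistings.
  refine ⟨⟨fun U => ((β.app U).comp (AddMonoidHom.fst (B.obj U) ((D'.Z X r n).obj U)) +
    ((D'.lam φ b).app U).comp (((D'.σ X r n).app U).comp (AddMonoidHom.snd (B.obj U)
      ((D'.Z X r n).obj U)))).prod (((pushZ q α n).app U).comp (AddMonoidHom.snd (B.obj U)
      ((D'.Z X r n).obj U))), fun U a x => ?_, fun g U V h x => ?_⟩, fun U c => ?_, fun U x => ?_⟩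
  · refine Prod.ext ?_ ((pushZ q α n).app_smul U a x.2)
    change β.app U (a • x.1) + (D'.lam φ b).app U ((D'.σ X r n).app U (a • x.2)) =
      φ.app U a • (β.app U x.1 + (D'.lam φ b).app U ((D'.σ X r n).app U x.2))
    have h1 : (D'.σ X r n).app U (a • x.2) = a • (D'.σ X r n).app U x.2 :=
      (D'.σ X r n).app_smul U a x.2
    rw [h1, β.app_smul, (D'.lam φ b).app_smul, smul_add]
  · refine Prod.ext ?_ ((pushZ q α n).app_act g h x.2)
    change β.app V (B.act g h x.1 + hu'.twisting.τ g h x.2) +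
      (D'.lam φ b).app V ((D'.σ X r n).app V ((D'.Z X r n).act g h x.2)) =
      B'.act g h (β.app U x.1 + (D'.lam φ b).app U ((D'.σ X r n).app U x.2)) +
        hu.twisting.τ g h ((pushZ q α n).app U x.2)
    rw [hu'.τ_apply, hu.τ_apply, map_add, map_add, app_θ q β hub V (d_defect g h x.2),
      push_defect q α hα, β.app_act, ← D'.lam_act φ hb, defect_apply (D := D'), map_sub]
    abel
  · refine Prod.ext ?_ (map_zero ((pushZ q α n).app U))
    change β.app U c + (D'.lam φ b).app U ((D'.σ X r n).app U 0) = β.app U c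
    rw [map_zero, map_zero, add_zero]
  · rfl

/-- Functoriality of the extension attached to a cocycle, and its independence of the cocycle in a
cohomology class. -/
theorem IsCocycle.map_ext (hB : B.IsQCoh) (hB' : B'.IsQCoh) : ∀ {n : ℕ}
    {u' : (Fin (n + 2) → D'.Q) → B.obj ⊤} (hu' : D'.IsCocycle u')
    {u : (Fin (n + 2) → D.Q) → B'.obj ⊤} (hu : D.IsCocycle u)
    {b : (Fin (n + 1) → D'.Q) → B'.obj ⊤}
    (hb : ∀ g x, b (g • x) = B'.act g (GScheme.le_tr_top g ⊤) (b x))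
    (hub : ∀ x, β.app ⊤ (u' x) = u (fun i => q.toFun (x i)) + hδ b x),
    NExt.Map α β (hu'.ext hB) (hu.ext hB')
  | 0, _, hu', _, hu, _, hb, hub => hu'.map_ses q α hα β hB hB' hu hb hub
  | n + 1, _, hu', _, hu, _, hb, hub =>
    ⟨pushZ q α (n + 1), hu'.map_ses q α hα β hB hB' hu hb hub, map_resolution q α hα (n + 1)⟩

end FinTorsor

end FunctorialityOfResolution

/-! ### Finite quotients of a profinite group. -/

section Profinite

variable {G : Type w} [Group G] [TopologicalSpace G] [IsTopologicalGroup G] [CompactSpace G]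
  [T2Space G] [TotallyDisconnectedSpace G]

/-- Locally constant functions on powers of a profinite group are uniformly locally constant. -/
lemma exists_openSubgroup_forall_eq {M : Type*} {m : ℕ} {f : (Fin m → G) → M}
    (hf : IsLocallyConstant f) :
    ∃ K : OpenSubgroup G, ∀ x y, (∀ i, (x i)⁻¹ * y i ∈ K) → f x = f y := by
  -- Compactness makes local constancy uniform: one neighbourhood of the identity serves for all
  -- `x`.
  have h : ∀ᶠ k in 𝓝 (1 : Fin m → G), ∀ x ∈ (Set.univ : Set (Fin m → G)), f (x * k) = f x := by
    refine isCompact_univ.eventually_forall_of_forall_eventually fun x _ => ?_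
    have h1 : ∀ᶠ z : (Fin m → G) × (Fin m → G) in 𝓝 (1, x), f (z.2 * z.1) = f (x * 1) :=
      (show Continuous fun z : (Fin m → G) × (Fin m → G) => z.2 * z.1 by
        fun_prop).tendsto (1, x) (hf.eventually_eq (x * 1))
    have h2 : ∀ᶠ z : (Fin m → G) × (Fin m → G) in 𝓝 (1, x), f z.2 = f x :=
      continuous_snd.tendsto ((1 : Fin m → G), x) (hf.eventually_eq x)
    filter_upwards [h1, h2] with z hz hz'
    rw [hz, hz', mul_one]
  rw [Filter.Eventually, nhds_pi, Filter.mem_pi] at h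
  obtain ⟨I, -, t, ht, hI⟩ := h
  have ht' : (⋂ i, t i) ∈ 𝓝 (1 : G) := Filter.iInter_mem.2 ht
  obtain ⟨W, hW, hWo, hW1⟩ := mem_nhds_iff.1 ht'
  obtain ⟨H, hH⟩ := ProfiniteGrp.exist_openNormalSubgroup_sub_open_nhds_of_one hWo hW1
  refine ⟨H.toOpenSubgroup, fun x y hxy => ?_⟩
  have h3 := hI (show (fun i => (x i)⁻¹ * y i) ∈ I.pi t from fun i _ =>
    Set.mem_iInter.1 (hW (hH (hxy i))) i) x trivial
  rw [← h3]
  exact congrArg f (funext fun i => mul_inv_cancel_left (x i) (y i))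

namespace FinTorsor

/-- The finite quotients of `G` are cofinal. -/
lemma exists_stabilizer_le (K : OpenSubgroup G) :
    ∃ D : FinTorsor G, ∀ g : G, g • D.o = D.o → g ∈ K := by
  obtain ⟨H, hH⟩ := ProfiniteGrp.exist_openNormalSubgroup_sub_open_nhds_of_one K.isOpen K.one_mem
  have : Finite (G ⧸ H.toSubgroup) := Subgroup.quotient_finite_of_isOpen _ H.isOpen'
  have hN : H.toSubgroup.Normal := inferInstance
  -- The finite quotient is transported to some `Fin k`, because the underlying set of a `FinTorsor`
  -- lives in the lowest universe.
  let E : Fin (Nat.card (G ⧸ H.toSubgroup)) ≃ G ⧸ H.toSubgroup := (Finite.equivFin _).symm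
  let _ : MulAction G (Fin (Nat.card (G ⧸ H.toSubgroup))) :=
    { smul := fun g x => E.symm (g • E x)
      one_smul := fun x => by
        change E.symm ((1 : G) • E x) = x
        rw [one_smul, E.symm_apply_apply]
      mul_smul := fun g g' x => by
        change E.symm ((g * g') • E x) = E.symm (g • E (E.symm (g' • E x)))
        rw [E.apply_symm_apply, mul_smul] }
  have hs : ∀ (g : G) x, g • x = E.symm (g • E x) := fun _ _ => rfl
  have ho : ∀ g : G, g • E.symm (1 : G) = E.symm (1 : G) ↔ g ∈ H.toSubgroup := fun g => by
    rw [hs, E.apply_symm_apply, E.symm.injective.eq_iff, MulAction.Quotient.smul_coe,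
      smul_eq_mul, mul_one, eq_comm, QuotientGroup.eq, inv_one, one_mul]
  refine ⟨⟨Fin (Nat.card (G ⧸ H.toSubgroup)), E.symm (1 : G), fun x => ?_, ?_, fun g x hg => ?_⟩,
    fun g hg => hH ((ho g).1 hg)⟩
  · obtain ⟨g, hg⟩ := QuotientGroup.mk_surjective (E x)
    refine ⟨g, ?_⟩
    rw [hs, E.apply_symm_apply, MulAction.Quotient.smul_coe, smul_eq_mul, mul_one, hg,
      E.symm_apply_apply]
  · convert H.isOpen' using 1
    ext g
    exact ho g
  · obtain ⟨k, hk⟩ := QuotientGroup.mk_surjective (E x)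
    rw [hs, ← hk, MulAction.Quotient.smul_coe, smul_eq_mul, Equiv.symm_apply_eq, ← hk, eq_comm,
      QuotientGroup.eq, ← mul_assoc]
    have := hN.conj_mem g ((ho g).1 hg) k⁻¹
    rwa [inv_inv] at this

omit [IsTopologicalGroup G] [CompactSpace G] [T2Space G] [TotallyDisconnectedSpace G]

/-- The map `g • D'.o ↦ g • D.o` is well defined by the inclusion of stabilizers. -/
lemma exists_hom {D' D : FinTorsor G} (h : ∀ g : G, g • D'.o = D'.o → g • D.o = D.o) :
    Nonempty (Hom D' D) := by
  choose t ht using D'.trans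
  have key : ∀ g g' : G, g • D'.o = g' • D'.o → g • D.o = g' • D.o := fun g g' e => by
    have := h (g'⁻¹ * g) (by rw [mul_smul, e, inv_smul_smul])
    rwa [mul_smul, inv_smul_eq_iff] at this
  refine ⟨fun x => t x • D.o, fun g x => ?_, ?_⟩
  · rw [smul_smul]
    exact key _ _ (by rw [ht, mul_smul, ht])
  · exact (key _ 1 (by rw [ht, one_smul])).trans (one_smul _ _)

end FinTorsor

end Profinite

/-! ### Cochains with values in global sections, and their models on finite quotients. -/

section GlobalCochains

variable {p : ℕ} {G : Type w} [Group G] [TopologicalSpace G] {X : GScheme.{u} p G} {R : GRing X}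

/-- The action of `G` on global sections. -/
def GMod.globalRep (B : GMod R) : Representation ℤ G (B.obj ⊤) where
  toFun g := (B.act g (GScheme.le_tr_top g ⊤)).toIntLinearMap
  map_one' := by
    ext1 x
    exact B.act_one ⊤ _ x
  map_mul' g h := by
    ext1 x
    exact (B.act_act g h _ _ x).symm

lemma GMod.globalRep_apply (B : GMod R) (g : G) (x : B.obj ⊤) :
    B.globalRep g x = B.act g (GScheme.le_tr_top g ⊤) x := rfl

lemma GMod.exists_globalRep_eq (B : GMod R) :
    ∃ K : OpenSubgroup G, ∀ g ∈ K, ∀ x, B.globalRep g x = x := by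
  obtain ⟨K, hK⟩ := B.naive
  exact ⟨K, fun g hg x => (hK g hg _ le_rfl x).trans (B.act_one ⊤ _ x)⟩

variable [IsTopologicalGroup G]

lemma GMod.isLocallyConstant_homog (B : GMod R) {n : ℕ} {c : (Fin n → G) → B.obj ⊤}
    (hc : IsLocallyConstant c) : IsLocallyConstant (homog B.globalRep c) := by
  obtain ⟨K, hK⟩ := B.exists_globalRep_eq
  rw [IsLocallyConstant.iff_eventually_eq]
  intro x
  have h1 : ∀ᶠ y in 𝓝 x, (x 0)⁻¹ * y 0 ∈ K :=
    (show Continuous fun y : Fin (n + 1) → G => (x 0)⁻¹ * y 0 by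
      fun_prop).continuousAt.eventually (K.isOpen'.mem_nhds (by simp))
  have h2 : ∀ᶠ y in 𝓝 x, c (fun i => (y i.castSucc)⁻¹ * y i.succ) =
      c fun i => (x i.castSucc)⁻¹ * x i.succ :=
    (show Continuous fun (y : Fin (n + 1) → G) (i : Fin n) => (y i.castSucc)⁻¹ * y i.succ by
      fun_prop).continuousAt.eventually (hc.eventually_eq _)
  filter_upwards [h1, h2] with y hy hy'
  have e := congrArg (B.globalRep (x 0)) (hK _ hy (c fun i => (x i.castSucc)⁻¹ * x i.succ))
  rw [← Module.End.mul_apply, ← _root_.map_mul, mul_inv_cancel_left] at e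
  rw [homog, homog, hy', e]

namespace FinTorsor

/-- Points of a power of `D`, given by elements of `G`. -/
def pt (D : FinTorsor G) {n : ℕ} (x : Fin n → G) : Fin n → D.Q := fun i => x i • D.o

lemma exists_pt_eq (D : FinTorsor G) {n : ℕ} (y : Fin n → D.Q) : ∃ x, D.pt x = y := by
  choose t ht using D.trans
  exact ⟨fun i => t (y i), funext fun i => ht (y i)⟩

lemma Hom.pt {D' D : FinTorsor G} (q : Hom D' D) {n : ℕ} (x : Fin n → G) :
    (fun i => q.toFun (D'.pt x i)) = D.pt x :=
  funext fun i => by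
    change q.toFun (x i • D'.o) = x i • D.o
    rw [q.map_smul, q.map_o]

lemma continuous_comp_pt (D : FinTorsor G) {n : ℕ} {M : Type*} (u : (Fin n → D.Q) → M) :
    IsLocallyConstant fun x => u (D.pt x) := by
  refine IsLocallyConstant.comp (f := fun x => D.pt x) ?_ u
  rw [IsLocallyConstant.iff_eventually_eq]
  intro x
  have h1 : ∀ i, ∀ᶠ y in 𝓝 x, (x i)⁻¹ * y i ∈ (MulAction.stabilizer G D.o : Set G) := fun i =>
    (show Continuous fun y : Fin n → G => (x i)⁻¹ * y i by
      fun_prop).continuousAt.eventually (D.isOpen.mem_nhds (by simp))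
  filter_upwards [Filter.eventually_all.2 h1] with y hy
  refine funext fun i => ?_
  have h2 : ((x i)⁻¹ * y i) • D.o = D.o := hy i
  rwa [mul_smul, inv_smul_eq_iff] at h2

/-- `u` is the function on a power of `D` given by the homogeneous cochain attached to `c`. -/
structure IsModel (D : FinTorsor G) {B : GMod R} {n : ℕ} (c : (Fin n → G) → B.obj ⊤)
    (u : (Fin (n + 1) → D.Q) → B.obj ⊤) : Prop where
  eq : ∀ x, u (D.pt x) = homog B.globalRep c x

variable {D : FinTorsor G} {B : GMod R}

lemma IsModel.smul {n : ℕ} {c : (Fin n → G) → B.obj ⊤} {u : (Fin (n + 1) → D.Q) → B.obj ⊤}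
    (h : D.IsModel c u) (g : G) (x) : u (g • x) = B.act g (GScheme.le_tr_top g ⊤) (u x) := by
  obtain ⟨x, rfl⟩ := D.exists_pt_eq x
  have h1 : g • D.pt x = D.pt fun i => g * x i := funext fun i => (mul_smul g (x i) D.o).symm
  rw [h1, h.eq, h.eq, homog_smul]
  rfl

lemma IsModel.hδ {n : ℕ} {c : (Fin n → G) → B.obj ⊤} {u : (Fin (n + 1) → D.Q) → B.obj ⊤}
    (h : D.IsModel c u) : D.IsModel (coboundary B.globalRep n c) (WittLift.hδ u) :=
  ⟨fun x => by
    rw [← hδ_homog]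
    refine (hδ_comp u (fun g : G => g • D.o) x).symm.trans ?_
    refine congrArg (fun f => WittLift.hδ f x) (funext fun y => h.eq y)⟩

/-- The cochain attached to an equivariant function on a power of `D`. -/
lemma isModel_of_smul {n : ℕ} {u : (Fin (n + 1) → D.Q) → B.obj ⊤}
    (hu : ∀ g x, u (g • x) = B.act g (GScheme.le_tr_top g ⊤) (u x)) :
    D.IsModel (fun g => u (D.pt (Fin.partialProd g))) u := by
  refine ⟨fun x => ?_⟩
  rw [homog, GMod.globalRep_apply, ← hu]
  refine congrArg u ?_
  conv_lhs => rw [eq_smul_partialProd x]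
  exact funext fun i => mul_smul _ _ _

lemma isLocallyConstant_partialProd {n : ℕ} (u : (Fin (n + 1) → D.Q) → B.obj ⊤) :
    IsLocallyConstant fun g : Fin n → G => u (D.pt (Fin.partialProd g)) :=
  (D.continuous_comp_pt u).comp_continuous (continuous_partialProd n)

/-- Locally constant cochains are cochains of small finite quotients. -/
lemma exists_isModel [CompactSpace G] [T2Space G] [TotallyDisconnectedSpace G] {n : ℕ}
    {c : (Fin n → G) → B.obj ⊤} (hc : IsLocallyConstant c) :
    ∃ K : OpenSubgroup G, ∀ D : FinTorsor G, (∀ g : G, g • D.o = D.o → g ∈ K) →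
      ∃ u, D.IsModel c u := by
  obtain ⟨K, hK⟩ := exists_openSubgroup_forall_eq (B.isLocallyConstant_homog hc)
  refine ⟨K, fun D hD => ?_⟩
  choose t ht using D.trans
  refine ⟨fun x => homog B.globalRep c fun i => t (x i), ⟨fun x => (hK _ _ fun i => hD _ ?_).symm⟩⟩
  rw [mul_smul, ht, inv_smul_eq_iff]
  rfl

end FinTorsor

end GlobalCochains

/-! ### Extensions and inhomogeneous cocycles; extensions exact on global sections. -/

section CocyclesOfQuotients

variable {p : ℕ} [Fact p.Prime] {G : Type w} [Group G] [TopologicalSpace G] [IsTopologicalGroup G]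
  {X : GScheme.{u} p G} {r s : ℕ}

namespace FinTorsor

variable {D : FinTorsor G} {B : GMod (X.W r)}

lemma IsModel.isCocycle {n : ℕ} {c : (Fin n → G) → B.obj ⊤} {u : (Fin (n + 1) → D.Q) → B.obj ⊤}
    (h : D.IsModel c u) (hc : coboundary B.globalRep n c = 0) : D.IsCocycle u := by
  refine ⟨h.smul, fun x => ?_⟩
  obtain ⟨x, rfl⟩ := D.exists_pt_eq x
  rw [h.hδ.eq, hc]
  exact _root_.map_zero _

lemma IsCocycle.coboundary_eq_zero {n : ℕ} {u : (Fin (n + 1) → D.Q) → B.obj ⊤}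
    (hu : D.IsCocycle u) :
    coboundary B.globalRep n (fun g => u (D.pt (Fin.partialProd g))) = 0 := by
  have h := (isModel_of_smul hu.smul).hδ
  ext1 x
  rw [← homog_partialProd B.globalRep (coboundary _ _ _), ← h.eq, hu.hδ_eq]
  rfl

/-- Morphisms between extensions attached to cocycles, in terms of inhomogeneous cochains. -/
lemma IsModel.map_ext {D' : FinTorsor G} (q : Hom D' D) {φ : GRing.Hom (X.W r) (X.W s)}
    {α : GMod.Hom φ (X.WMod r) (X.WMod s)} (hα : ∀ U a, α.app U a = φ.app U a)
    {B' : GMod (X.W s)} (β : GMod.Hom φ B B') (hB : B.IsQCoh) (hB' : B'.IsQCoh) {n : ℕ}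
    {c' : (Fin (n + 1) → G) → B.obj ⊤} {u' : (Fin (n + 2) → D'.Q) → B.obj ⊤} (hu' : D'.IsModel c' u')
    (hc' : D'.IsCocycle u')
    {c : (Fin (n + 1) → G) → B'.obj ⊤} {u : (Fin (n + 2) → D.Q) → B'.obj ⊤} (hu : D.IsModel c u)
    (hc : D.IsCocycle u)
    {b : (Fin n → G) → B'.obj ⊤} {v : (Fin (n + 1) → D'.Q) → B'.obj ⊤} (hv : D'.IsModel b v)
    (hb : ∀ x, β.app ⊤ (c' x) = c x + coboundary B'.globalRep n b x) :
    NExt.Map α β (hc'.ext hB) (hc.ext hB') := by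
  refine IsCocycle.map_ext q α hα β hB hB' hc' hc hv.smul fun x => ?_
  obtain ⟨x, rfl⟩ := D'.exists_pt_eq x
  rw [hu'.eq, q.pt, hu.eq, hv.hδ.eq]
  refine (β.app_act _ _ _).trans ?_
  rw [hb, _root_.map_add]
  rfl

end FinTorsor

/-- The projections of all the short exact sequences of which the extension is the splice are
surjective on global sections. -/
def NExt.IsGloballyExact {A : GMod (X.W r)} : ∀ {n : ℕ} {B : GMod (X.W r)}, NExt A n B → Prop
  | 0, _, _ => True
  | 1, _, E => ∀ c, ∃ x, (SES.π E).app ⊤ x = c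
  | _ + 2, _, E => (∀ c, ∃ x, E.2.1.π.app ⊤ x = c) ∧ NExt.IsGloballyExact E.2.2

lemma SES.exists_isGood {B C : GMod (X.W r)} (E : SES B C) (hE : ∀ c, ∃ x, E.π.app ⊤ x = c) :
    ∃ K : OpenSubgroup G, ∀ D : FinTorsor G, (∀ g : G, g • D.o = D.o → g ∈ K) → E.IsGood D := by
  obtain ⟨K, hK⟩ := E.M.exists_globalRep_eq
  exact ⟨K, fun D hD => ⟨hE, fun g hg x => hK g (hD g hg) x⟩⟩

lemma NExt.exists_isGood {A : GMod (X.W r)} : ∀ {n : ℕ} {B : GMod (X.W r)} (E : NExt A n B),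
    E.IsGloballyExact → ∃ K : OpenSubgroup G, ∀ D : FinTorsor G,
      (∀ g : G, g • D.o = D.o → g ∈ K) → E.IsGood D
  | 0, _, _, _ => ⟨⊤, fun D _ => trivial⟩
  | 1, _, E, hE => SES.exists_isGood E hE
  | n + 2, _, E, hE => by
    obtain ⟨K, hK⟩ := SES.exists_isGood E.2.1 hE.1
    obtain ⟨K', hK'⟩ := NExt.exists_isGood E.2.2 hE.2
    exact ⟨K ⊓ K', fun D hD => ⟨hK D fun g hg => (hD g hg).1, hK' D fun g hg => (hD g hg).2⟩⟩

lemma SES.IsSplit.exists_π_eq {B C : GMod (X.W r)} {E : SES B C} (hE : E.IsSplit) (c : C.obj ⊤) :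
    ∃ x, E.π.app ⊤ x = c := by
  obtain ⟨σ, -, hσ⟩ := hE
  exact ⟨σ ⊤ c, hσ ⊤ c⟩

lemma NExt.IsSGT.isGloballyExact {A : GMod (X.W r)} : ∀ {n : ℕ} {B : GMod (X.W r)} {E : NExt A n B},
    E.IsSGT → E.IsGloballyExact
  | 0, _, _, _ => trivial
  | 1, _, E, hE => SES.IsSplit.exists_π_eq hE
  | n + 2, _, E, hE => ⟨SES.IsSplit.exists_π_eq hE.1, NExt.IsSGT.isGloballyExact hE.2⟩

end CocyclesOfQuotients

/-! ### Ideals generated by Teichmüller representatives. -/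

section TeichmullerIdeals

variable {p : ℕ} [Fact p.Prime] {A : Type u} [CommRing A]

lemma verschiebung_mul_self (x : WittVector p A) :
    WittVector.verschiebung x * WittVector.verschiebung x =
      (p : WittVector p A) * WittVector.verschiebung (x * x) := by
  rw [← WittVector.verschiebung_mul_frobenius, WittVector.frobenius_verschiebung, ← mul_assoc,
    mul_comm, ← nsmul_eq_mul, ← nsmul_eq_mul, map_nsmul]

/-- Such a vector is a Verschiebung, whose square is divisible by `p`; and `p^{s+1} = 0` in length
`s + 1`. -/
lemma isNilpotent_of_coeffZero_eq_zero (h : (p : A) = 0) {s : ℕ}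
    {x : TruncatedWittVector p (s + 1) A} (hx : coeffZero p s A x = 0) : IsNilpotent x := by
  obtain ⟨y, rfl⟩ := exists_tV_eq hx
  obtain ⟨y, rfl⟩ := WittVector.truncate_surjective p s A y
  refine ⟨2 * (s + 1), ?_⟩
  rw [tV_truncate, pow_mul, pow_two, ← map_mul, verschiebung_mul_self, map_mul, mul_pow, map_natCast,
    truncated_natCast_pow h, zero_mul]

/-- An ideal of `W_s(A)` that contains powers of the Teichmüller representatives of a family of
elements that generate the unit ideal of `A` is the unit ideal. -/
lemma one_mem_of_teich_pow_mem (h : (p : A) = 0) (s : ℕ) (J : Ideal (TruncatedWittVector p s A))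
    {S : Set A} (hS : Ideal.span S = ⊤) (hJ : ∀ f ∈ S, ∃ k : ℕ, teich p s f ^ k ∈ J) : 1 ∈ J := by
  cases s with
  | zero =>
    rw [Subsingleton.elim 1 (0 : TruncatedWittVector p 0 A)]
    exact J.zero_mem
  | succ s =>
    rw [← J.eq_top_iff_one]
    by_contra hne
    obtain ⟨m, hm, hJm⟩ := J.exists_le_maximal hne
    have hp := hm.isPrime
    have key : ∀ f ∈ Ideal.span S, teich p (s + 1) f ∈ m := by
      intro f hf
      induction hf using Submodule.span_induction with
      | mem f hf =>
        obtain ⟨k, hk⟩ := hJ f hf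
        exact hp.mem_of_pow_mem k (hJm hk)
      | zero =>
        rw [teich_zero]
        exact m.zero_mem
      | add a b _ _ ha hb =>
        -- The Teichmüller map is additive up to nilpotents, which belong to every prime ideal. So
        -- the elements with representative in `m` are closed under sums and multiples.
        have h1 : IsNilpotent (teich p (s + 1) (a + b) - (teich p (s + 1) a + teich p (s + 1) b)) :=
          isNilpotent_of_coeffZero_eq_zero h (by
            rw [map_sub, map_add (coeffZero p s A), coeffZero_teich, coeffZero_teich,
              coeffZero_teich, sub_self])
        have h2 : teich p (s + 1) (a + b) - (teich p (s + 1) a + teich p (s + 1) b) ∈ m := by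
          obtain ⟨k, hk⟩ := h1
          exact hp.mem_of_pow_mem k (hk ▸ m.zero_mem)
        have h3 := m.add_mem h2 (m.add_mem ha hb)
        rwa [sub_add_cancel] at h3
      | smul a b _ hb =>
        rw [smul_eq_mul, map_mul]
        exact m.mul_mem_left _ hb
    have h1 := key 1 (hS ▸ trivial)
    rw [map_one] at h1
    exact hm.ne_top ((Ideal.eq_top_iff_one m).2 h1)

end TeichmullerIdeals

/-! ### Exactness of global sections on affine schemes. -/

section AffineExactness

variable {p : ℕ} [Fact p.Prime] {G : Type w} [Group G] [TopologicalSpace G] {X : GScheme.{u} p G}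
  {r : ℕ}

/-- On an affine scheme, the functor of global sections is exact on quasi-coherent modules. -/
lemma SES.exists_π_eq_of_isAffine (hX : IsAffine X.S) {B C : GMod (X.W r)} (hC : C.IsQCoh)
    (E : SES B C) (c : C.obj ⊤) : ∃ x, E.π.app ⊤ x = c := by
  have hU : IsAffineOpen (⊤ : X.S.Opens) := isAffineOpen_top X.S
  have hsm : ∀ (U : X.S.Opens) (a : (X.W r).obj U) (x : E.M.obj U),
    E.π.app U (a • x) = a • E.π.app U x := fun U a x => E.π.app_smul U a x
  -- `J` consists of the `a` for which `a • c` lifts globally. Quasi-coherence of the middle term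
  -- and of `C` puts a power of `[f]` in `J` whenever `c` lifts over `D(f)`, and such `D(f)` cover.
  let J : Ideal ((X.W r).obj ⊤) :=
    { carrier := {a | ∃ x, E.π.app ⊤ x = a • c}
      zero_mem' := ⟨0, by rw [_root_.map_zero, zero_smul]⟩
      add_mem' := by
        rintro a b ⟨x, hx⟩ ⟨y, hy⟩
        exact ⟨x + y, by rw [_root_.map_add, hx, hy, add_smul]⟩
      smul_mem' := by
        rintro a b ⟨x, hx⟩
        exact ⟨a • x, by rw [hsm, hx, smul_smul, smul_eq_mul]⟩ }
  have key : ∀ (f : X.O.obj ⊤) (x : E.M.obj (X.basicOpen f)),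
      E.π.app _ x = C.res (GScheme.basicOpen_le f) c → ∃ k : ℕ, X.teich r f ^ k ∈ J := by
    intro f x hx
    obtain ⟨k, y, hy⟩ := (E.qcoh ⊤ hU f).2 x
    obtain ⟨k', hk'⟩ := (hC ⊤ hU f).1 (E.π.app ⊤ y - X.teich r f ^ k • c) (by
      rw [_root_.map_sub, ← E.π.app_res, hy, hsm, hx, GMod.res_smul, _root_.map_pow, sub_self])
    refine ⟨k' + k, X.teich r f ^ k' • y, ?_⟩
    rw [smul_sub, smul_smul, ← pow_add, sub_eq_zero] at hk'
    rw [hsm, hk']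
  have hspan : Ideal.span {f : Γ(X.S, ⊤) | ∃ k : ℕ, X.teich r (show X.O.obj ⊤ from f) ^ k ∈ J} =
      ⊤ := by
    rw [← hU.self_le_iSup_basicOpen_iff]
    intro t _
    obtain ⟨V, hV, x, ht, hx⟩ := E.surj ⊤ c t trivial
    obtain ⟨f, hf, htf⟩ := hU.exists_basicOpen_le ⟨t, ht⟩ trivial
    refine TopologicalSpace.Opens.mem_iSup.2 ⟨⟨f, ?_⟩, htf⟩
    refine key f (E.M.res hf x) ?_
    exact (E.π.app_res hf x).trans ((congrArg (C.res hf) hx).trans (C.res_res _ _ c))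
  obtain ⟨x, hx⟩ : (1 : (X.W r).obj ⊤) ∈ J :=
    one_mem_of_teich_pow_mem (X.char_obj ⊤) r J hspan fun f hf => hf
  exact ⟨x, hx.trans (one_smul _ c)⟩

lemma NExt.isGloballyExact_of_isAffine (hX : IsAffine X.S) {A : GMod (X.W r)} (hA : A.IsQCoh) :
    ∀ {n : ℕ} {B : GMod (X.W r)} (E : NExt A n B), E.IsGloballyExact
  | 0, _, _ => trivial
  | 1, _, E => SES.exists_π_eq_of_isAffine hX hA E
  | n + 2, _, E => ⟨SES.exists_π_eq_of_isAffine hX E.1.2 E.2.1,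
      NExt.isGloballyExact_of_isAffine hX hA E.2.2⟩

end AffineExactness

/-! ### Global sections of Teichmüller lifts as Witt vectors over the functions on generators. -/

section WeightsOfLineBundle

variable {p : ℕ} [Fact p.Prime] {G : Type w} [Group G] [TopologicalSpace G] {X : GScheme.{u} p G}

namespace GMod

variable {L : GMod X.O}

lemma Gens.eq_of {U : X.S.Opens} {q q' : L.Gens U} (hV : q'.V = q.V)
    (hℓ : q'.ℓ = L.res hV.le q.ℓ) : q' = q := by
  obtain ⟨V, le, ℓ, hq⟩ := q
  obtain ⟨V', le', ℓ', hq'⟩ := q'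
  dsimp only at hV
  subst hV
  have h1 : ℓ' = ℓ := hℓ.trans (L.res_self _ _)
  subst h1
  rfl

lemma Gens.translate_one {U : X.S.Opens} (q : L.Gens U) (h : U ≤ X.tr 1 U) :
    q.translate 1 h = q :=
  Gens.eq_of (by
    change X.tr 1⁻¹ q.V = q.V
    rw [inv_one, X.tr_one]) (L.act_congr inv_one _ _ _)

lemma Gens.translate_translate {U V W : X.S.Opens} (q : L.Gens W) (g g' : G) (h : W ≤ X.tr g V)
    (h' : V ≤ X.tr g' U) :
    (q.translate g h).translate g' h' = q.translate (g * g') (GScheme.le_tr_mul h h') :=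
  have hV : X.tr g'⁻¹ (X.tr g⁻¹ q.V) = X.tr (g * g')⁻¹ q.V := by rw [mul_inv_rev, X.tr_mul]
  Gens.eq_of hV ((L.act_act' (mul_inv_rev g g').symm _ _ hV.le _).trans (L.res_act _ _ _ _).symm)

variable (L)

/-- Families of functions, one for each generator of `L`. -/
abbrev GenFun : Type u := ∀ q : L.Gens ⊤, X.O.obj q.V

variable {L}

lemma act_genFun_congr (f : L.GenFun) {q q' : L.Gens ⊤} (e : q = q') (g : G) {V : X.S.Opens}
    (h : V ≤ X.tr g q.V) (h' : V ≤ X.tr g q'.V) : X.O.act g h (f q) = X.O.act g h' (f q') := by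
  subst e
  rfl

variable (L)

/-- The action of `G` on families of functions indexed by the generators. -/
def genAct : G →* (L.GenFun →+* L.GenFun) where
  toFun g := RingHom.pi fun q => (X.O.act g (GScheme.le_tr_tr_inv g q.V)).comp
    (Pi.evalRingHom _ (q.translate g (GScheme.le_tr_top g ⊤)))
  map_one' := RingHom.ext fun f => funext fun q =>
    (act_genFun_congr f (q.translate_one _) 1 _ (GScheme.le_tr_one le_rfl)).trans
      (X.O.act_one _ _ _)
  map_mul' g g' := RingHom.ext fun f => funext fun q => by
    refine Eq.symm ((X.O.act_act g g' (GScheme.le_tr_tr_inv g q.V) (GScheme.le_tr_tr_inv g' _)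
      (f ((q.translate g (GScheme.le_tr_top g ⊤)).translate g' (GScheme.le_tr_top g' ⊤)))).trans ?_)
    exact act_genFun_congr f (q.translate_translate g g' _ _) (g * g') _ _

lemma genAct_apply (g : G) (f : L.GenFun) (q : L.Gens ⊤) : L.genAct g f q =
    X.O.act g (GScheme.le_tr_tr_inv g q.V) (f (q.translate g (GScheme.le_tr_top g ⊤))) := rfl

variable {L}

lemma genFun_char : (p : L.GenFun) = 0 := funext fun q => X.char_obj q.V

variable (L)

/-- The component of a family of functions at a generator. -/
def genProj (q : L.Gens ⊤) : L.GenFun →+* X.O.obj q.V :=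
  Pi.evalRingHom (fun q : L.Gens ⊤ => X.O.obj q.V) q

/-- The components of a Witt vector with coefficients in the families of functions indexed by the
generators. -/
def genEval (s : ℕ) : TruncatedWittVector p s L.GenFun →+ ∀ q : L.Gens ⊤, (X.W s).obj q.V where
  toFun x q := wittMap p s (L.genProj q) x
  map_zero' := funext fun q => _root_.map_zero _
  map_add' x y := funext fun q => _root_.map_add _ _ _

variable {L}

lemma coeff_genEval {s : ℕ} (x : TruncatedWittVector p s L.GenFun) (q : L.Gens ⊤) (i : Fin s) :
    X.coeff i (L.genEval s x q) = x.coeff i q :=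
  coeff_wittMap (L.genProj q) x i

lemma genEval_injective (s : ℕ) : Function.Injective (L.genEval s) := fun x y h =>
  TruncatedWittVector.ext fun i => funext fun q => by
    rw [← coeff_genEval, h, coeff_genEval]

lemma genEval_truncate {t s : ℕ} (h : t ≤ s) (x : TruncatedWittVector p s L.GenFun)
    (q : L.Gens ⊤) :
    L.genEval t (TruncatedWittVector.truncate h x) q = (X.trunc h).app _ (L.genEval s x q) :=
  (truncate_wittMap h (L.genProj q) x).symm

lemma genEval_frob {s : ℕ} (m : ℕ) (x : TruncatedWittVector p s L.GenFun) (q : L.Gens ⊤) :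
    L.genEval s (wittMap p s (WittLift.frob m genFun_char) x) q =
      (X.frob s m).app _ (L.genEval s x q) :=
  (wittMap_frob m genFun_char (X.char_obj q.V) (L.genProj q) x).symm

lemma genEval_tV {s : ℕ} (x : TruncatedWittVector p s L.GenFun) (q : L.Gens ⊤) :
    L.genEval (s + 1) (tV p s _ x) q = tV p s (X.O.obj q.V) (L.genEval s x q) :=
  wittMap_tV s (L.genProj q) x

lemma genEval_act {s : ℕ} (g : G) (x : TruncatedWittVector p s L.GenFun) (q : L.Gens ⊤) :
    L.genEval s (wittMap p s (L.genAct g) x) q =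
      (X.W s).act g (GScheme.le_tr_tr_inv g q.V)
        (L.genEval s x (q.translate g (GScheme.le_tr_top g ⊤))) :=
  GScheme.W_ext fun i => by
    rw [coeff_genEval, GScheme.coeff_act, coeff_genEval, coeff_wittMap, genAct_apply]

lemma genEval_teich {s : ℕ} (f : L.GenFun) (q : L.Gens ⊤) :
    L.genEval s (teich p s f) q = X.teich s (f q) :=
  wittMap_teich (L.genProj q) f

/-- The projection formula, together with `F[a] = [a]^p`. It is the reason why the Verschiebung maps
weight `k p` to weight `k`. -/
lemma teich_mul_tV {s k : ℕ} {V : X.S.Opens} (a : X.O.obj V) (y : (X.W s).obj V) :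
    X.teich (s + 1) a ^ k * (show (X.W (s + 1)).obj V from tV p s (X.O.obj V) y) =
      tV p s (X.O.obj V) (X.teich s a ^ (k * p) * y) := by
  have hc : (p : X.O.obj V) = 0 := X.char_obj V
  refine (mul_tV s hc (teich p (s + 1) a ^ k) y).trans ?_
  have h1 : wittMap p s (WittLift.frob 1 hc) (TruncatedWittVector.truncate s.le_succ
      (teich p (s + 1) a ^ k)) = teich p s a ^ (k * p) := by
    rw [_root_.map_pow, _root_.map_pow, truncate_teich, wittMap_teich]
    change teich p s (a ^ p ^ 1) ^ k = teich p s a ^ (k * p)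
    rw [pow_one, _root_.map_pow, ← pow_mul, mul_comm]
  exact congrArg (fun z : TruncatedWittVector p s (X.O.obj V) =>
    tV p s (X.O.obj V) (z * (show TruncatedWittVector p s (X.O.obj V) from y))) h1

variable (L)

/-- The weight subgroups attached to a line bundle: the global sections of its Teichmüller lifts. -/
def weights : WittWeights p G L.GenFun where
  char := genFun_char
  act := L.genAct
  N s k := (L.teichSections s k ⊤).comap (L.genEval s)
  trunc_mem {t s} h {k x} hx := by
    have h1 := ((L.teichTrunc h k).app ⊤ ⟨_, hx⟩).2
    exact (congrArg (· ∈ L.teichSections _ _ ⊤) (funext fun q => genEval_truncate h x q)).mpr h1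
  frob_mem {s k} m {x} hx := by
    have h1 := ((L.teichFrob s m k).app ⊤ ⟨_, hx⟩).2
    exact (congrArg (· ∈ L.teichSections _ _ ⊤) (funext fun q => genEval_frob m x q)).mpr h1
  tV_mem {s k x} := by
    refine forall_congr' fun q => forall_congr' fun q' => forall_congr' fun h =>
      forall_congr' fun a => forall_congr' fun ha => ?_
    rw [genEval_tV, genEval_tV, teich_mul_tV]
    refine Iff.trans (Eq.congr_right ?_) (tV_injective s).eq_iff
    exact wittMap_tV s _ _
  -- In length one the weight condition reads `a^k x_i(q') = x_i(q)`, up to restriction. Multiplying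
  -- the `p^m` relations gives the factor `a^{k p^m}`, and multiplicativity of the Teichmüller map
  -- carries the product relation to length `s`.
  teich_mem s {k m} x hx := by
    intro q q' h a ha
    have h1 : ∀ i, a ^ k * x i q' = X.O.res h (x i q) := fun i => by
      have h2 := hx i q q' h a ha
      rw [genEval_teich, genEval_teich, GScheme.res_teich, ← _root_.map_pow, ← _root_.map_mul] at h2
      have h3 := congrArg (coeffZero p 0 (X.O.obj q'.V)) h2
      exact (coeffZero_teich 0 _).symm.trans (h3.trans (coeffZero_teich 0 _))
    rw [genEval_teich, genEval_teich, GScheme.res_teich, ← _root_.map_pow, ← _root_.map_mul,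
      Finset.prod_apply, Finset.prod_apply, _root_.map_prod, ← Finset.prod_congr rfl fun i _ => h1 i,
      Finset.prod_mul_distrib, Finset.prod_const, Finset.card_univ, Fintype.card_fin, pow_mul]
  act_mem g {s k x} hx := by
    have h1 := (teichAct g (GScheme.le_tr_top g ⊤) ⟨_, hx⟩).2
    exact (congrArg (· ∈ L.teichSections _ _ ⊤) (funext fun q => genEval_act g x q)).mpr h1
  naive s k := by
    obtain ⟨K, hK⟩ := (L.teichLift s k).naive
    refine ⟨K, fun g hg x hx => genEval_injective s (funext fun q => ?_)⟩
    have h1 := hK g hg (GScheme.le_tr_top g ⊤) le_rfl ⟨_, hx⟩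
    have h2 := h1.trans ((L.teichLift s k).act_one ⊤ _ _)
    exact (genEval_act g x q).trans (congrFun (congrArg Subtype.val h2) q)

lemma mem_weights {s k : ℕ} {x : TruncatedWittVector p s L.GenFun} :
    x ∈ L.weights.N s k ↔ L.genEval s x ∈ L.teichSections s k ⊤ := Iff.rfl

end GMod

end WeightsOfLineBundle

/-! ### Comparison of global sections of the coefficients with weight subgroups. -/

section SectionsAsWittVectors

variable {p : ℕ} [Fact p.Prime] {G : Type w} [Group G] [TopologicalSpace G] [IsTopologicalGroup G]
  {X : GScheme.{u} p G} (L : LineBundle X) {N : ℕ∞} (T : CycChar p N G) (n : ℕ)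

namespace LineBundle

/-- Global sections of the Teichmüller lift, viewed as Witt vectors. -/
def glob (s : ℕ) (hs : (s : ℕ∞) ≤ N) (k : ℕ) :
    (L.coef T n s hs k).obj ⊤ →+ TruncatedWittVector p s L.GenFun where
  toFun σ := TruncatedWittVector.mk p fun i q => X.coeff i ((show L.teichSections s k ⊤ from σ).1 q)
  map_zero' := GMod.genEval_injective s (funext fun q => GScheme.W_ext fun i => by
    rw [GMod.coeff_genEval, TruncatedWittVector.coeff_mk, _root_.map_zero]
    rfl)
  map_add' σ τ := GMod.genEval_injective s (funext fun q => GScheme.W_ext fun i => by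
    rw [GMod.coeff_genEval, TruncatedWittVector.coeff_mk, _root_.map_add]
    refine congrArg (X.coeff i) ((congrArg₂ (· + ·) ?_ ?_ : _ = L.genEval s _ q + L.genEval s _ q))
    all_goals
      refine GScheme.W_ext fun i => ?_
      rw [GMod.coeff_genEval, TruncatedWittVector.coeff_mk])

variable {T n} {s t : ℕ} {hs : (s : ℕ∞) ≤ N} {ht : (t : ℕ∞) ≤ N} {k : ℕ}

lemma genEval_glob (σ : (L.coef T n s hs k).obj ⊤) :
    L.genEval s (L.glob T n s hs k σ) = (show L.teichSections s k ⊤ from σ).1 :=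
  funext fun q => GScheme.W_ext fun i => by
    rw [GMod.coeff_genEval]
    rfl

lemma glob_injective : Function.Injective (L.glob T n s hs k) := fun σ τ h => by
  have h1 := congrArg (L.genEval s) h
  rw [genEval_glob, genEval_glob] at h1
  exact Subtype.ext h1

lemma glob_mem (σ : (L.coef T n s hs k).obj ⊤) : L.glob T n s hs k σ ∈ L.weights.N s k := by
  rw [GMod.mem_weights, genEval_glob]
  exact (show L.teichSections s k ⊤ from σ).2

lemma exists_glob_eq {x : TruncatedWittVector p s L.GenFun} (hx : x ∈ L.weights.N s k) :
    ∃ σ, L.glob T n s hs k σ = x :=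
  ⟨(show L.teichSections s k ⊤ from ⟨_, hx⟩), GMod.genEval_injective s (L.genEval_glob _)⟩

lemma glob_globalRep (g : G) (σ : (L.coef T n s hs k).obj ⊤) :
    L.glob T n s hs k ((L.coef T n s hs k).globalRep g σ) =
      L.weights.rep s (T.mod s hs ^ n) g (L.glob T n s hs k σ) := by
  have h1 : (L.coef T n s hs k).globalRep g σ = (((T.mod s hs ^ n) g : ZMod (p ^ s)).val •
    (show (L.coef T n s hs k).obj ⊤ from
      GMod.teichAct g (GScheme.le_tr_top g ⊤) (show L.teichSections s k ⊤ from σ)) :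
        (L.coef T n s hs k).obj ⊤) := rfl
  rw [h1, _root_.map_nsmul, WittWeights.rep_apply]
  congr 1
  refine GMod.genEval_injective s (funext fun q => ?_)
  rw [genEval_glob]
  refine Eq.trans ?_ (GMod.genEval_act g _ q).symm
  rw [genEval_glob]
  rfl

lemma glob_coefTrunc (h : t ≤ s) (σ : (L.coef T n s hs k).obj ⊤) :
    L.glob T n t ht k ((L.coefTrunc T n h hs ht k).app ⊤ σ) =
      TruncatedWittVector.truncate h (L.glob T n s hs k σ) := by
  refine GMod.genEval_injective t (funext fun q => ?_)
  rw [GMod.genEval_truncate, genEval_glob, genEval_glob]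
  rfl

lemma glob_coefFrob (m : ℕ) (σ : (L.coef T n s hs k).obj ⊤) :
    L.glob T n s hs (k * p ^ m) ((L.coefFrob T n s hs m k).app ⊤ σ) =
      wittMap p s (WittLift.frob m L.weights.char) (L.glob T n s hs k σ) := by
  refine GMod.genEval_injective s (funext fun q => ?_)
  rw [GMod.genEval_frob, genEval_glob, genEval_glob]
  rfl

/-- Cochains of sections and cochains of Witt vectors. -/
lemma glob_coboundary {j : ℕ} (c : (Fin j → G) → (L.coef T n s hs k).obj ⊤) (x : Fin (j + 1) → G) :
    L.glob T n s hs k (coboundary (L.coef T n s hs k).globalRep j c x) =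
      coboundary (L.weights.rep s (T.mod s hs ^ n)) j (fun y => L.glob T n s hs k (c y)) x := by
  simp only [coboundary, AddMonoidHom.coe_mk, ZeroHom.coe_mk, _root_.map_add, map_sum, map_zsmul,
    glob_globalRep]

end LineBundle

end SectionsAsWittVectors

/-! ### Lifting of extension classes by lifting cocycles. -/

section LiftingClasses

variable {p : ℕ} [Fact p.Prime] {G : Type w} [Group G] [TopologicalSpace G] {X : GScheme.{u} p G}

namespace FinTorsor

variable {D : FinTorsor G} {r s : ℕ}

lemma isModel_zero {B : GMod (X.W r)} {n : ℕ} :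
    D.IsModel (fun _ : Fin n → G => (0 : B.obj ⊤)) fun _ => 0 :=
  ⟨fun x => (_root_.map_zero _).symm⟩

lemma IsModel.map {B : GMod (X.W r)} {B' : GMod (X.W s)} {φ : GRing.Hom (X.W r) (X.W s)}
    (β : GMod.Hom φ B B') {n : ℕ} {c : (Fin n → G) → B.obj ⊤}
    {u : (Fin (n + 1) → D.Q) → B.obj ⊤} (h : D.IsModel c u) :
    D.IsModel (fun x => β.app ⊤ (c x)) fun x => β.app ⊤ (u x) :=
  ⟨fun x => (congrArg (β.app ⊤) (h.eq x)).trans (β.app_act _ _ _)⟩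

lemma IsCocycle.map {B : GMod (X.W r)} {B' : GMod (X.W s)} {φ : GRing.Hom (X.W r) (X.W s)}
    (β : GMod.Hom φ B B') {n : ℕ} {u : (Fin (n + 1) → D.Q) → B.obj ⊤} (h : D.IsCocycle u) :
    D.IsCocycle fun x => β.app ⊤ (u x) :=
  ⟨fun g x => (congrArg (β.app ⊤) (h.smul g x)).trans (β.app_act _ _ _), fun x =>
    (map_hδ (β.app ⊤) u x).symm.trans ((congrArg (β.app ⊤) (h.hδ_eq x)).trans (map_zero _))⟩

variable [IsTopologicalGroup G] [CompactSpace G] [T2Space G] [TotallyDisconnectedSpace G]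

/-- Every globally exact extension has the class of an extension attached to a cocycle. -/
lemma exists_mk_ext_eq {B : GMod (X.W r)} (hB : B.IsQCoh) {n : ℕ} (E : NExt (X.WMod r) (n + 1) B)
    (hE : E.IsGloballyExact) :
    ∃ (D : FinTorsor G) (u : (Fin (n + 2) → D.Q) → B.obj ⊤) (hu : D.IsCocycle u),
      YonedaH.mk (hu.ext hB) = YonedaH.mk E := by
  obtain ⟨K, hK⟩ := NExt.exists_isGood E hE
  obtain ⟨D, hD⟩ := exists_stabilizer_le K
  obtain ⟨u, hu, h⟩ := exists_map_ext hB E (hK D hD)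
  exact ⟨D, u, hu, Quot.sound h⟩

end FinTorsor

namespace LineBundle

variable [IsTopologicalGroup G] [CompactSpace G] [T2Space G] [TotallyDisconnectedSpace G]
  (L : LineBundle X) {N : ℕ∞} {T : CycChar p N G}

lemma exists_glob_comp_eq {n s : ℕ} {hs : (s : ℕ∞) ≤ N} {k : ℕ} {Y : Type*} [TopologicalSpace Y]
    {c : Y → TruncatedWittVector p s L.GenFun} (hc : IsLocallyConstant c)
    (hm : ∀ y, c y ∈ L.weights.N s k) :
    ∃ c' : Y → (L.coef T n s hs k).obj ⊤, IsLocallyConstant c' ∧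
      ∀ y, L.glob T n s hs k (c' y) = c y := by
  choose c' hc' using fun y => L.exists_glob_eq (T := T) (n := n) (hs := hs) (hm y)
  refine ⟨c', IsLocallyConstant.desc c' (L.glob T n s hs k) ?_ L.glob_injective, hc'⟩
  convert hc using 1
  exact funext hc'

/-- The class attached to a cocycle lifts if the cocycle lifts up to a coboundary. -/
lemma liftsSGT_mk_ext {ν r : ℕ} {hr : (r : ℕ∞) ≤ N} {k : ℕ} {D : FinTorsor G}
    {u : (Fin (ν + 2) → D.Q) → (L.coef T (ν + 1) r hr k).obj ⊤} (hu : D.IsCocycle u)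
    {c : (Fin (ν + 1) → G) → (L.coef T (ν + 1) r hr k).obj ⊤} (hcu : D.IsModel c u)
    {C : ∀ s : ℕ, (s : ℕ∞) ≤ N → (Fin (ν + 1) → G) → TruncatedWittVector p s L.GenFun}
    (hC : ∀ s hs, L.weights.IsCocycle (T.mod s hs ^ (ν + 1)) (ν + 1) k (C s hs))
    (hCt : ∀ t s ht hs (h : t ≤ s) x, TruncatedWittVector.truncate h (C s hs x) = C t ht x)
    {b : (Fin ν → G) → TruncatedWittVector p r L.GenFun} (hb : IsLocallyConstant b)
    (hbm : ∀ x, b x ∈ L.weights.N r k)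
    (hCb : ∀ x, C r hr x = L.glob T (ν + 1) r hr k (c x) +
      coboundary (L.weights.rep r (T.mod r hr ^ (ν + 1))) ν b x) :
    L.LiftsSGT (YonedaH.mk (hu.ext (L.coef_isQCoh T (ν + 1) r hr k))) := by
  choose C' hC'l hC'g using fun s hs => L.exists_glob_comp_eq (T := T) (n := ν + 1) (hs := hs)
    (hC s hs).cont (hC s hs).mem
  obtain ⟨b', hb'l, hb'g⟩ := L.exists_glob_comp_eq (T := T) (n := ν + 1) (hs := hr) hb hbm
  have hC'0 : ∀ s hs, coboundary (L.coef T (ν + 1) s hs k).globalRep (ν + 1) (C' s hs) = 0 := by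
    intro s hs
    ext1 x
    refine L.glob_injective ?_
    rw [glob_coboundary]
    simp only [hC'g]
    rw [(hC s hs).cocycle, Pi.zero_apply, Pi.zero_apply, _root_.map_zero]
  have hC't : ∀ t s ht hs (h : t ≤ s) x,
      (L.coefTrunc T (ν + 1) h hs ht k).app ⊤ (C' s hs x) = C' t ht x := by
    intro t s ht hs h x
    refine L.glob_injective ?_
    rw [glob_coefTrunc, hC'g, hC'g, hCt]
  -- Each lifted cocycle, being locally constant, comes from a finite quotient, which can be taken
  -- as small as required. The quotient depends on `s`.
  have hmod : ∀ s hs (K : OpenSubgroup G), ∃ (D' : FinTorsor G)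
      (u' : (Fin (ν + 2) → D'.Q) → (L.coef T (ν + 1) s hs k).obj ⊤),
      (∀ g : G, g • D'.o = D'.o → g ∈ K) ∧ D'.IsModel (C' s hs) u' := by
    intro s hs K
    obtain ⟨K', hK'⟩ := FinTorsor.exists_isModel (hC'l s hs)
    obtain ⟨D', hD'⟩ := FinTorsor.exists_stabilizer_le (K ⊓ K')
    obtain ⟨u', hu'⟩ := hK' D' fun g hg => (hD' g hg).2
    exact ⟨D', u', fun g hg => (hD' g hg).1, hu'⟩
  have hq := fun s hs => L.coef_isQCoh T (ν + 1) s hs k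
  obtain ⟨Kb, hKb⟩ := FinTorsor.exists_isModel hb'l
  -- The quotient `D₀` is taken fine enough to map to `D` and to carry the correcting cochain `b'`;
  -- then the extension of `C' r` on `D₀` has the class of the given one on `D`.
  obtain ⟨D₀, u₀, hD₀, hu₀⟩ := hmod r hr (Kb ⊓ ⟨MulAction.stabilizer G D.o, D.isOpen⟩)
  obtain ⟨v, hv⟩ := hKb D₀ fun g hg => (hD₀ g hg).1
  obtain ⟨q₀⟩ := FinTorsor.exists_hom fun g hg => (hD₀ g hg).2
  have hmk : YonedaH.mk ((hu₀.isCocycle (hC'0 r hr)).ext (hq r hr)) =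
      YonedaH.mk (hu.ext (hq r hr)) := by
    refine Quot.sound (FinTorsor.IsModel.map_ext q₀ (α := GMod.Hom.id _) (fun _ _ => rfl)
      (GMod.Hom.id _) (hq r hr) (hq r hr) hu₀ _ hcu hu hv fun x => ?_)
    refine L.glob_injective ?_
    rw [_root_.map_add, glob_coboundary]
    simp only [hb'g]
    exact (hC'g r hr x).trans (hCb x)
  have hred : ∀ {t s : ℕ} (h : t ≤ s) (hs : (s : ℕ∞) ≤ N) (ht : (t : ℕ∞) ≤ N)
      {D' D : FinTorsor G} {u' : (Fin (ν + 2) → D'.Q) → (L.coef T (ν + 1) s hs k).obj ⊤}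
      {u : (Fin (ν + 2) → D.Q) → (L.coef T (ν + 1) t ht k).obj ⊤}
      (hu' : D'.IsModel (C' s hs) u') (hu : D.IsModel (C' t ht) u)
      (_ : ∀ g : G, g • D'.o = D'.o → g • D.o = D.o),
      L.IsRed h ((hu'.isCocycle (hC'0 s hs)).ext (hq s hs))
        ((hu.isCocycle (hC'0 t ht)).ext (hq t ht)) := by
    intro t s h hs ht D' D u' u hu' hu hDD
    obtain ⟨q⟩ := FinTorsor.exists_hom hDD
    refine FinTorsor.IsModel.map_ext q (α := X.truncMod h) (fun _ _ => rfl)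
      (L.coefTrunc T (ν + 1) h hs ht k) (hq s hs) (hq t ht) hu' _ hu _ FinTorsor.isModel_zero
      fun x => ?_
    rw [hC't]
    have h0 : coboundary (L.coef T (ν + 1) t ht k).globalRep ν (fun _ => 0) x = 0 :=
      congrFun (_root_.map_zero (coboundary (L.coef T (ν + 1) t ht k).globalRep ν)) x
    rw [h0, add_zero]
  refine ⟨fun s hs => ?_, fun hN => ?_⟩
  · obtain ⟨D', u', hD', hu'⟩ := hmod s hs.le ⟨MulAction.stabilizer G D₀.o, D₀.isOpen⟩
    exact ⟨_, ⟨_, rfl, (hu'.isCocycle (hC'0 s hs.le)).ext_isSGT (hq s hs.le)⟩, _, _, rfl, hmk,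
      hred _ hs.le hr hu' hu₀ hD'⟩
  · have hs : ∀ i : ℕ, ((r + i : ℕ) : ℕ∞) ≤ N := fun i => hN ▸ le_top
    let A : ℕ → Type _ := fun i => {x : Σ D' : FinTorsor G,
      (Fin (ν + 2) → D'.Q) → (L.coef T (ν + 1) (r + i) (hs i) k).obj ⊤ //
        x.1.IsModel (C' (r + i) (hs i)) x.2}
    have hstep : ∀ (i : ℕ) (a : A i), ∃ a' : A (i + 1),
        ∀ g : G, g • a'.1.1.o = a'.1.1.o → g • a.1.1.o = a.1.1.o := by
      intro i a
      obtain ⟨D', u', hD', hu'⟩ := hmod (r + (i + 1)) (hs (i + 1))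
        ⟨MulAction.stabilizer G a.1.1.o, a.1.1.isOpen⟩
      exact ⟨⟨⟨D', u'⟩, hu'⟩, hD'⟩
    choose nxt hnxt using hstep
    -- For infinite length a single finite quotient need not serve for all levels. They are chosen
    -- recursively, each dominating the preceding one, so that the reduction morphisms exist.
    let a : ∀ i, A i := fun i => Nat.rec ⟨⟨D₀, u₀⟩, hu₀⟩ nxt i
    exact ⟨fun i => ((a i).2.isCocycle (hC'0 _ (hs i))).ext (hq _ (hs i)),
      fun i => FinTorsor.IsCocycle.ext_isSGT _ _, hmk,
      fun i => hred _ (hs (i + 1)) (hs i) (a (i + 1)).2 (a i).2 (hnxt i (a i))⟩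

/-- The cochain of Witt vectors attached to a cocycle of a finite quotient. -/
lemma isCocycle_glob {n s : ℕ} {hs : (s : ℕ∞) ≤ N} {k : ℕ} {D : FinTorsor G}
    {u : (Fin (n + 1) → D.Q) → (L.coef T n s hs k).obj ⊤} (hu : D.IsCocycle u) :
    L.weights.IsCocycle (T.mod s hs ^ n) n k
      fun g => L.glob T n s hs k (u (D.pt (Fin.partialProd g))) := by
  refine ⟨(FinTorsor.isLocallyConstant_partialProd u).comp _, fun _ => L.glob_mem _, ?_⟩
  ext1 x
  rw [← glob_coboundary, hu.coboundary_eq_zero]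
  exact _root_.map_zero _

/-- Lifting of strongly geometrically trivial classes, after a Frobenius pullback. -/
theorem exists_isFrobPullback_liftsSGT {ν : ℕ} {e : ℕ∞} {T : CycChar p (e + 1) G}
    (hT : IsCyclotomicPair (ν + 1) e T) {r : ℕ} {hr : (r : ℕ∞) ≤ e + 1} {k : ℕ}
    {c : L.H T (ν + 1) r hr k} (hc : c.IsSGT) :
    ∃ (m : ℕ) (c' : L.H T (ν + 1) r hr (k * p ^ m)),
      L.IsFrobPullback m c c' ∧ c'.IsSGT ∧ L.LiftsSGT c' := by
  obtain ⟨E, rfl, hE⟩ := hc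
  have hq := fun k => L.coef_isQCoh T (ν + 1) r hr k
  obtain ⟨D, u, hu, hmk⟩ := FinTorsor.exists_mk_ext_eq (hq k) E hE.isGloballyExact
  obtain ⟨m, C, hC, hCt, b, hb, hbm, hCb⟩ := L.weights.exists_lift hT r hr (L.isCocycle_glob hu)
  have hu' := hu.map (L.coefFrob T (ν + 1) r hr m k)
  have hm := FinTorsor.isModel_of_smul hu.smul
  have hm' := hm.map (L.coefFrob T (ν + 1) r hr m k)
  refine ⟨m, YonedaH.mk (hu'.ext (hq _)), ⟨_, _, hmk, rfl, ?_⟩,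
    ⟨_, rfl, hu'.ext_isSGT (hq _)⟩, L.liftsSGT_mk_ext hu' hm' hC hCt hb hbm fun x => ?_⟩
  · refine FinTorsor.IsModel.map_ext (FinTorsor.Hom.id D) (α := X.frobMod r m) (fun _ _ => rfl)
      (L.coefFrob T (ν + 1) r hr m k) (hq _) (hq _) hm hu hm' hu' FinTorsor.isModel_zero fun x => ?_
    have h0 : coboundary (L.coef T (ν + 1) r hr (k * p ^ m)).globalRep ν (fun _ => 0) x = 0 :=
      congrFun (_root_.map_zero (coboundary (L.coef T (ν + 1) r hr (k * p ^ m)).globalRep ν)) x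
    rw [h0, add_zero]
  · rw [hCb, glob_coefFrob]

end LineBundle

end LiftingClasses

/-! ### Perfectness of the rings of functions on a perfect affine scheme. -/

section Perfect

variable {p : ℕ} [Fact p.Prime] {G : Type w} [Group G] [TopologicalSpace G] {X : GScheme.{u} p G}

lemma isUnit_res_basicOpen {U : X.S.Opens} (f : X.O.obj U) :
    IsUnit (X.O.res (GScheme.basicOpen_le f) f) := by
  rw [O_res]
  exact RingedSpace.isUnit_res_basicOpen X.S.toRingedSpace (show Γ(X.S, U) from f)

/-- A localization of a perfect ring is perfect. Denominators and annihilators are powers of `f`,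
and can be enlarged to `p`-th powers. -/
lemma frob_bijective_basicOpen {U : X.S.Opens} (hU : IsAffineOpen U)
    (hF : Function.Bijective fun a : X.O.obj U => a ^ p) (f : X.O.obj U) :
    Function.Bijective fun a : X.O.obj (X.basicOpen f) => a ^ p := by
  have hp : p ≠ 0 := (Fact.out : p.Prime).ne_zero
  have hu := isUnit_res_basicOpen f
  have hinj : ∀ y : X.O.obj (X.basicOpen f), y ^ p = 0 → y = 0 := by
    intro y hy
    obtain ⟨k, x, hx⟩ := exists_res_eq_pow_mul hU f y
    obtain ⟨j, hj⟩ := exists_pow_mul_eq_zero_of_res hU f (x ^ p) (by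
      rw [_root_.map_pow, hx, mul_pow, hy, mul_zero])
    have h1 : f ^ j * x = 0 := hF.1 (by
      change (f ^ j * x) ^ p = 0 ^ p
      rw [mul_pow, zero_pow hp, ← pow_sub_mul_pow (f ^ j) (Nat.one_le_iff_ne_zero.2 hp), pow_one,
        mul_assoc, hj, mul_zero])
    have h2 := congrArg (X.O.res (GScheme.basicOpen_le f)) h1
    rw [_root_.map_mul, _root_.map_pow, _root_.map_zero, hx, ← mul_assoc, ← pow_add] at h2
    exact (hu.pow _).mul_right_eq_zero.1 h2
  refine ⟨fun a b hab => ?_, fun y => ?_⟩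
  · have h1 := _root_.map_sub (WittLift.frob 1 (X.char_obj (X.basicOpen f))) a b
    have h2 : (a - b) ^ p ^ 1 = a ^ p ^ 1 - b ^ p ^ 1 := h1
    rw [pow_one] at h2
    exact sub_eq_zero.1 (hinj _ (h2.trans (sub_eq_zero.2 hab)))
  · obtain ⟨k, x, hx⟩ := exists_res_eq_pow_mul hU f y
    -- From `y = x / f^k = f^{k(p-1)} x / (f^k)^p`, a `p`-th root of `y` is a root of the numerator
    -- divided by `f^k`.
    obtain ⟨x', hx'⟩ := hF.2 (f ^ (k * (p - 1)) * x)
    obtain ⟨v, hv⟩ := (hu.pow k).exists_right_inv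
    refine ⟨v * X.O.res (GScheme.basicOpen_le f) x', ?_⟩
    have h1 : X.O.res (GScheme.basicOpen_le f) x' ^ p =
        (X.O.res (GScheme.basicOpen_le f) f ^ k) ^ p * y := by
      rw [← _root_.map_pow]
      refine (congrArg (X.O.res (GScheme.basicOpen_le f)) hx').trans ?_
      rw [_root_.map_mul, hx, _root_.map_pow, ← mul_assoc, ← pow_add, ← pow_mul]
      congr 2
      obtain ⟨p', hp'⟩ := Nat.exists_eq_succ_of_ne_zero hp
      rw [hp']
      simp [Nat.mul_succ]
    change (v * _) ^ p = y
    rw [mul_pow, h1, ← mul_assoc, ← mul_pow, mul_comm v, hv, one_pow, one_mul]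

/-- On a perfect affine scheme, all the rings of functions are perfect. -/
lemma frob_bijective (hX : IsAffine X.S) (hF : Function.Bijective fun a : Γ(X.S, ⊤) => a ^ p)
    (V : X.S.Opens) : Function.Bijective fun a : X.O.obj V => a ^ p := by
  have hU : IsAffineOpen (⊤ : X.S.Opens) := isAffineOpen_top X.S
  have hb := fun f : X.O.obj ⊤ => frob_bijective_basicOpen hU hF f
  have hcov : ∀ {W : X.S.Opens} (t : X.S), t ∈ W → ∃ f : X.O.obj ⊤, X.basicOpen f ≤ W ∧
      t ∈ X.basicOpen f := by
    intro W t ht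
    obtain ⟨f, hf, htf⟩ := hU.exists_basicOpen_le ⟨t, ht⟩ trivial
    exact ⟨f, hf, htf⟩
  have hinj : ∀ (W : X.S.Opens) (a b : X.O.obj W), a ^ p = b ^ p → a = b := by
    intro W a b hab
    refine O_sep a b fun t ht => ?_
    obtain ⟨f, hf, htf⟩ := hcov t ht
    refine ⟨_, hf, htf, (hb f).1 ?_⟩
    change X.O.res hf a ^ p = X.O.res hf b ^ p
    rw [← _root_.map_pow, ← _root_.map_pow, hab]
  refine ⟨fun a b => hinj V a b, fun y => ?_⟩
  choose f hf htf using fun t : V => hcov t.1 t.2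
  choose z hz using fun t : V => (hb (f t)).2 (X.O.res (hf t) y)
  obtain ⟨x, hx⟩ := O_glue (fun t : V => X.basicOpen (f t)) hf (fun t ht => ⟨⟨t, ht⟩, htf ⟨t, ht⟩⟩) z
    fun i j W hi hj => hinj W _ _ (by
      rw [← _root_.map_pow, ← _root_.map_pow]
      exact ((congrArg (X.O.res hi) (hz i)).trans (X.O.res_res hi (hf i) y)).trans
        ((congrArg (X.O.res hj) (hz j)).trans (X.O.res_res hj (hf j) y)).symm)
  refine ⟨x, O_sep _ _ fun t ht => ⟨_, hf ⟨t, ht⟩, htf ⟨t, ht⟩, ?_⟩⟩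
  refine (_root_.map_pow (X.O.res (hf ⟨t, ht⟩)) x p).trans ?_
  exact (congrArg (· ^ p) (hx ⟨t, ht⟩)).trans (hz ⟨t, ht⟩)

end Perfect

/-! ### Lifting of classes on perfect affine schemes. -/

section LiftingPerfect

variable {p : ℕ} [Fact p.Prime] {G : Type w} [Group G] [TopologicalSpace G] [IsTopologicalGroup G]
  [CompactSpace G] [T2Space G] [TotallyDisconnectedSpace G] {X : GScheme.{u} p G}

namespace LineBundle

lemma LiftsSGT.lifts {L : LineBundle X} {N : ℕ∞} {T : CycChar p N G} {n r : ℕ} {hr : (r : ℕ∞) ≤ N}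
    {k : ℕ} {c : L.H T n r hr k} (h : L.LiftsSGT c) : L.Lifts c := by
  refine ⟨fun s hs => ?_, fun hN => ?_⟩
  · obtain ⟨c', -, h1⟩ := h.1 s hs
    exact ⟨c', h1⟩
  · obtain ⟨E, -, h1⟩ := h.2 hN
    exact ⟨E, h1⟩

/-- Lifting of classes on a perfect affine scheme. -/
theorem lifts_of_isAffine (L : LineBundle X) {ν : ℕ} {e : ℕ∞} {T : CycChar p (e + 1) G}
    (hT : IsCyclotomicPair (ν + 1) e T) {r : ℕ} {hr : (r : ℕ∞) ≤ e + 1} {k : ℕ}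
    (hX : IsAffine X.S) (hF : Function.Bijective fun a : Γ(X.S, ⊤) => a ^ p)
    (c : L.H T (ν + 1) r hr k) : L.Lifts c := by
  obtain ⟨E, rfl⟩ : ∃ E, YonedaH.mk E = c := Quot.exists_rep c
  have hq := L.coef_isQCoh T (ν + 1) r hr k
  obtain ⟨D, u, hu, hmk⟩ := FinTorsor.exists_mk_ext_eq hq E
    (NExt.isGloballyExact_of_isAffine hX (WMod_isQCoh r) E)
  have hbij : ∀ (m : ℕ) (V : X.S.Opens), Function.Bijective (WittLift.frob m (X.char_obj V)) := by
    intro m V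
    have h1 : ∀ m, Function.Bijective fun a : X.O.obj V => a ^ p ^ m := by
      intro m
      induction m with
      | zero =>
        simp only [pow_zero, pow_one]
        exact Function.bijective_id
      | succ m ih =>
        have h2 := (frob_bijective hX hF V).comp ih
        convert h2 using 1
        exact funext fun a => by rw [Function.comp_apply, ← pow_mul, pow_succ]
    exact h1 m
  have hinj : ∀ m, Function.Injective (WittLift.frob m L.weights.char) := fun m a b h =>
    funext fun q => (hbij m q.V).1 (congrFun h q)
  have hsurj : ∀ (s k m : ℕ), ∀ x ∈ L.weights.N s (k * p ^ m), ∃ y ∈ L.weights.N s k,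
      wittMap p s (WittLift.frob m L.weights.char) y = x := by
    intro s k m x hx
    obtain ⟨y, hy⟩ : ∃ y : Fin s → L.GenFun, ∀ i q,
        WittLift.frob m L.weights.char (y i) q = x.coeff i q := by
      choose y hy using fun (i : Fin s) (q : L.Gens ⊤) => (hbij m q.V).2 (x.coeff i q)
      exact ⟨y, hy⟩
    have hy' : wittMap p s (WittLift.frob m L.weights.char) (TruncatedWittVector.mk p y) = x :=
      TruncatedWittVector.ext fun i => funext fun q => by
        rw [coeff_wittMap, TruncatedWittVector.coeff_mk]
        exact hy i q
    -- The roots are taken component by component, at each generator separately; injectivity of the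
    -- Frobenius shows that they satisfy the compatibility of weight `k`.
    refine ⟨TruncatedWittVector.mk p y, fun q q' h a ha => ?_, hy'⟩
    have h1 := hx q q' h a ha
    rw [← hy'] at h1
    have h2 : ∀ q, L.genEval s (wittMap p s (WittLift.frob m L.weights.char)
        (TruncatedWittVector.mk p y)) q = (X.frob s m).app q.V
          (L.genEval s (TruncatedWittVector.mk p y) q) := GMod.genEval_frob m _
    rw [h2, h2] at h1
    refine wittMap_injective (p := p) s (hbij m q'.V).1 ?_
    change (X.frob s m).app q'.V _ = (X.frob s m).app q'.V _
    rw [_root_.map_mul, _root_.map_pow, X.frob_teich, ← pow_mul, mul_comm (p ^ m), h1,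
      (X.frob s m).app_res]
  obtain ⟨C, hC, hCt, b, hb, hbm, hCb⟩ := L.weights.exists_lift_of_perfect hT hinj hsurj r hr
    (L.isCocycle_glob hu)
  rw [← hmk]
  have h1 : L.LiftsSGT (YonedaH.mk (hu.ext hq)) :=
    L.liftsSGT_mk_ext hu (FinTorsor.isModel_of_smul hu.smul) hC hCt hb hbm hCb
  exact LiftsSGT.lifts h1

end LineBundle

end LiftingPerfect

open TensorProduct

/-! ### Rings of Witt vectors of finite or infinite length -/

section WittRings

variable {p : ℕ} [Fact p.Prime] {N : ℕ∞} {A : Type u} [CommRing A] {B : Type v} [CommRing B]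

lemma mem_wittIdeal {x : WittVector p A} :
    x ∈ wittIdeal p N A ↔ ∀ k : ℕ, (k : ℕ∞) ≤ N → WittVector.truncate k x = 0 := by
  simp only [wittIdeal, Ideal.mem_iInf, RingHom.mem_ker]

variable (p N) in
/-- Functoriality of the rings of Witt vectors of length `N`. -/
def wittRingMap (f : A →+* B) : WittRing p N A →+* WittRing p N B :=
  Ideal.Quotient.lift (wittIdeal p N A) ((Ideal.Quotient.mk _).comp (WittVector.map f)) (by
    intro x hx
    refine Ideal.Quotient.eq_zero_iff_mem.2 (mem_wittIdeal.2 fun k hk => ?_)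
    rw [← wittMap_truncate, mem_wittIdeal.1 hx k hk, map_zero])

lemma wittRingMap_mk (f : A →+* B) (x : WittVector p A) :
    wittRingMap p N f (Ideal.Quotient.mk _ x) = Ideal.Quotient.mk _ (WittVector.map f x) :=
  rfl

lemma wittRingMap_one (x : WittRing p N A) : wittRingMap p N (RingHom.id A) x = x := by
  obtain ⟨x, rfl⟩ := Ideal.Quotient.mk_surjective x
  rw [wittRingMap_mk]
  congr 1

lemma wittRingMap_wittRingMap {C : Type*} [CommRing C] (f : A →+* B) (g : B →+* C)
    (x : WittRing p N A) : wittRingMap p N g (wittRingMap p N f x) = wittRingMap p N (g.comp f) x := by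
  obtain ⟨x, rfl⟩ := Ideal.Quotient.mk_surjective x
  rfl

variable (p N A) in
/-- Teichmüller representatives. -/
def wittRingTeich : A →* WittRing p N A :=
  (Ideal.Quotient.mk (wittIdeal p N A) : WittVector p A →* _).comp (WittVector.teichmuller p)

lemma wittRingMap_teich (f : A →+* B) (a : A) :
    wittRingMap p N f (wittRingTeich p N A a) = wittRingTeich p N B (f a) := by
  change Ideal.Quotient.mk _ (WittVector.map f (WittVector.teichmuller p a)) = _
  rw [WittVector.map_teichmuller]
  rfl

lemma wittResidue_teich (hN : 1 ≤ N) (a : A) : wittResidue p hN A (wittRingTeich p N A a) = a :=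
  WittVector.teichmuller_coeff_zero p a

lemma wittResidue_wittRingMap (hN : 1 ≤ N) (f : A →+* B) (x : WittRing p N A) :
    wittResidue p hN B (wittRingMap p N f x) = f (wittResidue p hN A x) := by
  obtain ⟨x, rfl⟩ := Ideal.Quotient.mk_surjective x
  exact WittVector.map_coeff f x 0

variable (p N) in
/-- The structure of algebra over `ℤ/p^N` on the Witt vectors of length `N` of a ring of
characteristic `p`. -/
def cycWitt (hA : (p : A) = 0) : CycRing p N →+* WittRing p N A :=
  Ideal.Quotient.lift (cycIdeal p N) ((Ideal.Quotient.mk _).comp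
    ((WittVector.map (zmodHom hA)).comp (WittVector.fromPadicInt p))) (by
    intro a ha
    refine Ideal.Quotient.eq_zero_iff_mem.2 (mem_wittIdeal.2 fun k hk => ?_)
    obtain ⟨b, rfl⟩ := Ideal.mem_span_singleton.1 (Ideal.mem_iInf.1 (Ideal.mem_iInf.1 ha k) hk)
    rw [map_mul, map_mul, map_pow, map_pow, map_natCast, map_natCast, truncated_natCast_pow hA,
      zero_mul])

lemma wittRingMap_cycWitt (hA : (p : A) = 0) (hB : (p : B) = 0) (f : A →+* B) (a : CycRing p N) :
    wittRingMap p N f (cycWitt p N hA a) = cycWitt p N hB a := by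
  obtain ⟨a, rfl⟩ := Ideal.Quotient.mk_surjective a
  change Ideal.Quotient.mk _ (WittVector.map f (WittVector.map (zmodHom hA) _)) =
    Ideal.Quotient.mk _ (WittVector.map (zmodHom hB) _)
  refine congrArg _ (WittVector.ext fun i => ?_)
  rw [WittVector.map_coeff, WittVector.map_coeff, WittVector.map_coeff, ← RingHom.comp_apply,
    Subsingleton.elim (f.comp (zmodHom hA)) (zmodHom hB)]

lemma wittResidue_cycWitt (hN : 1 ≤ N) (hA : (p : A) = 0) (a : CycRing p N) :
    wittResidue p hN A (cycWitt p N hA a) = zmodHom hA (cycOne p hN a) := by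
  obtain ⟨a, rfl⟩ := Ideal.Quotient.mk_surjective a
  refine (WittVector.map_coeff (zmodHom hA) _ 0).trans (congrArg _ ?_)
  have h1 : (WittVector.truncate 1).comp (WittVector.fromPadicInt p) =
      (TruncatedWittVector.zmodEquivTrunc p 1).toRingHom.comp (PadicInt.toZModPow 1) :=
    WittVector.truncate_comp_lift _ _
  have h2 : (WittVector.fromPadicInt p a).coeff 0 =
      coeffZero p 0 (ZMod p) (WittVector.truncate 1 (WittVector.fromPadicInt p a)) :=
    (WittVector.coeff_truncate _ (0 : Fin 1)).symm
  rw [h2]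
  refine (congrArg (coeffZero p 0 (ZMod p)) (RingHom.congr_fun h1 a)).trans ?_
  exact RingHom.congr_fun (Subsingleton.elim
    ((coeffZero p 0 (ZMod p)).comp (TruncatedWittVector.zmodEquivTrunc p 1).toRingHom)
    (ZMod.ringEquivCongr (pow_one p) : ZMod (p ^ 1) →+* ZMod p)) (PadicInt.toZModPow 1 a)

/-- For perfect `A`, the kernel of `W(A) → A` is generated by `p`, and it lies in the Jacobson
radical because `W(A)` is `p`-adically complete. The truncated case follows by passing to the
quotient. -/
lemma isUnit_one_add_of_wittResidue_eq_zero (hN : 1 ≤ N) (hA : (p : A) = 0)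
    (hF : Function.Bijective fun a : A => a ^ p) {x : WittRing p N A}
    (hx : wittResidue p hN A x = 0) : IsUnit (1 + x) := by
  obtain ⟨x, rfl⟩ := Ideal.Quotient.mk_surjective x
  rw [← map_one (Ideal.Quotient.mk (wittIdeal p N A)), ← map_add]
  refine IsUnit.map _ ?_
  rcases subsingleton_or_nontrivial A with h | h
  · have : (1 + x) = 1 := WittVector.ext fun i => Subsingleton.elim _ _
    rw [this]
    exact isUnit_one
  · have := charP_of_natCast_eq_zero hA
    have : PerfectRing A p := ⟨hF⟩
    have h1 : x ∈ Ideal.span {(p : WittVector p A)} :=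
      (WittVector.mem_span_p_iff_coeff_zero_eq_zero x).2 hx
    have h2 := Ideal.mem_jacobson_bot.1 (IsAdicComplete.le_jacobson_bot _ h1) 1
    rwa [mul_one, add_comm] at h2

end WittRings

/-! ### Invertible modules -/

section Invertible

/-- The symmetry hypothesis says that `E` has rank at most one. It implies `ev(s) t = ev(t) s` in
the tensor product of the dual with `E`; choosing `e` with `ev(e) = 1` gives `s = ev(s) e`, so that
the evaluation is injective. -/
lemma invertible_of_surjective {W E : Type*} [CommRing W] [AddCommGroup E] [Module W E]
    (h : ∀ (φ : Module.Dual W E) (x y : E), φ x • y = φ y • x)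
    (hs : Function.Surjective (contractLeft W E)) : Module.Invertible W E := by
  refine ⟨⟨fun s t hst => ?_, hs⟩⟩
  have key : ∀ s t : Module.Dual W E ⊗[W] E, contractLeft W E s • t = contractLeft W E t • s := by
    intro s t
    induction s using TensorProduct.induction_on with
    | zero => simp
    | add s s' h1 h2 => rw [map_add, add_smul, h1, h2, smul_add]
    | tmul φ x =>
      induction t using TensorProduct.induction_on with
      | zero => simp
      | add s s' h1 h2 => rw [map_add, add_smul, ← h1, ← h2, smul_add]
      | tmul ψ y =>
        rw [contractLeft_apply, contractLeft_apply, ← TensorProduct.tmul_smul, h φ x y,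
          TensorProduct.tmul_smul, TensorProduct.smul_tmul', TensorProduct.smul_tmul']
        refine congrArg (· ⊗ₜ[W] x) (LinearMap.ext fun z => ?_)
        have h3 := congrArg φ (h ψ y z)
        rw [map_smul, map_smul, smul_eq_mul, smul_eq_mul] at h3
        rw [LinearMap.smul_apply, LinearMap.smul_apply, smul_eq_mul, smul_eq_mul, h3, mul_comm]
  obtain ⟨e, he⟩ := hs 1
  have h1 := key e s
  have h2 := key e t
  rw [he, one_smul] at h1 h2
  rw [h1, h2, hst]

lemma invertible_smul_comm {A L : Type*} [CommRing A] [AddCommGroup L] [Module A L]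
    [Module.Invertible A L] (y : Module.Dual A L) (z z' : L) : y z • z' = y z' • z := by
  have h := congrArg ((TensorProduct.lid A L).toLinearMap ∘ₗ TensorProduct.map y LinearMap.id)
    (Module.Invertible.tmul_comm (R := A) (m₁ := z) (m₂ := z'))
  simpa using h

lemma invertible_mul_comm {A L : Type*} [CommRing A] [AddCommGroup L] [Module A L]
    [Module.Invertible A L] (y y' : Module.Dual A L) (z z' : L) : y z * y' z' = y z' * y' z := by
  rw [← smul_eq_mul, ← smul_eq_mul, ← map_smul, ← map_smul, invertible_smul_comm]

lemma invertible_span_eq_top {A L : Type*} [CommRing A] [AddCommGroup L] [Module A L]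
    [Module.Invertible A L] : Ideal.span {a : A | ∃ (y : Module.Dual A L) (z : L), y z = a} = ⊤ := by
  have key : ∀ t, contractLeft A L t ∈
      Ideal.span {a : A | ∃ (y : Module.Dual A L) (z : L), y z = a} := by
    intro t
    induction t using TensorProduct.induction_on with
    | zero => simp
    | tmul y z => exact Ideal.subset_span ⟨y, z, rfl⟩
    | add s t h1 h2 =>
      rw [map_add]
      exact add_mem h1 h2
  rw [Ideal.eq_top_iff_one]
  obtain ⟨t, ht⟩ := (Module.Invertible.bijective (R := A) (M := L)).2 1
  rw [← ht]
  exact key t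

/-- `y(z) (x - x') = y(x - x') z = 0`, and the values `y(z)` generate the unit ideal. -/
lemma invertible_eq_of_forall_dual {A L : Type*} [CommRing A] [AddCommGroup L] [Module A L]
    [Module.Invertible A L] {x x' : L} (h : ∀ y : Module.Dual A L, y x = y x') : x = x' := by
  have key : ∀ a ∈ Ideal.span {a : A | ∃ (y : Module.Dual A L) (z : L), y z = a}, a • (x - x') = 0 := by
    intro a ha
    induction ha using Submodule.span_induction with
    | mem a ha =>
      obtain ⟨y, z, rfl⟩ := ha
      rw [invertible_smul_comm, map_sub, h, sub_self, zero_smul]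
    | zero => simp
    | add a b _ _ h1 h2 => rw [add_smul, h1, h2, add_zero]
    | smul a b _ h => rw [smul_assoc, h, smul_zero]
  have h1 := key 1 ((Ideal.eq_top_iff_one _).1 (invertible_span_eq_top (A := A) (L := L)))
  rwa [one_smul, sub_eq_zero] at h1

/-- With `invertible_eq_of_forall_dual`, this identifies `L` with the functions on its dual
satisfying the proportionality relations, which is the description that `teichLine` lifts. The
multiple `y(z) f` comes from `f(y) z`, and the `y(z)` generate the unit ideal. -/
lemma invertible_exists_eq {A L : Type*} [CommRing A] [AddCommGroup L] [Module A L]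
    [Module.Invertible A L] (f : Module.Dual A L → A)
    (hf : ∀ (y y' : Module.Dual A L) z, y' z * f y = y z * f y') : ∃ x : L, ∀ y, y x = f y := by
  let J : Ideal A :=
    { carrier := {a | ∃ x : L, ∀ y : Module.Dual A L, y x = a * f y}
      zero_mem' := ⟨0, by simp⟩
      add_mem' := by
        rintro a b ⟨x, hx⟩ ⟨x', hx'⟩
        exact ⟨x + x', fun y => by rw [map_add, hx, hx', add_mul]⟩
      smul_mem' := by
        rintro a b ⟨x, hx⟩
        exact ⟨a • x, fun y => by rw [map_smul, hx, smul_eq_mul, smul_eq_mul, mul_assoc]⟩ }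
  have hJ : Ideal.span {a : A | ∃ (y : Module.Dual A L) (z : L), y z = a} ≤ J := by
    refine Ideal.span_le.2 ?_
    rintro _ ⟨y, z, rfl⟩
    exact ⟨f y • z, fun y' => by rw [map_smul, smul_eq_mul, mul_comm, ← hf]⟩
  obtain ⟨x, hx⟩ := hJ ((Ideal.eq_top_iff_one _).1 (invertible_span_eq_top (A := A) (L := L)))
  exact ⟨x, fun y => by rw [hx, one_mul]⟩

end Invertible

/-! ### Lines of Witt vectors -/

section TeichLine

variable {A : Type u} [CommRing A] {W : Type v} [CommRing W] {Y Z : Type*}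

/-- The functions `w` on `Y` which are proportional to the functions `y ↦ τ (β y z)`. For a pairing
`β` of rank one whose values generate the unit ideal, this is an invertible module. -/
def teichLine (τ : A →* W) (β : Y → Z → A) : Submodule W (Y → W) where
  carrier := {w | ∀ y y' z, τ (β y' z) * w y = τ (β y z) * w y'}
  zero_mem' := by simp
  add_mem' := by
    intro w w' h h' y y' z
    rw [Pi.add_apply, Pi.add_apply, mul_add, mul_add, h, h']
  smul_mem' := by
    intro a w h y y' z
    rw [Pi.smul_apply, Pi.smul_apply, smul_eq_mul, smul_eq_mul, mul_left_comm, h, mul_left_comm]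

variable {τ : A →* W} {π : W →+* A} {β : Y → Z → A}

/-- The function `y ↦ τ (β y z)`. -/
def teichLineGen (τ : A →* W) (hβ : ∀ y y' z z', β y z * β y' z' = β y z' * β y' z) (z : Z) :
    teichLine τ β :=
  ⟨fun y => τ (β y z), fun y y' z' => by rw [← map_mul, ← map_mul, mul_comm, hβ]⟩

/-- This replaces localization at the values of the pairing. The image of `J` in `A` contains the
`k`-th powers of generators of the unit ideal, and an element of `J` with residue `1` is a unit. -/
lemma teichLine_ideal_eq_top (hτ : ∀ a, π (τ a) = a) (hπ : ∀ x, π x = 0 → IsUnit (1 + x))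
    (hspan : Ideal.span {a | ∃ y z, β y z = a} = ⊤) {J : Ideal W} {k : ℕ}
    (hJ : ∀ y z, τ (β y z) ^ k ∈ J) : J = ⊤ := by
  have h1 : Ideal.map π J = ⊤ := by
    refine top_le_iff.1 ((Ideal.span_pow_eq_top _ hspan k).ge.trans (Ideal.span_le.2 ?_))
    rintro _ ⟨_, ⟨y, z, rfl⟩, rfl⟩
    have h2 := Ideal.mem_map_of_mem π (hJ y z)
    rwa [map_pow, hτ] at h2
  obtain ⟨j, hj, hj1⟩ := (Ideal.mem_map_iff_of_surjective π fun a => ⟨τ a, hτ a⟩).1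
    ((Ideal.eq_top_iff_one _).1 h1)
  refine Ideal.eq_top_of_isUnit_mem _ hj ?_
  have h2 := hπ (j - 1) (by rw [map_sub, hj1, map_one, sub_self])
  rwa [add_sub_cancel] at h2

variable (hτ : ∀ a, π (τ a) = a) (hπ : ∀ x, π x = 0 → IsUnit (1 + x))
    (hspan : Ideal.span {a | ∃ y z, β y z = a} = ⊤)
    (hβ : ∀ y y' z z', β y z * β y' z' = β y z' * β y' z)

include hτ hπ hspan

/-- After multiplication by `τ(β y'' z)^2` the equality follows from the defining relations of `w`
and `w'`; the annihilator of the difference is thus the unit ideal. -/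
lemma teichLine_mul_comm (w w' : teichLine τ β) (y y' : Y) :
    w.1 y * w'.1 y' = w'.1 y * w.1 y' := by
  let J : Ideal W := (Ideal.span {w.1 y * w'.1 y' - w'.1 y * w.1 y'}).annihilator
  have h1 := (Ideal.eq_top_iff_one J).1 (teichLine_ideal_eq_top (k := 2) hτ hπ hspan fun y'' z => by
    rw [Submodule.mem_annihilator_span_singleton, smul_eq_mul, mul_sub, sub_eq_zero, sq]
    linear_combination w.2 y y'' z * (τ (β y'' z) * w'.1 y') +
      (τ (β y z) * w.1 y'') * w'.2 y' y'' z - w'.2 y y'' z * (τ (β y'' z) * w.1 y') -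
      (τ (β y z) * w'.1 y'') * w.2 y' y'' z)
  rw [Submodule.mem_annihilator_span_singleton, one_smul, sub_eq_zero] at h1
  exact h1

lemma teichLine_smul_comm (w w' : teichLine τ β) (y : Y) : w.1 y • w' = w'.1 y • w :=
  Subtype.ext <| funext fun y' => teichLine_mul_comm hτ hπ hspan w w' y y'

include hβ

lemma teichLine_invertible : Module.Invertible W (teichLine τ β) := by
  refine invertible_of_surjective (fun φ x x' => Subtype.ext <| funext fun y => ?_) ?_
  · have h1 := congrArg φ (teichLine_smul_comm hτ hπ hspan x x' y)
    rw [map_smul, map_smul, smul_eq_mul, smul_eq_mul] at h1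
    change φ x * x'.1 y = φ x' * x.1 y
    rw [mul_comm, ← h1, mul_comm]
  · rw [← LinearMap.range_eq_top]
    refine teichLine_ideal_eq_top (k := 1) hτ hπ hspan fun y z => ?_
    rw [pow_one]
    exact ⟨((LinearMap.proj y).comp (teichLine τ β).subtype) ⊗ₜ teichLineGen τ hβ z, rfl⟩

/-- If all residues vanish, the rank-one relation `τ(β y z) x = x(y) • teichLineGen z` shows that
these multiples of `x` lie in the submodule, and the elements `τ(β y z)` generate the unit ideal. -/
lemma mem_ker_smul_teichLine (x : teichLine τ β) :
    x ∈ RingHom.ker π • (⊤ : Submodule W (teichLine τ β)) ↔ ∀ y, π (x.1 y) = 0 := by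
  refine ⟨fun hx y => ?_, fun hx => ?_⟩
  · induction hx using Submodule.smul_induction_on' with
    | smul a ha w _ =>
      change π (a * w.1 y) = 0
      rw [map_mul, (RingHom.mem_ker).1 ha, zero_mul]
    | add w _ w' _ h h' =>
      change π (w.1 y + w'.1 y) = 0
      rw [map_add, h, h', add_zero]
  · let J : Ideal W := Submodule.comap (LinearMap.toSpanSingleton W _ x)
      (RingHom.ker π • (⊤ : Submodule W (teichLine τ β)))
    have h1 := (Ideal.eq_top_iff_one J).1 (teichLine_ideal_eq_top (k := 1) hτ hπ hspan fun y z => by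
      rw [pow_one]
      change τ (β y z) • x ∈ RingHom.ker π • (⊤ : Submodule W (teichLine τ β))
      have h2 : x.1 y • teichLineGen τ hβ z = τ (β y z) • x :=
        teichLine_smul_comm hτ hπ hspan x (teichLineGen τ hβ z) y
      rw [← h2]
      exact Submodule.smul_mem_smul (hx y) trivial)
    change (1 : W) • x ∈ RingHom.ker π • (⊤ : Submodule W (teichLine τ β)) at h1
    rwa [one_smul] at h1

end TeichLine

/-! ### The Teichmüller lift of an equivariant line over a perfect ring. -/

section Smooth

variable {p : ℕ} [Fact p.Prime] {G : Type w} [Group G] [TopologicalSpace G] [IsTopologicalGroup G]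
  {N : ℕ∞} (T : CycChar p N G) (hN : 1 ≤ N) (n : ℕ) {A : Type u} [CommRing A] [MulSemiringAction G A]
  {L : Type u} [AddCommGroup L] [Module A L] [DistribMulAction G L] (hA : (p : A) = 0)

namespace CycChar

/-- The character giving the action on `A(n)`, for a ring `A` of characteristic `p`. -/
def scalar : G →* A :=
  ((zmodHom hA : ZMod p →+* A) : ZMod p →* A).comp ((Units.coeHom (ZMod p)).comp (T.one hN n))

/-- The character giving the action on `W_N(A)(n)`. -/
def wittScalar : G →* WittRing p N A :=
  ((cycWitt p N hA : CycRing p N →+* WittRing p N A) : CycRing p N →* WittRing p N A).comp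
    ((Units.coeHom (CycRing p N)).comp (T.χ ^ n))

lemma smul_scalar (g h : G) : g • T.scalar hN n hA h = T.scalar hN n hA h :=
  RingHom.congr_fun (Subsingleton.elim
    ((MulSemiringAction.toRingHom G A g).comp (zmodHom hA)) (zmodHom hA)) _

lemma scalar_mul_scalar_inv (g : G) : T.scalar hN n hA g * T.scalar hN n hA g⁻¹ = 1 := by
  rw [← map_mul, mul_inv_cancel, map_one]

lemma wittResidue_wittScalar (g : G) :
    wittResidue p hN A (T.wittScalar n hA g) = T.scalar hN n hA g :=
  wittResidue_cycWitt hN hA _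

lemma wittRingMap_wittScalar (f : A →+* A) (g : G) :
    wittRingMap p N f (T.wittScalar n hA g) = T.wittScalar n hA g :=
  wittRingMap_cycWitt hA hA f _

end CycChar

variable (hL : ∀ (g : G) (a : A) (x : L), g • (a • x) = (g • a) • g • x)

/-- The action of `G` on the `A(n)`-valued dual of `L`. -/
def dualAct (g : G) (y : Module.Dual A L) : Module.Dual A L where
  toFun x := T.scalar hN n hA g * g • y (g⁻¹ • x)
  map_add' x x' := by rw [smul_add, map_add, smul_add, mul_add]
  map_smul' a x := by
    rw [hL, map_smul, smul_eq_mul, smul_mul', smul_inv_smul, RingHom.id_apply, smul_eq_mul,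
      mul_left_comm]

lemma dualAct_apply (g : G) (y : Module.Dual A L) (x : L) :
    dualAct T hN n hA hL g y x = T.scalar hN n hA g * g • y (g⁻¹ • x) :=
  rfl

lemma dualAct_one (y : Module.Dual A L) : dualAct T hN n hA hL 1 y = y :=
  LinearMap.ext fun x => by rw [dualAct_apply, map_one, one_mul, inv_one, one_smul, one_smul]

lemma dualAct_dualAct (g h : G) (y : Module.Dual A L) :
    dualAct T hN n hA hL g (dualAct T hN n hA hL h y) = dualAct T hN n hA hL (g * h) y :=
  LinearMap.ext fun x => by
    rw [dualAct_apply, dualAct_apply, dualAct_apply, smul_mul', CycChar.smul_scalar, map_mul,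
      mul_assoc, mul_inv_rev, mul_smul, mul_smul]

/-- The action on `L`, seen on functions on the dual, acquires an explicit factor `χ^n`. Thus `L`
becomes a twist by `χ^n`, as the cyclotomic hypothesis requires. -/
lemma apply_smul_eq (g : G) (y : Module.Dual A L) (x : L) :
    y (g • x) = T.scalar hN n hA g * g • (dualAct T hN n hA hL g⁻¹ y x) := by
  rw [dualAct_apply, smul_mul', CycChar.smul_scalar, smul_inv_smul, inv_inv, ← mul_assoc,
    CycChar.scalar_mul_scalar_inv, one_mul]

lemma smul_dualAct_inv_apply (g : G) (y : Module.Dual A L) (x : L) :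
    g • (dualAct T hN n hA hL g⁻¹ y x) = T.scalar hN n hA g⁻¹ * y (g • x) := by
  rw [apply_smul_eq T hN n hA hL, ← mul_assoc, mul_comm (T.scalar hN n hA g⁻¹),
    CycChar.scalar_mul_scalar_inv, one_mul]

/-- An open subgroup acts trivially on all the data. -/
lemma exists_openSubgroup_dualAct (s : ℕ) (hAc : ∃ K : OpenSubgroup G, ∀ g ∈ K, ∀ a : A, g • a = a)
    (hLc : ∃ K : OpenSubgroup G, ∀ g ∈ K, ∀ x : L, g • x = x) :
    ∃ K : OpenSubgroup G, ∀ g ∈ K, (∀ a : A, g • a = a) ∧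
      (∀ y, dualAct T hN n hA hL g y = y) ∧
      ∃ b : WittRing p N A, T.wittScalar n hA g = 1 + p ^ s * b := by
  obtain ⟨K, hK⟩ := hAc
  obtain ⟨K', hK'⟩ := hLc
  obtain ⟨K₁, hK₁⟩ := T.exists_openSubgroup n 1
  obtain ⟨K₂, hK₂⟩ := T.exists_openSubgroup n s
  refine ⟨(K ⊓ K') ⊓ (K₁ ⊓ K₂), fun g hg => ⟨hK g hg.1.1, fun y => LinearMap.ext fun x => ?_, ?_⟩⟩
  · obtain ⟨b, hb⟩ := hK₁ g hg.2.1
    have h1 : T.scalar hN n hA g = 1 := by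
      change zmodHom hA (cycOne p hN ((T.χ ^ n) g : CycRing p N)) = 1
      rw [hb, map_add, map_mul, map_pow, map_natCast, CharP.cast_eq_zero, pow_one, zero_mul,
        map_one, add_zero, map_one]
    rw [dualAct_apply, h1, one_mul, hK g hg.1.1, hK' _ (inv_mem hg.1.2)]
  · obtain ⟨b, hb⟩ := hK₂ g hg.2.2
    refine ⟨cycWitt p N hA b, ?_⟩
    change cycWitt p N hA ((T.χ ^ n) g : CycRing p N) = _
    rw [hb, map_add, map_mul, map_pow, map_natCast, map_one]

variable (p N A L) in
/-- The lift of the line `L` to `W_N(A)`. -/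
abbrev TeichLift : Type u :=
  teichLine (wittRingTeich p N A) (fun (y : Module.Dual A L) (z : L) => y z)

/-- The action of `G` on the lift of a line. -/
def teichAct (g : G) : TeichLift p N A L →+ TeichLift p N A L where
  toFun w := ⟨fun y => T.wittScalar n hA g * wittRingMap p N (MulSemiringAction.toRingHom G A g)
      (w.1 (dualAct T hN n hA hL g⁻¹ y)), fun y y' z => by
    have h1 := congrArg (wittRingMap p N (MulSemiringAction.toRingHom G A g))
      (w.2 (dualAct T hN n hA hL g⁻¹ y) (dualAct T hN n hA hL g⁻¹ y') (g⁻¹ • z))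
    rw [map_mul, map_mul, wittRingMap_teich, wittRingMap_teich, MulSemiringAction.toRingHom_apply,
      MulSemiringAction.toRingHom_apply, smul_dualAct_inv_apply, smul_dualAct_inv_apply,
      smul_inv_smul, map_mul, map_mul] at h1
    have h2 := congrArg (wittRingTeich p N A) (T.scalar_mul_scalar_inv hN n hA g)
    rw [map_mul, map_one] at h2
    -- The relation `h1` carries the Teichmüller representative of the scalar of `g⁻¹`, which is
    -- cancelled by that of `g`.
    linear_combination (T.wittScalar n hA g * wittRingTeich p N A (T.scalar hN n hA g)) * h1 -
      (T.wittScalar n hA g * (wittRingTeich p N A (y' z) *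
        wittRingMap p N (MulSemiringAction.toRingHom G A g) (w.1 (dualAct T hN n hA hL g⁻¹ y)) -
        wittRingTeich p N A (y z) *
        wittRingMap p N (MulSemiringAction.toRingHom G A g) (w.1 (dualAct T hN n hA hL g⁻¹ y')))) * h2⟩
  map_zero' := Subtype.ext <| funext fun y => by
    change _ * wittRingMap p N _ 0 = 0
    rw [map_zero, mul_zero]
  map_add' w w' := Subtype.ext <| funext fun y => by
    change _ * wittRingMap p N _ (_ + _) = _ * _ + _ * _
    rw [map_add, mul_add]

lemma teichAct_apply (g : G) (w : TeichLift p N A L) (y : Module.Dual A L) :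
    (teichAct T hN n hA hL g w).1 y = T.wittScalar n hA g *
      wittRingMap p N (MulSemiringAction.toRingHom G A g) (w.1 (dualAct T hN n hA hL g⁻¹ y)) :=
  rfl

/-- The action of `G` on the lift of a line. -/
abbrev teichDistribMulAction : DistribMulAction G (TeichLift p N A L) where
  smul g w := teichAct T hN n hA hL g w
  one_smul w := Subtype.ext <| funext fun y => by
    change (teichAct T hN n hA hL 1 w).1 y = _
    have h1 : MulSemiringAction.toRingHom G A 1 = RingHom.id A := RingHom.ext fun a => one_smul G a
    rw [teichAct_apply, inv_one, dualAct_one, map_one, one_mul, h1, wittRingMap_one]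
  mul_smul g h w := Subtype.ext <| funext fun y => by
    change (teichAct T hN n hA hL (g * h) w).1 y =
      (teichAct T hN n hA hL g (teichAct T hN n hA hL h w)).1 y
    have h1 : MulSemiringAction.toRingHom G A (g * h) = (MulSemiringAction.toRingHom G A g).comp
      (MulSemiringAction.toRingHom G A h) := RingHom.ext fun a => mul_smul g h a
    rw [teichAct_apply, teichAct_apply, teichAct_apply, map_mul (wittRingMap p N _),
      CycChar.wittRingMap_wittScalar, wittRingMap_wittRingMap, ← h1, dualAct_dualAct, mul_inv_rev,
      map_mul, mul_assoc]
  smul_zero g := map_zero (teichAct T hN n hA hL g)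
  smul_add g := map_add (teichAct T hN n hA hL g)

section Residue

variable [Module.Invertible A L]

variable (p L) in
lemma exists_teichResidue (w : TeichLift p N A L) :
    ∃ x : L, ∀ y : Module.Dual A L, y x = wittResidue p hN A (w.1 y) :=
  invertible_exists_eq _ fun y y' z => by
    have h1 := congrArg (wittResidue p hN A) (w.2 y y' z)
    rwa [map_mul, map_mul, wittResidue_teich, wittResidue_teich] at h1

variable (p L) in
/-- The reduction of the lift of a line. -/
def teichResidue : TeichLift p N A L →+ L where
  toFun w := (exists_teichResidue p hN L w).choose
  map_zero' := invertible_eq_of_forall_dual fun y => by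
    rw [(exists_teichResidue p hN L _).choose_spec, map_zero]
    exact map_zero _
  map_add' w w' := invertible_eq_of_forall_dual fun y => by
    rw [(exists_teichResidue p hN L _).choose_spec, map_add,
      (exists_teichResidue p hN L _).choose_spec, (exists_teichResidue p hN L _).choose_spec]
    exact map_add _ _ _

lemma apply_teichResidue (w : TeichLift p N A L) (y : Module.Dual A L) :
    y (teichResidue p hN L w) = wittResidue p hN A (w.1 y) :=
  (exists_teichResidue p hN L w).choose_spec y

lemma teichResidue_smul (a : WittRing p N A) (w : TeichLift p N A L) :
    teichResidue p hN L (a • w) = wittResidue p hN A a • teichResidue p hN L w :=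
  invertible_eq_of_forall_dual fun y => by
    rw [apply_teichResidue, map_smul, apply_teichResidue]
    exact map_mul _ _ _

lemma teichResidue_teichAct (g : G) (w : TeichLift p N A L) :
    teichResidue p hN L (teichAct T hN n hA hL g w) = g • teichResidue p hN L w :=
  invertible_eq_of_forall_dual fun y => by
    rw [apply_teichResidue, teichAct_apply, map_mul, CycChar.wittResidue_wittScalar,
      wittResidue_wittRingMap, apply_smul_eq T hN n hA hL, apply_teichResidue]
    rfl

lemma teichResidue_surjective : Function.Surjective (teichResidue p hN L (A := A)) := fun x =>
  ⟨teichLineGen _ (fun y y' z z' => invertible_mul_comm y y' z z') x,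
    invertible_eq_of_forall_dual fun y => by
      rw [apply_teichResidue]
      exact wittResidue_teich hN _⟩

variable (hF : Function.Bijective fun a : A => a ^ p)

include hA hF

lemma teichResidue_eq_zero_iff (w : TeichLift p N A L) : teichResidue p hN L w = 0 ↔
    w ∈ RingHom.ker (wittResidue p hN A) • (⊤ : Submodule (WittRing p N A) (TeichLift p N A L)) := by
  refine Iff.trans ⟨fun h y => ?_, fun h => invertible_eq_of_forall_dual (A := A) fun y => ?_⟩
    (mem_ker_smul_teichLine (wittResidue_teich hN)
      (fun x => isUnit_one_add_of_wittResidue_eq_zero hN hA hF) invertible_span_eq_top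
      (fun y y' z z' => invertible_mul_comm y y' z z') w).symm
  · rw [← apply_teichResidue, h, map_zero]
  · rw [apply_teichResidue, h, map_zero]

/-- The lift of a `G`-linearized invertible `A`-module to `W_N(A)`, where `A` is perfect. -/
def teichWittLine (hAc : ∃ K : OpenSubgroup G, ∀ g ∈ K, ∀ a : A, g • a = a)
    (hLc : ∃ K : OpenSubgroup G, ∀ g ∈ K, ∀ x : L, g • x = x) : WittLine p N A G where
  L := TeichLift p N A L
  act := teichDistribMulAction T hN n hA hL
  invertible := teichLine_invertible (wittResidue_teich hN)
    (fun x => isUnit_one_add_of_wittResidue_eq_zero hN hA hF) invertible_span_eq_top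
    (fun y y' z z' => invertible_mul_comm y y' z z')
  semilinear g a w := Subtype.ext <| funext fun y => by
    change T.wittScalar n hA g * wittRingMap p N _ (_ * _) = _ * (T.wittScalar n hA g * _)
    rw [map_mul, wittRingMap_mk, mul_left_comm]
  cont s := by
    obtain ⟨K, hK⟩ := exists_openSubgroup_dualAct T hN n hA hL s hAc hLc
    refine ⟨K, fun g hg w => ?_⟩
    obtain ⟨b, hb⟩ := (hK g hg).2.2
    refine ⟨b • w, Subtype.ext <| funext fun y => ?_⟩
    have h1 : MulSemiringAction.toRingHom G A g = RingHom.id A := RingHom.ext (hK g hg).1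
    change T.wittScalar n hA g * wittRingMap p N (MulSemiringAction.toRingHom G A g)
      (w.1 (dualAct T hN n hA hL g⁻¹ y)) = w.1 y + p ^ s • (b * w.1 y)
    rw [h1, wittRingMap_one, (hK g⁻¹ (inv_mem hg)).2.1, hb, nsmul_eq_mul, Nat.cast_pow]
    ring

end Residue

end Smooth

/-! ### Lifting cocycles with values in lines, and smoothness. -/

section Smooth

variable {p : ℕ} [Fact p.Prime] {G : Type w} [Group G] [TopologicalSpace G] [IsTopologicalGroup G]

/-- A finite family of proportional functions on the dual of an invertible module, permuted by `G`,
gives an equivariant map from a permutation module to the lift of the line. -/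
lemma exists_permHom {N : ℕ∞} (T : CycChar p N G) (hN : 1 ≤ N) (n : ℕ) {A : Type u} [CommRing A]
    [MulSemiringAction G A] {L : Type u} [AddCommGroup L] [Module A L] [DistribMulAction G L]
    [Module.Invertible A L] (hA : (p : A) = 0)
    (hL : ∀ (g : G) (a : A) (x : L), g • (a • x) = (g • a) • g • x) {Φ : Type u} [Fintype Φ]
    [MulAction G Φ] (t : Φ → Module.Dual A L → A)
    (ht : ∀ φ (y y' : Module.Dual A L) z, y' z * t φ y = y z * t φ y')
    (htg : ∀ (g : G) φ y, g • t φ (dualAct T hN n hA hL g⁻¹ y) = t (g • φ) y) :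
    ∃ (Θ : (Φ → CycRing p N) →+ TeichLift p N A L) (θ : (Φ → ZMod p) →+ L),
      (∀ g F, Θ (permRep (T.χ ^ n) Φ g F) = teichAct T hN n hA hL g (Θ F)) ∧
      (∀ g F, θ (permRep (T.one hN n) Φ g F) = g • θ F) ∧
      (∀ F, teichResidue p hN L (Θ F) = θ fun φ => cycOne p hN (F φ)) ∧
      ∀ F (y : Module.Dual A L), y (θ F) = ∑ φ, zmodHom hA (F φ) * t φ y := by
  let κ : CycRing p N →+* (Module.Dual A L → WittRing p N A) := RingHom.pi fun _ => cycWitt p N hA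
  let τ : Φ → Module.Dual A L → WittRing p N A := fun φ y => wittRingTeich p N A (t φ y)
  have hmem : ∀ F, permSum κ τ F ∈
      teichLine (wittRingTeich p N A) (fun (y : Module.Dual A L) (z : L) => y z) := by
    intro F
    refine sum_mem fun φ _ => Submodule.smul_mem _ (cycWitt p N hA (F φ)) ?_
    intro y y' z
    change _ * wittRingTeich p N A (t φ y) = _ * wittRingTeich p N A (t φ y')
    rw [← map_mul, ← map_mul, ht]
  let Θ : (Φ → CycRing p N) →+ TeichLift p N A L :=
    { toFun := fun F => ⟨permSum κ τ F, hmem F⟩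
      map_zero' := Subtype.ext (map_zero (permSum κ τ))
      map_add' := fun F F' => Subtype.ext (map_add (permSum κ τ) F F') }
  -- A proportional function on the dual is evaluation at an element `ξ φ` of `L`; the residue of
  -- the lifted map is the combination of these elements.
  choose ξ hξ using fun φ => invertible_exists_eq (t φ) (ht φ)
  let θ : (Φ → ZMod p) →+ L :=
    { toFun := fun F => ∑ φ, zmodHom hA (F φ) • ξ φ
      map_zero' := by simp
      map_add' := fun F F' => by simp [add_smul, Finset.sum_add_distrib] }
  have hθ : ∀ F (y : Module.Dual A L), y (θ F) = ∑ φ, zmodHom hA (F φ) * t φ y := by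
    intro F y
    change y (∑ φ, zmodHom hA (F φ) • ξ φ) = _
    rw [map_sum]
    exact Finset.sum_congr rfl fun φ _ => by rw [map_smul, hξ, smul_eq_mul]
  refine ⟨Θ, θ, fun g F => Subtype.ext ?_, fun g F => ?_, fun F => ?_, hθ⟩
  · let σ : (Module.Dual A L → WittRing p N A) →+* (Module.Dual A L → WittRing p N A) :=
      RingHom.pi fun y => (wittRingMap p N (MulSemiringAction.toRingHom G A g)).comp
        (Pi.evalRingHom _ (dualAct T hN n hA hL g⁻¹ y))
    exact permSum_permRep κ (T.χ ^ n) τ σ (fun a => funext fun y => wittRingMap_cycWitt hA hA _ a) g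
      (fun φ => funext fun y => (wittRingMap_teich _ _).trans
        (congrArg (wittRingTeich p N A) (htg g φ y))) F
  · refine invertible_eq_of_forall_dual (A := A) fun y => ?_
    rw [hθ, apply_smul_eq T hN n hA hL, hθ, Finset.smul_sum, Finset.mul_sum]
    refine (Fintype.sum_equiv (MulAction.toPerm g) _ _ fun φ => ?_).symm
    have h1 : g • zmodHom hA (F φ) = zmodHom hA (F φ) := RingHom.congr_fun (Subsingleton.elim
      ((MulSemiringAction.toRingHom G A g).comp (zmodHom hA)) (zmodHom hA)) (F φ)
    rw [permRep_apply, MulAction.toPerm_apply, inv_smul_smul, map_mul, smul_mul', htg, h1, mul_assoc]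
    rfl
  · refine invertible_eq_of_forall_dual (A := A) fun y => ?_
    rw [apply_teichResidue, hθ]
    change wittResidue p hN A ((∑ φ, κ (F φ) * τ φ) y) = _
    rw [Finset.sum_apply, map_sum]
    refine Finset.sum_congr rfl fun φ _ => ?_
    change wittResidue p hN A (cycWitt p N hA (F φ) * wittRingTeich p N A (t φ y)) = _
    rw [map_mul, wittResidue_cycWitt, wittResidue_teich]

/-- Cocycles with values in a `G`-linearized line over a perfect ring lift to Witt vectors. -/
lemma exists_lift_line [CompactSpace G] {ν : ℕ} {e : ℕ∞} {T : CycChar p (e + 1) G}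
    (hT : IsCyclotomicPair (ν + 1) e T) {A : Type u} [CommRing A] [MulSemiringAction G A]
    {L : Type u} [AddCommGroup L] [Module A L] [DistribMulAction G L]
    [Module.Invertible A L] (hA : (p : A) = 0) (hF : Function.Bijective fun a : A => a ^ p)
    (hL : ∀ (g : G) (a : A) (x : L), g • (a • x) = (g • a) • g • x)
    (hAc : ∃ K : OpenSubgroup G, ∀ g ∈ K, ∀ a : A, g • a = a)
    (hLc : ∃ K : OpenSubgroup G, ∀ g ∈ K, ∀ x : L, g • x = x)
    {c : (Fin (ν + 1) → G) → L} (hc : IsLocallyConstant c)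
    (hc0 : coboundary (Representation.ofDistribMulAction ℤ G L) (ν + 1) c = 0) :
    ∃ (ρ : Representation ℤ G (TeichLift p (e + 1) A L)) (C : (Fin (ν + 1) → G) → TeichLift p (e + 1) A L),
      (∀ g w, ρ g w = teichAct T le_add_self (ν + 1) hA hL g w) ∧ PadicCont p C ∧
      coboundary ρ (ν + 1) C = 0 ∧
      ∃ b : (Fin ν → G) → L, IsLocallyConstant b ∧ ∀ x, teichResidue p le_add_self L (C x) =
        c x + coboundary (Representation.ofDistribMulAction ℤ G L) ν b x := by
  have hN : (1 : ℕ∞) ≤ e + 1 := le_add_self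
  let ρE : Representation ℤ G (TeichLift p (e + 1) A L) :=
    letI := teichDistribMulAction T hN (ν + 1) hA hL
    Representation.ofDistribMulAction ℤ G (TeichLift p (e + 1) A L)
  -- `L` is not a ring, so products of its elements are formed in the ring of functions on its dual,
  -- to which `exists_perm_cocycle` applies.
  let R := Module.Dual A L → A
  have hR : (p : R) = 0 := funext fun y => hA
  let _ : Algebra (ZMod p) R := (zmodHom hR).toAlgebra
  have hsm : ∀ (z : ZMod p) (f : R) y, (z • f) y = zmodHom hA z * f y := fun z f y =>
    congrArg (· * f y) (RingHom.congr_fun (Subsingleton.elim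
      ((Pi.evalRingHom (fun _ : Module.Dual A L => A) y).comp (zmodHom hR)) (zmodHom hA)) z)
  let act : G →* (R →+* R) :=
    { toFun := fun g => RingHom.pi fun y => (MulSemiringAction.toRingHom G A g).comp
        (Pi.evalRingHom _ (dualAct T hN (ν + 1) hA hL g⁻¹ y))
      map_one' := RingHom.ext fun f => funext fun y => by
        change (1 : G) • f (dualAct T hN (ν + 1) hA hL 1⁻¹ y) = f y
        rw [inv_one, one_smul, dualAct_one]
      map_mul' := fun g h => RingHom.ext fun f => funext fun y => by
        change (g * h) • f (dualAct T hN (ν + 1) hA hL (g * h)⁻¹ y) = g • h • f (dualAct T hN (ν + 1) hA hL h⁻¹ (dualAct T hN (ν + 1) hA hL g⁻¹ y))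
        rw [mul_smul, dualAct_dualAct, mul_inv_rev] }
  have hact : ∀ g f y, act g f y = g • f (dualAct T hN (ν + 1) hA hL g⁻¹ y) := fun g f y => rfl
  let ρ : Representation ℤ G R :=
    { toFun := fun g => ((DistribSMul.toAddMonoidHom R (T.one hN (ν + 1) g : ZMod p)).comp
        (act g).toAddMonoidHom).toIntLinearMap
      map_one' := by
        ext1 f
        change (T.one hN (ν + 1) 1 : ZMod p) • act 1 f = f
        rw [map_one, map_one, Units.val_one, one_smul]
        rfl
      map_mul' := fun g h => by
        ext1 f
        refine funext fun y => ?_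
        change ((T.one hN (ν + 1) (g * h) : ZMod p) • act (g * h) f) y =
          ((T.one hN (ν + 1) g : ZMod p) • act g ((T.one hN (ν + 1) h : ZMod p) • act h f)) y
        have h1 := CycChar.smul_scalar T hN (ν + 1) hA g h
        change g • zmodHom hA (T.one hN (ν + 1) h : ZMod p) = _ at h1
        rw [hsm, hsm, hact g, hsm, smul_mul', h1, map_mul, map_mul, Units.val_mul, map_mul, mul_assoc]
        rfl }
  have hρ : ∀ g f, ρ g f = (T.one le_add_self (ν + 1) g : ZMod p) • act g f := fun g f => rfl
  let ev : L →+ R :=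
    { toFun := fun x y => y x
      map_zero' := funext fun y => map_zero y
      map_add' := fun x x' => funext fun y => map_add y x x' }
  have hev : ∀ g x, ev (Representation.ofDistribMulAction ℤ G L g x) = ρ g (ev x) := fun g x =>
    funext fun y => by
      rw [hρ, hsm, hact]
      exact apply_smul_eq T hN (ν + 1) hA hL g y x
  have hnaive : ∃ K : OpenSubgroup G, ∀ g ∈ K, ∀ x, act g (ev (c x)) = ev (c x) := by
    obtain ⟨K, hK⟩ := exists_openSubgroup_dualAct T hN (ν + 1) hA hL 0 hAc hLc
    refine ⟨K, fun g hg x => funext fun y => ?_⟩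
    rw [hact, (hK g hg).1, (hK _ (inv_mem hg)).2.1]
  obtain ⟨Φ, _, _, t, m, htg, htm, C, hC, hC0, b, hb, hCb⟩ :=
    hT.exists_perm_cocycle act hρ (hc.comp ev) hnaive (by
      have h1 := cochainMap_coboundary ev hev (n := ν + 1) c
      rw [hc0, map_zero] at h1
      exact h1.symm)
  have hFm : Function.Bijective (frob m hA) := by
    have h1 : (frob m hA : A → A) = (fun a : A => a ^ p)^[m] := by
      rw [pow_iterate]
      rfl
    rw [h1]
    exact hF.iterate m
  -- Perfectness allows `p^m`-th roots of the `t φ` to be taken, so that the construction returns to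
  -- `L` itself rather than its Frobenius pullback.
  let φ : A ≃+* A := RingEquiv.ofBijective (frob m hA) hFm
  have hφ : ∀ a, φ a = a ^ p ^ m := fun a => rfl
  have hφz : ∀ z, φ (zmodHom hA z) = zmodHom hA z := fun z => RingHom.congr_fun (Subsingleton.elim
    ((φ : A →+* A).comp (zmodHom hA)) (zmodHom hA)) z
  -- The translates of values of `c` are, up to a scalar, evaluations at elements of `L`, which are
  -- proportional to each other by rank one; the relations are additive in `f`.
  have hline : ∀ f ∈ AddSubgroup.closure {a | ∃ g y, act g (ev (c y)) = a},
      ∀ (y y' : Module.Dual A L) z, y' z * f y = y z * f y' := by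
    intro f hf y y' z
    induction hf using AddSubgroup.closure_induction with
    | mem f hf =>
      obtain ⟨g, x, rfl⟩ := hf
      have h1 : ∀ y, act g (ev (c x)) y = T.scalar hN (ν + 1) hA g⁻¹ * y (g • c x) := fun y =>
        smul_dualAct_inv_apply T hN (ν + 1) hA hL g y (c x)
      rw [h1, h1]
      linear_combination T.scalar hN (ν + 1) hA g⁻¹ * invertible_mul_comm y' y z (g • c x)
    | zero => rw [Pi.zero_apply, Pi.zero_apply, mul_zero, mul_zero]
    | add f f' _ _ h h' => rw [Pi.add_apply, Pi.add_apply, mul_add, mul_add, h, h']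
    | neg f _ h => rw [Pi.neg_apply, Pi.neg_apply, mul_neg, mul_neg, h]
  -- Multiplying the relations of the `p^m` factors of `t q` gives the relation of `t q` with
  -- coefficients raised to the power `p^m`; its `p^m`-th root is the relation required here.
  obtain ⟨Θ, θ, hΘg, hθg, hΘθ, hθ⟩ := exists_permHom T hN (ν + 1) hA hL (Φ := Φ)
    (fun q y => φ.symm (t q y)) (fun q y y' z => φ.injective (by
      rw [map_mul, map_mul, φ.apply_symm_apply, φ.apply_symm_apply, hφ, hφ]
      rcases htm q with h | ⟨x, hx, h⟩
      · rw [h, Pi.zero_apply, Pi.zero_apply, mul_zero, mul_zero]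
      · have h1 : ∀ a : A, a ^ p ^ m = ∏ _i : Fin (p ^ m), a := fun a => by simp
        rw [h, Finset.prod_apply, Finset.prod_apply, h1, h1, ← Finset.prod_mul_distrib,
          ← Finset.prod_mul_distrib]
        exact Finset.prod_congr rfl fun i _ => hline _ (hx i) y y' z))
    (fun g q y => φ.injective (by
      rw [φ.apply_symm_apply, ← htg, hact, hφ, ← smul_pow', ← hφ, φ.apply_symm_apply]))
  refine ⟨ρE, fun x => Θ (C x), fun g w => rfl, hC.map Θ, ?_, fun x => θ (b x), hb.comp θ,
    fun x => invertible_eq_of_forall_dual (A := A) fun y => φ.injective ?_⟩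
  · have h1 := cochainMap_coboundary (ρ' := ρE) Θ hΘg (n := ν + 1) C
    rw [hC0, map_zero] at h1
    exact h1.symm
  · have h1 : coboundary (Representation.ofDistribMulAction ℤ G L) ν (fun x => θ (b x)) x =
        θ (coboundary (permRep (T.one hN (ν + 1)) Φ) ν b x) :=
      (congrFun (cochainMap_coboundary (ρ' := Representation.ofDistribMulAction ℤ G L) θ hθg b) x).symm
    have h2 : ∀ F : Φ → ZMod p, φ (y (θ F)) = (∑ q, F q • t q) y := by
      intro F
      rw [hθ, map_sum, Finset.sum_apply]
      refine Finset.sum_congr rfl fun q _ => ?_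
      rw [map_mul, hφz, φ.apply_symm_apply, hsm]
    rw [hΘθ, h1, map_add, map_add, h2, h2, hCb]
    rfl

/-- The source of a cyclotomic pair is a smooth profinite group. -/
theorem IsCyclotomicPair.isSmooth [CompactSpace G] {ν : ℕ} {e : ℕ∞} {T : CycChar p (e + 1) G}
    (hT : IsCyclotomicPair (ν + 1) e T) : IsSmooth.{u, w} p (ν + 1) e G := by
  intro A _ _ L _ _ _ hA hF hAc hinv hL hLc c
  obtain ⟨⟨c, hc⟩, rfl⟩ := QuotientAddGroup.mk_surjective c
  have hlc : IsLocallyConstant c := PadicCont.isLocallyConstant hc.1 (s := 1) fun x => by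
    rw [pow_one, ← Nat.cast_smul_eq_nsmul A, hA, zero_smul]
  obtain ⟨ρ, C, hρ, hC, hC0, b, hb, hCb⟩ := exists_lift_line hT hA hF hL hAc hLc hlc hc.2
  let E := teichWittLine T le_add_self (ν + 1) hA hL hF hAc hLc
  have hρE : ρ = Representation.ofDistribMulAction ℤ G E.L :=
    MonoidHom.ext fun g => LinearMap.ext fun w => hρ g w
  subst hρE
  refine ⟨E, teichResidue p le_add_self L, teichResidue_teichAct T le_add_self (ν + 1) hA hL,
    teichResidue_surjective le_add_self, teichResidue_smul le_add_self,
    teichResidue_eq_zero_iff le_add_self hA hF, QuotientAddGroup.mk ⟨C, hC, hC0⟩, ?_⟩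
  refine (QuotientAddGroup.eq.2 ?_).symm
  refine ⟨b, padicCont_of_isLocallyConstant hb, funext fun x => ?_⟩
  change coboundary (Representation.ofDistribMulAction ℤ G L) ν b x =
    -c x + teichResidue p le_add_self L (C x)
  rw [hCb, neg_add_cancel_left]

end Smooth

end WittLift

end

theorem theoremA (p : ℕ) [Fact p.Prime] (G : Type w) [Group G] [TopologicalSpace G]
    [IsTopologicalGroup G] [CompactSpace G] [T2Space G] [TotallyDisconnectedSpace G]
    (n : ℕ) (hn : 1 ≤ n) (e : ℕ∞) (he : 1 ≤ e)
    (T : WittLift.CycChar p (e + 1) G) (hT : WittLift.IsCyclotomicPair n e T) :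
    (∀ (r : ℕ) (_ : 1 ≤ r) (hr : (r : ℕ∞) ≤ e) (X : WittLift.GScheme.{u} p G)
      (L : WittLift.LineBundle X),
      (∀ c : L.H T n r (hr.trans le_self_add) 1, c.IsSGT →
        ∃ (m : ℕ) (c' : L.H T n r (hr.trans le_self_add) (1 * p ^ m)),
          L.IsFrobPullback m c c' ∧ c'.IsSGT ∧ L.LiftsSGT c') ∧
      (IsAffine X.S → Function.Bijective (fun a : Γ(X.S, ⊤) => a ^ p) →
        ∀ c : L.H T n r (hr.trans le_self_add) 1, L.Lifts c)) ∧
    WittLift.IsSmooth.{u, w} p n e G := by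
  -- In positive degree, coboundaries come from cochains of degree `ν`, and all the lifting
  -- statements are up to such coboundaries.
  obtain ⟨ν, rfl⟩ : ∃ ν, n = ν + 1 := ⟨n - 1, by omega⟩
  exact ⟨fun r _ hr X L => ⟨fun c hc => L.exists_isFrobPullback_liftsSGT hT hc,
    fun hX hF c => L.lifts_of_isAffine hT hX hF c⟩, hT.isSmooth⟩
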